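/- **Setting.** Let $M$ be a smooth manifold (Hausdorff, second countable, finite dimensional), let $E\to M$ be an oriented smooth complex Hermitian vector bundle of rank $n\ge 1$ (the orientation being a smooth complex volume form on the fibres which has modulus one on orthonormal frames), and let $P$ be its $SU(n)$-principal bundle of oriented orthonormal frames. Put $N=n^2-1$, $\mathfrak A=\Gamma(\mathrm{End}\,E)$ and $\mathfrak B=C^\infty(P)\otimes M_n(\mathbb C)=M_n(C^\infty(P))$, all functions being complex valued. An endomorphism field $a\in\mathfrak A$ is identified with the element $(e_1,\dots,e_n)\mapsto(\langle e_i,a\,e_j\rangle)_{i,j}$ of $\mathfrak B$. For a complex unital algebra $A$ with centre $Z(A)$, $\Omega^k_{\mathrm{Der}}(A)$ is the space of alternating $Z(A)$-multilinear maps $\mathrm{Der}(A)^k\to A$, with the differential $\hat d$ given by the Koszul formula $$\hat d\omega(X_0,\dots,X_k)=\sum_{i}(-1)^iX_i\,\omega(\dots,\widehat{X_i},\dots)+\sum_{i<j}(-1)^{i+j}\omega([X_i,X_j],\dots,\widehat{X_i},\dots,\widehat{X_j},\dots).$$ For $A=C^\infty(P)$ or $C^\infty(M)$ this is the complex de Rham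 complex $(\Omega(P),d)$ or $(\Omega(M),d)$. A form on $\mathfrak A$ (or on $M$) is said to correspond to a form on $\mathfrak B$ (or on $P$) if the latter is obtained from the former by evaluation on derivations $X_i$ of the larger algebra that restrict to derivations $Y_i$ of the smaller one: $\omega(X_1,\dots,X_k)=\eta(Y_1,\dots,Y_k)$; between $M$ and $P$ this says that the form on $P$ is the pullback of the form on $M$. For $A\in\mathfrak{su}(n)$ let $A^v$ be the vertical vector field on $P$ generated by $A$. Forms on $\mathfrak B$ are called horizontal, invariant or basic with respect to the derivations $A^v+\mathrm{ad}_A$, and forms on $P$ with respect to the $A^v$ ($A\in\mathfrak{su}(n)$): horizontal means annihilated by the contractions, invariant means annihilated by the Lie derivatives, basic means both. **The integral.** Fix an orientation of $\mathfrak{su}(n)$ and an oriented basis $X_k=iE_k$, $1\le k\le N$. Put $g_{kl}=\frac1n\mathrm{Tr}(E_kE_l)$, and let $\theta^k$ be the basis of $1$-forms on $M_n(\mathbb C)$ dual to the derivations $\mathrm{ad}_{X_k}$. The noncommutative integral on $\Omega^{N}_{\mathrm{Der}}(M_n(\mathbb C))$ is $$\int_{\mathrm{nc}}a\,\sqrt{\det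 g}\;\theta^1\cdots\theta^{N}=\tfrac1n\mathrm{Tr}\,a,\qquad a\in M_n(\mathbb C).$$ For $\omega\in\Omega^{p+N}_{\mathrm{Der}}(\mathfrak B)$ and vector fields $Y_1,\dots,Y_p$ on $P$ put $$\Big(\int_{\mathrm{nc}}\omega\Big)(Y_1,\dots,Y_p)=\frac{1}{n\sqrt{\det g}}\,\mathrm{Tr}\,\omega(Y_1,\dots,Y_p,\mathrm{ad}_{X_1},\dots,\mathrm{ad}_{X_{N}}),$$ and put $\int_{\mathrm{nc}}\omega=0$ if the degree of $\omega$ is less than $N$. Write $\Omega^{a,b}_{\mathrm{Der}}(\mathfrak B)=\Omega^a(P)\otimes\Omega^b_{\mathrm{Der}}(M_n(\mathbb C))$. **Proposition.** 0. The map $\int_{\mathrm{nc}}:\Omega^{p,N}_{\mathrm{Der}}(\mathfrak B)\to\Omega^p(P)$ is the one induced by the noncommutative integral on $M_n(\mathbb C)$: it sends $\alpha\otimes\beta$ to $(\int_{\mathrm{nc}}\beta)\,\alpha$. Moreover $\int_{\mathrm{nc}}$ vanishes on $\Omega^{a,b}_{\mathrm{Der}}(\mathfrak B)$ for $b\neq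 N$. 1. If $\omega\in\Omega^{p+N}_{\mathrm{Der}}(\mathfrak B)$ (in particular if $\omega\in\Omega^{p,N}_{\mathrm{Der}}(\mathfrak B)$) is horizontal, then so is $\int_{\mathrm{nc}}\omega\in\Omega^p(P)$; if $\omega$ is invariant, then so is $\int_{\mathrm{nc}}\omega$. 2. Every $\eta\in\Omega^r_{\mathrm{Der}}(\mathfrak A)$ corresponds to a unique basic form $\omega\in\Omega^r_{\mathrm{Der}}(\mathfrak B)$, and for $r\ge N$ the form $\int_{\mathrm{nc}}\omega$ is the pullback to $P$ of a unique form on $M$. This defines a linear map $\int_{\mathrm{nc}}:\Omega^r_{\mathrm{Der}}(\mathfrak A)\to\Omega^{r-N}(M)$ for $r\ge N$, extended by zero to $r<N$ (integration along the noncommutative fibre). 3. Both maps commute with the differentials: $\int_{\mathrm{nc}}\hat d\omega=d\int_{\mathrm{nc}}\omega$ for every form $\omega$ on $\mathfrak B$, and for every form on $\mathfrak A$; in degree $N-1$ this reads $\int_{\mathrm{nc}}\hat d\omega=0$. 4. Consequently they induce linear maps, for every $r$ (zero for $r<N$), $$H^r(\Omega_{\mathrm{Der}}(\mathfrak B),\hat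 d)\to H^{r-N}(P),\qquad H^r(\Omega_{\mathrm{Der}}(\mathfrak A),\hat d)\to H^{r-N}(M),$$ sending the class of a closed form to the class of its integral. -/

import Mathlib

open scoped Manifold ContDiff Matrix
open Bundle Function

namespace DerivationCalculus

noncomputable section

section Algebra

variable (A : Type*) [Ring A] [Algebra ℂ A]

section

attribute [local instance 100] LieRing.ofAssociativeRing

/-- The Lie algebra of derivations of an associative complex algebra. -/
def Der : LieSubalgebra ℂ (Module.End ℂ A) where
  carrier := {X | ∀ a b : A, X (a * b) = X a * b + a * X b}
  add_mem' := by
    intro X Y hX hY a b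
    simp only [LinearMap.add_apply, hX a b, hY a b, add_mul, mul_add]
    abel
  zero_mem' := by intro a b; simp
  smul_mem' := by
    intro c X hX a b
    simp [hX a b, smul_add]
  lie_mem' := by
    intro X Y hX hY a b
    have hX' : ∀ a b : A, X (a * b) = X a * b + a * X b := hX
    have hY' : ∀ a b : A, Y (a * b) = Y a * b + a * Y b := hY
    simp only [Ring.lie_def, LinearMap.sub_apply, Module.End.mul_apply, hX', hY', map_add,
      sub_mul, mul_sub]
    abel

instance : LieRing (Der A) := inferInstance

instance : LieAlgebra ℂ (Der A) := inferInstance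

instance : AddCommGroup (Der A) := inferInstance

instance : AddCommMonoid (Der A) := inferInstance

instance : Add (Der A) := inferInstance

instance : Zero (Der A) := inferInstance

instance : Neg (Der A) := inferInstance

end

variable {A}

instance : FunLike (Der A) A A where
  coe X := X.1
  coe_injective _ _ h := Subtype.ext (DFunLike.coe_injective h)

instance : LinearMapClass (Der A) ℂ A A where
  map_add X := X.1.map_add
  map_smulₛₗ X := X.1.map_smul

theorem Der.leibniz (X : Der A) (a b : A) : X (a * b) = X a * b + a * X b := X.2 a b

@[ext] theorem Der.ext {X Y : Der A} (h : ∀ a, X a = Y a) : X = Y :=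
  DFunLike.ext _ _ h

theorem Der.bracket_apply (X Y : Der A) (a : A) : ⁅X, Y⁆ a = X (Y a) - Y (X a) := rfl

/-- Derivations form a module over the centre of the algebra: `(z • X) a = z * X a`. -/
instance : SMul (Subalgebra.center ℂ A) (Der A) where
  smul z X := ⟨LinearMap.mulLeft ℂ (z : A) ∘ₗ X.1, by
    intro a b
    have hz : a * (z : A) = z * a := (Subalgebra.mem_center_iff.1 z.2 a)
    change (z : A) * X (a * b) = z * X a * b + a * (z * X b)
    rw [Der.leibniz X a b, mul_add, ← mul_assoc, ← mul_assoc, ← mul_assoc, hz]⟩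

theorem Der.smul_apply (z : Subalgebra.center ℂ A) (X : Der A) (a : A) :
    (z • X) a = (z : A) * X a := rfl

instance : Module (Subalgebra.center ℂ A) (Der A) where
  one_smul X := by ext a; simp [Der.smul_apply]
  mul_smul z w X := by ext a; simp [Der.smul_apply, mul_assoc]
  smul_zero z := by
    ext a
    change (z : A) * (0 : A) = 0
    exact mul_zero _
  smul_add z X Y := by
    ext a
    change (z : A) * (X a + Y a) = z * X a + z * Y a
    exact mul_add _ _ _
  add_smul z w X := by
    ext a
    change ((z : A) + w) * X a = z * X a + w * X a
    exact add_mul _ _ _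
  zero_smul X := by
    ext a
    change (0 : A) * X a = 0
    exact zero_mul _

/-- A derivation maps the centre to itself. -/
def Der.onCenter (X : Der A) (z : Subalgebra.center ℂ A) : Subalgebra.center ℂ A :=
  ⟨X (z : A), Subalgebra.mem_center_iff.2 fun b => by
    have h1 : X (b * (z : A)) = X ((z : A) * b) := by
      rw [Subalgebra.mem_center_iff.1 z.2 b]
    rw [Der.leibniz X, Der.leibniz X, Subalgebra.mem_center_iff.1 z.2 (X b)] at h1
    rw [add_comm] at h1
    exact add_right_cancel h1⟩

theorem Der.bracket_smul (X Y : Der A) (z : Subalgebra.center ℂ A) :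
    ⁅X, z • Y⁆ = Der.onCenter X z • Y + z • ⁅X, Y⁆ := by
  ext a
  change X ((z : A) * Y a) - (z : A) * Y (X a) = X (z : A) * Y a + z * (X (Y a) - Y (X a))
  rw [Der.leibniz X, mul_sub]; abel

theorem Der.smul_bracket (X Y : Der A) (z : Subalgebra.center ℂ A) :
    ⁅z • X, Y⁆ = -(Der.onCenter Y z • X) + z • ⁅X, Y⁆ := by
  rw [← lie_skew, Der.bracket_smul Y X z, ← lie_skew X Y, smul_neg]; abel

theorem Der.apply_smul (X : Der A) (z : Subalgebra.center ℂ A) (a : A) :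
    X (z • a) = Der.onCenter X z • a + z • X a := Der.leibniz X (z : A) a

/-- The inner derivation `ad_m = [m, ·]`. -/
def adDer (m : A) : Der A :=
  ⟨LinearMap.mulLeft ℂ m - LinearMap.mulRight ℂ m, by
    intro a b
    simp only [LinearMap.sub_apply, LinearMap.mulLeft_apply, LinearMap.mulRight_apply,
      sub_mul, mul_sub, mul_assoc]
    abel⟩

variable (A)

/-- Noncommutative differential forms of degree `k` of the derivation-based calculus: alternating
maps from derivations to the algebra, multilinear over the centre. For the algebra of smooth
functions on a manifold the derivations are the (complex) vector fields and these are the usual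
(complex) differential forms, with the differential `dForm` below as exterior derivative. -/
abbrev Form (k : ℕ) : Type _ := Der A [⋀^Fin k]→ₗ[Subalgebra.center ℂ A] A

instance (k : ℕ) : AddCommGroup (Form A k) := inferInstance

instance (k : ℕ) : AddCommMonoid (Form A k) := inferInstance

instance (k : ℕ) : Module ℂ (Form A k) := inferInstance

variable {A}

/-- The Lie derivative
`(L_X ξ)(v) = X (ξ v) - ∑ i, ξ (v₀, …, [X, v_i], …)`. -/
def lieForm (X : Der A) {k : ℕ} (ξ : Form A k) : Form A k where
  toFun v := X (ξ v) - ∑ i, ξ (update v i ⁅X, v i⁆)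
  map_update_add' := by
    intro _ v i x y
    have hdec : ‹DecidableEq (Fin k)› = instDecidableEqFin k := Subsingleton.elim _ _
    subst hdec
    have h : ∀ z : Der A, ∑ j, ξ (update (update v i z) j ⁅X, update v i z j⁆)
        = ξ (update v i ⁅X, z⁆) +
          ∑ j ∈ Finset.univ.erase i, ξ (update (update v j ⁅X, v j⁆) i z) := by
      intro z
      rw [← Finset.add_sum_erase _ _ (Finset.mem_univ i)]
      simp only [update_self, update_idem]
      congr 1
      refine Finset.sum_congr rfl fun j hj => ?_
      have hji := Finset.ne_of_mem_erase hj
      rw [update_of_ne hji, update_comm hji.symm]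
    rw [h, h, h, lie_add]
    simp only [ξ.map_update_add, Finset.sum_add_distrib]
    rw [map_add]; abel
  map_update_smul' := by
    intro _ v i z x
    have hdec : ‹DecidableEq (Fin k)› = instDecidableEqFin k := Subsingleton.elim _ _
    subst hdec
    have h : ∀ y : Der A, ∑ j, ξ (update (update v i y) j ⁅X, update v i y j⁆)
        = ξ (update v i ⁅X, y⁆) +
          ∑ j ∈ Finset.univ.erase i, ξ (update (update v j ⁅X, v j⁆) i y) := by
      intro z
      rw [← Finset.add_sum_erase _ _ (Finset.mem_univ i)]
      simp only [update_self, update_idem]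
      congr 1
      refine Finset.sum_congr rfl fun j hj => ?_
      have hji := Finset.ne_of_mem_erase hj
      rw [update_of_ne hji, update_comm hji.symm]
    rw [h, h, Der.bracket_smul X]
    simp only [ξ.map_update_add, ξ.map_update_smul, Der.apply_smul X, ← Finset.smul_sum, smul_sub,
      smul_add]
    abel
  map_eq_zero_of_eq' := by
    intro v i j hv hij
    have h0 : ξ v = 0 := ξ.map_eq_zero_of_eq v hv hij
    have h1 : ∑ l, ξ (update v l ⁅X, v l⁆)
        = ξ (update v i ⁅X, v i⁆) + ξ (update v j ⁅X, v j⁆) := by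
      refine Fintype.sum_eq_add _ _ hij fun l hl => ?_
      exact ξ.map_eq_zero_of_eq _ (by rw [update_of_ne hl.1.symm, update_of_ne hl.2.symm, hv]) hij
    have h2 : ξ (update v j ⁅X, v j⁆) = - ξ (update v i ⁅X, v i⁆) := by
      have := ξ.map_swap (update v i ⁅X, v i⁆) hij
      rw [← this]
      congr 1
      funext l
      by_cases hli : l = i
      · subst hli; simp [hij, hij.symm, hv]
      by_cases hlj : l = j
      · subst hlj; simp [hv]
      · simp [Equiv.swap_apply_of_ne_of_ne hli hlj, hli, hlj]
    rw [h0, h1, h2]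
    simp

theorem lieForm_apply (X : Der A) {k : ℕ} (ξ : Form A k) (v : Fin k → Der A) :
    lieForm X ξ v = X (ξ v) - ∑ i, ξ (update v i ⁅X, v i⁆) := rfl

/-- The Koszul formula for the differential of a `k`-form, in which the bracket
`[v_i, v_j]`, `i < j`, is put in the slot of `v_i` and the slot of `v_j` is removed:
`∑ⱼ (-1)ʲ vⱼ ξ(…, v̂ⱼ, …) + ∑_{i<j} (-1)ʲ ξ(…, [vᵢ, vⱼ], …, v̂ⱼ, …)`, the second sum being
equal to `∑_{i<j} (-1)ⁱ⁺ʲ ξ([vᵢ, vⱼ], …, v̂ᵢ, …, v̂ⱼ, …)`. -/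
def koszul {k : ℕ} (ξ : Form A k) (v : Fin (k + 1) → Der A) : A :=
  ∑ j : Fin (k + 1), (-1 : ℤ) ^ (j : ℕ) •
    (v j (ξ (j.removeNth v)) + ∑ i with i < j, ξ (j.removeNth (update v i ⁅v i, v j⁆)))

theorem koszul_cons {k : ℕ} (ξ : Form A (k + 1)) (x : Der A) (w : Fin (k + 1) → Der A) :
    koszul ξ (Fin.cons x w : Fin (k + 2) → Der A)
      = lieForm x ξ w - koszul (ξ.curryLeft x) w := by
  have e1 : ∀ (j : Fin (k + 1)) (y : Der A) (u : Fin (k + 1) → Der A),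
      (Fin.succ j).removeNth (Fin.cons y u : Fin (k + 2) → Der A)
        = Matrix.vecCons y (j.removeNth u) := by
    intro j y u
    funext l
    refine Fin.cases ?_ (fun l => ?_) l <;> simp [Fin.removeNth, Matrix.vecCons]
  have e2 : ∀ j : Fin (k + 1), ξ (update w j ⁅x, w j⁆)
      = (-1 : ℤ) ^ (j : ℕ) • ξ (Matrix.vecCons ⁅x, w j⁆ (j.removeNth w)) := by
    intro j
    rw [← Fin.insertNth_removeNth, ξ.map_insertNth]
  unfold koszul
  rw [Fin.sum_univ_succ, lieForm_apply]
  simp only [Finset.sum_filter, Fin.sum_univ_succ (n := k + 1), Fin.cons_zero, Fin.cons_succ,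
    Fin.succ_lt_succ_iff, Fin.succ_pos, if_true, Fin.not_lt_zero, if_false,
    Fin.update_cons_zero, ← Fin.cons_update, e1, e2, Fin.removeNth_zero, Fin.tail_cons,
    AlternatingMap.curryLeft_apply_apply, Fin.val_succ, Fin.val_zero, pow_zero, one_smul,
    pow_succ, mul_neg_one, neg_smul, Finset.sum_const_zero, add_zero]
  rw [sub_sub, sub_eq_add_neg, ← Finset.sum_add_distrib, ← Finset.sum_neg_distrib]
  congr 1
  refine Finset.sum_congr rfl fun j _ => ?_
  rw [← smul_add]
  congr 2
  abel

theorem koszul_zero_form (ξ : Form A 0) (v : Fin 1 → Der A) : koszul ξ v = v 0 (ξ ![]) := by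
  unfold koszul
  simp
  congr 2
  exact Subsingleton.elim _ _

theorem koszul_add {k : ℕ} (ξ η : Form A k) (v : Fin (k + 1) → Der A) :
    koszul (ξ + η) v = koszul ξ v + koszul η v := by
  unfold koszul
  rw [← Finset.sum_add_distrib]
  refine Finset.sum_congr rfl fun j _ => ?_
  rw [← smul_add]
  congr 1
  simp only [AlternatingMap.add_apply, Finset.sum_add_distrib]
  rw [map_add]
  abel

theorem koszul_csmul {k : ℕ} (c : ℂ) (ξ : Form A k) (v : Fin (k + 1) → Der A) :
    koszul (c • ξ) v = c • koszul ξ v := by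
  unfold koszul
  rw [Finset.smul_sum]
  refine Finset.sum_congr rfl fun j _ => ?_
  rw [smul_comm c]
  congr 1
  simp only [AlternatingMap.smul_apply, ← Finset.smul_sum, smul_add]
  congr 1
  exact map_smul (v j) c _

theorem koszul_smul {k : ℕ} (z : Subalgebra.center ℂ A) (ξ : Form A k)
    (v : Fin (k + 1) → Der A) :
    koszul (z • ξ) v = z • koszul ξ v +
      ∑ j : Fin (k + 1), (-1 : ℤ) ^ (j : ℕ) • Der.onCenter (v j) z • ξ (j.removeNth v) := by
  unfold koszul
  rw [Finset.smul_sum, ← Finset.sum_add_distrib]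
  refine Finset.sum_congr rfl fun j _ => ?_
  rw [smul_comm z, ← smul_add]
  congr 1
  simp only [AlternatingMap.smul_apply, ← Finset.smul_sum, smul_add, Der.apply_smul]
  abel

theorem update_eq_insertNth {k : ℕ} (ξ : Form A (k + 1)) (w : Fin (k + 1) → Der A)
    (j : Fin (k + 1)) (x : Der A) :
    ξ (update w j x) = (-1 : ℤ) ^ (j : ℕ) • ξ (Matrix.vecCons x (j.removeNth w)) := by
  rw [← Fin.insertNth_removeNth, ξ.map_insertNth]

theorem lieForm_add_left {k : ℕ} (x y : Der A) (ξ : Form A k) (w : Fin k → Der A) :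
    lieForm (x + y) ξ w = lieForm x ξ w + lieForm y ξ w := by
  simp only [lieForm_apply, add_lie, ξ.map_update_add, Finset.sum_add_distrib]
  change x _ + y _ - _ = _
  abel

theorem lieForm_smul_left {k : ℕ} (z : Subalgebra.center ℂ A) (x : Der A) (ξ : Form A k)
    (w : Fin k → Der A) :
    lieForm (z • x) ξ w = z • lieForm x ξ w + ∑ i, Der.onCenter (w i) z • ξ (update w i x) := by
  simp only [lieForm_apply, Der.smul_bracket, ξ.map_update_add, ξ.map_update_neg,
    ξ.map_update_smul, Finset.sum_add_distrib, smul_sub, Finset.smul_sum,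
    Finset.sum_neg_distrib]
  change z • x _ - _ = _
  abel

theorem koszul_map_update_add {k : ℕ} (ξ : Form A k) (v : Fin (k + 1) → Der A)
    (i : Fin (k + 1)) (x y : Der A) :
    koszul ξ (update v i (x + y)) = koszul ξ (update v i x) + koszul ξ (update v i y) := by
  induction k with
  | zero =>
    obtain rfl : i = 0 := Fin.fin_one_eq_zero i
    simp only [koszul_zero_form, update_self]
    rfl
  | succ k ih =>
    obtain ⟨a, w, rfl⟩ : ∃ a w, v = (Fin.cons a w : Fin (k + 2) → Der A) :=
      ⟨v 0, Fin.tail v, (Fin.cons_self_tail v).symm⟩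
    refine Fin.cases ?_ (fun i => ?_) i
    · simp only [Fin.update_cons_zero, koszul_cons, lieForm_add_left, map_add, koszul_add]
      abel
    · simp only [← Fin.cons_update, koszul_cons, AlternatingMap.map_update_add, ih]
      abel

theorem koszul_map_update_smul {k : ℕ} (ξ : Form A k) (v : Fin (k + 1) → Der A)
    (i : Fin (k + 1)) (z : Subalgebra.center ℂ A) (x : Der A) :
    koszul ξ (update v i (z • x)) = z • koszul ξ (update v i x) := by
  induction k with
  | zero =>
    obtain rfl : i = 0 := Fin.fin_one_eq_zero i
    simp only [koszul_zero_form, update_self]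
    rfl
  | succ k ih =>
    obtain ⟨a, w, rfl⟩ : ∃ a w, v = (Fin.cons a w : Fin (k + 2) → Der A) :=
      ⟨v 0, Fin.tail v, (Fin.cons_self_tail v).symm⟩
    refine Fin.cases ?_ (fun i => ?_) i
    · simp only [Fin.update_cons_zero, koszul_cons, lieForm_smul_left, map_smul, koszul_smul,
        update_eq_insertNth, AlternatingMap.curryLeft_apply_apply, smul_sub]
      have : ∀ j : Fin (k + 1), (-1 : ℤ) ^ (j : ℕ) • Der.onCenter (w j) z •
          ξ (Matrix.vecCons x (j.removeNth w)) = Der.onCenter (w j) z • (-1 : ℤ) ^ (j : ℕ) •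
          ξ (Matrix.vecCons x (j.removeNth w)) := fun j => smul_comm _ _ _
      simp only [this]
      abel
    · simp only [← Fin.cons_update, koszul_cons, AlternatingMap.map_update_smul, ih, smul_sub]

/-- The Koszul formula as a multilinear map. -/
def koszulMultilinear {k : ℕ} (ξ : Form A k) :
    MultilinearMap (Subalgebra.center ℂ A) (fun _ : Fin (k + 1) => Der A) A where
  toFun := koszul ξ
  map_update_add' v i x y := by
    rename_i inst
    rw [Subsingleton.elim inst (instDecidableEqFin _)]
    exact koszul_map_update_add ξ v i x y
  map_update_smul' v i z x := by
    rename_i inst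
    rw [Subsingleton.elim inst (instDecidableEqFin _)]
    exact koszul_map_update_smul ξ v i z x

theorem koszul_eq_zero {k : ℕ} (ξ : Form A k) (v : Fin (k + 1) → Der A) (i j : Fin (k + 1))
    (hv : v i = v j) (hij : i ≠ j) : koszul ξ v = 0 := by
  induction k with
  | zero => exact absurd ((Fin.fin_one_eq_zero i).trans (Fin.fin_one_eq_zero j).symm) hij
  | succ k ih =>
    -- two equal entries after the first one
    have tail : ∀ (v : Fin (k + 2) → Der A) (a b : Fin (k + 1)), v a.succ = v b.succ → a ≠ b →
        koszul ξ v = 0 := by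
      intro v a b h hab
      rw [← Fin.cons_self_tail v, koszul_cons, ih _ _ a b h hab,
        (lieForm (v 0) ξ).map_eq_zero_of_eq (Fin.tail v) h hab, sub_zero]
    -- the first two entries are equal
    have first : ∀ (v : Fin (k + 2) → Der A), v 0 = v 1 → koszul ξ v = 0 := by
      intro v h
      cases k with
      | zero =>
        rw [← Fin.cons_self_tail v, koszul_cons, lieForm_apply, koszul_zero_form]
        have h1 : Fin.tail v = ![v 0] := by
          funext l
          rw [Subsingleton.elim l 0]
          exact h.symm
        rw [h1]
        simp
      | succ k =>
        obtain ⟨x, u, rfl⟩ : ∃ x u, v = (Fin.cons x (Fin.cons x u : Fin (k + 2) → Der A) :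
            Fin (k + 3) → Der A) := by
          refine ⟨v 0, Fin.tail (Fin.tail v), ?_⟩
          conv_lhs => rw [← Fin.cons_self_tail v, ← Fin.cons_self_tail (Fin.tail v)]
          rw [h]
          rfl
        rw [koszul_cons, koszul_cons, AlternatingMap.curryLeft_same]
        have h0 : koszul (0 : Form A k) u = 0 := by
          have := koszul_csmul (0 : ℂ) (0 : Form A k) u
          rwa [zero_smul, zero_smul] at this
        rw [h0, sub_zero, lieForm_apply, lieForm_apply, Fin.sum_univ_succ]
        simp only [Fin.cons_zero, Fin.cons_succ, lie_self, ← Fin.cons_update,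
          Fin.update_cons_zero]
        have hz : ξ (Fin.cons 0 u : Fin (k + 2) → Der A) = 0 := ξ.map_coord_zero 0 rfl
        rw [hz, zero_add]
        exact sub_self _
    have zero_any : ∀ (v : Fin (k + 2) → Der A) (b : Fin (k + 1)), v 0 = v b.succ →
        koszul ξ v = 0 := by
      intro v b h
      by_cases hb : b = 0
      · subst hb; exact first v h
      -- exchange the entries `1` and `b + 1`
      have hne : (1 : Fin (k + 2)) ≠ b.succ := fun h' => hb (Fin.succ_injective _ h'.symm)
      set x := v 1
      set y := v b.succ
      have z1 : ∀ p : Der A, koszulMultilinear ξ (update (update v 1 p) b.succ p) = 0 := by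
        intro p
        refine tail _ 0 b ?_ (fun h' => hb h'.symm)
        change update (update v 1 p) b.succ p 1 = _
        rw [update_of_ne hne, update_self, update_self]
      have z2 : koszulMultilinear ξ (update (update v 1 y) b.succ x) = 0 := by
        refine first _ ?_
        rw [update_of_ne hne, update_self, update_of_ne (Fin.succ_ne_zero b).symm,
          update_of_ne (by simp), h]
      have hs := z1 (x + y)
      have hadd : ∀ p q r : Der A, koszulMultilinear ξ (update (update v 1 (p + q)) b.succ r) =
          koszulMultilinear ξ (update (update v 1 p) b.succ r) +
          koszulMultilinear ξ (update (update v 1 q) b.succ r) := by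
        intro p q r
        have hc : ∀ s : Der A, update (update v 1 s) b.succ r = update (update v b.succ r) 1 s :=
          fun s => update_comm (β := fun _ => Der A) hne s r v
        simp only [hc, MultilinearMap.map_update_add]
      rw [MultilinearMap.map_update_add, hadd, hadd, z1 x, z1 y, z2, zero_add, add_zero,
        zero_add] at hs
      have : update (update v 1 x) b.succ y = v := by simp [x, y]
      rw [this] at hs
      exact hs
    induction i using Fin.cases with
    | zero =>
      induction j using Fin.cases with
      | zero => exact absurd rfl hij
      | succ j => exact zero_any v j hv
    | succ i =>
      induction j using Fin.cases with
      | zero => exact zero_any v i hv.symm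
      | succ j => exact tail v i j hv (fun h => hij (congrArg Fin.succ h))

/-- The differential of the derivation-based differential calculus. -/
def dForm (k : ℕ) : Form A k →ₗ[ℂ] Form A (k + 1) where
  toFun ξ :=
    { koszulMultilinear ξ with
      map_eq_zero_of_eq' := fun v i j hv hij => koszul_eq_zero ξ v i j hv hij }
  map_add' ξ η := by ext v; exact koszul_add ξ η v
  map_smul' c ξ := by ext v; exact koszul_csmul c ξ v

theorem dForm_apply {k : ℕ} (ξ : Form A k) (v : Fin (k + 1) → Der A) :
    dForm k ξ v = ∑ j : Fin (k + 1), (-1 : ℤ) ^ (j : ℕ) •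
      (v j (ξ (j.removeNth v)) + ∑ i with i < j, ξ (j.removeNth (update v i ⁅v i, v j⁆))) := rfl

/-- The contraction `i_X`. -/
def contract (X : Der A) {k : ℕ} (ξ : Form A (k + 1)) : Form A k := ξ.curryLeft X

/-- Horizontal forms with respect to a set `S` of derivations: `i_X ξ = 0` for `X ∈ S` (no condition
in degree `0`). -/
def IsHorizontal (S : Set (Der A)) : ∀ {k : ℕ}, Form A k → Prop
  | 0, _ => True
  | _ + 1, ξ => ∀ X ∈ S, contract X ξ = 0

/-- Forms annihilated by the Lie derivatives `L_X`, `X ∈ S`. -/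
def IsInvariant (S : Set (Der A)) {k : ℕ} (ξ : Form A k) : Prop := ∀ X ∈ S, lieForm X ξ = 0

/-- Basic forms: horizontal and invariant. -/
def IsBasic (S : Set (Der A)) {k : ℕ} (ξ : Form A k) : Prop :=
  IsHorizontal S ξ ∧ IsInvariant S ξ

/-- For `φ : A → B`, a derivation `X` of `B` and a derivation `Y` of `A` are `φ`-related if
`X ∘ φ = φ ∘ Y`. A form `ξ` on `B` is induced by a form `η` on `A` if it takes the value
`φ (η (Y₁, …, Y_k))` on all derivations `X₁, …, X_k` of `B` that are `φ`-related to derivations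
`Y₁, …, Y_k` of `A`. For the inclusion of the functions on the base of a fibration into the
functions on its total space this says that `ξ` is the pullback of `η`. -/
def IsInduced {B : Type*} [Ring B] [Algebra ℂ B] (φ : A → B) {k : ℕ} (η : Form A k)
    (ξ : Form B k) : Prop :=
  ∀ (Y : Fin k → Der A) (X : Fin k → Der B), (∀ i a, X i (φ a) = φ (Y i a)) → ξ X = φ (η Y)

variable (A) in
/-- The closed forms of degree `k`. -/
def closedForms (k : ℕ) : Submodule ℂ (Form A k) := LinearMap.ker (dForm k)

variable (A) in
/-- The exact forms of degree `k`. -/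
def exactForms : ∀ k : ℕ, Submodule ℂ (Form A k)
  | 0 => ⊥
  | k + 1 => LinearMap.range (dForm k)

/-- The quotient of a submodule `Z` by its intersection with the submodule `B`. -/
def Subquotient {W : Type*} [AddCommGroup W] [Module ℂ W] (Z B : Submodule ℂ W) : Type _ :=
  Z ⧸ B.comap Z.subtype

instance {W : Type*} [AddCommGroup W] [Module ℂ W] (Z B : Submodule ℂ W) :
    AddCommGroup (Subquotient Z B) := inferInstanceAs (AddCommGroup (Z ⧸ B.comap Z.subtype))

instance {W : Type*} [AddCommGroup W] [Module ℂ W] (Z B : Submodule ℂ W) :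
    Module ℂ (Subquotient Z B) := inferInstanceAs (Module ℂ (Z ⧸ B.comap Z.subtype))

/-- The class in `Z / (Z ∩ B)` of an element of `Z`. -/
def Subquotient.mk {W : Type*} [AddCommGroup W] [Module ℂ W] (Z B : Submodule ℂ W) :
    Z →ₗ[ℂ] Subquotient Z B := (B.comap Z.subtype).mkQ

variable (A) in
/-- The cohomology `H^k(Ω_Der(A))`: closed forms modulo exact forms. -/
abbrev Cohomology (k : ℕ) : Type _ := Subquotient (closedForms A k) (exactForms A k)

/-- The cohomology class of a closed form. -/
def cohomologyClass {k : ℕ} (ξ : Form A k) (hξ : dForm k ξ = 0) : Cohomology A k :=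
  Subquotient.mk (closedForms A k) (exactForms A k) ⟨ξ, hξ⟩

end Algebra

section Matrices

variable {C : Type*} [CommRing C] [Algebra ℂ C] {n : ℕ}

/-- The entrywise extension of a derivation of `C` to `M_n(C)`. -/
def liftDer (X : Der C) : Der (Matrix (Fin n) (Fin n) C) :=
  ⟨{ toFun := fun b => b.map X
     map_add' := fun a b => by ext i j; exact map_add X (a i j) (b i j)
     map_smul' := fun c a => by ext i j; exact map_smul X c (a i j) }, by
    intro a b
    ext i j
    change X ((a * b) i j) = (a.map X * b) i j + (a * b.map X) i j
    simp only [Matrix.mul_apply, map_sum, Der.leibniz, Matrix.map_apply, Finset.sum_add_distrib]⟩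

theorem liftDer_apply (X : Der C) (b : Matrix (Fin n) (Fin n) C) (i j : Fin n) :
    liftDer X b i j = X (b i j) := rfl

theorem liftDer_add (X Y : Der C) :
    (liftDer (X + Y) : Der (Matrix (Fin n) (Fin n) C)) = liftDer X + liftDer Y := by
  ext b
  rfl

/-- Central functions give central matrices. -/
def scalarCenter (f : Subalgebra.center ℂ C) :
    Subalgebra.center ℂ (Matrix (Fin n) (Fin n) C) :=
  ⟨Matrix.scalar (Fin n) (f : C), Subalgebra.mem_center_iff.2 fun b =>
    (Matrix.scalar_commute (f : C) (fun _ => mul_comm _ _) b).symm⟩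

theorem liftDer_smul (f : Subalgebra.center ℂ C) (X : Der C) :
    (liftDer (f • X) : Der (Matrix (Fin n) (Fin n) C)) =
      (scalarCenter f : Subalgebra.center ℂ (Matrix (Fin n) (Fin n) C)) • liftDer X := by
  ext b i j
  change (f : C) * X (b i j) = (Matrix.scalar (Fin n) (f : C) * b.map X) i j
  simp [Matrix.scalar_apply, Matrix.diagonal_mul]

/-- A complex matrix as a constant matrix over `C`. -/
def constMatrix (m : Matrix (Fin n) (Fin n) ℂ) : Matrix (Fin n) (Fin n) C :=
  m.map (algebraMap ℂ C)

/-- The forms of bidegree `(a, r - a)` on `M_n(C) = C ⊗ M_n(ℂ)`, that is the elements of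
`Ω^a_Der(C) ⊗ Ω^{r-a}_Der(M_n(ℂ))`: they vanish on derivations of which `s ≠ a` come from `C` and
the others are inner derivations of `M_n(ℂ)`. -/
def HasBidegree (a : ℕ) {r : ℕ} (ξ : Form (Matrix (Fin n) (Fin n) C) r) : Prop :=
  ∀ (s : Finset (Fin r)) (X : Fin r → Der C) (m : Fin r → Matrix (Fin n) (Fin n) ℂ),
    s.card ≠ a → ξ (fun i => if i ∈ s then liftDer (X i) else adDer (constMatrix (m i))) = 0

/-- The arguments `X₁, …, X_p` (derivations of `C`) followed by `ad m₁, …, ad m_q`. -/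
def mixedArgs {p q r : ℕ} (hr : p + q = r) (X : Fin p → Der C)
    (m : Fin q → Matrix (Fin n) (Fin n) ℂ) : Fin r → Der (Matrix (Fin n) (Fin n) C) :=
  fun i => Fin.append (fun j => liftDer (X j)) (fun j => adDer (constMatrix (m j)))
    (Fin.cast hr.symm i)

/-- `ξ` is the form `α ⊗ β` of bidegree `(p, q)`. -/
def IsTensor {p q r : ℕ} (hr : p + q = r) (ξ : Form (Matrix (Fin n) (Fin n) C) r)
    (α : Form C p) (β : Form (Matrix (Fin n) (Fin n) ℂ) q) : Prop :=
  HasBidegree p ξ ∧ ∀ (X : Fin p → Der C) (m : Fin q → Matrix (Fin n) (Fin n) ℂ),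
    ξ (mixedArgs hr X m) = α X • constMatrix (β fun j => adDer (m j))

/-- The real Lie algebra `su(n)` of traceless skew-Hermitian matrices. -/
def su (n : ℕ) : Submodule ℝ (Matrix (Fin n) (Fin n) ℂ) where
  carrier := {A | Aᴴ = -A ∧ A.trace = 0}
  add_mem' := by
    rintro A B ⟨hA, hA'⟩ ⟨hB, hB'⟩
    refine ⟨?_, by rw [Matrix.trace_add, hA', hB', add_zero]⟩
    rw [Matrix.conjTranspose_add, hA, hB, neg_add]
  zero_mem' := ⟨by simp, by simp⟩
  smul_mem' := by
    rintro c A ⟨hA, hA'⟩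
    refine ⟨?_, by rw [Matrix.trace_smul, hA', smul_zero]⟩
    rw [Matrix.conjTranspose_smul, hA, star_trivial, smul_neg]

/-- The factor `1 / (n √(det g))` for a basis `(X_k) = (i E_k)` of `su(n)` and the canonical metric
`g_{kl} = (1/n) Tr(E_k E_l) = -(1/n) Tr(X_k X_l)`. -/
def volumeFactor {N : ℕ} (b : Fin N → su n) : ℝ :=
  ((n : ℝ) * √(Matrix.of fun k l : Fin N =>
    -(1 / (n : ℝ)) * (Matrix.trace ((b k : Matrix (Fin n) (Fin n) ℂ) *
      (b l : Matrix (Fin n) (Fin n) ℂ))).re).det)⁻¹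

/-- The noncommutative integral on `Ω^{n²-1}_Der(M_n(ℂ))`: if `θ^k` is the basis dual to
`∂_k = ad X_k`, then `∫ a √(det g) θ¹ ⋯ θ^{n²-1} = (1/n) Tr a`. It depends on the basis only through
its orientation. -/
def ncIntegral (b : Module.Basis (Fin (n ^ 2 - 1)) ℝ (su n))
    (β : Form (Matrix (Fin n) (Fin n) ℂ) (n ^ 2 - 1)) : ℂ :=
  (volumeFactor b : ℂ) * Matrix.trace (β fun k => adDer (b k : Matrix (Fin n) (Fin n) ℂ))

theorem mixedArgs_update {p q r : ℕ} (hr : p + q = r) (X : Fin p → Der C)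
    (m : Fin q → Matrix (Fin n) (Fin n) ℂ) (i : Fin p) (Y : Der C) :
    mixedArgs hr (update X i Y) m =
      update (mixedArgs hr X m) (Fin.cast hr (Fin.castAdd q i)) (liftDer Y) := by
  subst hr
  funext l
  change Fin.append (fun j => liftDer (update X i Y j)) (fun j => adDer (constMatrix (m j))) l =
    update (Fin.append (fun j => liftDer (X j)) (fun j => adDer (constMatrix (m j))))
      (Fin.castAdd q i) (liftDer Y) l
  refine Fin.addCases (fun l => ?_) (fun l => ?_) l
  · by_cases hl : l = i
    · subst hl; simp
    · have : Fin.castAdd q l ≠ Fin.castAdd q i := fun h => hl (Fin.castAdd_injective _ _ h)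
      simp [hl, this]
  · have : Fin.natAdd p l ≠ Fin.castAdd q i := by
      intro h
      have := congrArg Fin.val h
      simp at this
      omega
    simp [this]

/-- The noncommutative integral over the matrix directions of a form of degree `p + (n² - 1)`: the
noncommutative integral is applied to the last `n² - 1` arguments. -/
def fiberIntegralForm (b : Module.Basis (Fin (n ^ 2 - 1)) ℝ (su n)) {p r : ℕ}
    (hr : p + (n ^ 2 - 1) = r) (ξ : Form (Matrix (Fin n) (Fin n) C) r) : Form C p where
  toFun X := (volumeFactor b : ℂ) •
    Matrix.trace (ξ (mixedArgs hr X fun k => (b k : Matrix (Fin n) (Fin n) ℂ)))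
  map_update_add' := by
    intro inst X i Y Z
    rw [Subsingleton.elim inst (instDecidableEqFin _)]
    simp only [mixedArgs_update, liftDer_add, ξ.map_update_add, Matrix.trace_add, smul_add]
  map_update_smul' := by
    intro inst X i f Y
    rw [Subsingleton.elim inst (instDecidableEqFin _)]
    simp only [mixedArgs_update, liftDer_smul, ξ.map_update_smul]
    rw [smul_comm f]
    congr 1
    have : ∀ a : Matrix (Fin n) (Fin n) C,
        (scalarCenter f : Subalgebra.center ℂ (Matrix (Fin n) (Fin n) C)) • a =
          (f : C) • a := by
      intro a
      ext i j
      change (Matrix.scalar (Fin n) (f : C) * a) i j = (f : C) • a i j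
      simp [Matrix.scalar_apply, Matrix.diagonal_mul]
    rw [this, Matrix.trace_smul]
    rfl
  map_eq_zero_of_eq' := by
    intro X i j hX hij
    rw [ξ.map_eq_zero_of_eq _ (i := Fin.cast hr (Fin.castAdd _ i))
      (j := Fin.cast hr (Fin.castAdd _ j)), Matrix.trace_zero, smul_zero]
    · simp [mixedArgs, hX]
    · simpa [Fin.ext_iff] using hij

theorem fiberIntegralForm_apply (b : Module.Basis (Fin (n ^ 2 - 1)) ℝ (su n)) {p r : ℕ}
    (hr : p + (n ^ 2 - 1) = r) (ξ : Form (Matrix (Fin n) (Fin n) C) r) (X : Fin p → Der C) :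
    fiberIntegralForm b hr ξ X = (volumeFactor b : ℂ) •
      Matrix.trace (ξ (mixedArgs hr X fun k => (b k : Matrix (Fin n) (Fin n) ℂ))) := rfl

/-- The noncommutative integral over the matrix directions as a linear map
`Ω^r_Der(M_n(C)) → Ω^p_Der(C)`, `r = p + (n² - 1)`. -/
def fiberIntegral (b : Module.Basis (Fin (n ^ 2 - 1)) ℝ (su n)) {p r : ℕ}
    (hr : p + (n ^ 2 - 1) = r) : Form (Matrix (Fin n) (Fin n) C) r →ₗ[ℂ] Form C p where
  toFun := fiberIntegralForm b hr
  map_add' ξ η := by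
    ext X
    simp only [AlternatingMap.add_apply, fiberIntegralForm_apply, Matrix.trace_add, smul_add]
  map_smul' c ξ := by
    ext X
    simp only [AlternatingMap.smul_apply, fiberIntegralForm_apply, Matrix.trace_smul,
      RingHom.id_apply]
    exact smul_comm _ _ _

end Matrices

theorem det_exp_su {n : ℕ} (A : Matrix (Fin n) (Fin n) ℂ) (h : A ∈ su n) :
    (NormedSpace.exp A).det = 1 := by
  have hH : (Complex.I • A).IsHermitian := by
    have := h.1
    rw [Matrix.IsHermitian, Matrix.conjTranspose_smul, this]
    simp
  set U : Matrix (Fin n) (Fin n) ℂ := (hH.eigenvectorUnitary : Matrix (Fin n) (Fin n) ℂ)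
  have hU : U * star U = 1 := Unitary.coe_mul_star_self hH.eigenvectorUnitary
  have hU' : star U * U = 1 := Unitary.coe_star_mul_self hH.eigenvectorUnitary
  let V : (Matrix (Fin n) (Fin n) ℂ)ˣ := ⟨U, star U, hU, hU'⟩
  let w : Fin n → ℂ := fun i => -Complex.I * (hH.eigenvalues i : ℂ)
  have hA : A = V * Matrix.diagonal w * (V⁻¹ : (Matrix (Fin n) (Fin n) ℂ)ˣ) := by
    have h1 := hH.spectral_theorem
    rw [Unitary.conjStarAlgAut_apply] at h1
    have h2 : A = (-Complex.I) • (Complex.I • A) := by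
      rw [smul_smul]; simp
    rw [h2, h1]
    have h3 : Matrix.diagonal w = (-Complex.I) •
        (Matrix.diagonal (RCLike.ofReal ∘ hH.eigenvalues) : Matrix (Fin n) (Fin n) ℂ) := by
      rw [← Matrix.diagonal_smul]
      rfl
    rw [h3, Matrix.mul_smul, Matrix.smul_mul]
    rfl
  have ht : ∑ i, w i = 0 := by
    have : A.trace = ∑ i, w i := by
      conv_lhs => rw [hA]
      rw [Matrix.trace_units_conj, Matrix.trace_diagonal]
    rw [← this, h.2]
  rw [hA, Matrix.exp_units_conj, Matrix.exp_diagonal, Matrix.det_units_conj, Matrix.det_diagonal]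
  have : ∀ i, NormedSpace.exp w i = Complex.exp (w i) := fun i => by
    rw [Pi.coe_exp, Complex.exp_eq_exp_ℂ]
  simp only [this]
  rw [← Complex.exp_sum, ht, Complex.exp_zero]

/-- The one-parameter subgroup `t ↦ exp (tA)` of `SU(n)`. -/
def expSU {n : ℕ} (A : su n) (t : ℝ) : Matrix.specialUnitaryGroup (Fin n) ℂ :=
  ⟨NormedSpace.exp (t • (A : Matrix (Fin n) (Fin n) ℂ)), by
    have hA : (t • (A : Matrix (Fin n) (Fin n) ℂ)) ∈ su n := (su n).smul_mem t A.2
    refine Matrix.mem_specialUnitaryGroup_iff.2 ⟨?_, det_exp_su _ hA⟩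
    rw [Matrix.mem_unitaryGroup_iff, Matrix.star_eq_conjTranspose, ← Matrix.exp_conjTranspose,
      hA.1, ← Matrix.exp_add_of_commute _ _
        (Commute.refl (t • (A : Matrix (Fin n) (Fin n) ℂ))).neg_right, add_neg_cancel,
      NormedSpace.exp_zero]⟩

theorem expSU_zero {n : ℕ} (A : su n) :
    (expSU A 0 : Matrix (Fin n) (Fin n) ℂ) = 1 := by
  simp [expSU, NormedSpace.exp_zero]

open scoped Matrix.Norms.Operator in
theorem contDiff_expSU {n : ℕ} (A : su n) (i j : Fin n) :
    ContDiff ℝ ∞ (fun t : ℝ => (expSU A t : Matrix (Fin n) (Fin n) ℂ) i j) := by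
  have h1 : ContDiff ℝ ∞ (fun t : ℝ =>
      NormedSpace.exp (t • (A : Matrix (Fin n) (Fin n) ℂ))) := by
    have h2 : ContDiff ℝ ∞ (NormedSpace.exp : Matrix (Fin n) (Fin n) ℂ → _) :=
      contDiff_iff_contDiffAt.2 fun x =>
        (NormedSpace.exp_analytic (𝕂 := ℝ) x).contDiffAt
    exact h2.comp (contDiff_id.smul contDiff_const)
  let L : Matrix (Fin n) (Fin n) ℂ →ₗ[ℝ] ℂ :=
    { toFun := fun B => B i j, map_add' := fun _ _ => rfl, map_smul' := fun _ _ => rfl }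
  exact (LinearMap.toContinuousLinearMap L).contDiff.comp h1

theorem contMDiffOn_cmul {V H X : Type*} [NormedAddCommGroup V] [NormedSpace ℝ V]
    [TopologicalSpace H] {I : ModelWithCorners ℝ V H} [TopologicalSpace X] [ChartedSpace H X]
    {f g : X → ℂ} {s : Set X} (hf : ContMDiffOn I 𝓘(ℝ, ℂ) ∞ f s)
    (hg : ContMDiffOn I 𝓘(ℝ, ℂ) ∞ g s) : ContMDiffOn I 𝓘(ℝ, ℂ) ∞ (fun x => f x * g x) s := by
  have h : ContDiff ℝ ∞ (fun q : ℂ × ℂ => q.1 * q.2) := contDiff_fst.mul contDiff_snd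
  exact h.contMDiff.comp_contMDiffOn (hf.prodMk_space hg)

theorem contMDiffOn_cstar {V H X : Type*} [NormedAddCommGroup V] [NormedSpace ℝ V]
    [TopologicalSpace H] {I : ModelWithCorners ℝ V H} [TopologicalSpace X] [ChartedSpace H X]
    {f : X → ℂ} {s : Set X} (hf : ContMDiffOn I 𝓘(ℝ, ℂ) ∞ f s) :
    ContMDiffOn I 𝓘(ℝ, ℂ) ∞ (fun x => star (f x)) s :=
  (Complex.conjCLE.contDiff (n := ∞)).contMDiff.comp_contMDiffOn hf

section Bundle

variable {d n : ℕ} {M : Type*} [TopologicalSpace M] [ChartedSpace (EuclideanSpace ℝ (Fin d)) M]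
  (E : M → Type*) [TopologicalSpace (TotalSpace (Fin n → ℂ) E)]
  [∀ x, AddCommGroup (E x)] [∀ x, Module ℂ (E x)] [∀ x, TopologicalSpace (E x)]
  [FiberBundle (Fin n → ℂ) E] [VectorBundle ℂ (Fin n → ℂ) E]

variable (d M) in
/-- The algebra of smooth complex functions on the manifold `M`. -/
def smoothFunctions : Subalgebra ℂ (M → ℂ) where
  carrier := {f | ContMDiff (𝓡 d) 𝓘(ℝ, ℂ) ∞ f}
  mul_mem' := fun hf hg => contMDiffOn_univ.1 (contMDiffOn_cmul hf.contMDiffOn hg.contMDiffOn)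
  add_mem' := fun hf hg => ContMDiff.add hf hg
  algebraMap_mem' := fun _ => contMDiff_const

/-- The local frame over the base set of the preferred trivialization at `x₀`. -/
def localFrame (x₀ x : M) (j : Fin n) : E x :=
  (trivializationAt (Fin n → ℂ) E x₀).symmₗ ℂ x (Pi.single j 1)

/-- The coordinates of a vector in the local frame at `x₀`. -/
def localCoord (x₀ x : M) : E x →ₗ[ℂ] (Fin n → ℂ) :=
  (trivializationAt (Fin n → ℂ) E x₀).linearMapAt ℂ x

theorem sum_localCoord (x₀ x : M) (hx : x ∈ (trivializationAt (Fin n → ℂ) E x₀).baseSet)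
    (v : E x) :
    ∑ j : Fin n, (localCoord E x₀ x v : Fin n → ℂ) j • localFrame E x₀ x j = v := by
  conv_rhs => rw [← (trivializationAt (Fin n → ℂ) E x₀).symmₗ_linearMapAt (R := ℂ) hx v]
  rw [show (trivializationAt (Fin n → ℂ) E x₀).linearMapAt ℂ x v = localCoord E x₀ x v from rfl]
  simp only [localFrame, ← map_smul, ← map_sum]
  congr 1
  ext k
  simp [Finset.sum_apply, Pi.single_apply]

variable (n) in
/-- The algebra of smooth sections of the endomorphism bundle of `E`: families of endomorphisms of
the fibres whose matrix coefficients in the local frames are smooth. -/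
def endSections : Subalgebra ℂ (∀ x : M, Module.End ℂ (E x)) where
  carrier := {a | ∀ (x₀ : M) (i j : Fin n), ContMDiffOn (𝓡 d) 𝓘(ℝ, ℂ) ∞
    (fun x => localCoord E x₀ x (a x (localFrame E x₀ x j)) i)
    (trivializationAt (Fin n → ℂ) E x₀).baseSet}
  mul_mem' := by
    intro a b ha hb x₀ i j
    have : ContMDiffOn (𝓡 d) 𝓘(ℝ, ℂ) ∞
        (fun x => ∑ k, localCoord E x₀ x (b x (localFrame E x₀ x j)) k *
          localCoord E x₀ x (a x (localFrame E x₀ x k)) i)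
        (trivializationAt (Fin n → ℂ) E x₀).baseSet :=
      contMDiffOn_finsetSum fun k _ => contMDiffOn_cmul (hb x₀ k j) (ha x₀ i k)
    refine this.congr fun x hx => ?_
    rw [Pi.mul_apply, Module.End.mul_apply]
    conv_lhs => rw [← sum_localCoord E x₀ x hx (b x (localFrame E x₀ x j))]
    simp [Finset.sum_apply]
  add_mem' := by
    intro a b ha hb x₀ i j
    refine ((ha x₀ i j).add (hb x₀ i j)).congr fun x _ => ?_
    simp
  algebraMap_mem' := by
    intro c x₀ i j
    refine (contMDiffOn_const (c := c * (Pi.single j (1 : ℂ) : Fin n → ℂ) i)).congr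
      fun x hx => ?_
    simp only [Pi.algebraMap_apply, Module.algebraMap_end_apply, map_smul, Pi.smul_apply,
      smul_eq_mul]
    rw [localCoord, localFrame, Trivialization.linearMapAt_symmₗ _ hx]

/-- A smooth Hermitian metric on `E`. -/
structure HermitianMetric where
  form : ∀ x, E x →ₗ⋆[ℂ] E x →ₗ[ℂ] ℂ
  conj_symm : ∀ x v w, star (form x v w) = form x w v
  pos : ∀ x v, v ≠ 0 → 0 < (form x v v).re
  smooth : ∀ (x₀ : M) (i j : Fin n), ContMDiffOn (𝓡 d) 𝓘(ℝ, ℂ) ∞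
    (fun x => form x (localFrame E x₀ x i) (localFrame E x₀ x j))
    (trivializationAt (Fin n → ℂ) E x₀).baseSet

variable {E}

/-- An orientation of a Hermitian bundle of rank `n`: a smooth complex volume form on the fibres, of
modulus one on orthonormal frames. -/
structure Orientation (h : HermitianMetric E (d := d) (n := n)) where
  vol : ∀ x, E x [⋀^Fin n]→ₗ[ℂ] ℂ
  norm_eq_one : ∀ (x : M) (e : Fin n → E x),
    (∀ i j, h.form x (e i) (e j) = if i = j then 1 else 0) → ‖vol x e‖ = 1
  smooth : ∀ x₀ : M, ContMDiffOn (𝓡 d) 𝓘(ℝ, ℂ) ∞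
    (fun x => vol x (localFrame E x₀ x)) (trivializationAt (Fin n → ℂ) E x₀).baseSet

/-- The total space of the `SU(n)`-frame bundle: oriented orthonormal frames of the fibres. -/
structure FrameBundle {h : HermitianMetric E (d := d) (n := n)} (o : Orientation h) where
  base : M
  frame : Fin n → E base
  orthonormal : ∀ i j, h.form base (frame i) (frame j) = if i = j then 1 else 0
  oriented : o.vol base frame = 1

variable {h : HermitianMetric E (d := d) (n := n)} {o : Orientation h}

/-- The right action of `SU(n)` on frames: `(e · g)_j = ∑ i, g_{ij} e_i`. -/
def FrameBundle.act (p : FrameBundle o) (g : Matrix.specialUnitaryGroup (Fin n) ℂ) :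
    FrameBundle o where
  base := p.base
  frame j := ∑ i, (g : Matrix (Fin n) (Fin n) ℂ) i j • p.frame i
  orthonormal := by
    intro i j
    have hg := (Matrix.mem_unitaryGroup_iff').1 (Matrix.mem_specialUnitaryGroup_iff.1 g.2).1
    have hg' := congrFun (congrFun hg i) j
    rw [Matrix.mul_apply, Matrix.one_apply] at hg'
    rw [← hg']
    simp [map_sum, LinearMap.sum_apply, p.orthonormal, Matrix.star_apply, mul_comm]
  oriented := by
    have hg := (Matrix.mem_specialUnitaryGroup_iff.1 g.2).2
    let f : (Fin n → ℂ) [⋀^Fin n]→ₗ[ℂ] ℂ :=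
      (o.vol p.base).compLinearMap (Fintype.linearCombination ℂ p.frame)
    have h1 := congrArg (fun F => F ((g : Matrix (Fin n) (Fin n) ℂ)ᵀ))
      (AlternatingMap.eq_smul_basis_det (Pi.basisFun ℂ (Fin n)) f)
    have h2 : f ((g : Matrix (Fin n) (Fin n) ℂ)ᵀ) =
        o.vol p.base (fun j => ∑ i, (g : Matrix (Fin n) (Fin n) ℂ) i j • p.frame i) := by
      simp only [f]
      congr 1
    have h3 : f (Pi.basisFun ℂ (Fin n)) = 1 := by
      rw [← p.oriented]
      simp only [f, AlternatingMap.compLinearMap_apply]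
      congr 1
      ext j
      simp [Fintype.linearCombination_apply, Pi.single_apply]
    rw [← h2, h1, h3]
    change (1 : ℂ) • (Pi.basisFun ℂ (Fin n)).det ((g : Matrix (Fin n) (Fin n) ℂ)ᵀ) = 1
    rw [one_smul]
    exact (Pi.basisFun_det_apply _).trans ((Matrix.det_transpose _).trans hg)

/-- Coordinates on the frame bundle: the base point and the coordinates of the frame vectors in the
local frame at `x₀`. -/
def frameCoord (x₀ : M) (p : FrameBundle o) : M × (Fin n → Fin n → ℂ) :=
  (p.base, fun j => localCoord E x₀ p.base (p.frame j))

/-- A function on the frame bundle is smooth if locally, in the coordinates of a trivialization of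
`E`, it is the restriction of a smooth function on the manifold of all `n`-tuples of vectors of `E`,
of which the frame bundle is an embedded submanifold. -/
def IsSmoothOnFrames (f : FrameBundle o → ℂ) : Prop :=
  ∀ p₀ : FrameBundle o, ∃ U : Set (M × (Fin n → Fin n → ℂ)), IsOpen U ∧
    frameCoord p₀.base p₀ ∈ U ∧ ∃ F : M × (Fin n → Fin n → ℂ) → ℂ,
      ContMDiffOn ((𝓡 d).prod 𝓘(ℝ, Fin n → Fin n → ℂ)) 𝓘(ℝ, ℂ) ∞ F U ∧
      ∀ p : FrameBundle o, p.base ∈ (trivializationAt (Fin n → ℂ) E p₀.base).baseSet →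
        frameCoord p₀.base p ∈ U → f p = F (frameCoord p₀.base p)

variable (o) in
/-- The algebra of smooth complex functions on the frame bundle. -/
def frameFunctions : Subalgebra ℂ (FrameBundle o → ℂ) where
  carrier := {f | IsSmoothOnFrames f}
  mul_mem' := by
    intro f g hf hg p₀
    obtain ⟨U, hU, hpU, F, hF, hfF⟩ := hf p₀
    obtain ⟨W, hW, hpW, G, hG, hgG⟩ := hg p₀
    refine ⟨U ∩ W, hU.inter hW, ⟨hpU, hpW⟩, fun q => F q * G q,
      contMDiffOn_cmul (hF.mono Set.inter_subset_left) (hG.mono Set.inter_subset_right),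
      fun p hp hpc => ?_⟩
    rw [Pi.mul_apply, hfF p hp hpc.1, hgG p hp hpc.2]
  add_mem' := by
    intro f g hf hg p₀
    obtain ⟨U, hU, hpU, F, hF, hfF⟩ := hf p₀
    obtain ⟨W, hW, hpW, G, hG, hgG⟩ := hg p₀
    refine ⟨U ∩ W, hU.inter hW, ⟨hpU, hpW⟩, fun q => F q + G q,
      (hF.mono Set.inter_subset_left).add (hG.mono Set.inter_subset_right),
      fun p hp hpc => ?_⟩
    rw [Pi.add_apply, hfF p hp hpc.1, hgG p hp hpc.2]
  algebraMap_mem' := fun c _ =>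
    ⟨Set.univ, isOpen_univ, Set.mem_univ _, fun _ => c, contMDiffOn_const, fun _ _ _ => rfl⟩

instance : CommRing (frameFunctions o) := inferInstance

instance : Algebra ℂ (frameFunctions o) := inferInstance

variable (o) in
/-- The algebra of matrix valued smooth functions on the frame bundle, `C^∞(P) ⊗ M_n(ℂ)`. -/
abbrev matrixFunctions : Type _ := Matrix (Fin n) (Fin n) (frameFunctions o)

/-- The motion of the coordinates of a frame under the one-parameter group `exp (tA)`. -/
def coordFlow (A : su n) (q : M × (Fin n → Fin n → ℂ)) (t : ℝ) : M × (Fin n → Fin n → ℂ) :=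
  (q.1, fun j => ∑ i, (expSU A t : Matrix (Fin n) (Fin n) ℂ) i j • q.2 i)

theorem coordFlow_zero (A : su n) (q : M × (Fin n → Fin n → ℂ)) : coordFlow A q 0 = q := by
  refine Prod.ext rfl ?_
  funext j
  simp [coordFlow, expSU_zero, Matrix.one_apply]

theorem frameCoord_act (A : su n) (x₀ : M) (p : FrameBundle o) (t : ℝ) :
    frameCoord x₀ (p.act (expSU A t)) = coordFlow A (frameCoord x₀ p) t := by
  refine Prod.ext rfl ?_
  funext j
  change localCoord E x₀ p.base (∑ i, (expSU A t : Matrix (Fin n) (Fin n) ℂ) i j • p.frame i)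
    = ∑ i, (expSU A t : Matrix (Fin n) (Fin n) ℂ) i j • localCoord E x₀ p.base (p.frame i)
  rw [map_sum]
  exact Finset.sum_congr rfl fun i _ => map_smul _ _ _

theorem contMDiff_coordFlow (A : su n) :
    ContMDiff (((𝓡 d).prod 𝓘(ℝ, Fin n → Fin n → ℂ)).prod 𝓘(ℝ, ℝ))
      ((𝓡 d).prod 𝓘(ℝ, Fin n → Fin n → ℂ)) ∞
      (fun q : (M × (Fin n → Fin n → ℂ)) × ℝ => coordFlow A q.1 q.2) := by
  have h : ContDiff ℝ ∞ (fun q : (Fin n → Fin n → ℂ) × ℝ => (fun j =>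
      ∑ i, (expSU A q.2 : Matrix (Fin n) (Fin n) ℂ) i j • q.1 i : Fin n → Fin n → ℂ)) := by
    refine contDiff_pi.2 fun j => ContDiff.sum fun i _ => contDiff_pi.2 fun k => ?_
    refine ContDiff.mul ((contDiff_expSU A i j).comp contDiff_snd) ?_
    exact (contDiff_apply_apply ℝ ℂ i k).comp contDiff_fst
  have h1 : ContMDiff (((𝓡 d).prod 𝓘(ℝ, Fin n → Fin n → ℂ)).prod 𝓘(ℝ, ℝ)) (𝓡 d) ∞
      (fun q : (M × (Fin n → Fin n → ℂ)) × ℝ => q.1.1) := contMDiff_fst.comp contMDiff_fst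
  have h2 : ContMDiff (((𝓡 d).prod 𝓘(ℝ, Fin n → Fin n → ℂ)).prod 𝓘(ℝ, ℝ))
      𝓘(ℝ, Fin n → Fin n → ℂ) ∞
      (fun q : (M × (Fin n → Fin n → ℂ)) × ℝ => q.1.2) := contMDiff_snd.comp contMDiff_fst
  have h3 : ContMDiff (((𝓡 d).prod 𝓘(ℝ, Fin n → Fin n → ℂ)).prod 𝓘(ℝ, ℝ)) 𝓘(ℝ, ℝ) ∞
      (fun q : (M × (Fin n → Fin n → ℂ)) × ℝ => q.2) := contMDiff_snd
  have h4 := h.contMDiff.comp (h2.prodMk_space h3)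
  exact h1.prodMk h4

theorem IsSmoothOnFrames.of_base {f : M → ℂ} (hf : ContMDiff (𝓡 d) 𝓘(ℝ, ℂ) ∞ f) :
    IsSmoothOnFrames (fun p : FrameBundle o => f p.base) := by
  intro p₀
  have h1 : ContMDiff ((𝓡 d).prod 𝓘(ℝ, Fin n → Fin n → ℂ)) 𝓘(ℝ, ℂ) ∞
      (fun q : M × (Fin n → Fin n → ℂ) => f q.1) :=
    ContMDiff.comp (g := f) (f := Prod.fst) hf contMDiff_fst
  exact ⟨Set.univ, isOpen_univ, Set.mem_univ _, fun q => f q.1, h1.contMDiffOn,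
    fun _ _ _ => rfl⟩

variable (o) in
/-- Composition of smooth functions on `M` with the projection of the frame bundle. -/
def pullbackFunction (f : smoothFunctions d M) : frameFunctions o :=
  ⟨fun p => f.1 p.base, IsSmoothOnFrames.of_base f.2⟩

theorem form_eq_sum (h : HermitianMetric E (d := d) (n := n)) (x₀ x : M)
    (hx : x ∈ (trivializationAt (Fin n → ℂ) E x₀).baseSet) (v w : E x) :
    h.form x v w = ∑ k : Fin n, ∑ l : Fin n, star ((localCoord E x₀ x v : Fin n → ℂ) k) *
      ((localCoord E x₀ x w : Fin n → ℂ) l *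
        h.form x (localFrame E x₀ x k) (localFrame E x₀ x l)) := by
  conv_lhs => rw [← sum_localCoord E x₀ x hx v, ← sum_localCoord E x₀ x hx w]
  simp only [map_sum, LinearMap.sum_apply, map_smulₛₗ, LinearMap.smul_apply, smul_eq_mul,
    RingHom.id_apply, starRingEnd_apply]
  simp only [Finset.mul_sum]
  rw [Finset.sum_comm]
  exact Finset.sum_congr rfl fun k _ => Finset.sum_congr rfl fun l _ => mul_left_comm _ _ _

variable (o) in
/-- The embedding of the sections of `End(E)` into the matrix valued functions on the frame bundle:
the matrix of the endomorphism in the given frame, whose entries are `⟨e_i, a e_j⟩`. -/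
def frameMatrix (a : endSections (d := d) n E) : matrixFunctions o :=
  Matrix.of fun i j => ⟨fun p => h.form p.base (p.frame i) (a.1 p.base (p.frame j)), by
    intro p₀
    set e := trivializationAt (Fin n → ℂ) E p₀.base
    refine ⟨e.baseSet ×ˢ Set.univ, e.open_baseSet.prod isOpen_univ,
      ⟨FiberBundle.mem_baseSet_trivializationAt' p₀.base, Set.mem_univ _⟩,
      fun q => ∑ k : Fin n, ∑ l : Fin n, star (q.2 i k) *
        ((∑ m : Fin n, q.2 j m * localCoord E p₀.base q.1
          (a.1 q.1 (localFrame E p₀.base q.1 m)) l) *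
          h.form q.1 (localFrame E p₀.base q.1 k) (localFrame E p₀.base q.1 l)), ?_, ?_⟩
    · have hc : ∀ i k : Fin n, ContMDiffOn ((𝓡 d).prod 𝓘(ℝ, Fin n → Fin n → ℂ)) 𝓘(ℝ, ℂ) ∞
          (fun q : M × (Fin n → Fin n → ℂ) => q.2 i k) (e.baseSet ×ˢ Set.univ) := fun i k =>
        ((contDiff_apply_apply ℝ ℂ i k).contMDiff.comp contMDiff_snd).contMDiffOn
      have hm : Set.MapsTo (Prod.fst : M × (Fin n → Fin n → ℂ) → M)
          (e.baseSet ×ˢ Set.univ) e.baseSet := fun q hq => hq.1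
      refine contMDiffOn_finsetSum fun k _ => contMDiffOn_finsetSum fun l _ =>
        contMDiffOn_cmul (contMDiffOn_cstar (hc i k)) (contMDiffOn_cmul
          (contMDiffOn_finsetSum fun m _ => contMDiffOn_cmul (hc j m) ?_) ?_)
      · exact (a.2 p₀.base l m).comp contMDiffOn_fst hm
      · exact (h.smooth p₀.base k l).comp contMDiffOn_fst hm
    · intro p hp _
      refine (form_eq_sum h p₀.base p.base hp (p.frame i) (a.1 p.base (p.frame j))).trans ?_
      refine Finset.sum_congr rfl fun k _ => Finset.sum_congr rfl fun l _ => ?_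
      congr 2
      conv_lhs => rw [← sum_localCoord E p₀.base p.base hp (p.frame j)]
      simp [map_sum, Finset.sum_apply, frameCoord]
      rfl⟩

theorem frameMatrix_apply (a : endSections (d := d) n E) (i j : Fin n) (p : FrameBundle o) :
    (frameMatrix o a i j).1 p = h.form p.base (p.frame i) (a.1 p.base (p.frame j)) := rfl

variable [IsManifold (𝓡 d) ∞ M]

theorem contMDiffOn_deriv_coordFlow (A : su n) {U : Set (M × (Fin n → Fin n → ℂ))}
    (hU : IsOpen U) {F : M × (Fin n → Fin n → ℂ) → ℂ}
    (hF : ContMDiffOn ((𝓡 d).prod 𝓘(ℝ, Fin n → Fin n → ℂ)) 𝓘(ℝ, ℂ) ∞ F U) :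
    (∀ q ∈ U, DifferentiableAt ℝ (fun t => F (coordFlow A q t)) 0) ∧
    ContMDiffOn ((𝓡 d).prod 𝓘(ℝ, Fin n → Fin n → ℂ)) 𝓘(ℝ, ℂ) ∞
      (fun q => deriv (fun t => F (coordFlow A q t)) 0) U := by
  have : IsManifold (𝓡 d) 1 M := IsManifold.of_le (n := ∞) (by simp)
  have key : ∀ q ∈ U, ContMDiffAt (((𝓡 d).prod 𝓘(ℝ, Fin n → Fin n → ℂ)).prod 𝓘(ℝ, ℝ))
      𝓘(ℝ, ℂ) ∞ (uncurry fun (q : M × (Fin n → Fin n → ℂ)) (t : ℝ) => F (coordFlow A q t))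
      (q, 0) := by
    intro q hq
    have h1 : ContMDiffAt ((𝓡 d).prod 𝓘(ℝ, Fin n → Fin n → ℂ)) 𝓘(ℝ, ℂ) ∞ F
        (coordFlow A q 0) := by
      rw [coordFlow_zero]
      exact hF.contMDiffAt (hU.mem_nhds hq)
    exact ContMDiffAt.comp (q, (0 : ℝ)) h1 (contMDiff_coordFlow A (q, 0))
  constructor
  · intro q hq
    have h1 : ContMDiffAt 𝓘(ℝ, ℝ) 𝓘(ℝ, ℂ) ∞ (fun t : ℝ => F (coordFlow A q t)) 0 :=
      ContMDiffAt.comp (g := uncurry fun (q : M × (Fin n → Fin n → ℂ)) (t : ℝ) =>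
        F (coordFlow A q t)) (f := fun t : ℝ => (q, t)) (0 : ℝ) (key q hq)
        (contMDiffAt_const.prodMk contMDiffAt_id)
    exact h1.contDiffAt.differentiableAt (by simp)
  · intro q hq
    have h1 := ContMDiffAt.mfderiv_apply (m := ∞)
      (fun (q : M × (Fin n → Fin n → ℂ)) (t : ℝ) => F (coordFlow A q t)) (fun _ => (0 : ℝ)) id
      (fun _ => (1 : ℝ)) (x₀ := q) (key q hq) contMDiffAt_const contMDiffAt_id contMDiffAt_const
      (by simp)
    refine ContMDiffAt.contMDiffWithinAt ?_
    refine h1.congr_of_eventuallyEq (Filter.Eventually.of_forall fun q' => ?_)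
    have h2 := inTangentCoordinates_model_space (I := 𝓘(ℝ, ℝ)) (I' := 𝓘(ℝ, ℂ))
      (fun _ : M × (Fin n → Fin n → ℂ) => (0 : ℝ)) (fun x => F (coordFlow A x 0))
      (fun x => mfderiv 𝓘(ℝ, ℝ) 𝓘(ℝ, ℂ) (fun t => F (coordFlow A x t)) 0) q
    refine Eq.trans ?_ (congrArg (fun L => L q' (1 : ℝ)) h2).symm
    change _ = (mfderiv 𝓘(ℝ, ℝ) 𝓘(ℝ, ℂ) (fun t => F (coordFlow A q' t)) 0) (1 : ℝ)
    rw [mfderiv_eq_fderiv]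
    exact fderiv_apply_one_eq_deriv.symm

theorem IsSmoothOnFrames.differentiableAt {f : FrameBundle o → ℂ} (hf : IsSmoothOnFrames f)
    (A : su n) (p : FrameBundle o) : DifferentiableAt ℝ (fun t => f (p.act (expSU A t))) 0 := by
  obtain ⟨U, hU, hpU, F, hF, hfF⟩ := hf p
  have hd := (contMDiffOn_deriv_coordFlow A hU hF).1 _ hpU
  refine hd.congr_of_eventuallyEq ?_
  have hc : ContinuousAt (fun t : ℝ => coordFlow A (frameCoord p.base p) t) 0 :=
    ((contMDiff_coordFlow (d := d) A).continuous.comp (Continuous.prodMk_right _)).continuousAt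
  have hn : ∀ᶠ t in nhds (0 : ℝ), coordFlow A (frameCoord p.base p) t ∈ U :=
    hc.eventually_mem (by rw [coordFlow_zero]; exact hU.mem_nhds hpU)
  filter_upwards [hn] with t ht
  rw [← frameCoord_act] at ht ⊢
  exact hfF _ (FiberBundle.mem_baseSet_trivializationAt' p.base) ht

theorem IsSmoothOnFrames.deriv {f : FrameBundle o → ℂ} (hf : IsSmoothOnFrames f) (A : su n) :
    IsSmoothOnFrames (fun p => _root_.deriv (fun t => f (p.act (expSU A t))) 0) := by
  intro p₀
  obtain ⟨U, hU, hpU, F, hF, hfF⟩ := hf p₀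
  refine ⟨U, hU, hpU, _, (contMDiffOn_deriv_coordFlow A hU hF).2, fun p hp hpU' => ?_⟩
  refine Filter.EventuallyEq.deriv_eq ?_
  have hc : ContinuousAt (fun t : ℝ => coordFlow A (frameCoord p₀.base p) t) 0 :=
    ((contMDiff_coordFlow (d := d) A).continuous.comp (Continuous.prodMk_right _)).continuousAt
  have hn : ∀ᶠ t in nhds (0 : ℝ), coordFlow A (frameCoord p₀.base p) t ∈ U :=
    hc.eventually_mem (by rw [coordFlow_zero]; exact hU.mem_nhds hpU')
  filter_upwards [hn] with t ht
  rw [← frameCoord_act] at ht ⊢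
  exact hfF _ hp ht

/-- The vertical derivation `A^v`, `(A^v f)(p) = d/dt f(p · exp(tA))` at `t = 0`. -/
def fundamentalDer (A : su n) : Der (frameFunctions o) :=
  ⟨{ toFun := fun f => ⟨fun p => deriv (fun t => f.1 (p.act (expSU A t))) 0, f.2.deriv A⟩
     map_add' := fun f g => by
       ext p
       exact deriv_fun_add (f.2.differentiableAt A p) (g.2.differentiableAt A p)
     map_smul' := fun c f => by
       ext p
       exact deriv_fun_const_smul c (f.2.differentiableAt A p) }, by
    intro f g
    have h0 : ∀ p : FrameBundle o, p.act (expSU A 0) = p := by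
      intro p
      cases p
      simp [FrameBundle.act, expSU_zero, Matrix.one_apply]
    ext p
    refine (deriv_fun_mul (f.2.differentiableAt A p) (g.2.differentiableAt A p)).trans ?_
    rw [h0]
    rfl⟩

theorem fundamentalDer_apply (A : su n) (f : frameFunctions o) (p : FrameBundle o) :
    (fundamentalDer A f).1 p = deriv (fun t => f.1 (p.act (expSU A t))) 0 := rfl

variable (o) in
/-- The derivations `A^v`, `A ∈ su(n)`, of the functions on the frame bundle. -/
def verticalDer : Set (Der (frameFunctions o)) := Set.range (fundamentalDer (o := o))

/-- The derivation `A^v + ad_A` of the matrix valued functions on the frame bundle. -/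
def gaugeAction (A : su n) : Der (matrixFunctions o) :=
  (liftDer (fundamentalDer (o := o) A) : Der (matrixFunctions o)) +
    adDer (constMatrix (C := frameFunctions o) (A : Matrix (Fin n) (Fin n) ℂ))

variable (o) in
/-- The derivations `A^v + ad_A`, `A ∈ su(n)`. -/
def gaugeDer : Set (Der (matrixFunctions o)) :=
  Set.range (gaugeAction (o := o))

end Bundle

end

end DerivationCalculus

open DerivationCalculus

namespace DerivationCalculus

noncomputable section

/-! ### Forms, related derivations and maps in cohomology. -/

section Forms

variable {A : Type*} [Ring A] [Algebra ℂ A]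

/-! Write 𝔄 for `endSections n E`, P for the frame bundle and 𝔅 = M_n(C^∞(P)). The integral puts the
inner derivations `ad b_k`, for a basis `b` of su(n), into the last N = n² - 1 slots of a form and
takes the trace. Two facts make it behave like integration over a closed fibre: the trace
annihilates the values of inner derivations, and su(n) is unimodular, tr ad_A = 0
(`trace_adMatrix`).

On 𝔅 this settles everything. In a slot occupied by A^v the derivation A^v + ad_A may be put
instead, because ad_A is a combination of the `ad b_k` that are already arguments; so horizontality
is inherited. In a Lie derivative along V + ad_A the matrix slots contribute only the factor tr
ad_A, which is zero (`lieForm_fiberIntegral`). For the differential, Cartan's formula `koszul_cons`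
splits off one argument coming from P, and induction reduces the claim to degree N - 1
(`trace_koszul_basis`): there the bracket terms add up to traces of ad, and the remaining terms are
traces of commutators.

The link between 𝔄 and 𝔅 rests on a local description of derivations. A derivation of 𝔄 along the
evaluation in a frame is a combination of d coordinate derivations, flat for a local orthonormal
frame, and an inner one (`IsDerivationAt.apply_eq`): Hadamard's lemma takes care of the coefficient
functions, the usual matrix unit computation of the rest. A derivation of 𝔅 that kills 𝔄 is a
combination of the A^v + ad_A over the centre (`exists_eq_sum_gaugeAction`), since the matrix
entries of endomorphism fields separate the derivations of C^∞(P)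
(`eq_zero_of_apply_frameMatrix_eq_zero`). The reason for the latter is that conjugation by a unitary
matrix determines it up to a phase, and determinant one leaves no infinitesimal phase. Hence, after
multiplication by cut-off functions, derivations of 𝔅 are spanned by those that restrict to 𝔄 and by
the A^v + ad_A, and a horizontal form is determined by its values on the former
(`form_eq_zero_of_isHorizontal`).

Conversely, the form on 𝔅 that corresponds to η is defined frame by frame: at `p` each argument is
replaced by a derivation of 𝔄 with the same effect on 𝔄 at `p`. The result does not depend on the
choice because forms multilinear over the centre are local (`matrixAt_form_eq_zero`), and it is
smooth because the choice can be made with smooth coefficients. It is basic because the A^v + ad_A,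
and their brackets with derivations that restrict to 𝔄, kill 𝔄.

The same construction gives the form on M. At a frame, the integral depends only on the projections
of its arguments to M, since a derivation vertical at `p` acts on 𝔄 at `p` like an inner one with
traceless generator, a combination of the `ad b_k` again (`fiberIntegral_eq_zero_of_vertical`). It
is constant along the fibres because passing from `p` to `p · g` conjugates the basis by `g`, with
determinant one on su(n), and conjugates the value, whose trace stays the same
(`fiberIntegral_act`). The differentials on 𝔄 and M are compatible because correspondence of forms
commutes with d and, by uniqueness, the differential of the basic form of η is the basic form of dη.
The maps in cohomology are a formal consequence. -/

theorem Der.add_apply (X Y : Der A) (a : A) : (X + Y) a = X a + Y a := rfl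

theorem Der.sub_apply (X Y : Der A) (a : A) : (X - Y) a = X a - Y a := rfl

theorem Der.csmul_apply (c : ℂ) (X : Der A) (a : A) : (c • X) a = c • X a := rfl

theorem Der.sum_apply {ι : Type*} (s : Finset ι) (X : ι → Der A) (a : A) :
    (∑ i ∈ s, X i) a = ∑ i ∈ s, X i a := by
  classical
  induction s using Finset.induction_on with
  | empty => rfl
  | insert i s hi ih => rw [Finset.sum_insert hi, Finset.sum_insert hi, Der.add_apply, ih]

theorem Der.map_one (X : Der A) : X 1 = 0 := by
  have h := Der.leibniz X 1 1
  simpa using h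

theorem Der.map_algebraMap (X : Der A) (c : ℂ) : X (algebraMap ℂ A c) = 0 := by
  rw [Algebra.algebraMap_eq_smul_one, map_smul, Der.map_one, smul_zero]

theorem Der.algebraMap_smul (c : ℂ) (X : Der A) :
    (algebraMap ℂ (Subalgebra.center ℂ A) c) • X = c • X := by
  ext a
  change algebraMap ℂ A c * X a = c • X a
  rw [Algebra.smul_def]

theorem adDer_apply (m a : A) : adDer m a = m * a - a * m := rfl

/-- The inner derivation as a linear function of the element. -/
def adDerLin : A →ₗ[ℂ] Der A where
  toFun := adDer
  map_add' x y := by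
    ext a
    simp only [Der.add_apply, adDer_apply]
    noncomm_ring
  map_smul' c x := by
    ext a
    simp only [RingHom.id_apply, Der.csmul_apply, adDer_apply, smul_mul_assoc, mul_smul_comm,
      smul_sub]

theorem adDerLin_apply (m : A) : adDerLin m = adDer m := rfl

theorem Der.lie_adDer (D : Der A) (m : A) : ⁅D, adDer m⁆ = adDer (D m) := by
  ext a
  simp only [Der.bracket_apply, adDer_apply, map_sub, Der.leibniz]
  abel

variable {k : ℕ}

theorem map_update_csmul (ξ : Form A k) (v : Fin k → Der A) (i : Fin k) (c : ℂ) (X : Der A) :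
    ξ (update v i (c • X)) = c • ξ (update v i X) := by
  rw [← Der.algebraMap_smul, ξ.map_update_smul]
  change algebraMap ℂ A c * _ = _
  rw [Algebra.smul_def]

theorem map_update_finsetSum (ξ : Form A k) (v : Fin k → Der A) (i : Fin k) {ι : Type*}
    (s : Finset ι) (X : ι → Der A) :
    ξ (update v i (∑ j ∈ s, X j)) = ∑ j ∈ s, ξ (update v i (X j)) := by
  exact map_sum (ξ.toMultilinearMap.toLinearMap v i) _ _

/-- Moving the `i`-th argument to the front costs only a sign, so contraction in the first slot
controls every slot. -/
theorem IsHorizontal.map_eq_zero {S : Set (Der A)} {ξ : Form A k} (h : IsHorizontal S ξ)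
    (v : Fin k → Der A) (i : Fin k) (hi : v i ∈ S) : ξ v = 0 := by
  cases k with
  | zero => exact i.elim0
  | succ k =>
    have h1 := congrArg (fun F => F (i.removeNth v)) (h _ hi)
    have h2 := update_eq_insertNth ξ v i (v i)
    rw [update_eq_self] at h2
    rw [h2]
    change ξ (Matrix.vecCons (v i) (i.removeNth v)) = 0 at h1
    rw [h1, smul_zero]

theorem isHorizontal_of_map_eq_zero {S : Set (Der A)} {ξ : Form A k}
    (h : ∀ v : Fin k → Der A, ∀ i, v i ∈ S → ξ v = 0) : IsHorizontal S ξ := by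
  cases k with
  | zero => trivial
  | succ k =>
    intro X hX
    ext w
    exact h (Matrix.vecCons X w) 0 hX

/-- Brackets of related derivations are related, so the Koszul formula for `ξ` is termwise the image
of the one for `η`. -/
theorem IsInduced.dForm {B : Type*} [Ring B] [Algebra ℂ B] {φ : A →ₗ[ℂ] B} {η : Form A k}
    {ξ : Form B k} (h : IsInduced φ η ξ) : IsInduced φ (dForm k η) (dForm k ξ) := by
  intro Y X hYX
  have hb : ∀ i j a, ⁅X i, X j⁆ (φ a) = φ (⁅Y i, Y j⁆ a) := by
    intro i j a
    rw [Der.bracket_apply, Der.bracket_apply, hYX, hYX, hYX, hYX, map_sub]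
  rw [dForm_apply, dForm_apply, map_sum]
  refine Finset.sum_congr rfl fun j _ => ?_
  rw [map_zsmul, map_add, map_sum]
  congr 2
  · rw [h (j.removeNth Y) (j.removeNth X) fun i a => hYX _ a, hYX]
  · refine Finset.sum_congr rfl fun i _ => h _ _ fun l a => ?_
    simp only [Fin.removeNth]
    by_cases hl : j.succAbove l = i
    · rw [hl, update_self, update_self, hb]
    · rw [update_of_ne hl, update_of_ne hl, hYX]

theorem IsInduced.add {B : Type*} [Ring B] [Algebra ℂ B] {φ : A →ₗ[ℂ] B} {η η' : Form A k}
    {ξ ξ' : Form B k} (h : IsInduced φ η ξ) (h' : IsInduced φ η' ξ') :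
    IsInduced φ (η + η') (ξ + ξ') := by
  intro Y X hYX
  rw [AlternatingMap.add_apply, AlternatingMap.add_apply, map_add, h Y X hYX, h' Y X hYX]

theorem IsInduced.csmul {B : Type*} [Ring B] [Algebra ℂ B] {φ : A →ₗ[ℂ] B} {η : Form A k}
    {ξ : Form B k} (h : IsInduced φ η ξ) (c : ℂ) : IsInduced φ (c • η) (c • ξ) := by
  intro Y X hYX
  rw [AlternatingMap.smul_apply, AlternatingMap.smul_apply, map_smul, h Y X hYX]

/-- Cartan's formula i_X d = L_X - d i_X. Horizontality is all that is needed of the differential: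
its invariance comes out of the uniqueness of the basic form. -/
theorem IsBasic.isHorizontal_dForm {S : Set (Der A)} {ξ : Form A k} (h : IsBasic S ξ) :
    IsHorizontal S (dForm k ξ) := by
  intro X hX
  ext w
  cases k with
  | zero =>
    have h1 := congrArg (fun F => F ![]) (h.2 X hX)
    simp only [lieForm_apply, Finset.univ_eq_empty, Finset.sum_empty, sub_zero] at h1
    exact (koszul_zero_form ξ _).trans h1
  | succ k =>
    refine (koszul_cons ξ X w).trans ?_
    have h0 : ξ.curryLeft X = 0 := h.1 X hX
    have h1 : koszul (0 : Form A k) w = 0 := by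
      have := koszul_csmul (0 : ℂ) (0 : Form A k) w
      rwa [zero_smul, zero_smul] at this
    rw [h.2 X hX, h0, h1, sub_zero]

/-- A linear map on forms that preserves closed and exact forms induces a map in cohomology. -/
theorem exists_cohomology_map {B : Type*} [Ring B] [Algebra ℂ B] {r p : ℕ}
    (T : Form A r →ₗ[ℂ] Form B p) (hclosed : ∀ ξ, dForm r ξ = 0 → dForm p (T ξ) = 0)
    (hexact : ∀ ξ ∈ exactForms A r, T ξ ∈ exactForms B p) :
    ∃ K : Cohomology A r →ₗ[ℂ] Cohomology B p, ∀ (ξ : Form A r) (hξ : dForm r ξ = 0),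
      ∃ hI : dForm p (T ξ) = 0, K (cohomologyClass ξ hξ) = cohomologyClass (T ξ) hI := by
  let T' : closedForms A r →ₗ[ℂ] closedForms B p := T.restrict fun ξ hξ => hclosed ξ hξ
  let K : Cohomology A r →ₗ[ℂ] Cohomology B p :=
    Submodule.mapQ _ _ T' fun ξ hξ => hexact _ hξ
  exact ⟨K, fun ξ hξ => ⟨hclosed ξ hξ, rfl⟩⟩

end Forms

/-! ### Derivations of M_n(C): brackets, traces and mixed arguments. -/

section Matrices

variable {C : Type*} [CommRing C] [Algebra ℂ C] {n : ℕ}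

theorem lie_liftDer (X Y : Der C) :
    ⁅(liftDer X : Der (Matrix (Fin n) (Fin n) C)), (liftDer Y : Der (Matrix (Fin n) (Fin n) C))⁆ =
      liftDer ⁅X, Y⁆ := by
  ext b i j
  rfl

theorem liftDer_constMatrix (X : Der C) (m : Matrix (Fin n) (Fin n) ℂ) :
    (liftDer X : Der (Matrix (Fin n) (Fin n) C)) (constMatrix m) = 0 := by
  ext i j
  exact Der.map_algebraMap X _

/-- Constant matrices as an algebra homomorphism. -/
theorem constMatrix_eq_mapMatrix (m : Matrix (Fin n) (Fin n) ℂ) :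
    (constMatrix m : Matrix (Fin n) (Fin n) C) = (Algebra.ofId ℂ C).mapMatrix m := rfl

theorem constMatrix_mul (m m' : Matrix (Fin n) (Fin n) ℂ) :
    (constMatrix (m * m') : Matrix (Fin n) (Fin n) C) = constMatrix m * constMatrix m' :=
  map_mul (Algebra.ofId ℂ C).mapMatrix m m'

theorem constMatrix_sub (m m' : Matrix (Fin n) (Fin n) ℂ) :
    (constMatrix (m - m') : Matrix (Fin n) (Fin n) C) = constMatrix m - constMatrix m' :=
  map_sub (Algebra.ofId ℂ C).mapMatrix m m'

theorem constMatrix_sum_smul {ι : Type*} (s : Finset ι) (c : ι → ℂ)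
    (m : ι → Matrix (Fin n) (Fin n) ℂ) :
    (constMatrix (∑ i ∈ s, c i • m i) : Matrix (Fin n) (Fin n) C) =
      ∑ i ∈ s, c i • constMatrix (m i) := by
  simp only [constMatrix_eq_mapMatrix, map_sum, map_smul]

theorem trace_constMatrix (m : Matrix (Fin n) (Fin n) ℂ) :
    (constMatrix m : Matrix (Fin n) (Fin n) C).trace = algebraMap ℂ C m.trace := by
  simp [constMatrix, Matrix.trace]

theorem adDer_constMatrix_sum_smul {ι : Type*} (s : Finset ι) (c : ι → ℂ)
    (m : ι → Matrix (Fin n) (Fin n) ℂ) :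
    (adDer (constMatrix (∑ i ∈ s, c i • m i)) : Der (Matrix (Fin n) (Fin n) C)) =
      ∑ i ∈ s, c i • adDer (constMatrix (m i)) := by
  simp only [constMatrix_sum_smul, ← adDerLin_apply, map_sum, map_smul]

theorem lie_liftDer_adDer (X : Der C) (m : Matrix (Fin n) (Fin n) ℂ) :
    ⁅(liftDer X : Der (Matrix (Fin n) (Fin n) C)),
      (adDer (constMatrix m) : Der (Matrix (Fin n) (Fin n) C))⁆ = 0 := by
  rw [Der.lie_adDer, liftDer_constMatrix, ← adDerLin_apply, map_zero]

theorem lie_adDer_adDer (m m' : Matrix (Fin n) (Fin n) ℂ) :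
    ⁅(adDer (constMatrix m) : Der (Matrix (Fin n) (Fin n) C)),
      (adDer (constMatrix m') : Der (Matrix (Fin n) (Fin n) C))⁆ =
      adDer (constMatrix (m * m' - m' * m)) := by
  rw [Der.lie_adDer, adDer_apply, constMatrix_sub, constMatrix_mul, constMatrix_mul]

theorem trace_adDer (m b : Matrix (Fin n) (Fin n) C) : (adDer m b).trace = 0 := by
  rw [adDer_apply, Matrix.trace_sub, Matrix.trace_mul_comm, sub_self]

theorem trace_liftDer (X : Der C) (b : Matrix (Fin n) (Fin n) C) :
    ((liftDer X : Der (Matrix (Fin n) (Fin n) C)) b).trace = X b.trace := by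
  simp only [Matrix.trace, map_sum]
  rfl

theorem mixedArgs_castAdd {p q r : ℕ} (hr : p + q = r) (X : Fin p → Der C)
    (m : Fin q → Matrix (Fin n) (Fin n) ℂ) (i : Fin p) :
    mixedArgs hr X m (Fin.cast hr (Fin.castAdd q i)) = liftDer (X i) := by
  simp [mixedArgs]

theorem mixedArgs_natAdd {p q r : ℕ} (hr : p + q = r) (X : Fin p → Der C)
    (m : Fin q → Matrix (Fin n) (Fin n) ℂ) (i : Fin q) :
    mixedArgs hr X m (Fin.cast hr (Fin.natAdd p i)) = adDer (constMatrix (m i)) := by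
  simp [mixedArgs]

theorem mixedArgs_cons {p q r : ℕ} (hr : p + q = r) (hr' : p + 1 + q = r + 1) (Y : Der C)
    (X : Fin p → Der C) (m : Fin q → Matrix (Fin n) (Fin n) ℂ) :
    mixedArgs hr' (Matrix.vecCons Y X) m = Matrix.vecCons (liftDer Y) (mixedArgs hr X m) := by
  subst hr
  funext l
  refine Fin.cases ?_ (fun l => ?_) l
  · have h : (0 : Fin (p + q + 1)) = Fin.cast hr' (Fin.castAdd q 0) := rfl
    rw [h, mixedArgs_castAdd]
    rfl
  · rw [Matrix.cons_val_succ]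
    refine Fin.addCases (fun i => ?_) (fun i => ?_) l
    · have h1 : (Fin.castAdd q i).succ = Fin.cast hr' (Fin.castAdd q i.succ) := rfl
      have h2 : Fin.castAdd q i = Fin.cast rfl (Fin.castAdd q i) := rfl
      rw [h1, mixedArgs_castAdd, Matrix.cons_val_succ, h2, mixedArgs_castAdd]
    · have h1 : (Fin.natAdd p i).succ = Fin.cast hr' (Fin.natAdd (p + 1) i) := by
        ext
        simp
        omega
      have h2 : Fin.natAdd p i = Fin.cast rfl (Fin.natAdd p i) := rfl
      rw [h1, mixedArgs_natAdd, h2, mixedArgs_natAdd]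

theorem mixedArgs_update_right {p q r : ℕ} (hr : p + q = r) (X : Fin p → Der C)
    (m : Fin q → Matrix (Fin n) (Fin n) ℂ) (i : Fin q) (a : Matrix (Fin n) (Fin n) ℂ) :
    mixedArgs hr X (update m i a) =
      update (mixedArgs hr X m) (Fin.cast hr (Fin.natAdd p i)) (adDer (constMatrix a)) := by
  subst hr
  funext l
  refine Fin.addCases (fun j => ?_) (fun j => ?_) l
  · have h2 : Fin.castAdd q j = Fin.cast rfl (Fin.castAdd q j) := rfl
    rw [update_of_ne, h2, mixedArgs_castAdd, mixedArgs_castAdd]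
    intro h
    have := congrArg Fin.val h
    simp at this
    omega
  · have h2 : Fin.natAdd p j = Fin.cast rfl (Fin.natAdd p j) := rfl
    by_cases hj : j = i
    · subst hj
      refine (mixedArgs_natAdd rfl X (update m j a) j).trans ?_
      rw [update_self]
      exact (update_self (β := fun _ => Der (Matrix (Fin n) (Fin n) C))
        (Fin.natAdd p j) _ (mixedArgs rfl X m)).symm
    · rw [update_of_ne, h2, mixedArgs_natAdd, mixedArgs_natAdd, update_of_ne hj]
      intro h
      exact hj (Fin.natAdd_injective _ _ h)

theorem fiberIntegral_apply (b : Module.Basis (Fin (n ^ 2 - 1)) ℝ (su n)) {p r : ℕ}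
    (hr : p + (n ^ 2 - 1) = r) (ξ : Form (Matrix (Fin n) (Fin n) C) r) (X : Fin p → Der C) :
    fiberIntegral b hr ξ X = (volumeFactor b : ℂ) •
      Matrix.trace (ξ (mixedArgs hr X fun k => (b k : Matrix (Fin n) (Fin n) ℂ))) := rfl

theorem fiberIntegral_of_isTensor (b : Module.Basis (Fin (n ^ 2 - 1)) ℝ (su n)) {p r : ℕ}
    (hr : p + (n ^ 2 - 1) = r) {ξ : Form (Matrix (Fin n) (Fin n) C) r} {α : Form C p}
    {β : Form (Matrix (Fin n) (Fin n) ℂ) (n ^ 2 - 1)} (h : IsTensor hr ξ α β) :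
    fiberIntegral b hr ξ = ncIntegral b β • α := by
  ext X
  rw [fiberIntegral_apply, h.2, Matrix.trace_smul, trace_constMatrix, AlternatingMap.smul_apply,
    ncIntegral, mul_smul, smul_eq_mul, mul_comm, ← Algebra.smul_def]

/-- The integral evaluates `ξ` on exactly `p` derivations of `C` and on inner derivations otherwise,
which is one of the tuples where a form of bidegree `a ≠ p` vanishes. -/
theorem fiberIntegral_of_hasBidegree (b : Module.Basis (Fin (n ^ 2 - 1)) ℝ (su n)) {p r : ℕ}
    (hr : p + (n ^ 2 - 1) = r) {ξ : Form (Matrix (Fin n) (Fin n) C) r} {a : ℕ} (ha : a ≠ p)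
    (h : HasBidegree a ξ) : fiberIntegral b hr ξ = 0 := by
  ext X
  rw [fiberIntegral_apply]
  let e : Fin p ↪ Fin r := ⟨fun i => Fin.cast hr (Fin.castAdd _ i), fun i j hij => by
    simpa [Fin.ext_iff] using hij⟩
  -- `HasBidegree` speaks of families indexed by all of `Fin r`; `X` and `b` are extended by zero at
  -- the positions where they are not used.
  have h1 := h (Finset.univ.map e) (fun l => if hl : (l : ℕ) < p then X ⟨l, hl⟩ else 0)
    (fun l => ((if hl : (l : ℕ) - p < n ^ 2 - 1 then b ⟨l - p, hl⟩ else 0 : su n) :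
      Matrix (Fin n) (Fin n) ℂ)) (by simpa using ha.symm)
  have h2 : mixedArgs hr X (fun k => (b k : Matrix (Fin n) (Fin n) ℂ)) = fun l : Fin r =>
      if l ∈ Finset.univ.map e then liftDer (if hl : (l : ℕ) < p then X ⟨l, hl⟩ else 0)
      else (adDer (constMatrix (((if hl : (l : ℕ) - p < n ^ 2 - 1 then b ⟨l - p, hl⟩ else 0 : su n) :
        Matrix (Fin n) (Fin n) ℂ))) : Der (Matrix (Fin n) (Fin n) C)) := by
    subst hr
    funext l
    refine Fin.addCases (fun i => ?_) (fun i => ?_) l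
    · have h3 : Fin.castAdd _ i ∈ Finset.univ.map e :=
        Finset.mem_map.2 ⟨i, Finset.mem_univ _, rfl⟩
      rw [if_pos h3]
      simp [mixedArgs]
    · have h3 : Fin.natAdd p i ∉ Finset.univ.map e := by
        simp only [Finset.mem_map, not_exists, not_and]
        intro j _ hj
        have := congrArg Fin.val hj
        simp [e] at this
        omega
      rw [if_neg h3]
      simp [mixedArgs]
  rw [h2, h1]
  simp

end Matrices

/-! ### su(n) inside M_n(ℂ): complexification, unimodularity, conjugation. -/

section SpecialUnitary

variable {n : ℕ}

theorem coe_su_eq_sum (b : Module.Basis (Fin (n ^ 2 - 1)) ℝ (su n)) (x : su n) :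
    (x : Matrix (Fin n) (Fin n) ℂ) =
      ∑ k, (b.repr x k : ℂ) • (b k : Matrix (Fin n) (Fin n) ℂ) := by
  refine (congrArg Subtype.val (b.sum_repr x)).symm.trans ?_
  rw [Submodule.coe_sum]
  refine Finset.sum_congr rfl fun k _ => ?_
  ext i j
  simp

/-- `(n² - 1) + 1` elements: a basis of `su(n)` together with the unit matrix. -/
def extendedFamily (b : Module.Basis (Fin (n ^ 2 - 1)) ℝ (su n)) :
    Fin (n ^ 2 - 1) ⊕ Unit → Matrix (Fin n) (Fin n) ℂ :=
  Sum.elim (fun k => (b k : Matrix (Fin n) (Fin n) ℂ)) fun _ => 1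

theorem coe_mem_span_extendedFamily (b : Module.Basis (Fin (n ^ 2 - 1)) ℝ (su n)) (x : su n) :
    (x : Matrix (Fin n) (Fin n) ℂ) ∈ Submodule.span ℂ (Set.range (extendedFamily b)) := by
  rw [coe_su_eq_sum b x]
  exact Submodule.sum_mem _ fun k _ => Submodule.smul_mem _ _
    (Submodule.subset_span ⟨Sum.inl k, rfl⟩)

/-- M_n(ℂ) is the sum of the scalars and of the complexification of su(n): a traceless `m₀` is half
of `m₀ - m₀ᴴ` plus `-i/2` times `i (m₀ + m₀ᴴ)`, and both of these matrices lie in su(n). -/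
theorem span_extendedFamily (hn : 1 ≤ n) (b : Module.Basis (Fin (n ^ 2 - 1)) ℝ (su n)) :
    ⊤ ≤ Submodule.span ℂ (Set.range (extendedFamily b)) := by
  intro m _
  have hn' : (n : ℂ) ≠ 0 := by exact_mod_cast (by omega : n ≠ 0)
  set m₀ : Matrix (Fin n) (Fin n) ℂ := m - (m.trace / n) • 1 with hm₀
  have ht : m₀.trace = 0 := by
    rw [hm₀, Matrix.trace_sub, Matrix.trace_smul, Matrix.trace_one]
    simp [hn']
  have h1 : m₀ - m₀ᴴ ∈ su n := by
    refine ⟨by simp, ?_⟩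
    rw [Matrix.trace_sub, Matrix.trace_conjTranspose, ht]
    simp
  have h2 : Complex.I • (m₀ + m₀ᴴ) ∈ su n := by
    refine ⟨?_, ?_⟩
    · rw [Matrix.conjTranspose_smul]
      simp [add_comm]
    · rw [Matrix.trace_smul, Matrix.trace_add, Matrix.trace_conjTranspose, ht]
      simp
  have h3 : m = (m.trace / n) • (1 : Matrix (Fin n) (Fin n) ℂ) + (1 / 2 : ℂ) • (m₀ - m₀ᴴ) +
      (-Complex.I / 2) • (Complex.I • (m₀ + m₀ᴴ)) := by
    rw [smul_smul]
    have : -Complex.I / 2 * Complex.I = 1 / 2 := by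
      rw [div_mul_eq_mul_div, neg_mul, Complex.I_mul_I, neg_neg]
    rw [this, add_assoc, ← smul_add]
    have h4 : m₀ - m₀ᴴ + (m₀ + m₀ᴴ) = (2 : ℂ) • m₀ := by rw [two_smul]; abel
    rw [h4, smul_smul, hm₀]
    norm_num
  rw [h3]
  refine Submodule.add_mem _ (Submodule.add_mem _ (Submodule.smul_mem _ _
    (Submodule.subset_span ⟨Sum.inr (), rfl⟩)) (Submodule.smul_mem _ _ ?_))
    (Submodule.smul_mem _ _ ?_)
  · exact coe_mem_span_extendedFamily b ⟨_, h1⟩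
  · exact coe_mem_span_extendedFamily b ⟨_, h2⟩

/-- A basis of `su(n)` and the unit matrix form a complex basis of `M_n(ℂ)`. -/
def extendedBasis (hn : 1 ≤ n) (b : Module.Basis (Fin (n ^ 2 - 1)) ℝ (su n)) :
    Module.Basis (Fin (n ^ 2 - 1) ⊕ Unit) ℂ (Matrix (Fin n) (Fin n) ℂ) :=
  basisOfTopLeSpanOfCardEqFinrank (extendedFamily b) (span_extendedFamily hn b) (by
    -- Needed for the truncated subtraction: `(n ^ 2 - 1) + 1 = n ^ 2`.
    have : 1 ≤ n ^ 2 := Nat.one_le_pow _ _ hn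
    rw [Module.finrank_matrix]
    simp only [Fintype.card_sum, Fintype.card_fin, Fintype.card_unit, Module.finrank_self]
    rw [mul_one, ← sq]
    omega)

theorem extendedBasis_inl (hn : 1 ≤ n) (b : Module.Basis (Fin (n ^ 2 - 1)) ℝ (su n))
    (k : Fin (n ^ 2 - 1)) : extendedBasis hn b (Sum.inl k) = b k := by
  simp [extendedBasis, extendedFamily]

theorem extendedBasis_inr (hn : 1 ≤ n) (b : Module.Basis (Fin (n ^ 2 - 1)) ℝ (su n)) (u : Unit) :
    extendedBasis hn b (Sum.inr u) = 1 := by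
  simp [extendedBasis, extendedFamily]

/-- The coordinates of the traceless part of a matrix in a basis of `su(n)`. -/
def suCoord (hn : 1 ≤ n) (b : Module.Basis (Fin (n ^ 2 - 1)) ℝ (su n)) (k : Fin (n ^ 2 - 1)) :
    Matrix (Fin n) (Fin n) ℂ →ₗ[ℂ] ℂ := (extendedBasis hn b).coord (Sum.inl k)

theorem sum_suCoord (hn : 1 ≤ n) (b : Module.Basis (Fin (n ^ 2 - 1)) ℝ (su n))
    (m : Matrix (Fin n) (Fin n) ℂ) :
    ∑ k, suCoord hn b k m • (b k : Matrix (Fin n) (Fin n) ℂ) + (m.trace / n) • 1 = m := by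
  have hn' : (n : ℂ) ≠ 0 := by exact_mod_cast (by omega : n ≠ 0)
  have h := (extendedBasis hn b).sum_repr m
  rw [Fintype.sum_sum_type] at h
  simp only [extendedBasis_inl, extendedBasis_inr, Finset.univ_unique, Finset.sum_singleton] at h
  have ht := congrArg Matrix.trace h
  rw [Matrix.trace_add, Matrix.trace_sum] at ht
  simp only [Matrix.trace_smul, (b _).2.2, Matrix.trace_one, Fintype.card_fin, smul_eq_mul,
    mul_zero, Finset.sum_const_zero, zero_add] at ht
  rw [← ht, mul_div_assoc, div_self hn', mul_one]
  exact h

/-- A linear map given by a matrix on the basis of `su(n)` and by a multiple of the identity on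
scalar matrices. -/
theorem toMatrix_extendedBasis (hn : 1 ≤ n) (b : Module.Basis (Fin (n ^ 2 - 1)) ℝ (su n))
    (f : Matrix (Fin n) (Fin n) ℂ →ₗ[ℂ] Matrix (Fin n) (Fin n) ℂ)
    (T : Matrix (Fin (n ^ 2 - 1)) (Fin (n ^ 2 - 1)) ℂ) (t : ℂ)
    (hT : ∀ k, f (b k) = ∑ l, T l k • (b l : Matrix (Fin n) (Fin n) ℂ)) (ht : f 1 = t • 1) :
    LinearMap.toMatrix (extendedBasis hn b) (extendedBasis hn b) f =
      Matrix.fromBlocks T 0 0 (Matrix.of fun _ _ => t) := by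
  set B := extendedBasis hn b
  have h1 : ∀ k, B.repr (f (b k)) = ∑ l, T l k • Finsupp.single (Sum.inl l) 1 := by
    intro k
    rw [hT, map_sum]
    refine Finset.sum_congr rfl fun l _ => ?_
    rw [map_smul, ← extendedBasis_inl hn b l, Module.Basis.repr_self]
  have h2 : B.repr (f 1) = t • Finsupp.single (Sum.inr ()) 1 := by
    rw [ht, map_smul, ← extendedBasis_inr hn b (), Module.Basis.repr_self]
  ext i j
  rw [LinearMap.toMatrix_apply]
  rcases j with k | u
  · rw [extendedBasis_inl, h1]
    rcases i with l | u
    · simp [Finsupp.single_apply]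
    · simp
  · rw [extendedBasis_inr, h2]
    rcases i with l | u
    · simp
    · simp

theorem lie_mem_su {A B : Matrix (Fin n) (Fin n) ℂ} (hA : A ∈ su n) (hB : B ∈ su n) :
    A * B - B * A ∈ su n := by
  refine ⟨?_, ?_⟩
  · rw [Matrix.conjTranspose_sub, Matrix.conjTranspose_mul, Matrix.conjTranspose_mul, hA.1, hB.1]
    noncomm_ring
  · rw [Matrix.trace_sub, Matrix.trace_mul_comm, sub_self]

/-- The structure constants: `[A, b_k] = ∑ l, (adMatrix b A) l k • b_l`. -/
def adMatrix (b : Module.Basis (Fin (n ^ 2 - 1)) ℝ (su n)) (A : su n) :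
    Matrix (Fin (n ^ 2 - 1)) (Fin (n ^ 2 - 1)) ℂ :=
  Matrix.of fun l k => (b.repr ⟨_, lie_mem_su A.2 (b k).2⟩ l : ℂ)

theorem lie_eq_sum_adMatrix (b : Module.Basis (Fin (n ^ 2 - 1)) ℝ (su n)) (A : su n)
    (k : Fin (n ^ 2 - 1)) :
    (A : Matrix (Fin n) (Fin n) ℂ) * b k - b k * A =
      ∑ l, adMatrix b A l k • (b l : Matrix (Fin n) (Fin n) ℂ) :=
  coe_su_eq_sum b ⟨_, lie_mem_su A.2 (b k).2⟩

/-- Left multiplication is `A` on each of the `n` columns, right multiplication is `A` on each of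
the `n` rows. The two traces agree, so ad_A is traceless on M_n(ℂ). -/
theorem trace_mulLeft_matrix (A : Matrix (Fin n) (Fin n) ℂ) :
    LinearMap.trace ℂ _ (LinearMap.mulLeft ℂ A) = n * A.trace := by
  rw [LinearMap.trace_eq_matrix_trace ℂ (Matrix.stdBasis ℂ (Fin n) (Fin n)), Matrix.trace,
    Fintype.sum_prod_type, Finset.sum_comm]
  have : ∀ i j : Fin n, (LinearMap.toMatrix (Matrix.stdBasis ℂ (Fin n) (Fin n))
      (Matrix.stdBasis ℂ (Fin n) (Fin n)) (LinearMap.mulLeft ℂ A)).diag (i, j) = A i i := by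
    intro i j
    rw [Matrix.diag_apply, LinearMap.toMatrix_apply, Matrix.stdBasis_eq_single]
    change (A * (Matrix.single i j 1 : Matrix (Fin n) (Fin n) ℂ)) i j = _
    simp
  simp only [this]
  simp [Matrix.trace]

theorem trace_mulRight_matrix (A : Matrix (Fin n) (Fin n) ℂ) :
    LinearMap.trace ℂ _ (LinearMap.mulRight ℂ A) = n * A.trace := by
  rw [LinearMap.trace_eq_matrix_trace ℂ (Matrix.stdBasis ℂ (Fin n) (Fin n)), Matrix.trace,
    Fintype.sum_prod_type]
  have : ∀ i j : Fin n, (LinearMap.toMatrix (Matrix.stdBasis ℂ (Fin n) (Fin n))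
      (Matrix.stdBasis ℂ (Fin n) (Fin n)) (LinearMap.mulRight ℂ A)).diag (i, j) = A j j := by
    intro i j
    rw [Matrix.diag_apply, LinearMap.toMatrix_apply, Matrix.stdBasis_eq_single]
    change ((Matrix.single i j 1 : Matrix (Fin n) (Fin n) ℂ) * A) i j = _
    simp
  simp only [this]
  simp [Matrix.trace]

/-- `su(n)` is unimodular. -/
theorem trace_adMatrix (hn : 1 ≤ n) (b : Module.Basis (Fin (n ^ 2 - 1)) ℝ (su n)) (A : su n) :
    (adMatrix b A).trace = 0 := by
  -- ad_A vanishes on scalars, so its trace on M_n(ℂ) is already its trace on su(n).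
  have h := toMatrix_extendedBasis hn b (LinearMap.mulLeft ℂ (A : Matrix (Fin n) (Fin n) ℂ) -
    LinearMap.mulRight ℂ (A : Matrix (Fin n) (Fin n) ℂ)) (adMatrix b A) 0
    (lie_eq_sum_adMatrix b A) (by simp)
  have h1 := congrArg Matrix.trace h
  rw [← LinearMap.trace_eq_matrix_trace, map_sub, trace_mulLeft_matrix, trace_mulRight_matrix,
    sub_self] at h1
  rw [h1]
  simp [Matrix.trace]

theorem det_mulRight_matrix (A : Matrix (Fin n) (Fin n) ℂ) :
    LinearMap.det (LinearMap.mulRight ℂ A) = A.det ^ n := by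
  have h : LinearMap.mulRight ℂ A =
      LinearMap.pi fun i : Fin n => (Matrix.vecMulLinear A) ∘ₗ LinearMap.proj i := by
    ext m i j
    rfl
  rw [h]
  refine (LinearMap.det_pi (R := ℂ) (M := Fin n → ℂ) fun _ : Fin n => Matrix.vecMulLinear A).trans ?_
  have h2 : LinearMap.det (Matrix.vecMulLinear A) = A.det := by
    rw [← Matrix.mulVecLin_transpose, ← Matrix.toLin'_apply', LinearMap.det_toLin',
      Matrix.det_transpose]
  rw [h2]
  simp

theorem det_mulLeft_matrix (A : Matrix (Fin n) (Fin n) ℂ) :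
    LinearMap.det (LinearMap.mulLeft ℂ A) = A.det ^ n := by
  let e := Matrix.transposeLinearEquiv (Fin n) (Fin n) ℂ ℂ
  have h : LinearMap.mulLeft ℂ A =
      (e : Matrix (Fin n) (Fin n) ℂ →ₗ[ℂ] _) ∘ₗ LinearMap.mulRight ℂ Aᵀ ∘ₗ
        (e.symm : Matrix (Fin n) (Fin n) ℂ →ₗ[ℂ] _) := by
    refine LinearMap.ext fun m => ?_
    change A * m = (mᵀ * Aᵀ)ᵀ
    rw [Matrix.transpose_mul, Matrix.transpose_transpose, Matrix.transpose_transpose]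
  rw [h, LinearMap.det_conj, det_mulRight_matrix, Matrix.det_transpose]

theorem conj_mem_su {g A : Matrix (Fin n) (Fin n) ℂ} (hg : gᴴ * g = 1) (hA : A ∈ su n) :
    g * A * gᴴ ∈ su n := by
  refine ⟨?_, ?_⟩
  · rw [Matrix.conjTranspose_mul, Matrix.conjTranspose_mul, hA.1, Matrix.conjTranspose_conjTranspose]
    noncomm_ring
  · rw [Matrix.trace_mul_comm, ← mul_assoc, hg, one_mul, hA.2]

/-- Conjugation by an element of `SU(n)` acts on `su(n)` with determinant one. -/
theorem exists_conj_matrix (hn : 1 ≤ n) (b : Module.Basis (Fin (n ^ 2 - 1)) ℝ (su n))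
    (g : Matrix.specialUnitaryGroup (Fin n) ℂ) :
    ∃ R : Matrix (Fin (n ^ 2 - 1)) (Fin (n ^ 2 - 1)) ℂ, R.det = 1 ∧
      ∀ k, (g : Matrix (Fin n) (Fin n) ℂ) * b k * (g : Matrix (Fin n) (Fin n) ℂ)ᴴ =
        ∑ l, R l k • (b l : Matrix (Fin n) (Fin n) ℂ) := by
  obtain ⟨g, hg⟩ := g
  obtain ⟨hu, hdet⟩ := Matrix.mem_specialUnitaryGroup_iff.1 hg
  have h1 : gᴴ * g = 1 := Matrix.mem_unitaryGroup_iff'.1 hu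
  have h2 : g * gᴴ = 1 := Matrix.mem_unitaryGroup_iff.1 hu
  refine ⟨Matrix.of fun l k => (b.repr ⟨_, conj_mem_su h1 (b k).2⟩ l : ℂ), ?_,
    fun k => coe_su_eq_sum b ⟨_, conj_mem_su h1 (b k).2⟩⟩
  -- Conjugation fixes the unit matrix, so its determinant on su(n) is its determinant on M_n(ℂ), a
  -- product of powers of `det g` and its conjugate.
  have h := toMatrix_extendedBasis hn b (LinearMap.mulRight ℂ gᴴ ∘ₗ LinearMap.mulLeft ℂ g)
    (Matrix.of fun l k => (b.repr ⟨_, conj_mem_su h1 (b k).2⟩ l : ℂ)) 1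
    (fun k => coe_su_eq_sum b ⟨_, conj_mem_su h1 (b k).2⟩) (by simp [h2])
  have h3 := congrArg Matrix.det h
  rw [LinearMap.det_toMatrix, LinearMap.det_comp, det_mulRight_matrix, det_mulLeft_matrix,
    Matrix.det_conjTranspose, hdet, Matrix.det_fromBlocks_zero₂₁] at h3
  simpa using h3.symm

end SpecialUnitary

/-! ### The Koszul formula on a unimodular family of derivations. -/

section Unimodular

variable {A : Type*} [Ring A] [Algebra ℂ A] {k : ℕ}

/-- With `w` in both slots `i` and `j`, deleting one or the other of the equal entries gives the
same value up to the sign of a cyclic permutation. -/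
theorem removeNth_update_add_eq_zero (ξ : Form A k) (v : Fin (k + 1) → Der A)
    {i j : Fin (k + 1)} (hij : i ≠ j) (w : Der A) :
    (-1 : ℤ) ^ (j : ℕ) • ξ (j.removeNth (update v i w)) +
      (-1 : ℤ) ^ (i : ℕ) • ξ (i.removeNth (update v j w)) = 0 := by
  have h := ξ.neg_one_pow_smul_map_removeNth_add_eq_zero_of_eq
    (v := update (update v i w) j w) (i := j) (j := i)
    (by rw [update_self, update_of_ne hij, update_self]) hij.symm
  have h1 : j.removeNth (update (update v i w) j w) = j.removeNth (update v i w) := by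
    funext l
    simp [Fin.removeNth]
  have h2 : i.removeNth (update (update v i w) j w) = i.removeNth (update v j w) := by
    rw [update_comm hij]
    funext l
    simp [Fin.removeNth]
  rw [h1, h2] at h
  exact h

/-- The Koszul formula in top degree minus one on a unimodular Lie algebra. -/
theorem koszul_eq_sum_of_unimodular (ξ : Form A k) (v : Fin (k + 1) → Der A)
    (c : Fin (k + 1) → Fin (k + 1) → Fin (k + 1) → ℂ)
    (hc : ∀ i j, ⁅v i, v j⁆ = ∑ l, c i j l • v l) (hanti : ∀ i j l, c i j l = -c j i l)
    (htr : ∀ i, ∑ j, c i j j = 0) :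
    koszul ξ v = ∑ j : Fin (k + 1), (-1 : ℤ) ^ (j : ℕ) • v j (ξ (j.removeNth v)) := by
  set h : Fin (k + 1) → A := fun j => (-1 : ℤ) ^ (j : ℕ) • ξ (j.removeNth v) with hh
  have hrem : ∀ (i j : Fin (k + 1)), i ≠ j → ∀ w : Der A, ∃ i' : Fin k, j.succAbove i' = i ∧
      j.removeNth (update v i w) = update (j.removeNth v) i' w := by
    intro i j hij w
    obtain ⟨i', rfl⟩ := Fin.exists_succAbove_eq hij
    exact ⟨i', rfl, by rw [Fin.removeNth_update_succAbove]⟩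
  -- In the expansion of the bracket a `v l` with `l ≠ i, j` is already an argument and contributes
  -- nothing; `l = i` reproduces `h j`, and `l = j` gives `-h i`.
  have key : ∀ i j : Fin (k + 1), i ≠ j →
      (-1 : ℤ) ^ (j : ℕ) • ξ (j.removeNth (update v i ⁅v i, v j⁆)) =
        c i j i • h j - c i j j • h i := by
    intro i j hij
    have h1 : ξ (j.removeNth (update v i ⁅v i, v j⁆)) =
        ∑ l, c i j l • ξ (j.removeNth (update v i (v l))) := by
      obtain ⟨i', hi', -⟩ := hrem i j hij 0
      subst hi'
      simp only [Fin.removeNth_update_succAbove]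
      rw [hc, map_update_finsetSum]
      exact Finset.sum_congr rfl fun l _ => map_update_csmul _ _ _ _ _
    have h2 : ∀ l, l ≠ i ∧ l ≠ j → c i j l • ξ (j.removeNth (update v i (v l))) = 0 := by
      intro l hl
      obtain ⟨i', hi', h3⟩ := hrem i j hij (v l)
      obtain ⟨l', hl', -⟩ := hrem l j hl.2 0
      rw [h3, ξ.map_eq_zero_of_eq _ (i := i') (j := l'), smul_zero]
      · rw [update_self, update_of_ne]
        · simp only [Fin.removeNth, hl']
        · rintro rfl
          exact hl.1 (hl'.symm.trans hi')
      · rintro rfl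
        exact hl.1 (hl'.symm.trans hi')
    rw [h1, Fintype.sum_eq_add _ _ hij h2, update_eq_self, smul_add, smul_comm _ (c i j i),
      smul_comm _ (c i j j), sub_eq_add_neg, ← smul_neg]
    congr 2
    have h3 := removeNth_update_add_eq_zero ξ v hij (v j)
    rw [update_eq_self] at h3
    exact eq_neg_of_add_eq_zero_left h3
  -- By antisymmetry of `c`, the terms with `i < j` and, after exchanging the names, those with `j <
  -- i` complete each other: `h j` gets the coefficient `∑ i, c j i i` up to sign, which is a trace.
  -- The `v` need not be independent, so antisymmetry of `c` is a hypothesis of its own.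
  have hsum : ∑ j : Fin (k + 1), ∑ i : Fin (k + 1) with i < j,
      (-1 : ℤ) ^ (j : ℕ) • ξ (j.removeNth (update v i ⁅v i, v j⁆)) = 0 := by
    have h1 : ∀ j : Fin (k + 1), ∑ i : Fin (k + 1) with i < j, (-1 : ℤ) ^ (j : ℕ) • ξ (j.removeNth (update v i ⁅v i, v j⁆)) =
        ∑ i, if i < j then -(c j i i • h j) - c i j j • h i else 0 := by
      intro j
      rw [Finset.sum_filter]
      refine Finset.sum_congr rfl fun i _ => ?_
      split_ifs with hij
      · rw [key i j hij.ne, hanti i j i, neg_smul]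
      · rfl
    have h2 : ∀ i j : Fin (k + 1), (if i < j then -(c j i i • h j) - c i j j • h i else 0) =
        -(if i < j then c j i i • h j else 0) - (if i < j then c i j j • h i else 0) := by
      intro i j
      split_ifs <;> simp
    simp only [h1, h2, Finset.sum_sub_distrib, Finset.sum_neg_distrib]
    rw [Finset.sum_comm (f := fun j i => if i < j then c i j j • h i else 0), ← neg_add',
      ← Finset.sum_add_distrib, neg_eq_zero]
    refine Finset.sum_eq_zero fun j _ => ?_
    rw [← Finset.sum_add_distrib]
    have h3 : ∀ i, (if i < j then c j i i • h j else 0) + (if j < i then c j i i • h j else 0) =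
        c j i i • h j := by
      intro i
      rcases lt_trichotomy i j with hij | rfl | hij
      · simp [hij, hij.not_gt]
      · have : c i i i = 0 := by
          have := hanti i i i
          exact self_eq_neg.1 this
        simp [this]
      · simp [hij, hij.not_gt]
    simp only [h3]
    rw [← Finset.sum_smul, htr, zero_smul]
  unfold koszul
  simp only [smul_add, Finset.sum_add_distrib, Finset.smul_sum, hsum, add_zero]

end Unimodular

/-! ### The noncommutative integral on 𝔅: Lie derivatives and differential. -/

section FiberIntegral

variable {C : Type*} [CommRing C] [Algebra ℂ C] {n : ℕ}
  (b : Module.Basis (Fin (n ^ 2 - 1)) ℝ (su n))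

/-- The arguments `X₁, …, X_p` followed by `ad b₁, …, ad b_N`. -/
def basisArgs {p r : ℕ} (hr : p + (n ^ 2 - 1) = r) (X : Fin p → Der C) :
    Fin r → Der (Matrix (Fin n) (Fin n) C) :=
  mixedArgs hr X fun k => (b k : Matrix (Fin n) (Fin n) ℂ)

theorem basisArgs_castAdd {p r : ℕ} (hr : p + (n ^ 2 - 1) = r) (X : Fin p → Der C) (i : Fin p) :
    basisArgs b hr X (Fin.cast hr (Fin.castAdd _ i)) = liftDer (X i) :=
  mixedArgs_castAdd hr X _ i

theorem basisArgs_natAdd {p r : ℕ} (hr : p + (n ^ 2 - 1) = r) (X : Fin p → Der C)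
    (k : Fin (n ^ 2 - 1)) : basisArgs b hr X (Fin.cast hr (Fin.natAdd p k)) =
      adDer (constMatrix (b k : Matrix (Fin n) (Fin n) ℂ)) :=
  mixedArgs_natAdd hr X _ k

theorem basisArgs_cons {p r : ℕ} (hr : p + (n ^ 2 - 1) = r)
    (hr' : p + 1 + (n ^ 2 - 1) = r + 1) (Y : Der C) (X : Fin p → Der C) :
    basisArgs b hr' (Matrix.vecCons Y X) = Matrix.vecCons (liftDer Y) (basisArgs b hr X) :=
  mixedArgs_cons hr hr' Y X _

theorem basisArgs_update {p r : ℕ} (hr : p + (n ^ 2 - 1) = r) (X : Fin p → Der C) (i : Fin p)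
    (Y : Der C) : basisArgs b hr (update X i Y) =
      update (basisArgs b hr X) (Fin.cast hr (Fin.castAdd _ i)) (liftDer Y) :=
  mixedArgs_update hr X _ i Y

theorem fiberIntegral_eq_trace {p r : ℕ} (hr : p + (n ^ 2 - 1) = r)
    (ξ : Form (Matrix (Fin n) (Fin n) C) r) (X : Fin p → Der C) :
    fiberIntegral b hr ξ X = (volumeFactor b : ℂ) • (ξ (basisArgs b hr X)).trace := rfl

/-- `ad_A` is a combination of the `ad b_k`, each of which is already one of the last arguments. -/
theorem map_update_basisArgs_left {p r : ℕ} (hr : p + (n ^ 2 - 1) = r)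
    (ξ : Form (Matrix (Fin n) (Fin n) C) r) (X : Fin p → Der C) (i : Fin p) (A : su n) :
    ξ (update (basisArgs b hr X) (Fin.cast hr (Fin.castAdd _ i))
      (adDer (constMatrix (A : Matrix (Fin n) (Fin n) ℂ)))) = 0 := by
  rw [coe_su_eq_sum b A, adDer_constMatrix_sum_smul, map_update_finsetSum]
  refine Finset.sum_eq_zero fun k _ => ?_
  rw [map_update_csmul]
  have hne : Fin.cast hr (Fin.natAdd p k) ≠ Fin.cast hr (Fin.castAdd _ i) := by
    intro h
    have := congrArg Fin.val h
    simp at this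
    omega
  rw [ξ.map_eq_zero_of_eq _ (i := Fin.cast hr (Fin.castAdd _ i))
    (j := Fin.cast hr (Fin.natAdd p k)) _ hne.symm, smul_zero]
  rw [update_self, update_of_ne hne, basisArgs_natAdd]

/-- By the preceding lemma an argument `V` can be exchanged for `V + ad_A`, where `ξ` vanishes. -/
theorem fiberIntegral_eq_zero_of_horizontal {p r : ℕ} (hr : p + (n ^ 2 - 1) = r)
    (ξ : Form (Matrix (Fin n) (Fin n) C) r) (V : Der C) (A : su n)
    (h : ∀ (v : Fin r → Der (Matrix (Fin n) (Fin n) C)) (i : Fin r),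
      v i = liftDer V + adDer (constMatrix (A : Matrix (Fin n) (Fin n) ℂ)) → ξ v = 0)
    (X : Fin p → Der C) (i : Fin p) (hi : X i = V) : fiberIntegral b hr ξ X = 0 := by
  have h1 := h (update (basisArgs b hr X) (Fin.cast hr (Fin.castAdd _ i)) _) _ (update_self _ _ _)
  rw [ξ.map_update_add, map_update_basisArgs_left, add_zero, ← hi] at h1
  have h2 := basisArgs_castAdd b hr X i
  rw [← h2, update_eq_self] at h1
  rw [fiberIntegral_eq_trace]
  rw [h1, Matrix.trace_zero, smul_zero]

/-- An endomorphism acts on an alternating map of top degree, as a derivation, by its trace: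
off-diagonal entries produce repeated arguments. -/
theorem sum_map_update_basisArgs_right {p r : ℕ} (hr : p + (n ^ 2 - 1) = r)
    (ξ : Form (Matrix (Fin n) (Fin n) C) r) (X : Fin p → Der C)
    (T : Matrix (Fin (n ^ 2 - 1)) (Fin (n ^ 2 - 1)) ℂ) :
    ∑ k, ξ (update (basisArgs b hr X) (Fin.cast hr (Fin.natAdd p k))
      (∑ l, T l k • adDer (constMatrix (b l : Matrix (Fin n) (Fin n) ℂ)))) =
    T.trace • ξ (basisArgs b hr X) := by
  rw [Matrix.trace, Finset.sum_smul]
  refine Finset.sum_congr rfl fun k _ => ?_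
  rw [map_update_finsetSum, Finset.sum_eq_single k]
  · rw [map_update_csmul, ← basisArgs_natAdd b hr X k,
      update_eq_self]
    rfl
  · intro l _ hl
    have hne : Fin.cast hr (Fin.natAdd p l) ≠ Fin.cast hr (Fin.natAdd p k) := by
      intro h
      have := congrArg Fin.val h
      simp at this
      exact hl (Fin.ext this)
    rw [map_update_csmul, ξ.map_eq_zero_of_eq _ (i := Fin.cast hr (Fin.natAdd p k))
      (j := Fin.cast hr (Fin.natAdd p l)) _ hne.symm, smul_zero]
    rw [update_self, update_of_ne hne, basisArgs_natAdd]
  · intro h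
    exact absurd (Finset.mem_univ k) h

/-- `A` is arbitrary: the trace kills ad_A on values, ad_A commutes with lifted derivations, and its
brackets with the `ad b_k` contribute the factor tr ad_A = 0. Invariance uses the `A` that belongs
to `V`, the differential uses `A = 0`. -/
theorem lieForm_fiberIntegral (hn : 1 ≤ n) {p r : ℕ} (hr : p + (n ^ 2 - 1) = r)
    (ξ : Form (Matrix (Fin n) (Fin n) C) r) (V : Der C) (A : su n) (X : Fin p → Der C) :
    lieForm V (fiberIntegral b hr ξ) X = (volumeFactor b : ℂ) •
      (lieForm (liftDer V + adDer (constMatrix (A : Matrix (Fin n) (Fin n) ℂ))) ξ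
        (basisArgs b hr X)).trace := by
  set G : Der (Matrix (Fin n) (Fin n) C) :=
    liftDer V + adDer (constMatrix (A : Matrix (Fin n) (Fin n) ℂ)) with hG
  have h1 : (G (ξ (basisArgs b hr X))).trace = V (ξ (basisArgs b hr X)).trace := by
    rw [hG, Der.add_apply, Matrix.trace_add, trace_adDer, add_zero, trace_liftDer]
  have h2 : ∀ i, ⁅G, basisArgs b hr X (Fin.cast hr (Fin.castAdd _ i))⁆ = liftDer ⁅V, X i⁆ := by
    intro i
    rw [basisArgs_castAdd, hG, add_lie, lie_liftDer, ← lie_skew (adDer _) (liftDer (X i)),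
      lie_liftDer_adDer, neg_zero, add_zero]
  have h3 : ∀ k, ⁅G, basisArgs b hr X (Fin.cast hr (Fin.natAdd p k))⁆ =
      ∑ l, adMatrix b A l k • adDer (constMatrix (b l : Matrix (Fin n) (Fin n) ℂ)) := by
    intro k
    rw [basisArgs_natAdd, hG, add_lie, lie_liftDer_adDer, zero_add, lie_adDer_adDer,
      lie_eq_sum_adMatrix, adDer_constMatrix_sum_smul]
  have h4 : ∑ l, ξ (update (basisArgs b hr X) l ⁅G, basisArgs b hr X l⁆) =
      ∑ i, ξ (basisArgs b hr (update X i ⁅V, X i⁆)) := by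
    -- The slots are split into those from `C`, where brackets stay lifted, and the matrix slots,
    -- whose joint contribution is a trace.
    rw [← Equiv.sum_comp (finCongr hr), Fin.sum_univ_add]
    simp only [finCongr_apply, h2, h3]
    rw [sum_map_update_basisArgs_right, trace_adMatrix hn, zero_smul, add_zero]
    exact Finset.sum_congr rfl fun i _ => by rw [basisArgs_update]
  rw [lieForm_apply, lieForm_apply, h4, Matrix.trace_sub, h1, Matrix.trace_sum, smul_sub,
    Finset.smul_sum]
  congr 1
  exact map_smul V _ _

/-- Stokes' theorem on the noncommutative fibre. Unimodularity removes the bracket terms, and the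
others are traces of commutators. -/
theorem trace_koszul_basis (hn : 1 ≤ n) {k : ℕ} (hk : 0 + (n ^ 2 - 1) = k + 1)
    (ξ : Form (Matrix (Fin n) (Fin n) C) k) (X : Fin 0 → Der C) :
    (koszul ξ (basisArgs b hk X)).trace = 0 := by
  set e : Fin (n ^ 2 - 1) ≃ Fin (k + 1) := finCongr ((zero_add _).symm.trans hk)
  have hv : ∀ j, basisArgs b hk X j =
      adDer (constMatrix (b (e.symm j) : Matrix (Fin n) (Fin n) ℂ)) := by
    intro j
    obtain ⟨j, rfl⟩ := e.surjective j
    have h1 : e j = Fin.cast hk (Fin.natAdd 0 j) := by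
      ext
      simp [e]
    rw [e.symm_apply_apply, h1, basisArgs_natAdd]
  rw [koszul_eq_sum_of_unimodular ξ (basisArgs b hk X)
    (fun i j l => adMatrix b (b (e.symm i)) (e.symm l) (e.symm j))]
  · rw [Matrix.trace_sum]
    refine Finset.sum_eq_zero fun j _ => ?_
    rw [Matrix.trace_smul, hv, trace_adDer, smul_zero]
  · intro i j
    rw [hv, hv, lie_adDer_adDer, lie_eq_sum_adMatrix, adDer_constMatrix_sum_smul,
      ← Equiv.sum_comp e]
    refine Finset.sum_congr rfl fun l _ => ?_
    rw [hv, e.symm_apply_apply]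
  · intro i j l
    simp only [adMatrix, Matrix.of_apply]
    rw [← Complex.ofReal_neg, ← Finsupp.neg_apply, ← map_neg]
    congr 3
    ext : 1
    simp
  · intro i
    have h1 := trace_adMatrix hn b (b (e.symm i))
    rw [Matrix.trace] at h1
    rw [← h1, ← Equiv.sum_comp e.symm]
    rfl

theorem curryLeft_fiberIntegral {p r : ℕ} (hr : p + (n ^ 2 - 1) = r)
    (hr' : p + 1 + (n ^ 2 - 1) = r + 1) (ξ : Form (Matrix (Fin n) (Fin n) C) (r + 1))
    (Y : Der C) :
    (fiberIntegral b hr' ξ).curryLeft Y = fiberIntegral b hr (ξ.curryLeft (liftDer Y)) := by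
  ext X
  rw [AlternatingMap.curryLeft_apply_apply, fiberIntegral_eq_trace, fiberIntegral_eq_trace,
    basisArgs_cons b hr hr', AlternatingMap.curryLeft_apply_apply]

/-- Induction on `p` along Cartan's formula. Contraction with and Lie derivative along a lifted
derivation commute with the integral; for `p = 0` the contracted form has degree below N, and its
differential integrates to zero by `trace_koszul_basis`. -/
theorem koszul_fiberIntegral (hn : 1 ≤ n) {p r : ℕ} (hr : p + (n ^ 2 - 1) = r)
    (hr' : p + 1 + (n ^ 2 - 1) = r + 1) (ξ : Form (Matrix (Fin n) (Fin n) C) r)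
    (X : Fin (p + 1) → Der C) :
    (volumeFactor b : ℂ) • (koszul ξ (basisArgs b hr' X)).trace =
      koszul (fiberIntegral b hr ξ) X := by
  induction p generalizing r with
  | zero =>
    obtain ⟨Y, X, rfl⟩ : ∃ Y X', X = Matrix.vecCons Y X' :=
      ⟨X 0, Fin.tail X, (Fin.cons_self_tail X).symm⟩
    rw [koszul_zero_form, basisArgs_cons b hr hr']
    cases r with
    -- Here `n ^ 2 - 1 = 0`: there are no matrix directions, and the integral is a multiple of the
    -- trace.
    | zero =>
      rw [koszul_zero_form, Matrix.cons_val_zero, trace_liftDer, Matrix.cons_val_zero,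
        fiberIntegral_eq_trace, map_smul]
      congr 5
      exact Subsingleton.elim _ _
    | succ r =>
      have h1 := koszul_cons ξ (liftDer Y) (basisArgs b hr X)
      have h2 := lieForm_fiberIntegral b hn hr ξ Y 0 X
      have h3 : (adDer (constMatrix ((0 : su n) : Matrix (Fin n) (Fin n) ℂ)) :
          Der (Matrix (Fin n) (Fin n) C)) = 0 := by
        have : (constMatrix (0 : Matrix (Fin n) (Fin n) ℂ) : Matrix (Fin n) (Fin n) C) = 0 :=
          map_zero (Algebra.ofId ℂ C).mapMatrix
        rw [Submodule.coe_zero, this, ← adDerLin_apply, map_zero]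
      rw [h3, add_zero, lieForm_apply, Finset.univ_eq_empty, Finset.sum_empty, sub_zero] at h2
      refine (congrArg (fun z : Matrix (Fin n) (Fin n) C => (volumeFactor b : ℂ) • z.trace)
        h1).trans ?_
      rw [Matrix.trace_sub, trace_koszul_basis b hn hr, sub_zero, ← h2, Matrix.cons_val_zero]
      congr 2
  | succ p ih =>
    obtain ⟨Y, X, rfl⟩ : ∃ Y X', X = Matrix.vecCons Y X' :=
      ⟨X 0, Fin.tail X, (Fin.cons_self_tail X).symm⟩
    obtain ⟨r, rfl⟩ : ∃ s, r = s + 1 := ⟨r - 1, by omega⟩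
    have h1 := koszul_cons ξ (liftDer Y) (basisArgs b hr X)
    have h2 := lieForm_fiberIntegral b hn hr ξ Y 0 X
    have h3 : (adDer (constMatrix ((0 : su n) : Matrix (Fin n) (Fin n) ℂ)) :
        Der (Matrix (Fin n) (Fin n) C)) = 0 := by
      have : (constMatrix (0 : Matrix (Fin n) (Fin n) ℂ) : Matrix (Fin n) (Fin n) C) = 0 :=
        map_zero (Algebra.ofId ℂ C).mapMatrix
      rw [Submodule.coe_zero, this, ← adDerLin_apply, map_zero]
    rw [h3, add_zero] at h2
    have h4 := koszul_cons (fiberIntegral b hr ξ) Y X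
    have hr0 : p + (n ^ 2 - 1) = r := by omega
    rw [basisArgs_cons b hr hr']
    refine Eq.trans ?_ h4.symm
    refine (congrArg (fun z : Matrix (Fin n) (Fin n) C => (volumeFactor b : ℂ) • z.trace)
      h1).trans ?_
    rw [Matrix.trace_sub, smul_sub, ← h2, ih hr0 hr, curryLeft_fiberIntegral b hr0 hr]

theorem fiberIntegral_dForm (hn : 1 ≤ n) {p r : ℕ} (hr : p + (n ^ 2 - 1) = r)
    (hr' : p + 1 + (n ^ 2 - 1) = r + 1) (ξ : Form (Matrix (Fin n) (Fin n) C) r) :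
    fiberIntegral b hr' (dForm r ξ) = dForm p (fiberIntegral b hr ξ) := by
  ext X
  exact koszul_fiberIntegral b hn hr hr' ξ X

theorem fiberIntegral_dForm_eq_zero (hn : 1 ≤ n) {r : ℕ} (hr : 0 + (n ^ 2 - 1) = r + 1)
    (ξ : Form (Matrix (Fin n) (Fin n) C) r) : fiberIntegral b hr (dForm r ξ) = 0 := by
  ext X
  rw [fiberIntegral_eq_trace]
  change _ • (koszul ξ (basisArgs b hr X)).trace = 0
  rw [trace_koszul_basis b hn, smul_zero]

/-- A family of linear maps of degree `-N` between the complexes of forms on two algebras, which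
commutes with the differentials (and kills exact forms in degree `N`), induces maps in
cohomology. -/
theorem exists_cohomology_map_of_commutes {A B : Type*} [Ring A] [Algebra ℂ A] [Ring B]
    [Algebra ℂ B] {N : ℕ} (T : ∀ p r : ℕ, p + N = r → (Form A r →ₗ[ℂ] Form B p))
    (h : ∀ (p r : ℕ) (hr : p + N = r) (hr' : p + 1 + N = r + 1) (ξ : Form A r),
      T (p + 1) (r + 1) hr' (dForm r ξ) = dForm p (T p r hr ξ))
    (h0 : ∀ (r : ℕ) (hr : 0 + N = r + 1) (ξ : Form A r), T 0 (r + 1) hr (dForm r ξ) = 0)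
    (p r : ℕ) (hr : p + N = r) :
    ∃ K : Cohomology A r →ₗ[ℂ] Cohomology B p, ∀ (ξ : Form A r) (hξ : dForm r ξ = 0),
      ∃ hI : dForm p (T p r hr ξ) = 0,
        K (cohomologyClass ξ hξ) = cohomologyClass (T p r hr ξ) hI := by
  refine exists_cohomology_map (T p r hr) (fun ξ hξ => ?_) fun ξ hξ => ?_
  · rw [← h p r hr (by omega), hξ, map_zero]
  · cases r with
    | zero =>
      rw [(Submodule.mem_bot ℂ).1 hξ, map_zero]
      exact Submodule.zero_mem _
    | succ r =>
      obtain ⟨ζ, rfl⟩ := hξ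
      cases p with
      | zero => exact (Submodule.mem_bot ℂ).2 (h0 r hr ζ)
      | succ p => exact ⟨T p r (by omega) ζ, (h p r (by omega) hr ζ).symm⟩

end FiberIntegral

/-! ### Derivations of matrix algebras via matrix units. -/

section MatrixUnits

/-- The generator `∑ i, D i k₀ * E k₀ i` is the classical one. Only the Leibniz rule on the matrix
units themselves enters, so derivations along a homomorphism, such as evaluation in a frame, are
covered. -/
theorem matrixUnit_inner {R ι : Type*} [Ring R] [Fintype ι] [DecidableEq ι] (E D : ι → ι → R)
    (k₀ : ι) (hE : ∀ k l i j, E k l * E i j = if l = i then E k j else 0)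
    (hone : ∑ i, E i i = 1)
    (hD : ∀ k l i j, D k l * E i j + E k l * D i j = if l = i then D k j else 0) (k l : ι) :
    D k l = (∑ i, D i k₀ * E k₀ i) * E k l - E k l * ∑ i, D i k₀ * E k₀ i := by
  have h1 : (∑ i, D i k₀ * E k₀ i) * E k l = D k k₀ * E k₀ l := by
    rw [Finset.sum_mul, Finset.sum_eq_single k]
    · rw [mul_assoc, hE, if_pos rfl]
    · intro i _ hi
      rw [mul_assoc, hE, if_neg hi, mul_zero]
    · intro h
      exact absurd (Finset.mem_univ _) h
  have h2 : E k l * ∑ i, D i k₀ * E k₀ i = D k k₀ * E k₀ l - D k l := by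
    have h3 : ∀ i, E k l * (D i k₀ * E k₀ i) =
        (if l = i then D k k₀ * E k₀ i else 0) - D k l * E i i := by
      intro i
      rw [← mul_assoc, eq_sub_of_add_eq' (hD k l i k₀), sub_mul, mul_assoc (D k l), hE,
        if_pos rfl, ite_mul, zero_mul]
    rw [Finset.mul_sum]
    simp only [h3, Finset.sum_sub_distrib, Finset.sum_ite_eq, Finset.mem_univ, if_true,
      ← Finset.mul_sum, hone, mul_one]
  rw [h1, h2, sub_sub_cancel]

variable {C : Type*} [CommRing C] [Algebra ℂ C] {n : ℕ}

theorem exists_scalar_of_mem_center (hn : 1 ≤ n) {z : Matrix (Fin n) (Fin n) C}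
    (hz : z ∈ Subalgebra.center ℂ (Matrix (Fin n) (Fin n) C)) :
    z = Matrix.scalar (Fin n) (z ⟨0, hn⟩ ⟨0, hn⟩) := by
  have h : z ∈ Set.range (Matrix.scalar (Fin n)) :=
    Matrix.mem_range_scalar_iff_commute_single'.2 fun i j =>
      Subalgebra.mem_center_iff.1 hz (Matrix.single i j 1)
  obtain ⟨c, rfl⟩ := h
  simp

/-- The action of a derivation of `M_n(C)` on the scalar matrices. -/
def scalarPart (hn : 1 ≤ n) (Z : Der (Matrix (Fin n) (Fin n) C)) : Der C :=
  ⟨{ toFun := fun f => Z (Matrix.scalar (Fin n) f) ⟨0, hn⟩ ⟨0, hn⟩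
     map_add' := fun f g => by rw [map_add, map_add, Matrix.add_apply]
     map_smul' := fun c f => by
       have : Matrix.scalar (Fin n) (c • f) = c • Matrix.scalar (Fin n) f := by
         ext i j
         simp [Matrix.diagonal_apply]
       rw [this, map_smul, Matrix.smul_apply, RingHom.id_apply] }, by
    intro f g
    change Z (Matrix.scalar (Fin n) (f * g)) _ _ = Z (Matrix.scalar (Fin n) f) _ _ * g +
      f * Z (Matrix.scalar (Fin n) g) _ _
    rw [map_mul, Der.leibniz, Matrix.add_apply]
    simp [Matrix.diagonal_mul, Matrix.mul_diagonal]⟩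

/-- A derivation preserves the centre, and the centre consists of the scalar matrices. -/
theorem apply_scalar (hn : 1 ≤ n) (Z : Der (Matrix (Fin n) (Fin n) C)) (f : C) :
    Z (Matrix.scalar (Fin n) f) = Matrix.scalar (Fin n) (scalarPart hn Z f) := by
  let z : Subalgebra.center ℂ (Matrix (Fin n) (Fin n) C) :=
    ⟨Matrix.scalar (Fin n) f, Subalgebra.mem_center_iff.2 fun b =>
      (Matrix.scalar_commute f (fun _ => mul_comm _ _) b).symm⟩
  exact exists_scalar_of_mem_center hn (Der.onCenter Z z).2

/-- Every derivation of `M_n(C)` is the sum of a derivation of `C` and of an inner derivation. -/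
theorem exists_eq_liftDer_add_adDer (hn : 1 ≤ n) (Z : Der (Matrix (Fin n) (Fin n) C)) :
    ∃ m : Matrix (Fin n) (Fin n) C, m.trace = 0 ∧ Z = liftDer (scalarPart hn Z) + adDer m := by
  set E : Fin n → Fin n → Matrix (Fin n) (Fin n) C := fun k l => Matrix.single k l 1
  have hE : ∀ k l i j, E k l * E i j = if l = i then E k j else 0 := by
    intro k l i j
    split_ifs with h
    · subst h
      simp [E]
    · simp [E, h]
  have hone : ∑ i, E i i = 1 := by
    ext i j
    simp [E, Matrix.sum_apply, Matrix.single_apply, Matrix.one_apply, ite_and]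
  have hD : ∀ k l i j, Z (E k l) * E i j + E k l * Z (E i j) =
      if l = i then Z (E k j) else 0 := by
    intro k l i j
    rw [← Der.leibniz, hE]
    split_ifs <;> simp
  have h := matrixUnit_inner E (fun k l => Z (E k l)) ⟨0, hn⟩ hE hone hD
  set m₀ : Matrix (Fin n) (Fin n) C := ∑ i, Z (E i ⟨0, hn⟩) * E ⟨0, hn⟩ i
  have hn' : (n : ℂ) ≠ 0 := by exact_mod_cast (by omega : n ≠ 0)
  -- Subtracting the scalar part makes the generator traceless without changing its commutators.
  refine ⟨m₀ - (n : ℂ)⁻¹ • Matrix.scalar (Fin n) m₀.trace, ?_, ?_⟩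
  · have : (Matrix.scalar (Fin n) m₀.trace).trace = (n : ℂ) • m₀.trace := by
      simp [Matrix.trace_diagonal, Nat.cast_smul_eq_nsmul]
    rw [Matrix.trace_sub, Matrix.trace_smul, this, smul_smul, inv_mul_cancel₀ hn', one_smul,
      sub_self]
  · ext1 a
    have ha : a = ∑ k, ∑ l, Matrix.scalar (Fin n) (a k l) * E k l := by
      conv_lhs => rw [Matrix.matrix_eq_sum_single a]
      refine Finset.sum_congr rfl fun k _ => Finset.sum_congr rfl fun l _ => ?_
      ext i j
      simp [E, Matrix.single_apply, Matrix.diagonal_mul]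
    have h1 : ∀ b, adDer (m₀ - (n : ℂ)⁻¹ • Matrix.scalar (Fin n) m₀.trace) b = m₀ * b - b * m₀ := by
      intro b
      rw [adDer_apply, sub_mul, mul_sub, smul_mul_assoc, mul_smul_comm,
        (Matrix.scalar_commute m₀.trace (fun _ => mul_comm _ _) b).eq]
      abel
    have hl : liftDer (scalarPart hn Z) a =
        ∑ k, ∑ l, Matrix.scalar (Fin n) (scalarPart hn Z (a k l)) * E k l := by
      conv_lhs => rw [Matrix.matrix_eq_sum_single (liftDer (scalarPart hn Z) a)]
      refine Finset.sum_congr rfl fun k _ => Finset.sum_congr rfl fun l _ => ?_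
      rw [liftDer_apply]
      ext i j
      simp [E, Matrix.single_apply, Matrix.diagonal_mul]
    rw [Der.add_apply, h1, hl]
    conv_lhs => rw [ha]
    rw [map_sum]
    simp only [map_sum, Der.leibniz, apply_scalar hn, Finset.sum_add_distrib]
    congr 1
    have h2 : ∀ k l, Matrix.scalar (Fin n) (a k l) * Z (E k l) =
        m₀ * (Matrix.scalar (Fin n) (a k l) * E k l) -
          (Matrix.scalar (Fin n) (a k l) * E k l) * m₀ := by
      intro k l
      rw [h k l, mul_sub, ← mul_assoc, ← mul_assoc m₀,
        ← (Matrix.scalar_commute (a k l) (fun _ => mul_comm _ _) m₀).eq, mul_assoc, mul_assoc]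
    simp only [h2, Finset.sum_sub_distrib, ← Finset.mul_sum, ← Finset.sum_mul]
    rw [← ha]

end MatrixUnits

/-! ### Hadamard's lemma with smooth dependence. -/

section Hadamard

universe u

variable {V : Type u} [NormedAddCommGroup V] [NormedSpace ℝ V] [FiniteDimensional ℝ V]

/-- Differentiation under the integral sign produces a factor `t` and replaces `f` by its
derivative. The induction therefore runs over all weights `φ` and all target spaces `W`; the common
universe of `V` and `W` admits `V →L[ℝ] W` as the next target. -/
theorem contDiff_nat_integral_segment (k : ℕ) : ∀ {W : Type u} [NormedAddCommGroup W]
    [NormedSpace ℝ W] (φ : ℝ → ℝ) (_ : Continuous φ) (f : V → W)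
    (_ : ContDiff ℝ k f) (v₀ : V),
    ContDiff ℝ k (fun v => ∫ t in (0 : ℝ)..1, φ t • f (v₀ + t • (v - v₀))) := by
  induction k with
  | zero =>
    intro W _ _ φ hφ f hf v₀
    rw [Nat.cast_zero, contDiff_zero] at hf ⊢
    refine intervalIntegral.continuous_parametric_intervalIntegral_of_continuous' ?_ 0 1
    have : Continuous fun p : V × ℝ => f (v₀ + p.2 • (p.1 - v₀)) := hf.comp (by fun_prop)
    exact (hφ.comp continuous_snd).smul this
  | succ k ih =>
    intro W _ _ φ hφ f hf v₀
    rw [Nat.cast_succ] at hf ⊢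
    rw [contDiff_succ_iff_hasFDerivAt] at hf ⊢
    obtain ⟨f', hf', hff'⟩ := hf
    have hfc : Continuous f := continuous_iff_continuousAt.2 fun x => (hff' x).continuousAt
    refine ⟨fun v => ∫ t in (0 : ℝ)..1, (φ t * t) • f' (v₀ + t • (v - v₀)),
      ih (fun t => φ t * t) (hφ.mul continuous_id) f' hf' v₀, fun v => ?_⟩
    have hc : Continuous fun p : V × ℝ => (φ p.2 * p.2) • f' (v₀ + p.2 • (p.1 - v₀)) := by
      have h1 : Continuous fun p : V × ℝ => f' (v₀ + p.2 • (p.1 - v₀)) :=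
        hf'.continuous.comp (by fun_prop)
      exact ((hφ.comp continuous_snd).mul continuous_snd).smul h1
    have hc0 : Continuous fun p : V × ℝ => φ p.2 • f (v₀ + p.2 • (p.1 - v₀)) := by
      have h1 : Continuous fun p : V × ℝ => f (v₀ + p.2 • (p.1 - v₀)) :=
        hfc.comp (by fun_prop)
      exact (hφ.comp continuous_snd).smul h1
    -- A bound for the differentiated integrand on the compact set of points near `v` and times in
    -- `[0, 1]`, as dominating function.
    obtain ⟨K, hK⟩ := ((isCompact_closedBall v 1).prod (isCompact_Icc (a := (0 : ℝ))
      (b := 1))).exists_bound_of_continuousOn hc.continuousOn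
    refine intervalIntegral.hasFDerivAt_integral_of_dominated_of_fderiv_le
      (F := fun v t => φ t • f (v₀ + t • (v - v₀)))
      (F' := fun v t => (φ t * t) • f' (v₀ + t • (v - v₀))) (bound := fun _ => K)
      (Metric.ball_mem_nhds v one_pos) ?_ ?_ ?_ ?_ ?_ ?_
    · exact Filter.Eventually.of_forall fun w =>
        (hc0.comp (Continuous.prodMk_right w)).aestronglyMeasurable
    · exact (hc0.comp (Continuous.prodMk_right v)).intervalIntegrable _ _
    · exact (hc.comp (Continuous.prodMk_right v)).aestronglyMeasurable
    · refine Filter.Eventually.of_forall fun t ht w hw => hK (w, t) ⟨Metric.ball_subset_closedBall hw, ?_⟩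
      rw [Set.uIoc_of_le zero_le_one] at ht
      exact Set.Ioc_subset_Icc_self ht
    · exact intervalIntegrable_const
    · refine Filter.Eventually.of_forall fun t _ w _ => ?_
      have h1 : HasFDerivAt (fun w : V => v₀ + t • (w - v₀)) (t • ContinuousLinearMap.id ℝ V) w :=
        (((hasFDerivAt_id w).sub_const v₀).const_smul t).const_add v₀
      have h2 := ((hff' _).comp w h1).const_smul (φ t)
      refine h2.congr_fderiv ?_
      ext x
      simp [mul_smul]

/-- Hadamard's lemma. -/
theorem exists_hadamard {W : Type u} [NormedAddCommGroup W] [NormedSpace ℝ W] [CompleteSpace W]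
    {f : V → W} (hf : ContDiff ℝ ∞ f) (v₀ : V) :
    ∃ G : V → V →L[ℝ] W, ContDiff ℝ ∞ G ∧ G v₀ = fderiv ℝ f v₀ ∧
      ∀ v, f v - f v₀ = G v (v - v₀) := by
  have hf' : ContDiff ℝ ∞ (fderiv ℝ f) := (contDiff_infty_iff_fderiv.1 hf).2
  refine ⟨fun v => ∫ t in (0 : ℝ)..1, fderiv ℝ f (v₀ + t • (v - v₀)), ?_, ?_, fun v => ?_⟩
  · refine contDiff_infty.2 fun k => ?_
    have := contDiff_nat_integral_segment k (fun _ => (1 : ℝ)) continuous_const (fderiv ℝ f)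
      (contDiff_infty.1 hf' k) v₀
    simpa using this
  · simp
  · have hseg : IntervalIntegrable (fun t : ℝ => fderiv ℝ f (v₀ + t • (v - v₀)))
        MeasureTheory.volume 0 1 :=
      (hf'.continuous.comp (by fun_prop)).intervalIntegrable _ _
    rw [ContinuousLinearMap.intervalIntegral_apply hseg]
    have h1 : ∀ t : ℝ, HasDerivAt (fun t : ℝ => f (v₀ + t • (v - v₀)))
        (fderiv ℝ f (v₀ + t • (v - v₀)) (v - v₀)) t := by
      intro t
      have h2 : HasDerivAt (fun t : ℝ => v₀ + t • (v - v₀)) (v - v₀) t := by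
        simpa using ((hasDerivAt_id t).smul_const (v - v₀)).const_add v₀
      exact ((hf.differentiable (by simp)) _).hasFDerivAt.comp_hasDerivAt t h2
    rw [intervalIntegral.integral_eq_sub_of_hasDerivAt (fun t _ => h1 t)]
    · simp
    · refine Continuous.intervalIntegrable ?_ _ _
      have : Continuous fun t : ℝ => fderiv ℝ f (v₀ + t • (v - v₀)) :=
        hf'.continuous.comp (by fun_prop)
      exact this.clm_apply continuous_const

end Hadamard

/-! ### Point derivations in coordinates. -/

section PointDerivation

variable {S : Type*} {R : Subalgebra ℂ (S → ℂ)} {V : Type} [NormedAddCommGroup V]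
  [NormedSpace ℝ V] [FiniteDimensional ℝ V]

/-- A derivation at a point of an algebra of functions, expressed in coordinates `c` on the support
of a cut-off function `χ`. -/
theorem pointDerivation_eq_sum (p : S) (δ : R →ₗ[ℂ] ℂ)
    (hδ : ∀ f g : R, δ (f * g) = δ f * g.1 p + f.1 p * δ g) (c : S → V) (χ : R) (hχ : χ.1 p = 1)
    (hext : ∀ H : V → ℂ, ContDiff ℝ ∞ H → (fun s => χ.1 s * H (c s)) ∈ R)
    {ι : Type*} [Fintype ι] (B : Module.Basis ι ℝ V) (y : ι → R)
    (hy : ∀ j s, χ.1 s ≠ 0 → (y j).1 s = (B.coord j (c s) : ℂ))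
    (f : R) (F : V → ℂ) (hF : ContDiff ℝ ∞ F) (hfF : ∀ s, χ.1 s ≠ 0 → f.1 s = F (c s)) :
    δ f = ∑ j, δ (y j) * fderiv ℝ F (c p) (B j) := by
  obtain ⟨G, hG, hG0, hFG⟩ := exists_hadamard hF (c p)
  let g : ι → R := fun j => ⟨_, hext (fun v => G v (B j)) (hG.clm_apply contDiff_const)⟩
  have hgv : ∀ j s, (g j).1 s = χ.1 s * G (c s) (B j) := fun _ _ => rfl
  have hχ0 : χ.1 p ≠ 0 := by rw [hχ]; exact one_ne_zero
  have hgp : ∀ j, (g j).1 p = fderiv ℝ F (c p) (B j) := by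
    intro j
    rw [hgv, hχ, one_mul, hG0]
  have hδ1 : δ 1 = 0 := by
    have h := hδ 1 1
    have h1 : (1 : R).1 p = 1 := rfl
    rw [mul_one, h1, mul_one, one_mul] at h
    exact left_eq_add.1 h
  have hδc : ∀ (u : R) (z : ℂ), δ (u - algebraMap ℂ R z) = δ u := by
    intro u z
    rw [map_sub, Algebra.algebraMap_eq_smul_one, map_smul, hδ1, smul_zero, sub_zero]
  -- Hadamard's expansion on the support of `χ`; elsewhere both sides are zero. Each term on the
  -- right has a factor vanishing at `p`, so the Leibniz rule leaves only the derivative of that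
  -- factor.
  have hid : χ * χ * (f - algebraMap ℂ R (F (c p))) =
      ∑ j, (y j - algebraMap ℂ R (B.coord j (c p) : ℂ)) * (χ * g j) := by
    ext s
    have hR : (∑ j, (y j - algebraMap ℂ R (B.coord j (c p) : ℂ)) * (χ * g j) : R).1 s =
        ∑ j, ((y j).1 s - (B.coord j (c p) : ℂ)) * (χ.1 s * (g j).1 s) := by
      rw [AddSubmonoidClass.coe_finsetSum, Finset.sum_apply]
      rfl
    refine Eq.trans ?_ hR.symm
    change χ.1 s * χ.1 s * (f.1 s - F (c p)) = _
    by_cases h0 : χ.1 s = 0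
    · simp [h0]
    · simp only [hgv]
      rw [hfF s h0, hFG]
      have h4 : c s - c p = ∑ j, (B.coord j (c s) - B.coord j (c p)) • B j := by
        conv_lhs => rw [← B.sum_repr (c s - c p)]
        simp [Module.Basis.coord_apply]
      conv_lhs => rw [h4]
      rw [map_sum, Finset.mul_sum]
      refine Finset.sum_congr rfl fun j _ => ?_
      rw [map_smul, Complex.real_smul, hy j s h0]
      push_cast
      ring
  have h1 : δ (χ * χ * (f - algebraMap ℂ R (F (c p)))) = δ f := by
    have h2 : (f - algebraMap ℂ R (F (c p))).1 p = 0 := sub_eq_zero.2 (hfF p hχ0)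
    have h3 : (χ * χ).1 p = 1 := by
      change χ.1 p * χ.1 p = 1
      rw [hχ, mul_one]
    rw [hδ, h2, h3, mul_zero, zero_add, one_mul, hδc]
  rw [← h1, hid, map_sum]
  refine Finset.sum_congr rfl fun j _ => ?_
  have h2 : (y j - algebraMap ℂ R (B.coord j (c p) : ℂ)).1 p = 0 :=
    sub_eq_zero.2 (hy j p hχ0)
  have h3 : (χ * g j).1 p = fderiv ℝ F (c p) (B j) := by
    change χ.1 p * (g j).1 p = _
    rw [hχ, one_mul, hgp]
  rw [hδ, h2, zero_mul, add_zero, h3, hδc]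

end PointDerivation

/-! ### Smooth oriented orthonormal frames over charts. -/

section Frames

variable {d n : ℕ} {M : Type*} [TopologicalSpace M] [ChartedSpace (EuclideanSpace ℝ (Fin d)) M]
  {E : M → Type*} [TopologicalSpace (TotalSpace (Fin n → ℂ) E)]
  [∀ x, AddCommGroup (E x)] [∀ x, Module ℂ (E x)] [∀ x, TopologicalSpace (E x)]
  [FiberBundle (Fin n → ℂ) E] [VectorBundle ℂ (Fin n → ℂ) E]

theorem contMDiffOn_prod_c {V H X ι : Type*} [NormedAddCommGroup V] [NormedSpace ℝ V]
    [TopologicalSpace H] {I : ModelWithCorners ℝ V H} [TopologicalSpace X] [ChartedSpace H X]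
    {f : ι → X → ℂ} {s : Set X} (t : Finset ι) (hf : ∀ i ∈ t, ContMDiffOn I 𝓘(ℝ, ℂ) ∞ (f i) s) :
    ContMDiffOn I 𝓘(ℝ, ℂ) ∞ (fun x => ∏ i ∈ t, f i x) s := by
  classical
  induction t using Finset.induction_on with
  | empty => simpa using contMDiffOn_const
  | insert i t hi ih =>
    simp only [Finset.prod_insert hi]
    exact contMDiffOn_cmul (hf i (Finset.mem_insert_self _ _))
      (ih fun j hj => hf j (Finset.mem_insert_of_mem hj))

theorem contMDiffOn_det {V H X : Type*} [NormedAddCommGroup V] [NormedSpace ℝ V]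
    [TopologicalSpace H] {I : ModelWithCorners ℝ V H} [TopologicalSpace X] [ChartedSpace H X]
    {f : Fin n → Fin n → X → ℂ} {s : Set X} (hf : ∀ i j, ContMDiffOn I 𝓘(ℝ, ℂ) ∞ (f i j) s) :
    ContMDiffOn I 𝓘(ℝ, ℂ) ∞ (fun x => (Matrix.of fun i j => f i j x).det) s := by
  simp only [Matrix.det_apply']
  exact contMDiffOn_finsetSum fun σ _ => contMDiffOn_cmul contMDiffOn_const
    (contMDiffOn_prod_c _ fun i _ => hf _ _)

variable (E) in
theorem localCoord_localFrame (x₀ x : M)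
    (hx : x ∈ (trivializationAt (Fin n → ℂ) E x₀).baseSet) (j : Fin n) :
    localCoord E x₀ x (localFrame E x₀ x j) = Pi.single j 1 := by
  rw [localCoord, localFrame, Trivialization.linearMapAt_symmₗ _ hx]

/-- A family of vectors with smooth coordinates over the base set of the trivialization at `x₀`. -/
def SmoothVec (d n : ℕ) {M : Type*} [TopologicalSpace M]
    [ChartedSpace (EuclideanSpace ℝ (Fin d)) M]
    {E : M → Type*} [TopologicalSpace (TotalSpace (Fin n → ℂ) E)]
    [∀ x, AddCommGroup (E x)] [∀ x, Module ℂ (E x)] [∀ x, TopologicalSpace (E x)]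
    [FiberBundle (Fin n → ℂ) E] [VectorBundle ℂ (Fin n → ℂ) E] (x₀ : M) (s : ∀ x, E x) : Prop :=
  ∀ k : Fin n, ContMDiffOn (𝓡 d) 𝓘(ℝ, ℂ) ∞ (fun x => localCoord E x₀ x (s x) k)
    (trivializationAt (Fin n → ℂ) E x₀).baseSet

theorem smoothVec_localFrame (x₀ : M) (j : Fin n) :
    SmoothVec d n x₀ (fun x => localFrame E x₀ x j) := by
  intro k
  refine (contMDiffOn_const (c := (Pi.single j (1 : ℂ) : Fin n → ℂ) k)).congr fun x hx => ?_
  rw [localCoord_localFrame E x₀ x hx]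

theorem SmoothVec.sub {x₀ : M} {s t : ∀ x, E x} (hs : SmoothVec d n x₀ s) (ht : SmoothVec d n x₀ t) :
    SmoothVec d n x₀ (fun x => s x - t x) := by
  intro k
  refine ((hs k).sub (ht k)).congr fun x _ => ?_
  rw [map_sub]
  rfl

theorem SmoothVec.smul {x₀ : M} {s : ∀ x, E x} (hs : SmoothVec d n x₀ s) {f : M → ℂ}
    (hf : ContMDiffOn (𝓡 d) 𝓘(ℝ, ℂ) ∞ f (trivializationAt (Fin n → ℂ) E x₀).baseSet) :
    SmoothVec d n x₀ (fun x => f x • s x) := by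
  intro k
  refine (contMDiffOn_cmul hf (hs k)).congr fun x _ => ?_
  rw [map_smul]
  rfl

theorem SmoothVec.sum {x₀ : M} {ι : Type*} {t : Finset ι} {s : ι → ∀ x, E x}
    (hs : ∀ i ∈ t, SmoothVec d n x₀ (s i)) : SmoothVec d n x₀ (fun x => ∑ i ∈ t, s i x) := by
  intro k
  refine (contMDiffOn_finsetSum fun i hi => hs i hi k).congr fun x _ => ?_
  rw [map_sum, Finset.sum_apply]

theorem SmoothVec.form (h : HermitianMetric E (d := d) (n := n)) {x₀ : M} {s t : ∀ x, E x}
    (hs : SmoothVec d n x₀ s) (ht : SmoothVec d n x₀ t) :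
    ContMDiffOn (𝓡 d) 𝓘(ℝ, ℂ) ∞ (fun x => h.form x (s x) (t x))
      (trivializationAt (Fin n → ℂ) E x₀).baseSet := by
  have : ContMDiffOn (𝓡 d) 𝓘(ℝ, ℂ) ∞ (fun x => ∑ k : Fin n, ∑ l : Fin n,
      star ((localCoord E x₀ x (s x) : Fin n → ℂ) k) *
      ((localCoord E x₀ x (t x) : Fin n → ℂ) l *
        h.form x (localFrame E x₀ x k) (localFrame E x₀ x l)))
      (trivializationAt (Fin n → ℂ) E x₀).baseSet :=
    contMDiffOn_finsetSum fun k _ => contMDiffOn_finsetSum fun l _ =>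
      contMDiffOn_cmul (contMDiffOn_cstar (hs k)) (contMDiffOn_cmul (ht l) (h.smooth x₀ k l))
  exact this.congr fun x hx => form_eq_sum h x₀ x hx _ _

theorem vol_eq_det {h : HermitianMetric E (d := d) (n := n)} (o : Orientation h) (x₀ x : M)
    (hx : x ∈ (trivializationAt (Fin n → ℂ) E x₀).baseSet) (v : Fin n → E x) :
    o.vol x v = (Matrix.of fun i j => (localCoord E x₀ x (v i) : Fin n → ℂ) j).det *
      o.vol x (localFrame E x₀ x) := by
  let f : (Fin n → ℂ) [⋀^Fin n]→ₗ[ℂ] ℂ :=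
    (o.vol x).compLinearMap (Fintype.linearCombination ℂ (localFrame E x₀ x))
  have h1 := congrArg (fun F => F fun i => (localCoord E x₀ x (v i) : Fin n → ℂ))
    (AlternatingMap.eq_smul_basis_det (Pi.basisFun ℂ (Fin n)) f)
  have h2 : f (fun i => (localCoord E x₀ x (v i) : Fin n → ℂ)) = o.vol x v := by
    change o.vol x (fun i => ∑ k, (localCoord E x₀ x (v i) : Fin n → ℂ) k • localFrame E x₀ x k) = _
    congr 1
    funext i
    exact sum_localCoord E x₀ x hx (v i)
  have h3 : f (Pi.basisFun ℂ (Fin n)) = o.vol x (localFrame E x₀ x) := by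
    simp only [f, AlternatingMap.compLinearMap_apply]
    congr 1
    ext j
    simp [Fintype.linearCombination_apply, Pi.single_apply]
  rw [← h2, h1, h3]
  change o.vol x (localFrame E x₀ x) *
    (Pi.basisFun ℂ (Fin n)).det (fun i => (localCoord E x₀ x (v i) : Fin n → ℂ)) = _
  rw [mul_comm]
  congr 1
  exact Pi.basisFun_det_apply _

theorem form_self_re (h : HermitianMetric E (d := d) (n := n)) (x : M) (v : E x) :
    ((h.form x v v).re : ℂ) = h.form x v v :=
  Complex.conj_eq_iff_re.1 (h.conj_symm x v v)

theorem form_smul_left (h : HermitianMetric E (d := d) (n := n)) (x : M) (c : ℂ) (v w : E x) :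
    h.form x (c • v) w = star c * h.form x v w := by
  rw [map_smulₛₗ]
  rfl

theorem form_smul_right (h : HermitianMetric E (d := d) (n := n)) (x : M) (c : ℂ) (v w : E x) :
    h.form x v (c • w) = c * h.form x v w := by
  rw [map_smul]
  rfl

theorem contDiffAt_inv_sqrt_re {z : ℂ} (hz : 0 < z.re) :
    ContDiffAt ℝ ∞ (fun z : ℂ => (((√z.re)⁻¹ : ℝ) : ℂ)) z := by
  have h1 : ContDiffAt ℝ ∞ (fun z : ℂ => z.re) z := Complex.reCLM.contDiff.contDiffAt
  have h2 : ContDiffAt ℝ ∞ (fun z : ℂ => (√z.re)⁻¹) z :=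
    (h1.sqrt hz.ne').inv (Real.sqrt_pos.2 hz).ne'
  exact Complex.ofRealCLM.contDiff.contDiffAt.comp z h2

/-- The Gram-Schmidt process for the local frame at `x₀`. -/
theorem exists_orthonormal_smoothVec (h : HermitianMetric E (d := d) (n := n)) (x₀ : M) (k : ℕ)
    (hk : k ≤ n) : ∃ s : ℕ → ∀ x, E x, (∀ i < k, SmoothVec d n x₀ (s i)) ∧
      ∀ x ∈ (trivializationAt (Fin n → ℂ) E x₀).baseSet,
        (∀ i < k, ∀ j < k, h.form x (s i x) (s j x) = if i = j then 1 else 0) ∧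
        ∀ i < k, ∀ j : Fin n, i < j → (localCoord E x₀ x (s i x) : Fin n → ℂ) j = 0 := by
  induction k with
  | zero => exact ⟨fun _ _ => 0, by simp, by simp⟩
  | succ k ih =>
    obtain ⟨s, hs, hs'⟩ := ih (by omega)
    let k' : Fin n := ⟨k, by omega⟩
    let e : ∀ x, E x := fun x => localFrame E x₀ x k'
    have he : SmoothVec d n x₀ e := smoothVec_localFrame x₀ k'
    let v : ∀ x, E x := fun x => e x - ∑ i ∈ Finset.range k, h.form x (s i x) (e x) • s i x
    have hv : SmoothVec d n x₀ v := he.sub (SmoothVec.sum fun i hi =>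
      (hs i (Finset.mem_range.1 hi)).smul ((hs i (Finset.mem_range.1 hi)).form h he))
    -- The triangular shape is carried through the induction for this purpose: the new vector has
    -- `k`-th coordinate one and cannot vanish, although no independence was assumed.
    have hvcoord : ∀ x ∈ (trivializationAt (Fin n → ℂ) E x₀).baseSet, ∀ j : Fin n, k ≤ j →
        (localCoord E x₀ x (v x) : Fin n → ℂ) j = if j = k' then 1 else 0 := by
      intro x hx j hj
      simp only [v, e, map_sub, map_sum, map_smul, Pi.sub_apply, Finset.sum_apply, Pi.smul_apply]
      rw [localCoord_localFrame E x₀ x hx, Pi.single_apply, Finset.sum_eq_zero, sub_zero]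
      intro i hi
      have hik := Finset.mem_range.1 hi
      rw [(hs' x hx).2 i hik j (by omega), smul_zero]
    have hv0 : ∀ x ∈ (trivializationAt (Fin n → ℂ) E x₀).baseSet, v x ≠ 0 := by
      intro x hx h0
      have h1 := hvcoord x hx k' le_rfl
      rw [h0, map_zero, if_pos rfl] at h1
      exact zero_ne_one h1
    have hsv : ∀ x ∈ (trivializationAt (Fin n → ℂ) E x₀).baseSet, ∀ i < k,
        h.form x (s i x) (v x) = 0 := by
      intro x hx i hi
      simp only [v, map_sub, map_sum, form_smul_right]
      rw [Finset.sum_eq_single i]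
      · rw [(hs' x hx).1 i hi i hi, if_pos rfl, mul_one, sub_self]
      · intro j hj hji
        rw [(hs' x hx).1 i hi j (Finset.mem_range.1 hj), if_neg hji.symm, mul_zero]
      · intro h1
        exact absurd (Finset.mem_range.2 hi) h1
    let N : M → ℂ := fun x => (((√(h.form x (v x) (v x)).re)⁻¹ : ℝ) : ℂ)
    have hN : ContMDiffOn (𝓡 d) 𝓘(ℝ, ℂ) ∞ N (trivializationAt (Fin n → ℂ) E x₀).baseSet := by
      intro x hx
      exact ContMDiffAt.comp_contMDiffWithinAt
        (g := fun z : ℂ => (((√z.re)⁻¹ : ℝ) : ℂ)) (f := fun x => h.form x (v x) (v x)) x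
        (contDiffAt_inv_sqrt_re (h.pos x _ (hv0 x hx))).contMDiffAt (hv.form h hv x hx)
    refine ⟨fun i => if i = k then fun x => N x • v x else s i, ?_, ?_⟩
    · intro i hi
      by_cases hik : i = k
      · simp only [hik, if_true]
        exact hv.smul hN
      · simp only [hik, if_false]
        exact hs i (by omega)
    · intro x hx
      have hNv : h.form x (N x • v x) (N x • v x) = 1 := by
        have hpos := h.pos x _ (hv0 x hx)
        rw [form_smul_left, form_smul_right, ← form_self_re]
        simp only [N, Complex.star_def, Complex.conj_ofReal]
        rw [← Complex.ofReal_mul, ← Complex.ofReal_mul, ← Complex.ofReal_one]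
        congr 1
        have h1 : √(h.form x (v x) (v x)).re ≠ 0 := (Real.sqrt_pos.2 hpos).ne'
        have h2 := Real.mul_self_sqrt hpos.le
        field_simp
        rw [sq, h2]
      have hsv' : ∀ i < k, h.form x (s i x) (N x • v x) = 0 := fun i hi => by
        rw [form_smul_right, hsv x hx i hi, mul_zero]
      refine ⟨fun i hi j hj => ?_, fun i hi j hij => ?_⟩
      · by_cases hik : i = k <;> by_cases hjk : j = k
        · subst hik
          subst hjk
          simpa using hNv
        · subst hik
          simp only [if_true, if_neg hjk, if_neg (Ne.symm hjk)]
          rw [← h.conj_symm, hsv' j (by omega), star_zero]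
        · subst hjk
          simp only [if_true, if_neg hik]
          exact hsv' i (by omega)
        · simp only [if_neg hik, if_neg hjk]
          exact (hs' x hx).1 i (by omega) j (by omega)
      · by_cases hik : i = k
        · subst hik
          simp only [if_true, map_smul, Pi.smul_apply]
          rw [hvcoord x hx j hij.le, if_neg, smul_zero]
          rintro rfl
          exact lt_irrefl _ hij
        · simp only [if_neg hik]
          exact (hs' x hx).2 i (by omega) j hij

/-- A smooth oriented orthonormal frame over the domain of a trivialization. -/
theorem exists_oriented_frame (hn : 1 ≤ n) {h : HermitianMetric E (d := d) (n := n)}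
    (o : Orientation h) (x₀ : M) :
    ∃ s : Fin n → ∀ x, E x, (∀ i, SmoothVec d n x₀ (s i)) ∧
      ∀ x ∈ (trivializationAt (Fin n → ℂ) E x₀).baseSet,
        (∀ i j, h.form x (s i x) (s j x) = if i = j then 1 else 0) ∧
          o.vol x (fun i => s i x) = 1 := by
  obtain ⟨s, hs, hs'⟩ := exists_orthonormal_smoothVec h x₀ n le_rfl
  let i₀ : Fin n := ⟨0, hn⟩
  -- The volume of an orthonormal frame has modulus one, so multiplying one vector by its conjugate
  -- gives volume one and keeps the frame orthonormal.
  let w : M → ℂ := fun x => star (o.vol x fun i : Fin n => s i x)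
  have hw : ContMDiffOn (𝓡 d) 𝓘(ℝ, ℂ) ∞ w (trivializationAt (Fin n → ℂ) E x₀).baseSet := by
    refine contMDiffOn_cstar ?_
    have h1 := contMDiffOn_cmul (contMDiffOn_det (n := n)
      (f := fun i j x => (localCoord E x₀ x (s i x) : Fin n → ℂ) j)
      fun i j => hs i i.2 j) (o.smooth x₀)
    exact h1.congr fun x hx => vol_eq_det o x₀ x hx _
  have hwn : ∀ x ∈ (trivializationAt (Fin n → ℂ) E x₀).baseSet,
      w x * o.vol x (fun i : Fin n => s i x) = 1 := by
    intro x hx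
    have h1 := o.norm_eq_one x (fun i : Fin n => s i x) fun i j => by
      rw [(hs' x hx).1 i i.2 j j.2]
      simp [Fin.ext_iff]
    have h2 : w x * o.vol x (fun i : Fin n => s i x) =
      ((‖o.vol x (fun i : Fin n => s i x)‖ ^ 2 : ℝ) : ℂ) := by
      rw [Complex.ofReal_pow, ← Complex.conj_mul']
      rfl
    rw [h2, h1]
    simp
  refine ⟨fun i => if i = i₀ then fun x => w x • s i x else s i, ?_, ?_⟩
  · intro i
    by_cases hi : i = i₀
    · simp only [hi, if_true]
      exact (hs i₀ i₀.2).smul hw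
    · simp only [hi, if_false]
      exact hs i i.2
  · intro x hx
    have hww : star (w x) * w x = 1 := by
      rw [mul_comm, ← hwn x hx]
      simp [w]
    have horth : ∀ i j : Fin n, h.form x (s i x) (s j x) = if i = j then 1 else 0 := by
      intro i j
      rw [(hs' x hx).1 i i.2 j j.2]
      simp [Fin.ext_iff]
    constructor
    · intro i j
      by_cases hi : i = i₀ <;> by_cases hj : j = i₀
      · subst hi
        subst hj
        simp only [if_true, form_smul_left, form_smul_right]
        rw [horth, if_pos rfl, mul_one, mul_comm]
        exact hww
      · simp only [if_pos hi, if_neg hj, form_smul_left]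
        have hij : i ≠ j := fun h' => hj (h' ▸ hi)
        rw [horth, if_neg hij, mul_zero]
      · simp only [if_neg hi, if_pos hj, form_smul_right]
        have hij : i ≠ j := fun h' => hi (h' ▸ hj)
        rw [horth, if_neg hij, mul_zero]
      · simp only [if_neg hi, if_neg hj]
        exact horth i j
    · have h1 : (fun i : Fin n => (if i = i₀ then fun x => w x • s i x else s i : ∀ x, E x) x) =
          update (fun i : Fin n => s i x) i₀ (w x • s i₀ x) := by
        funext i
        by_cases hi : i = i₀
        · subst hi
          simp
        · simp [hi]
      rw [h1, (o.vol x).map_update_smul]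
      have h2 : update (fun i : Fin n => s i x) i₀ (s i₀ x) = fun i : Fin n => s i x :=
        update_eq_self i₀ _
      rw [h2]
      exact hwn x hx

variable [VectorBundle ℝ (Fin n → ℂ) E] [ContMDiffVectorBundle ∞ (Fin n → ℂ) E (𝓡 d)]

/-- This is where smoothness of the bundle enters: the change of trivialization of the underlying
real bundle, evaluated on a basis vector. It makes `SmoothVec` independent of the trivialization on
overlaps. -/
theorem contMDiffOn_transition (x₀ x₁ : M) (j k : Fin n) :
    ContMDiffOn (𝓡 d) 𝓘(ℝ, ℂ) ∞
      (fun x => (localCoord E x₁ x (localFrame E x₀ x j) : Fin n → ℂ) k)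
      ((trivializationAt (Fin n → ℂ) E x₀).baseSet ∩
        (trivializationAt (Fin n → ℂ) E x₁).baseSet) := by
  have h1 := contMDiffOn_coordChangeL (n := ∞) (IB := 𝓡 d) (𝕜 := ℝ)
    (trivializationAt (Fin n → ℂ) E x₀) (trivializationAt (Fin n → ℂ) E x₁)
  let L : ((Fin n → ℂ) →L[ℝ] (Fin n → ℂ)) →L[ℝ] ℂ :=
    (ContinuousLinearMap.proj k).comp
      (ContinuousLinearMap.apply ℝ (Fin n → ℂ) (Pi.single j (1 : ℂ) : Fin n → ℂ))
  have h2 := L.contDiff.contMDiff.comp_contMDiffOn h1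
  refine h2.congr fun x hx => ?_
  simp only [L, Function.comp_apply, ContinuousLinearMap.comp_apply,
    ContinuousLinearMap.apply_apply, ContinuousLinearMap.proj_apply]
  change _ = ((trivializationAt (Fin n → ℂ) E x₀).coordChangeL ℝ
    (trivializationAt (Fin n → ℂ) E x₁) x (Pi.single j 1)) k
  rw [Trivialization.coordChangeL_apply _ _ hx, localCoord, localFrame,
    Trivialization.coe_linearMapAt_of_mem _ hx.2, Trivialization.coe_symmₗ _ hx.1]

theorem SmoothVec.contMDiffOn {x₀ : M} {s : ∀ x, E x} (hs : SmoothVec d n x₀ s) (x₁ : M)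
    (k : Fin n) : ContMDiffOn (𝓡 d) 𝓘(ℝ, ℂ) ∞
      (fun x => (localCoord E x₁ x (s x) : Fin n → ℂ) k)
      ((trivializationAt (Fin n → ℂ) E x₀).baseSet ∩
        (trivializationAt (Fin n → ℂ) E x₁).baseSet) := by
  have h1 : ContMDiffOn (𝓡 d) 𝓘(ℝ, ℂ) ∞ (fun x => ∑ l : Fin n,
      (localCoord E x₀ x (s x) : Fin n → ℂ) l *
        (localCoord E x₁ x (localFrame E x₀ x l) : Fin n → ℂ) k)
      ((trivializationAt (Fin n → ℂ) E x₀).baseSet ∩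
        (trivializationAt (Fin n → ℂ) E x₁).baseSet) :=
    contMDiffOn_finsetSum fun l _ => contMDiffOn_cmul ((hs l).mono Set.inter_subset_left)
      (contMDiffOn_transition x₀ x₁ l k)
  refine h1.congr fun x hx => ?_
  conv_lhs => rw [← sum_localCoord E x₀ x hx.1 (s x)]
  simp [map_sum, Finset.sum_apply]

/-- A chart of the base together with a smooth oriented orthonormal frame over its domain. -/
structure FrameChart {h : HermitianMetric E (d := d) (n := n)} (o : Orientation h) where
  center : M
  dom : Set M
  isOpen_dom : IsOpen dom
  dom_subset : dom ⊆ (chartAt (EuclideanSpace ℝ (Fin d)) center).source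
  frame : ∀ x, Fin n → E x
  orthonormal : ∀ x ∈ dom, ∀ i j, h.form x (frame x i) (frame x j) = if i = j then 1 else 0
  oriented : ∀ x ∈ dom, o.vol x (frame x) = 1
  smooth : ∀ x₁ i k, ContMDiffOn (𝓡 d) 𝓘(ℝ, ℂ) ∞
    (fun x => (localCoord E x₁ x (frame x i) : Fin n → ℂ) k)
    (dom ∩ (trivializationAt (Fin n → ℂ) E x₁).baseSet)

theorem exists_frameChart (hn : 1 ≤ n) {h : HermitianMetric E (d := d) (n := n)}
    (o : Orientation h) (x₀ : M) : ∃ S : FrameChart o, S.center = x₀ ∧ x₀ ∈ S.dom := by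
  obtain ⟨s, hs, hs'⟩ := exists_oriented_frame hn o x₀
  refine ⟨{ center := x₀
            dom := (trivializationAt (Fin n → ℂ) E x₀).baseSet ∩
              (chartAt (EuclideanSpace ℝ (Fin d)) x₀).source
            isOpen_dom := (trivializationAt (Fin n → ℂ) E x₀).open_baseSet.inter
              (chartAt (EuclideanSpace ℝ (Fin d)) x₀).open_source
            dom_subset := Set.inter_subset_right
            frame := fun x i => s i x
            orthonormal := fun x hx => (hs' x hx.1).1
            oriented := fun x hx => (hs' x hx.1).2
            smooth := fun x₁ i k => ((hs i).contMDiffOn x₁ k).mono fun x hx => ⟨hx.1.1, hx.2⟩ },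
    rfl, FiberBundle.mem_baseSet_trivializationAt' x₀, mem_chart_source _ x₀⟩

end Frames

/-! ### Evaluation in a frame and the action of SU(n). -/

section FramePoints

variable {d n : ℕ} {M : Type*} [TopologicalSpace M] [ChartedSpace (EuclideanSpace ℝ (Fin d)) M]
  {E : M → Type*} [TopologicalSpace (TotalSpace (Fin n → ℂ) E)]
  [∀ x, AddCommGroup (E x)] [∀ x, Module ℂ (E x)] [∀ x, TopologicalSpace (E x)]
  [FiberBundle (Fin n → ℂ) E] [VectorBundle ℂ (Fin n → ℂ) E]
  {h : HermitianMetric E (d := d) (n := n)} {o : Orientation h}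

/-- Evaluation of functions on the frame bundle at a frame. -/
def evalFun (p : FrameBundle o) : frameFunctions o →ₐ[ℂ] ℂ :=
  (Pi.evalAlgHom ℂ (fun _ : FrameBundle o => ℂ) p).comp (frameFunctions o).val

theorem evalFun_apply (p : FrameBundle o) (f : frameFunctions o) : evalFun p f = f.1 p := rfl

/-- Evaluation of matrix valued functions on the frame bundle at a frame. -/
def evalMat (p : FrameBundle o) : matrixFunctions o →ₐ[ℂ] Matrix (Fin n) (Fin n) ℂ :=
  (evalFun p).mapMatrix

theorem evalMat_apply (p : FrameBundle o) (b : matrixFunctions o) (i j : Fin n) :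
    evalMat p b i j = (b i j).1 p := rfl

theorem matrixFunctions_ext {b b' : matrixFunctions o}
    (hb : ∀ p, evalMat p b = evalMat p b') : b = b' := by
  ext i j p
  exact congrFun (congrFun (hb p) i) j

theorem evalMat_constMatrix (p : FrameBundle o) (m : Matrix (Fin n) (Fin n) ℂ) :
    evalMat p (constMatrix m) = m := by
  ext i j
  rfl

theorem evalMat_scalar (p : FrameBundle o) (f : frameFunctions o) :
    evalMat p (Matrix.scalar (Fin n) f) = Matrix.scalar (Fin n) (f.1 p) := by
  ext i j
  rw [evalMat_apply]
  by_cases hij : i = j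
  · subst hij
    simp
  · simp only [Matrix.scalar_apply, Matrix.diagonal_apply_ne _ hij]
    rfl

theorem evalFun_trace (p : FrameBundle o) (b : matrixFunctions o) :
    b.trace.1 p = (evalMat p b).trace := by
  change evalFun p b.trace = _
  rw [Matrix.trace, map_sum]
  rfl

theorem finrank_fiber (E : M → Type*) [TopologicalSpace (TotalSpace (Fin n → ℂ) E)]
    [∀ x, AddCommGroup (E x)] [∀ x, Module ℂ (E x)] [∀ x, TopologicalSpace (E x)]
    [FiberBundle (Fin n → ℂ) E] [VectorBundle ℂ (Fin n → ℂ) E] (x : M) :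
    Module.finrank ℂ (E x) = n := by
  rw [((trivializationAt (Fin n → ℂ) E x).linearEquivAt ℂ x
    (FiberBundle.mem_baseSet_trivializationAt' x)).finrank_eq]
  simp

variable (p : FrameBundle o)

theorem FrameBundle.linearIndependent : LinearIndependent ℂ p.frame := by
  rw [Fintype.linearIndependent_iff]
  intro c hc i
  have h1 := congrArg (h.form p.base (p.frame i)) hc
  simpa [p.orthonormal] using h1

/-- Orthonormal vectors are independent, and `n` of them span a fibre of dimension `n`; the
coefficients are then read off by pairing. -/
theorem FrameBundle.sum_form (v : E p.base) :
    ∑ i, h.form p.base (p.frame i) v • p.frame i = v := by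
  have h1 : ⊤ ≤ Submodule.span ℂ (Set.range p.frame) := by
    rcases Nat.eq_zero_or_pos n with hn | hn
    · subst hn
      have : Subsingleton (E p.base) := by
        have : Module.Finite ℂ (E p.base) := Module.Finite.equiv
          ((trivializationAt (Fin 0 → ℂ) E p.base).linearEquivAt ℂ p.base
            (FiberBundle.mem_baseSet_trivializationAt' p.base)).symm
        exact Module.finrank_zero_iff.1 (finrank_fiber (n := 0) E p.base)
      intro v _
      rw [Subsingleton.elim v 0]
      exact Submodule.zero_mem _
    · have : Nonempty (Fin n) := ⟨⟨0, hn⟩⟩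
      exact (p.linearIndependent.span_eq_top_of_card_eq_finrank
        (by rw [finrank_fiber (n := n) E p.base, Fintype.card_fin])).ge
  obtain ⟨c, rfl⟩ := (Submodule.mem_span_range_iff_exists_fun ℂ).1 (h1 (Submodule.mem_top (x := v)))
  refine Finset.sum_congr rfl fun i _ => ?_
  congr 1
  simp [p.orthonormal]

theorem FrameBundle.end_eq_zero (f : Module.End ℂ (E p.base))
    (hf : ∀ i j, h.form p.base (p.frame i) (f (p.frame j)) = 0) : f = 0 := by
  ext v
  rw [← p.sum_form v, map_sum]
  refine (Finset.sum_eq_zero fun j _ => ?_).trans (LinearMap.zero_apply _).symm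
  rw [map_smul, ← p.sum_form (f (p.frame j))]
  simp [hf]

variable (o) in
/-- `frameMatrix` as a homomorphism of algebras. -/
def frameMatrixHom : endSections (d := d) n E →ₐ[ℂ] matrixFunctions o :=
  AlgHom.ofLinearMap
    { toFun := frameMatrix o
      map_add' := fun a b => by
        refine matrixFunctions_ext fun p => ?_
        ext i j
        exact map_add (h.form p.base (p.frame i)) _ _
      map_smul' := fun c a => by
        refine matrixFunctions_ext fun p => ?_
        ext i j
        exact map_smul (h.form p.base (p.frame i)) _ _ }
    (by
      refine matrixFunctions_ext fun p => ?_
      rw [map_one (evalMat p)]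
      ext i j
      exact (p.orthonormal i j).trans (Matrix.one_apply).symm)
    (fun a b => by
      refine matrixFunctions_ext fun p => ?_
      rw [map_mul (evalMat p)]
      ext i j
      rw [Matrix.mul_apply]
      change h.form p.base (p.frame i) (a.1 p.base (b.1 p.base (p.frame j))) =
        ∑ k, h.form p.base (p.frame i) (a.1 p.base (p.frame k)) *
          h.form p.base (p.frame k) (b.1 p.base (p.frame j))
      conv_lhs => rw [← p.sum_form (b.1 p.base (p.frame j))]
      simp only [map_sum, map_smul, smul_eq_mul]
      exact Finset.sum_congr rfl fun k _ => mul_comm _ _)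

theorem frameMatrixHom_apply (a : endSections (d := d) n E) :
    frameMatrixHom o a = frameMatrix o a := rfl

/-- The matrix of an endomorphism field in a frame. -/
def matrixAt : endSections (d := d) n E →ₐ[ℂ] Matrix (Fin n) (Fin n) ℂ :=
  (evalMat p).comp (frameMatrixHom o)

theorem matrixAt_apply (a : endSections (d := d) n E) (i j : Fin n) :
    matrixAt p a i j = h.form p.base (p.frame i) (a.1 p.base (p.frame j)) := rfl

theorem evalMat_frameMatrix (a : endSections (d := d) n E) :
    evalMat p (frameMatrix o a) = matrixAt p a := rfl

theorem matrixAt_act (g : Matrix.specialUnitaryGroup (Fin n) ℂ) (a : endSections (d := d) n E) :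
    matrixAt (p.act g) a = (g : Matrix (Fin n) (Fin n) ℂ)ᴴ * matrixAt p a *
      (g : Matrix (Fin n) (Fin n) ℂ) := by
  ext i j
  rw [matrixAt_apply, Matrix.mul_apply]
  simp only [Matrix.mul_apply, matrixAt_apply, Matrix.conjTranspose_apply]
  change h.form p.base (∑ k, (g : Matrix (Fin n) (Fin n) ℂ) k i • p.frame k)
    (a.1 p.base (∑ l, (g : Matrix (Fin n) (Fin n) ℂ) l j • p.frame l)) = _
  simp only [map_sum, LinearMap.sum_apply, map_smul, form_smul_left, Finset.sum_mul, smul_eq_mul,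
    Finset.mul_sum]
  refine Finset.sum_congr rfl fun l _ => Finset.sum_congr rfl fun k _ => ?_
  ring

theorem endSections_ext (a b : endSections (d := d) n E) (P : M → FrameBundle o)
    (hP : ∀ x, (P x).base = x) (hab : ∀ x, matrixAt (P x) a = matrixAt (P x) b) : a = b := by
  have key : ∀ p : FrameBundle o, matrixAt p a = matrixAt p b → a.1 p.base = b.1 p.base := by
    intro p hp
    refine sub_eq_zero.1 (p.end_eq_zero _ fun i j => ?_)
    have := congrFun (congrFun hp i) j
    rw [matrixAt_apply, matrixAt_apply] at this
    rw [LinearMap.sub_apply, map_sub, this, sub_self]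
  ext1
  funext x
  have := key (P x) (hab x)
  rwa [hP x] at this

variable (n E) in
/-- Multiples of the identity as endomorphism fields. -/
def scalarSection : smoothFunctions d M →ₐ[ℂ] endSections (d := d) n E where
  toFun f := ⟨fun x => algebraMap ℂ (Module.End ℂ (E x)) (f.1 x), by
    intro x₀ i j
    refine (contMDiffOn_cmul f.2.contMDiffOn (contMDiffOn_const
      (c := (Pi.single j (1 : ℂ) : Fin n → ℂ) i))).congr fun x hx => ?_
    simp only [Module.algebraMap_end_apply, map_smul, Pi.smul_apply, smul_eq_mul]
    rw [localCoord_localFrame E x₀ x hx]⟩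
  map_one' := by
    ext1
    funext x
    exact map_one (algebraMap ℂ (Module.End ℂ (E x)))
  map_mul' f g := by
    ext1
    funext x
    exact map_mul (algebraMap ℂ (Module.End ℂ (E x))) (f.1 x) (g.1 x)
  map_zero' := by
    ext1
    funext x
    exact map_zero (algebraMap ℂ (Module.End ℂ (E x)))
  map_add' f g := by
    ext1
    funext x
    exact map_add (algebraMap ℂ (Module.End ℂ (E x))) (f.1 x) (g.1 x)
  commutes' c := rfl

variable (n E) in
/-- Multiples of the identity as central elements. -/
def centralSection (f : smoothFunctions d M) : Subalgebra.center ℂ (endSections (d := d) n E) :=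
  ⟨scalarSection n E f, by
    refine Subalgebra.mem_center_iff.2 fun b => ?_
    ext1
    funext x
    exact (Algebra.commutes (f.1 x) (b.1 x)).symm⟩

theorem frameMatrix_scalarSection (f : smoothFunctions d M) :
    frameMatrix o (scalarSection n E f) = Matrix.scalar (Fin n) (pullbackFunction o f) := by
  refine matrixFunctions_ext fun p => ?_
  rw [evalMat_scalar]
  ext i j
  change h.form p.base (p.frame i) (f.1 p.base • p.frame j) = _
  rw [form_smul_right, p.orthonormal]
  by_cases hij : i = j
  · subst hij
    simp [pullbackFunction]
  · simp [hij]

theorem matrixAt_scalarSection (f : smoothFunctions d M) :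
    matrixAt p (scalarSection n E f) = f.1 p.base • 1 := by
  rw [← evalMat_frameMatrix, frameMatrix_scalarSection, evalMat_scalar]
  ext i j
  simp [pullbackFunction, Matrix.one_apply, Matrix.diagonal_apply]

theorem map_linearCombination_det {V : Type*} [AddCommGroup V] [Module ℂ V]
    (vol : V [⋀^Fin n]→ₗ[ℂ] ℂ) (s : Fin n → V) (g : Matrix (Fin n) (Fin n) ℂ) :
    vol (fun j => ∑ i, g i j • s i) = g.det * vol s := by
  let f : (Fin n → ℂ) [⋀^Fin n]→ₗ[ℂ] ℂ := vol.compLinearMap (Fintype.linearCombination ℂ s)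
  have h1 := congrArg (fun F => F gᵀ)
    (AlternatingMap.eq_smul_basis_det (Pi.basisFun ℂ (Fin n)) f)
  have h2 : f gᵀ = vol (fun j => ∑ i, g i j • s i) := by
    simp only [f]
    congr 1
  have h3 : f (Pi.basisFun ℂ (Fin n)) = vol s := by
    simp only [f, AlternatingMap.compLinearMap_apply]
    congr 1
    ext j
    simp [Fintype.linearCombination_apply, Pi.single_apply]
  rw [← h2, h1, h3]
  change vol s * (Pi.basisFun ℂ (Fin n)).det gᵀ = _
  rw [mul_comm]
  congr 1

/-- Orthonormality of both frames makes the matrix unitary; its determinant is the quotient of the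
two volumes, which are one. -/
theorem transition_mem (fr : Fin n → E p.base)
    (h1 : ∀ i j, h.form p.base (fr i) (fr j) = if i = j then 1 else 0) (h2 : o.vol p.base fr = 1) :
    (Matrix.of fun i j => h.form p.base (p.frame i) (fr j)) ∈
      Matrix.specialUnitaryGroup (Fin n) ℂ := by
  set g : Matrix (Fin n) (Fin n) ℂ :=
    Matrix.of fun i j => h.form p.base (p.frame i) (fr j)
  have hfr : ∀ j, fr j = ∑ i, g i j • p.frame i := fun j => (p.sum_form (fr j)).symm
  refine Matrix.mem_specialUnitaryGroup_iff.2 ⟨Matrix.mem_unitaryGroup_iff'.2 ?_, ?_⟩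
  · ext i j
    rw [Matrix.one_apply, ← h1 i j, hfr i, hfr j, Matrix.mul_apply]
    simp [map_sum, LinearMap.sum_apply, p.orthonormal, Matrix.star_apply, mul_comm]
  · have h3 := map_linearCombination_det (o.vol p.base) p.frame g
    rw [p.oriented, mul_one] at h3
    rw [← h3, ← h2]
    congr 1
    funext j
    exact (hfr j).symm

theorem exists_act_eq (q : FrameBundle o) (hq : q.base = p.base) :
    ∃ g : Matrix.specialUnitaryGroup (Fin n) ℂ, p.act g = q := by
  obtain ⟨x, fr, h1, h2⟩ := q
  change x = p.base at hq
  subst hq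
  refine ⟨⟨_, transition_mem p fr h1 h2⟩, ?_⟩
  rw [FrameBundle.act]
  congr 1
  funext j
  exact p.sum_form (fr j)

end FramePoints

/-! ### Coordinates on the frame bundle: base chart and change of frame. -/

section Coordinates

variable {d n : ℕ} {M : Type*} [TopologicalSpace M] [ChartedSpace (EuclideanSpace ℝ (Fin d)) M]
  {E : M → Type*} [TopologicalSpace (TotalSpace (Fin n → ℂ) E)]
  [∀ x, AddCommGroup (E x)] [∀ x, Module ℂ (E x)] [∀ x, TopologicalSpace (E x)]
  [FiberBundle (Fin n → ℂ) E] [VectorBundle ℂ (Fin n → ℂ) E]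
  {h : HermitianMetric E (d := d) (n := n)} {o : Orientation h}

variable (S : FrameChart o)

/-- The point of the frame bundle given by the frame at `x`. -/
def FrameChart.point (x : M) (hx : x ∈ S.dom) : FrameBundle o where
  base := x
  frame := S.frame x
  orthonormal := S.orthonormal x hx
  oriented := S.oriented x hx

open Classical in
/-- The transition matrix from the frame of `S` to `p`. -/
def FrameChart.gauge (p : FrameBundle o) : Matrix.specialUnitaryGroup (Fin n) ℂ :=
  if hp : p.base ∈ S.dom then
    ⟨_, transition_mem (S.point p.base hp) p.frame p.orthonormal p.oriented⟩
  else 1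

theorem FrameChart.gauge_apply {p : FrameBundle o} (hp : p.base ∈ S.dom) (i j : Fin n) :
    (S.gauge p : Matrix (Fin n) (Fin n) ℂ) i j =
      h.form p.base (S.frame p.base i) (p.frame j) := by
  rw [FrameChart.gauge, dif_pos hp]
  rfl

theorem FrameChart.sum_gauge {p : FrameBundle o} (hp : p.base ∈ S.dom) (j : Fin n) :
    ∑ i, (S.gauge p : Matrix (Fin n) (Fin n) ℂ) i j • S.frame p.base i = p.frame j := by
  simp only [S.gauge_apply hp]
  exact (S.point p.base hp).sum_form (p.frame j)

theorem FrameChart.act_gauge {p : FrameBundle o} (hp : p.base ∈ S.dom) :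
    (S.point p.base hp).act (S.gauge p) = p := by
  have h1 := S.sum_gauge hp
  obtain ⟨x, fr, h2, h3⟩ := p
  rw [FrameBundle.act]
  congr 1
  funext j
  exact h1 j

theorem FrameChart.gauge_point_act {x : M} (hx : x ∈ S.dom)
    (g : Matrix.specialUnitaryGroup (Fin n) ℂ) : S.gauge ((S.point x hx).act g) = g := by
  ext i j
  rw [S.gauge_apply (p := (S.point x hx).act g) hx]
  change h.form x (S.frame x i) (∑ k, (g : Matrix (Fin n) (Fin n) ℂ) k j • S.frame x k) = _
  simp [map_sum, S.orthonormal x hx]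

theorem FrameBundle.act_one (p : FrameBundle o) : p.act 1 = p := by
  cases p
  simp [FrameBundle.act, Matrix.one_apply]

theorem FrameChart.gauge_point {x : M} (hx : x ∈ S.dom) : S.gauge (S.point x hx) = 1 := by
  have h1 := S.gauge_point_act hx 1
  rwa [FrameBundle.act_one] at h1

theorem FrameChart.matrixAt_eq {p : FrameBundle o} (hp : p.base ∈ S.dom)
    (a : endSections (d := d) n E) :
    matrixAt p a = (S.gauge p : Matrix (Fin n) (Fin n) ℂ)ᴴ * matrixAt (S.point p.base hp) a *
      (S.gauge p : Matrix (Fin n) (Fin n) ℂ) := by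
  rw [← matrixAt_act, S.act_gauge]

/-- The coordinates on the part of the frame bundle over the domain of `S`. -/
def FrameChart.coord (p : FrameBundle o) : EuclideanSpace ℝ (Fin d) × (Fin n → Fin n → ℂ) :=
  (chartAt (EuclideanSpace ℝ (Fin d)) S.center p.base,
    fun i j => (S.gauge p : Matrix (Fin n) (Fin n) ℂ) i j)

/-- Smoothness of a function on the frame bundle near a point. -/
def SmoothNear (f : FrameBundle o → ℂ) (p₀ : FrameBundle o) : Prop :=
  ∃ U : Set (M × (Fin n → Fin n → ℂ)), IsOpen U ∧
    frameCoord p₀.base p₀ ∈ U ∧ ∃ F : M × (Fin n → Fin n → ℂ) → ℂ,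
      ContMDiffOn ((𝓡 d).prod 𝓘(ℝ, Fin n → Fin n → ℂ)) 𝓘(ℝ, ℂ) ∞ F U ∧
      ∀ p : FrameBundle o, p.base ∈ (trivializationAt (Fin n → ℂ) E p₀.base).baseSet →
        frameCoord p₀.base p ∈ U → f p = F (frameCoord p₀.base p)

theorem SmoothNear.mul {f g : FrameBundle o → ℂ} {p₀ : FrameBundle o} (hf : SmoothNear f p₀)
    (hg : SmoothNear g p₀) : SmoothNear (fun p => f p * g p) p₀ := by
  obtain ⟨U, hU, hpU, F, hF, hfF⟩ := hf
  obtain ⟨W, hW, hpW, G, hG, hgG⟩ := hg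
  refine ⟨U ∩ W, hU.inter hW, ⟨hpU, hpW⟩, fun q => F q * G q,
    contMDiffOn_cmul (hF.mono Set.inter_subset_left) (hG.mono Set.inter_subset_right),
    fun p hp hpc => ?_⟩
  change f p * g p = _
  rw [hfF p hp hpc.1, hgG p hp hpc.2]

theorem SmoothNear.congr_base {f g : FrameBundle o → ℂ} {p₀ : FrameBundle o}
    (hf : SmoothNear f p₀) {W : Set M} (hW : IsOpen W) (hp₀ : p₀.base ∈ W)
    (hfg : ∀ p : FrameBundle o, p.base ∈ W → g p = f p) : SmoothNear g p₀ := by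
  obtain ⟨U, hU, hpU, F, hF, hfF⟩ := hf
  refine ⟨U ∩ Prod.fst ⁻¹' W, hU.inter (hW.preimage continuous_fst), ⟨hpU, hp₀⟩, F,
    hF.mono Set.inter_subset_left, fun p hp hpc => ?_⟩
  rw [hfg p hpc.2, hfF p hp hpc.1]

theorem mem_frameFunctions_of_locally {f : FrameBundle o → ℂ}
    (hf : ∀ p₀ : FrameBundle o, ∃ g : frameFunctions o, ∃ W : Set M, IsOpen W ∧ p₀.base ∈ W ∧
      ∀ p : FrameBundle o, p.base ∈ W → f p = g.1 p) : f ∈ frameFunctions o := by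
  intro p₀
  obtain ⟨g, W, hW, hp₀, hfg⟩ := hf p₀
  exact SmoothNear.congr_base (g.2 p₀) hW hp₀ hfg

/-- Multiplication by a cut-off function. -/
theorem cutoff_mul_mem {ρ : smoothFunctions d M} {D : Set M} (hρ : tsupport ρ.1 ⊆ D)
    {f : FrameBundle o → ℂ} (hf : ∀ p₀ : FrameBundle o, p₀.base ∈ D → SmoothNear f p₀) :
    (fun p => ρ.1 p.base * f p) ∈ frameFunctions o := by
  intro p₀
  by_cases hp₀ : p₀.base ∈ tsupport ρ.1
  · exact SmoothNear.mul (IsSmoothOnFrames.of_base ρ.2 p₀) (hf p₀ (hρ hp₀))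
  · refine ⟨Prod.fst ⁻¹' (tsupport ρ.1)ᶜ,
      (isClosed_tsupport ρ.1).isOpen_compl.preimage continuous_fst, hp₀, fun _ => 0,
      contMDiffOn_const, fun p _ hpc => ?_⟩
    have : ρ.1 p.base = 0 := image_eq_zero_of_notMem_tsupport hpc
    simp [this]

theorem cutoff_mul_mem_smoothFunctions {ρ : smoothFunctions d M} {D : Set M}
    (hD : IsOpen D) (hρ : tsupport ρ.1 ⊆ D)
    {f : M → ℂ} (hf : ContMDiffOn (𝓡 d) 𝓘(ℝ, ℂ) ∞ f D) :
    (fun x => ρ.1 x * f x) ∈ smoothFunctions d M := by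
  refine contMDiff_of_tsupport fun x hx => ?_
  have hxD : x ∈ D := hρ (closure_mono (fun y hy => left_ne_zero_of_mul hy) hx)
  exact (contMDiffOn_cmul ρ.2.contMDiffOn hf).contMDiffAt (hD.mem_nhds hxD)

theorem cutoff_smul_mem_endSections {ρ : smoothFunctions d M} {D : Set M}
    (hD : IsOpen D) (hρ : tsupport ρ.1 ⊆ D) {a : ∀ x : M, Module.End ℂ (E x)}
    (ha : ∀ (x₀ : M) (i j : Fin n), ContMDiffOn (𝓡 d) 𝓘(ℝ, ℂ) ∞
      (fun x => localCoord E x₀ x (a x (localFrame E x₀ x j)) i)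
      (D ∩ (trivializationAt (Fin n → ℂ) E x₀).baseSet)) :
    (fun x => ρ.1 x • a x) ∈ endSections (d := d) n E := by
  intro x₀ i j x hx
  by_cases hxρ : x ∈ tsupport ρ.1
  · have h1 := contMDiffOn_cmul ρ.2.contMDiffOn (ha x₀ i j)
    refine ContMDiffAt.contMDiffWithinAt ?_
    refine (h1.contMDiffAt ((hD.inter (trivializationAt (Fin n → ℂ) E x₀).open_baseSet).mem_nhds
      ⟨hρ hxρ, hx⟩)).congr_of_eventuallyEq (Filter.Eventually.of_forall fun y => ?_)
    simp
  · refine ContMDiffAt.contMDiffWithinAt ?_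
    refine (contMDiffAt_const (c := (0 : ℂ))).congr_of_eventuallyEq ?_
    filter_upwards [(isClosed_tsupport ρ.1).isOpen_compl.mem_nhds hxρ] with y hy
    have : ρ.1 y = 0 := image_eq_zero_of_notMem_tsupport hy
    simp [this]

variable [IsManifold (𝓡 d) ∞ M]

/-- Smoothness on frames is formulated in trivializations of E. The map `Φ` computes those
coordinates smoothly from the base chart and the change of frame, so `F ∘ Φ` is the local
expression. The set `O` is open among all matrices, although the matrices that occur are in SU(n).
-/
theorem FrameChart.exists_coord_rep {f : FrameBundle o → ℂ} {p₀ : FrameBundle o}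
    (hf : SmoothNear f p₀) (hp₀ : p₀.base ∈ S.dom) :
    ∃ O : Set (EuclideanSpace ℝ (Fin d) × (Fin n → Fin n → ℂ)), IsOpen O ∧ S.coord p₀ ∈ O ∧
      ∃ F : EuclideanSpace ℝ (Fin d) × (Fin n → Fin n → ℂ) → ℂ, ContDiffOn ℝ ∞ F O ∧
        ∀ p : FrameBundle o, p.base ∈ S.dom → S.coord p ∈ O → f p = F (S.coord p) := by
  obtain ⟨U, hU, hpU, F, hF, hfF⟩ := hf
  set κ := chartAt (EuclideanSpace ℝ (Fin d)) S.center
  set e := trivializationAt (Fin n → ℂ) E p₀.base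
  set D : Set (EuclideanSpace ℝ (Fin d)) := κ.target ∩ κ.symm ⁻¹' (S.dom ∩ e.baseSet)
  have hD : IsOpen D := κ.symm.isOpen_inter_preimage (S.isOpen_dom.inter e.open_baseSet)
  let Φ : EuclideanSpace ℝ (Fin d) × (Fin n → Fin n → ℂ) → M × (Fin n → Fin n → ℂ) := fun q =>
    (κ.symm q.1, fun j k => ∑ i, q.2 i j *
      (localCoord E p₀.base (κ.symm q.1) (S.frame (κ.symm q.1) i) : Fin n → ℂ) k)
  have h1 : ContMDiffOn 𝓘(ℝ, EuclideanSpace ℝ (Fin d) × (Fin n → Fin n → ℂ)) (𝓡 d) ∞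
      (fun q : EuclideanSpace ℝ (Fin d) × (Fin n → Fin n → ℂ) => κ.symm q.1) (D ×ˢ Set.univ) :=
    (contMDiffOn_chart_symm (I := 𝓡 d) (n := ∞) (x := S.center)).comp
      (contDiff_fst.contMDiff.contMDiffOn) fun _ hq => (Set.mem_prod.1 hq).1.1
  have hΦ : ContMDiffOn 𝓘(ℝ, EuclideanSpace ℝ (Fin d) × (Fin n → Fin n → ℂ))
      ((𝓡 d).prod 𝓘(ℝ, Fin n → Fin n → ℂ)) ∞ Φ (D ×ˢ Set.univ) := by
    refine h1.prodMk (contMDiffOn_pi_space.2 fun j => contMDiffOn_pi_space.2 fun k =>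
      contMDiffOn_finsetSum fun i _ => contMDiffOn_cmul ?_ ?_)
    · exact ((contDiff_apply_apply ℝ ℂ i j).comp contDiff_snd).contMDiff.contMDiffOn
    · exact (S.smooth p₀.base i k).comp h1 fun q hq => hq.1.2
  have hcoord : ∀ p : FrameBundle o, p.base ∈ S.dom → Φ (S.coord p) = frameCoord p₀.base p := by
    intro p hp
    have hsymm : κ.symm (κ p.base) = p.base := κ.left_inv (S.dom_subset hp)
    have h2 : Φ (S.coord p) = (κ.symm (κ p.base), fun j k =>
      ∑ i, (S.gauge p : Matrix (Fin n) (Fin n) ℂ) i j * (localCoord E p₀.base (κ.symm (κ p.base))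
        (S.frame (κ.symm (κ p.base)) i) : Fin n → ℂ) k) := rfl
    rw [h2, hsymm]
    refine Prod.ext rfl ?_
    funext j k
    change _ = (localCoord E p₀.base p.base (p.frame j) : Fin n → ℂ) k
    rw [← S.sum_gauge hp]
    simp [map_sum, Finset.sum_apply]
  refine ⟨(D ×ˢ Set.univ) ∩ Φ ⁻¹' U,
    hΦ.continuousOn.isOpen_inter_preimage (hD.prod isOpen_univ) hU, ⟨⟨⟨?_, ?_⟩, trivial⟩, ?_⟩,
    F ∘ Φ, ?_, fun p hp hpc => ?_⟩
  · exact κ.map_source (S.dom_subset hp₀)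
  · change κ.symm (κ p₀.base) ∈ S.dom ∩ e.baseSet
    rw [κ.left_inv (S.dom_subset hp₀)]
    exact ⟨hp₀, FiberBundle.mem_baseSet_trivializationAt' p₀.base⟩
  · rw [Set.mem_preimage, hcoord p₀ hp₀]
    exact hpU
  · exact (hF.comp (hΦ.mono Set.inter_subset_left) fun q hq => hq.2).contDiffOn
  · have h3 := hpc.2
    have h4 := hpc.1.1.2.2
    change κ.symm (κ p.base) ∈ e.baseSet at h4
    rw [κ.left_inv (S.dom_subset hp)] at h4
    rw [Set.mem_preimage, hcoord p hp] at h3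
    rw [Function.comp_apply, hcoord p hp]
    exact hfF p h4 h3

/-- The converse passage: `Ψ` recovers the chart coordinates, the entries of the change of frame
being the pairings ⟨s_i, e_j⟩, smooth in the coordinates of the frame. -/
theorem FrameChart.smoothNear_of_coord_rep {f : FrameBundle o → ℂ} {p₀ : FrameBundle o}
    (hp₀ : p₀.base ∈ S.dom) {O : Set (EuclideanSpace ℝ (Fin d) × (Fin n → Fin n → ℂ))}
    (hO : IsOpen O) (hp₀O : S.coord p₀ ∈ O)
    {F : EuclideanSpace ℝ (Fin d) × (Fin n → Fin n → ℂ) → ℂ} (hF : ContDiffOn ℝ ∞ F O)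
    (hfF : ∀ p : FrameBundle o, p.base ∈ S.dom → S.coord p ∈ O → f p = F (S.coord p)) :
    SmoothNear f p₀ := by
  set κ := chartAt (EuclideanSpace ℝ (Fin d)) S.center
  set e := trivializationAt (Fin n → ℂ) E p₀.base
  set D : Set M := S.dom ∩ e.baseSet
  have hD : IsOpen D := S.isOpen_dom.inter e.open_baseSet
  let Ψ : M × (Fin n → Fin n → ℂ) → EuclideanSpace ℝ (Fin d) × (Fin n → Fin n → ℂ) := fun q =>
    (κ q.1, fun i j => ∑ k : Fin n, ∑ l : Fin n,
      star ((localCoord E p₀.base q.1 (S.frame q.1 i) : Fin n → ℂ) k) *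
      (q.2 j l * h.form q.1 (localFrame E p₀.base q.1 k) (localFrame E p₀.base q.1 l)))
  have hfst : ContMDiffOn ((𝓡 d).prod 𝓘(ℝ, Fin n → Fin n → ℂ)) (𝓡 d) ∞
      (Prod.fst : M × (Fin n → Fin n → ℂ) → M) (D ×ˢ Set.univ) := contMDiffOn_fst
  have hΨ : ContMDiffOn ((𝓡 d).prod 𝓘(ℝ, Fin n → Fin n → ℂ))
      𝓘(ℝ, EuclideanSpace ℝ (Fin d) × (Fin n → Fin n → ℂ)) ∞ Ψ (D ×ˢ Set.univ) := by
    refine ContMDiffOn.prodMk_space ?_ (contMDiffOn_pi_space.2 fun i =>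
      contMDiffOn_pi_space.2 fun j => contMDiffOn_finsetSum fun k _ =>
      contMDiffOn_finsetSum fun l _ => contMDiffOn_cmul (contMDiffOn_cstar ?_)
        (contMDiffOn_cmul ?_ ?_))
    · exact (contMDiffOn_chart (I := 𝓡 d) (n := ∞) (x := S.center)).comp hfst
        fun q hq => S.dom_subset hq.1.1
    · exact (S.smooth p₀.base i k).comp hfst fun q hq => hq.1
    · exact ((contDiff_apply_apply ℝ ℂ j l).contMDiff.comp contMDiff_snd).contMDiffOn
    · exact (h.smooth p₀.base k l).comp hfst fun q hq => hq.1.2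
  have hcoord : ∀ p : FrameBundle o, p.base ∈ D → Ψ (frameCoord p₀.base p) = S.coord p := by
    intro p hp
    refine Prod.ext rfl ?_
    funext i j
    change _ = (S.gauge p : Matrix (Fin n) (Fin n) ℂ) i j
    rw [S.gauge_apply hp.1, form_eq_sum h p₀.base p.base hp.2]
    rfl
  refine ⟨(D ×ˢ Set.univ) ∩ Ψ ⁻¹' O,
    hΨ.continuousOn.isOpen_inter_preimage (hD.prod isOpen_univ) hO, ⟨⟨⟨hp₀, ?_⟩, trivial⟩, ?_⟩,
    F ∘ Ψ, ?_, fun p hp hpc => ?_⟩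
  · exact FiberBundle.mem_baseSet_trivializationAt' p₀.base
  · rw [Set.mem_preimage, hcoord p₀ ⟨hp₀, FiberBundle.mem_baseSet_trivializationAt' p₀.base⟩]
    exact hp₀O
  · exact hF.contMDiffOn.comp (hΨ.mono Set.inter_subset_left) fun q hq => hq.2
  · have h3 := hpc.2
    rw [Set.mem_preimage, hcoord p hpc.1.1] at h3
    rw [Function.comp_apply, hcoord p hpc.1.1]
    exact hfF p hpc.1.1.1 h3

/-- Pullback along the local section given by the frame of the chart, on which the change of frame
is constantly the unit matrix. -/
theorem FrameChart.contMDiffOn_point (f : frameFunctions o) {F : M → ℂ}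
    (hF : ∀ x (hx : x ∈ S.dom), F x = f.1 (S.point x hx)) :
    ContMDiffOn (𝓡 d) 𝓘(ℝ, ℂ) ∞ F S.dom := by
  intro x hx
  set κ := chartAt (EuclideanSpace ℝ (Fin d)) S.center
  obtain ⟨O, hO, hxO, G, hG, hfG⟩ := S.exists_coord_rep (f.2 (S.point x hx)) (p₀ := S.point x hx) hx
  let c : M → EuclideanSpace ℝ (Fin d) × (Fin n → Fin n → ℂ) :=
    fun y => (κ y, fun i j => (1 : Matrix (Fin n) (Fin n) ℂ) i j)
  have hc : ∀ y (hy : y ∈ S.dom), S.coord (S.point y hy) = c y := by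
    intro y hy
    rw [FrameChart.coord, S.gauge_point hy]
    rfl
  have hcs : ContMDiffOn (𝓡 d) 𝓘(ℝ, EuclideanSpace ℝ (Fin d) × (Fin n → Fin n → ℂ)) ∞ c S.dom :=
    ContMDiffOn.prodMk_space ((contMDiffOn_chart (I := 𝓡 d) (n := ∞) (x := S.center)).mono
      S.dom_subset) contMDiffOn_const
  have h1 : ContMDiffOn (𝓡 d) 𝓘(ℝ, ℂ) ∞ (G ∘ c) (S.dom ∩ c ⁻¹' O) :=
    hG.contMDiffOn.comp (hcs.mono Set.inter_subset_left) fun y hy => hy.2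
  have hopen := hcs.continuousOn.isOpen_inter_preimage S.isOpen_dom hO
  have hxm : x ∈ S.dom ∩ c ⁻¹' O := ⟨hx, by rw [Set.mem_preimage, ← hc x hx]; exact hxO⟩
  refine ContMDiffAt.contMDiffWithinAt ?_
  refine (h1.contMDiffAt (hopen.mem_nhds hxm)).congr_of_eventuallyEq ?_
  filter_upwards [hopen.mem_nhds hxm] with y hy
  rw [hF y hy.1, hfG (S.point y hy.1) hy.1 (by rw [hc y hy.1]; exact hy.2), hc y hy.1]
  rfl

end Coordinates

/-! ### Local charts with nested cut-off functions. -/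

section LocalCharts

variable {d n : ℕ} {M : Type*} [TopologicalSpace M] [ChartedSpace (EuclideanSpace ℝ (Fin d)) M]
  {E : M → Type*} [TopologicalSpace (TotalSpace (Fin n → ℂ) E)]
  [∀ x, AddCommGroup (E x)] [∀ x, Module ℂ (E x)] [∀ x, TopologicalSpace (E x)]
  [FiberBundle (Fin n → ℂ) E] [VectorBundle ℂ (Fin n → ℂ) E]
  {h : HermitianMetric E (d := d) (n := n)} {o : Orientation h}

variable (o) in
/-- A chart with a frame, together with nested cut-off functions. -/
structure LocalChart extends FrameChart o where
  ρ₀ : smoothFunctions d M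
  ρ₁ : smoothFunctions d M
  ρ₂ : smoothFunctions d M
  tsupport_subset : tsupport ρ₀.1 ⊆ dom
  -- That ρ₀ is one where ρ₁ does not vanish, and ρ₁ is one where ρ₂ does not vanish, is stated as
  -- an identity in the algebra, so that derivations can be applied to it.
  mul₁₀ : ρ₁ * ρ₀ = ρ₁
  mul₂₁ : ρ₂ * ρ₁ = ρ₂
  -- Hadamard's lemma integrates along segments and needs a smooth function on the whole model
  -- space.
  exists_extension : ∀ f : smoothFunctions d M, ∃ F : EuclideanSpace ℝ (Fin d) → ℂ,
    ContDiff ℝ ∞ F ∧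
      ∀ x, ρ₁.1 x ≠ 0 → F (chartAt (EuclideanSpace ℝ (Fin d)) center x) = f.1 x

section Existence

variable [VectorBundle ℝ (Fin n → ℂ) E] [ContMDiffVectorBundle ∞ (Fin n → ℂ) E (𝓡 d)]
  [IsManifold (𝓡 d) ∞ M] [T2Space M]

/-- A real smooth bump function as a complex function. -/
def bumpFunction {x₀ : M} (f : SmoothBumpFunction (𝓡 d) x₀) : smoothFunctions d M :=
  ⟨fun x => (f x : ℂ), Complex.ofRealCLM.contDiff.contMDiff.comp f.contMDiff⟩

theorem support_bumpFunction {x₀ : M} (f : SmoothBumpFunction (𝓡 d) x₀) :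
    support (bumpFunction f).1 = support f := by
  ext x
  simp [bumpFunction]

theorem bumpFunction_mul {x₀ : M} {f g : SmoothBumpFunction (𝓡 d) x₀}
    (hfg : tsupport g ⊆ {x | f x = 1}) : bumpFunction g * bumpFunction f = bumpFunction g := by
  ext x
  change ((g x : ℝ) : ℂ) * ((f x : ℝ) : ℂ) = ((g x : ℝ) : ℂ)
  by_cases hx : x ∈ tsupport g
  · rw [hfg hx]
    simp
  · rw [image_eq_zero_of_notMem_tsupport hx]
    simp

/-- Three bump functions, each equal to one on the closed support of the next. A function is
extended to the model space by cutting off its local expression with the largest bump, which is one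
wherever ρ₁ does not vanish. -/
theorem exists_localChart (hn : 1 ≤ n) (o : Orientation h) (x₀ : M) :
    ∃ S : LocalChart o, S.ρ₂.1 x₀ ≠ 0 := by
  obtain ⟨S, rfl, hS⟩ := exists_frameChart hn o x₀
  obtain ⟨f₀, -, hf₀⟩ := (SmoothBumpFunction.nhds_basis_tsupport (I := 𝓡 d) S.center).mem_iff.1
    (S.isOpen_dom.mem_nhds hS)
  obtain ⟨f₁, -, hf₁⟩ := (SmoothBumpFunction.nhds_basis_tsupport (I := 𝓡 d) S.center).mem_iff.1
    f₀.eventuallyEq_one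
  obtain ⟨f₂, -, hf₂⟩ := (SmoothBumpFunction.nhds_basis_tsupport (I := 𝓡 d) S.center).mem_iff.1
    f₁.eventuallyEq_one
  refine ⟨{ S with
    ρ₀ := bumpFunction f₀
    ρ₁ := bumpFunction f₁
    ρ₂ := bumpFunction f₂
    tsupport_subset := ?_
    mul₁₀ := bumpFunction_mul hf₁
    mul₂₁ := bumpFunction_mul hf₂
    exists_extension := fun f => ?_ }, ?_⟩
  · rw [tsupport, support_bumpFunction]
    exact hf₀
  · set κ := chartAt (EuclideanSpace ℝ (Fin d)) S.center
    have hball : Metric.closedBall (κ S.center) f₀.rOut ⊆ κ.target := by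
      have := f₀.closedBall_subset
      simpa [κ, mfld_simps] using this
    refine ⟨fun v => ((f₀.toContDiffBump v : ℝ) : ℂ) * f.1 (κ.symm v), ?_, fun x hx => ?_⟩
    · refine contMDiff_iff_contDiff.1 (contMDiff_of_tsupport fun v hv => ?_)
      have hv1 : v ∈ tsupport f₀.toContDiffBump := by
        refine closure_mono (fun y hy => ?_) hv
        have := left_ne_zero_of_mul (mem_support.1 hy)
        exact mem_support.2 fun h0 => this (by rw [h0]; rfl)
      rw [f₀.toContDiffBump.tsupport_eq] at hv1
      have hvt : v ∈ κ.target := hball hv1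
      have h1 : ContMDiffOn (𝓡 d) 𝓘(ℝ, ℂ) ∞ (f.1 ∘ κ.symm) κ.target :=
        f.2.comp_contMDiffOn (contMDiffOn_chart_symm (I := 𝓡 d) (n := ∞) (x := S.center))
      have h2 : ContMDiff (𝓡 d) 𝓘(ℝ, ℂ) ∞
          (fun v : EuclideanSpace ℝ (Fin d) => ((f₀.toContDiffBump v : ℝ) : ℂ)) :=
        (Complex.ofRealCLM.contDiff.comp f₀.toContDiffBump.contDiff).contMDiff
      exact (contMDiffOn_cmul h2.contMDiffOn h1).contMDiffAt (κ.open_target.mem_nhds hvt)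
    · have hx1 : f₁ x ≠ 0 := fun h0 => hx (by
        change ((f₁ x : ℝ) : ℂ) = 0
        rw [h0]
        rfl)
      have hxs : x ∈ κ.source := f₁.support_subset_source hx1
      have h1 : f₀ x = 1 := hf₁ (subset_tsupport f₁ hx1)
      have h2 : f₀.toContDiffBump (κ x) = 1 := by
        rw [← h1, f₀.eqOn_source hxs]
        simp [κ, mfld_simps]
      change ((f₀.toContDiffBump (κ x) : ℝ) : ℂ) * f.1 (κ.symm (κ x)) = _
      rw [h2, κ.left_inv hxs]
      simp
  · change ((f₂ S.center : ℝ) : ℂ) ≠ 0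
    simp

end Existence

variable (S : LocalChart o)

theorem LocalChart.mem_dom {x : M} (hx : S.ρ₀.1 x ≠ 0) : x ∈ S.dom :=
  S.tsupport_subset (subset_tsupport _ hx)

theorem LocalChart.ρ₀_eq_one {x : M} (hx : S.ρ₁.1 x ≠ 0) : S.ρ₀.1 x = 1 := by
  have h1 := congrFun (congrArg Subtype.val S.mul₁₀) x
  exact mul_left_cancel₀ hx (h1.trans (mul_one _).symm)

theorem LocalChart.ρ₁_eq_one {x : M} (hx : S.ρ₂.1 x ≠ 0) : S.ρ₁.1 x = 1 := by
  have h1 := congrFun (congrArg Subtype.val S.mul₂₁) x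
  exact mul_left_cancel₀ hx (h1.trans (mul_one _).symm)

theorem LocalChart.ρ₁_ne_zero {x : M} (hx : S.ρ₂.1 x ≠ 0) : S.ρ₁.1 x ≠ 0 := by
  rw [S.ρ₁_eq_one hx]
  exact one_ne_zero

theorem LocalChart.ρ₀_ne_zero {x : M} (hx : S.ρ₁.1 x ≠ 0) : S.ρ₀.1 x ≠ 0 := by
  rw [S.ρ₀_eq_one hx]
  exact one_ne_zero

theorem LocalChart.mem_dom₁ {x : M} (hx : S.ρ₁.1 x ≠ 0) : x ∈ S.dom :=
  S.mem_dom (S.ρ₀_ne_zero hx)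

theorem LocalChart.mem_dom₂ {x : M} (hx : S.ρ₂.1 x ≠ 0) : x ∈ S.dom :=
  S.mem_dom₁ (S.ρ₁_ne_zero hx)

theorem LocalChart.tsupport_subset₁ : tsupport S.ρ₁.1 ⊆ S.dom :=
  (closure_mono fun _ hx => S.ρ₀_ne_zero hx).trans S.tsupport_subset

variable (h) in
/-- The endomorphism with a given matrix in a frame. -/
def frameEnd (x : M) (s : Fin n → E x) (m : Matrix (Fin n) (Fin n) ℂ) : Module.End ℂ (E x) :=
  ∑ k, ∑ l, m k l • (h.form x (s l)).smulRight (s k)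

theorem frameEnd_apply (x : M) (s : Fin n → E x) (m : Matrix (Fin n) (Fin n) ℂ) (v : E x) :
    frameEnd h x s m v = ∑ k, ∑ l, m k l • h.form x (s l) v • s k := by
  simp [frameEnd, LinearMap.sum_apply]

theorem FrameChart.contMDiffOn_form_frame (S : FrameChart o) (x₀ : M) (l j : Fin n) :
    ContMDiffOn (𝓡 d) 𝓘(ℝ, ℂ) ∞
      (fun x => h.form x (S.frame x l) (localFrame E x₀ x j))
      (S.dom ∩ (trivializationAt (Fin n → ℂ) E x₀).baseSet) := by
  have h1 : ContMDiffOn (𝓡 d) 𝓘(ℝ, ℂ) ∞ (fun x => ∑ k : Fin n,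
      star ((localCoord E x₀ x (S.frame x l) : Fin n → ℂ) k) *
        h.form x (localFrame E x₀ x k) (localFrame E x₀ x j))
      (S.dom ∩ (trivializationAt (Fin n → ℂ) E x₀).baseSet) :=
    contMDiffOn_finsetSum fun k _ => contMDiffOn_cmul (contMDiffOn_cstar (S.smooth x₀ l k))
      ((h.smooth x₀ k j).mono Set.inter_subset_right)
  refine h1.congr fun x hx => ?_
  conv_lhs => rw [← sum_localCoord E x₀ x hx.2 (S.frame x l)]
  simp only [map_sum, LinearMap.sum_apply, form_smul_left]

open Classical in
/-- The endomorphism of the fibre at `x` with the matrix `b` in the frame of the chart. -/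
def LocalChart.endAt (b : matrixFunctions o) (x : M) : Module.End ℂ (E x) :=
  if hx : x ∈ S.dom then frameEnd h x (S.frame x) (evalMat (S.point x hx) b) else 0

theorem LocalChart.endAt_of_mem (b : matrixFunctions o) {x : M} (hx : x ∈ S.dom) :
    S.endAt b x = frameEnd h x (S.frame x) (evalMat (S.point x hx) b) := dif_pos hx

variable [IsManifold (𝓡 d) ∞ M]

open Classical in
/-- Restriction of a function on the frame bundle to the frame of the chart, cut off. -/
def LocalChart.descend : frameFunctions o →ₗ[ℂ] smoothFunctions d M where
  toFun f := ⟨fun x => S.ρ₀.1 x * if hx : x ∈ S.dom then f.1 (S.point x hx) else 0,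
    cutoff_mul_mem_smoothFunctions S.isOpen_dom S.tsupport_subset
      (S.contMDiffOn_point f fun x hx => dif_pos hx)⟩
  map_add' f g := by
    ext x
    change S.ρ₀.1 x * _ = S.ρ₀.1 x * _ + S.ρ₀.1 x * _
    split_ifs
    · exact mul_add _ _ _
    · simp
  map_smul' c f := by
    ext x
    change S.ρ₀.1 x * _ = c * (S.ρ₀.1 x * _)
    split_ifs
    · exact mul_left_comm _ _ _
    · simp

theorem LocalChart.descend_apply (f : frameFunctions o) {x : M} (hx : x ∈ S.dom) :
    (S.descend f).1 x = S.ρ₀.1 x * f.1 (S.point x hx) := by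
  change S.ρ₀.1 x * _ = _
  rw [dif_pos hx]

open Classical in
/-- The endomorphism field with the matrix `ρ₀ b` in the frame of the chart. -/
def LocalChart.descendEnd : matrixFunctions o →ₗ[ℂ] endSections (d := d) n E where
  toFun b := ⟨fun x => S.ρ₀.1 x • S.endAt b x,
    cutoff_smul_mem_endSections S.isOpen_dom S.tsupport_subset fun x₀ i j => by
      have h1 : ∀ k l, ContMDiffOn (𝓡 d) 𝓘(ℝ, ℂ) ∞
          (fun x => if hx : x ∈ S.dom then (b k l).1 (S.point x hx) else 0) S.dom := fun k l =>
        S.contMDiffOn_point (b k l) fun x hx => dif_pos hx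
      have h2 : ContMDiffOn (𝓡 d) 𝓘(ℝ, ℂ) ∞ (fun x => ∑ k, ∑ l,
          (if hx : x ∈ S.dom then (b k l).1 (S.point x hx) else 0) *
            (h.form x (S.frame x l) (localFrame E x₀ x j) *
              (localCoord E x₀ x (S.frame x k) : Fin n → ℂ) i))
          (S.dom ∩ (trivializationAt (Fin n → ℂ) E x₀).baseSet) :=
        contMDiffOn_finsetSum fun k _ => contMDiffOn_finsetSum fun l _ =>
          contMDiffOn_cmul ((h1 k l).mono Set.inter_subset_left)
            (contMDiffOn_cmul (S.contMDiffOn_form_frame x₀ l j) (S.smooth x₀ k i))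
      refine h2.congr fun x hx => ?_
      rw [S.endAt_of_mem b hx.1, frameEnd_apply]
      simp only [dif_pos hx.1, map_sum, map_smul, Finset.sum_apply]
      rfl⟩
  map_add' b b' := by
    ext1
    funext x
    change S.ρ₀.1 x • S.endAt (b + b') x = S.ρ₀.1 x • S.endAt b x + S.ρ₀.1 x • S.endAt b' x
    rw [← smul_add]
    congr 1
    by_cases hx : x ∈ S.dom
    · simp only [S.endAt_of_mem _ hx, map_add]
      ext v
      simp [frameEnd_apply, add_smul, Finset.sum_add_distrib]
    · simp [LocalChart.endAt, hx]
  map_smul' c b := by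
    ext1
    funext x
    change S.ρ₀.1 x • S.endAt (c • b) x = c • (S.ρ₀.1 x • S.endAt b x)
    rw [smul_comm]
    congr 1
    by_cases hx : x ∈ S.dom
    · simp only [S.endAt_of_mem _ hx, map_smul]
      ext v
      simp [frameEnd_apply, mul_smul, Finset.smul_sum]
    · simp [LocalChart.endAt, hx]

theorem LocalChart.matrixAt_point_descendEnd (b : matrixFunctions o) {x : M} (hx : x ∈ S.dom) :
    matrixAt (S.point x hx) (S.descendEnd b) = S.ρ₀.1 x • evalMat (S.point x hx) b := by
  ext i j
  change h.form x (S.frame x i) ((S.ρ₀.1 x • S.endAt b x) (S.frame x j)) =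
    S.ρ₀.1 x * evalMat (S.point x hx) b i j
  rw [S.endAt_of_mem b hx, LinearMap.smul_apply, form_smul_right, frameEnd_apply]
  simp [S.orthonormal x hx]

theorem LocalChart.matrixAt_descendEnd (b : matrixFunctions o) {p : FrameBundle o}
    (hp : p.base ∈ S.dom) : matrixAt p (S.descendEnd b) = S.ρ₀.1 p.base •
      ((S.gauge p : Matrix (Fin n) (Fin n) ℂ)ᴴ * evalMat (S.point p.base hp) b *
        (S.gauge p : Matrix (Fin n) (Fin n) ℂ)) := by
  rw [S.matrixAt_eq hp, S.matrixAt_point_descendEnd, Matrix.mul_smul, Matrix.smul_mul]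

theorem LocalChart.matrixAt_descendEnd_eq_zero (b : matrixFunctions o) {p : FrameBundle o}
    (hp : S.ρ₀.1 p.base = 0) : matrixAt p (S.descendEnd b) = 0 := by
  ext i j
  rw [matrixAt_apply]
  change h.form p.base (p.frame i) ((S.ρ₀.1 p.base • _ : Module.End ℂ (E p.base)) _) = 0
  rw [hp, zero_smul, LinearMap.zero_apply, map_zero]

end LocalCharts

/-! ### Restriction of derivations to subalgebras. -/

section Descent

variable {A B : Type*} [Ring A] [Algebra ℂ A] [Ring B] [Algebra ℂ B]

/-- A derivation that preserves a subalgebra restricts to it. -/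
theorem exists_restricted_derivation {φ : A →ₐ[ℂ] B} (hφ : Injective φ) (X : Der B) (T : A → A)
    (hT : ∀ a, X (φ a) = φ (T a)) : ∃ Y : Der A, ∀ a, Y a = T a := by
  refine ⟨⟨{ toFun := T
             map_add' := fun a b => hφ (by rw [← hT, map_add φ, map_add, hT, hT, map_add])
             map_smul' := fun c a => hφ (by rw [← hT, map_smul φ, map_smul, hT]; exact (map_smul φ c _).symm) }, ?_⟩,
    fun a => rfl⟩
  intro a b
  refine hφ ?_
  change φ (T (a * b)) = φ (T a * b + a * T b)
  rw [← hT, map_mul, Der.leibniz, hT, hT, map_add, map_mul, map_mul]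

end Descent

/-! ### Coordinate derivations, flat in the frame of a chart. -/

section CoordinateDerivations

variable {d n : ℕ} {M : Type*} [TopologicalSpace M] [ChartedSpace (EuclideanSpace ℝ (Fin d)) M]
  {E : M → Type*} [TopologicalSpace (TotalSpace (Fin n → ℂ) E)]
  [∀ x, AddCommGroup (E x)] [∀ x, Module ℂ (E x)] [∀ x, TopologicalSpace (E x)]
  [FiberBundle (Fin n → ℂ) E] [VectorBundle ℂ (Fin n → ℂ) E]
  {h : HermitianMetric E (d := d) (n := n)} {o : Orientation h}

/-- `pullbackFunction` as a homomorphism of algebras. -/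
def pullbackHom (o : Orientation h) : smoothFunctions d M →ₐ[ℂ] frameFunctions o where
  toFun := pullbackFunction o
  map_one' := rfl
  map_mul' _ _ := rfl
  map_zero' := rfl
  map_add' _ _ := rfl
  commutes' _ := rfl

theorem matrixAt_eq_sum {p : FrameBundle o} (g : Matrix.specialUnitaryGroup (Fin n) ℂ)
    (a : endSections (d := d) n E) (i j : Fin n) :
    (frameMatrix o a i j).1 (p.act g) = ∑ k, ∑ l, star ((g : Matrix (Fin n) (Fin n) ℂ) k i) *
      (g : Matrix (Fin n) (Fin n) ℂ) l j * (frameMatrix o a k l).1 p := by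
  have h1 := congrFun (congrFun (matrixAt_act p g a) i) j
  refine h1.trans ?_
  simp only [Matrix.mul_apply, Finset.sum_mul, Matrix.conjTranspose_apply]
  rw [Finset.sum_comm]
  refine Finset.sum_congr rfl fun k _ => Finset.sum_congr rfl fun l _ => ?_
  change _ * (frameMatrix o a k l).1 p * _ = _
  ring

section Transport

variable (S : FrameChart o)

open Classical in
/-- The frame over `x` with the same components as `p` in the frame of the chart. -/
def FrameChart.transport (p : FrameBundle o) (x : M) : FrameBundle o :=
  if hx : x ∈ S.dom then (S.point x hx).act (S.gauge p) else p

theorem FrameChart.transport_of_mem (p : FrameBundle o) {x : M} (hx : x ∈ S.dom) :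
    S.transport p x = (S.point x hx).act (S.gauge p) := dif_pos hx

/-- The motion of a frame in the direction of the `j`-th coordinate. -/
def FrameChart.shift (j : Fin d) (p : FrameBundle o) (t : ℝ) : FrameBundle o :=
  S.transport p ((chartAt (EuclideanSpace ℝ (Fin d)) S.center).symm
    (chartAt (EuclideanSpace ℝ (Fin d)) S.center p.base + t • EuclideanSpace.basisFun (Fin d) ℝ j))

theorem FrameChart.shift_zero (j : Fin d) {p : FrameBundle o} (hp : p.base ∈ S.dom) :
    S.shift j p 0 = p := by
  rw [FrameChart.shift, zero_smul, add_zero,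
    (chartAt (EuclideanSpace ℝ (Fin d)) S.center).left_inv (S.dom_subset hp),
    S.transport_of_mem p hp, S.act_gauge]

theorem FrameChart.eventually_shift (j : Fin d) {p : FrameBundle o} (hp : p.base ∈ S.dom) :
    ∀ᶠ t in nhds (0 : ℝ), ∃ x : M, ∃ hx : x ∈ S.dom,
      (chartAt (EuclideanSpace ℝ (Fin d)) S.center).symm
        (chartAt (EuclideanSpace ℝ (Fin d)) S.center p.base +
          t • EuclideanSpace.basisFun (Fin d) ℝ j) = x ∧
      chartAt (EuclideanSpace ℝ (Fin d)) S.center x =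
        chartAt (EuclideanSpace ℝ (Fin d)) S.center p.base +
          t • EuclideanSpace.basisFun (Fin d) ℝ j ∧
      S.shift j p t = (S.point x hx).act (S.gauge p) := by
  set κ := chartAt (EuclideanSpace ℝ (Fin d)) S.center
  have hD : IsOpen (κ.target ∩ κ.symm ⁻¹' S.dom) := κ.symm.isOpen_inter_preimage S.isOpen_dom
  have hc : ContinuousAt (fun t : ℝ => κ p.base + t • EuclideanSpace.basisFun (Fin d) ℝ j) 0 := by
    fun_prop
  have hm : κ p.base + (0 : ℝ) • EuclideanSpace.basisFun (Fin d) ℝ j ∈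
      κ.target ∩ κ.symm ⁻¹' S.dom := by
    rw [zero_smul, add_zero]
    refine ⟨κ.map_source (S.dom_subset hp), ?_⟩
    rw [Set.mem_preimage, κ.left_inv (S.dom_subset hp)]
    exact hp
  filter_upwards [hc.eventually_mem (hD.mem_nhds hm)] with t ht
  exact ⟨_, ht.2, rfl, κ.right_inv ht.1, S.transport_of_mem p ht.2⟩

theorem FrameChart.coord_point_act {x : M} (hx : x ∈ S.dom)
    (g : Matrix.specialUnitaryGroup (Fin n) ℂ) : S.coord ((S.point x hx).act g) =
      (chartAt (EuclideanSpace ℝ (Fin d)) S.center x,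
        fun i j => (g : Matrix (Fin n) (Fin n) ℂ) i j) := by
  rw [FrameChart.coord, S.gauge_point_act]
  rfl

/-- In the coordinates of the chart the shift is a straight line in the base direction with constant
matrix part. -/
theorem FrameChart.hasDerivAt_shift (j : Fin d) {f : FrameBundle o → ℂ}
    {O : Set (EuclideanSpace ℝ (Fin d) × (Fin n → Fin n → ℂ))} (hO : IsOpen O)
    {F : EuclideanSpace ℝ (Fin d) × (Fin n → Fin n → ℂ) → ℂ} (hF : ContDiffOn ℝ ∞ F O)
    (hfF : ∀ p : FrameBundle o, p.base ∈ S.dom → S.coord p ∈ O → f p = F (S.coord p))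
    {p : FrameBundle o} (hp : p.base ∈ S.dom) (hpO : S.coord p ∈ O) :
    HasDerivAt (fun t => f (S.shift j p t))
      (fderiv ℝ F (S.coord p) (EuclideanSpace.basisFun (Fin d) ℝ j, 0)) 0 := by
  set κ := chartAt (EuclideanSpace ℝ (Fin d)) S.center
  let w : EuclideanSpace ℝ (Fin d) × (Fin n → Fin n → ℂ) :=
    (EuclideanSpace.basisFun (Fin d) ℝ j, 0)
  have hline : HasDerivAt (fun t : ℝ => S.coord p + t • w) w 0 := by
    simpa using ((hasDerivAt_id (0 : ℝ)).smul_const w).const_add (S.coord p)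
  have h0 : S.coord p + (0 : ℝ) • w = S.coord p := by rw [zero_smul, add_zero]
  have hFd : HasFDerivAt F (fderiv ℝ F (S.coord p)) (S.coord p + (0 : ℝ) • w) := by
    rw [h0]
    exact ((hF.contDiffAt (hO.mem_nhds hpO)).differentiableAt (by simp)).hasFDerivAt
  have h1 : HasDerivAt (fun t : ℝ => F (S.coord p + t • w)) (fderiv ℝ F (S.coord p) w) 0 :=
    hFd.comp_hasDerivAt (0 : ℝ) hline
  refine h1.congr_of_eventuallyEq ?_
  have hev : ∀ᶠ t in nhds (0 : ℝ), S.coord p + t • w ∈ O :=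
    hline.continuousAt.eventually_mem (by rw [h0]; exact hO.mem_nhds hpO)
  filter_upwards [hev, S.eventually_shift j hp]
  rintro t ht ⟨x, hx, -, hκ, hs⟩
  have hc : S.coord (S.shift j p t) = S.coord p + t • w := by
    rw [hs, S.coord_point_act, hκ]
    simp [FrameChart.coord, w]
  rw [hfF _ (by rw [hs]; exact hx) (by rw [hc]; exact ht), hc]

variable [IsManifold (𝓡 d) ∞ M]

theorem FrameChart.differentiableAt_shift (j : Fin d) (f : frameFunctions o) {p : FrameBundle o}
    (hp : p.base ∈ S.dom) : DifferentiableAt ℝ (fun t => f.1 (S.shift j p t)) 0 := by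
  obtain ⟨O, hO, hpO, F, hF, hfF⟩ := S.exists_coord_rep (f.2 p) hp
  exact (S.hasDerivAt_shift j hO hF hfF hp hpO).differentiableAt

theorem FrameChart.smoothNear_deriv_shift (j : Fin d) (f : frameFunctions o) {p : FrameBundle o}
    (hp : p.base ∈ S.dom) : SmoothNear (fun q => deriv (fun t => f.1 (S.shift j q t)) 0) p := by
  obtain ⟨O, hO, hpO, F, hF, hfF⟩ := S.exists_coord_rep (f.2 p) hp
  refine S.smoothNear_of_coord_rep hp hO hpO
    (F := fun q => fderiv ℝ F q (EuclideanSpace.basisFun (Fin d) ℝ j, 0)) ?_ fun q hq hqO =>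
      (S.hasDerivAt_shift j hO hF hfF hq hqO).deriv
  exact (hF.fderiv_of_isOpen hO (m := ∞) (by simp)).clm_apply contDiffOn_const

end Transport

variable (S : LocalChart o) [IsManifold (𝓡 d) ∞ M]

/-- The derivative in the direction of the `j`-th coordinate, horizontal with respect to the frame
of the chart and cut off. -/
def LocalChart.coordDer (j : Fin d) : Der (frameFunctions o) :=
  ⟨{ toFun := fun f => ⟨fun p => S.ρ₁.1 p.base * deriv (fun t => f.1 (S.shift j p t)) 0,
      cutoff_mul_mem S.tsupport_subset₁ fun _ hp => S.smoothNear_deriv_shift j f hp⟩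
     map_add' := fun f g => by
       ext p
       change S.ρ₁.1 p.base * deriv (fun t => f.1 (S.shift j p t) + g.1 (S.shift j p t)) 0 =
         S.ρ₁.1 p.base * _ + S.ρ₁.1 p.base * _
       by_cases hp : S.ρ₁.1 p.base = 0
       · simp [hp]
       · rw [deriv_fun_add (S.differentiableAt_shift j f (S.mem_dom₁ hp))
           (S.differentiableAt_shift j g (S.mem_dom₁ hp)), mul_add]
     map_smul' := fun c f => by
       ext p
       change S.ρ₁.1 p.base * deriv (fun t => c * f.1 (S.shift j p t)) 0 =
         c * (S.ρ₁.1 p.base * _)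
       by_cases hp : S.ρ₁.1 p.base = 0
       · simp [hp]
       · rw [deriv_const_mul c (S.differentiableAt_shift j f (S.mem_dom₁ hp)), mul_left_comm] }, by
    intro f g
    ext p
    change S.ρ₁.1 p.base * deriv (fun t => f.1 (S.shift j p t) * g.1 (S.shift j p t)) 0 =
      S.ρ₁.1 p.base * deriv (fun t => f.1 (S.shift j p t)) 0 * g.1 p +
        f.1 p * (S.ρ₁.1 p.base * deriv (fun t => g.1 (S.shift j p t)) 0)
    by_cases hp : S.ρ₁.1 p.base = 0
    · simp [hp]
    · rw [deriv_fun_mul (S.differentiableAt_shift j f (S.mem_dom₁ hp))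
        (S.differentiableAt_shift j g (S.mem_dom₁ hp)), S.shift_zero j (S.mem_dom₁ hp)]
      ring⟩

theorem LocalChart.coordDer_apply (j : Fin d) (f : frameFunctions o) (p : FrameBundle o) :
    (S.coordDer j f).1 p = S.ρ₁.1 p.base * deriv (fun t => f.1 (S.shift j p t)) 0 := rfl

/-- The derivative sees only the values along the shift, which keeps the change of frame constant.
Quantities that depend on this change of frame may thus be treated as constants. -/
theorem LocalChart.coordDer_congr (j : Fin d) {f g : frameFunctions o} {p q : FrameBundle o}
    (hpq : p.base = q.base)
    (hfg : ∀ x (hx : x ∈ S.dom), f.1 ((S.point x hx).act (S.gauge p)) =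
      g.1 ((S.point x hx).act (S.gauge q))) :
    (S.coordDer j f).1 p = (S.coordDer j g).1 q := by
  rw [S.coordDer_apply, S.coordDer_apply, hpq]
  by_cases hp : S.ρ₁.1 p.base = 0
  · rw [← hpq, hp, zero_mul, zero_mul]
  · congr 1
    have hp' := S.mem_dom₁ hp
    have hq' : q.base ∈ S.dom := hpq ▸ hp'
    refine Filter.EventuallyEq.deriv_eq ?_
    filter_upwards [S.eventually_shift j hp', S.eventually_shift j hq']
    rintro t ⟨x, hx, hx1, -, hx2⟩ ⟨y, hy, hy1, -, hy2⟩
    rw [hpq, hy1] at hx1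
    subst hx1
    rw [hx2, hy2, hfg]

/-- The change of frame `g` stays fixed along the shift, so the derivative of a matrix at `p` is the
conjugate by the fixed `g` of the derivative in the frame of the chart. This is the transformation
law of an endomorphism field, namely the one with that derivative as matrix in the frame of the
chart. -/
theorem LocalChart.coordDer_frameMatrix (j : Fin d) (a : endSections (d := d) n E) :
    (liftDer (S.coordDer j) : Der (matrixFunctions o)) (frameMatrix o a) =
      frameMatrix o (S.descendEnd ((liftDer (S.coordDer j) : Der (matrixFunctions o))
        (frameMatrix o a))) := by
  refine matrixFunctions_ext fun p => ?_
  rw [evalMat_frameMatrix]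
  by_cases hp : S.ρ₁.1 p.base = 0
  · have hz : ∀ q : FrameBundle o, q.base = p.base → evalMat q
        ((liftDer (S.coordDer j) : Der (matrixFunctions o)) (frameMatrix o a)) = 0 := by
      intro q hq
      ext i k
      change S.ρ₁.1 q.base * _ = 0
      rw [hq, hp, zero_mul]
    rw [hz p rfl]
    by_cases hp0 : S.ρ₀.1 p.base = 0
    · rw [S.matrixAt_descendEnd_eq_zero _ hp0]
    · rw [S.matrixAt_descendEnd _ (S.mem_dom hp0), hz (S.point p.base (S.mem_dom hp0)) rfl, mul_zero, zero_mul, smul_zero]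
  · have hpd := S.mem_dom₁ hp
    rw [S.matrixAt_descendEnd _ hpd, S.ρ₀_eq_one hp, one_smul]
    ext i k
    rw [Matrix.mul_apply]
    simp only [Matrix.mul_apply, Finset.sum_mul, Matrix.conjTranspose_apply, evalMat_apply,
      liftDer_apply]
    rw [Finset.sum_comm]
    have h2 : (S.coordDer j (frameMatrix o a i k)).1 p =
        (S.coordDer j (∑ l, ∑ m, (star ((S.gauge p : Matrix (Fin n) (Fin n) ℂ) l i) *
          (S.gauge p : Matrix (Fin n) (Fin n) ℂ) m k) • frameMatrix o a l m)).1
          (S.point p.base hpd) := by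
      refine S.coordDer_congr j rfl fun x hx => ?_
      rw [S.gauge_point, FrameBundle.act_one, matrixAt_eq_sum]
      change _ = evalFun (S.point x hx) _
      simp only [map_sum, map_smul, smul_eq_mul]
      rfl
    rw [h2]
    refine (evalFun_apply _ _).symm.trans ?_
    simp only [map_sum, map_smul, smul_eq_mul]
    refine Finset.sum_congr rfl fun l _ => Finset.sum_congr rfl fun m _ => ?_
    rw [evalFun_apply]
    ring

end CoordinateDerivations

/-! ### Coordinate functions and matrix units over a chart. -/

section LocalGeneration

variable {d n : ℕ} {M : Type*} [TopologicalSpace M] [ChartedSpace (EuclideanSpace ℝ (Fin d)) M]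
  {E : M → Type*} [TopologicalSpace (TotalSpace (Fin n → ℂ) E)]
  [∀ x, AddCommGroup (E x)] [∀ x, Module ℂ (E x)] [∀ x, TopologicalSpace (E x)]
  [FiberBundle (Fin n → ℂ) E] [VectorBundle ℂ (Fin n → ℂ) E]
  {h : HermitianMetric E (d := d) (n := n)} {o : Orientation h}

section Frames

variable [VectorBundle ℝ (Fin n → ℂ) E] [ContMDiffVectorBundle ∞ (Fin n → ℂ) E (𝓡 d)]

theorem exists_frame (hn : 1 ≤ n) (o : Orientation h) (x : M) : ∃ p : FrameBundle o, p.base = x := by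
  obtain ⟨S, -, hS⟩ := exists_frameChart hn o x
  exact ⟨S.point x hS, rfl⟩

theorem endSections_ext_matrixAt (hn : 1 ≤ n) (o : Orientation h) {a b : endSections (d := d) n E}
    (hab : ∀ p : FrameBundle o, matrixAt p a = matrixAt p b) : a = b := by
  choose P hP using exists_frame hn o
  exact endSections_ext a b P hP fun x => hab _

theorem frameMatrixHom_injective (hn : 1 ≤ n) (o : Orientation h) :
    Injective (frameMatrixHom o) := fun _ _ hab =>
  endSections_ext_matrixAt hn o fun p => congrArg (evalMat p) hab

theorem pullbackHom_injective (hn : 1 ≤ n) (o : Orientation h) : Injective (pullbackHom o) := by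
  intro f g hfg
  ext x
  obtain ⟨p, rfl⟩ := exists_frame hn o x
  exact congrFun (congrArg Subtype.val hfg) p

end Frames

theorem FrameChart.sum_smul_conj_single (S : FrameChart o) (p : FrameBundle o) (m : Matrix (Fin n) (Fin n) ℂ) :
    ∑ k, ∑ l, m k l • ((S.gauge p : Matrix (Fin n) (Fin n) ℂ)ᴴ *
      Matrix.single k l 1 * (S.gauge p : Matrix (Fin n) (Fin n) ℂ)) =
      (S.gauge p : Matrix (Fin n) (Fin n) ℂ)ᴴ * m * (S.gauge p : Matrix (Fin n) (Fin n) ℂ) := by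
  conv_rhs => rw [Matrix.matrix_eq_sum_single m]
  simp only [Finset.mul_sum, Finset.sum_mul]
  refine Finset.sum_congr rfl fun k _ => Finset.sum_congr rfl fun l _ => ?_
  rw [← Matrix.smul_mul, ← Matrix.mul_smul, Matrix.smul_single, smul_eq_mul, mul_one]

variable [IsManifold (𝓡 d) ∞ M] (S : LocalChart o)

/-- The coordinate functions, cut off. -/
def LocalChart.coordFun (j : Fin d) : smoothFunctions d M :=
  ⟨fun x => S.ρ₀.1 x * ((chartAt (EuclideanSpace ℝ (Fin d)) S.center x j : ℝ) : ℂ),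
    cutoff_mul_mem_smoothFunctions S.isOpen_dom S.tsupport_subset (by
      have h1 : ContDiff ℝ ∞ (fun v : EuclideanSpace ℝ (Fin d) => ((v j : ℝ) : ℂ)) :=
        Complex.ofRealCLM.contDiff.comp (EuclideanSpace.proj (𝕜 := ℝ) j).contDiff
      exact h1.contMDiff.comp_contMDiffOn
        ((contMDiffOn_chart (I := 𝓡 d) (n := ∞) (x := S.center)).mono S.dom_subset))⟩

theorem LocalChart.coordDer_pullback_apply (j : Fin d) {f : smoothFunctions d M}
    {F : EuclideanSpace ℝ (Fin d) → ℂ} (hF : ContDiff ℝ ∞ F)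
    (hfF : ∀ x, S.ρ₁.1 x ≠ 0 → F (chartAt (EuclideanSpace ℝ (Fin d)) S.center x) = f.1 x)
    (p : FrameBundle o) :
    (S.coordDer j (pullbackHom o f)).1 p = S.ρ₁.1 p.base *
      fderiv ℝ F (chartAt (EuclideanSpace ℝ (Fin d)) S.center p.base)
        (EuclideanSpace.basisFun (Fin d) ℝ j) := by
  set κ := chartAt (EuclideanSpace ℝ (Fin d)) S.center
  rw [S.coordDer_apply]
  by_cases hp : S.ρ₁.1 p.base = 0
  · rw [hp, zero_mul, zero_mul]
  · congr 1
    have hpd := S.mem_dom₁ hp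
    have hline : HasDerivAt (fun t : ℝ => κ p.base + t • EuclideanSpace.basisFun (Fin d) ℝ j)
        (EuclideanSpace.basisFun (Fin d) ℝ j) 0 := by
      simpa using ((hasDerivAt_id (0 : ℝ)).smul_const
        (EuclideanSpace.basisFun (Fin d) ℝ j)).const_add (κ p.base)
    have hFd : HasFDerivAt F (fderiv ℝ F (κ p.base))
        (κ p.base + (0 : ℝ) • EuclideanSpace.basisFun (Fin d) ℝ j) := by
      rw [zero_smul, add_zero]
      exact (hF.differentiable (by simp) _).hasFDerivAt
    refine ((hFd.comp_hasDerivAt (0 : ℝ) hline).congr_of_eventuallyEq ?_).deriv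
    have hopen : IsOpen (κ.target ∩ κ.symm ⁻¹' (support S.ρ₁.1)) :=
      κ.symm.isOpen_inter_preimage (S.ρ₁.2.continuous.isOpen_support)
    have hev : ∀ᶠ t in nhds (0 : ℝ), κ p.base + t • EuclideanSpace.basisFun (Fin d) ℝ j ∈
        κ.target ∩ κ.symm ⁻¹' (support S.ρ₁.1) := by
      refine hline.continuousAt.eventually_mem (hopen.mem_nhds ?_)
      rw [zero_smul, add_zero]
      refine ⟨κ.map_source (S.dom_subset hpd), ?_⟩
      rw [Set.mem_preimage, κ.left_inv (S.dom_subset hpd)]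
      exact hp
    filter_upwards [hev, S.eventually_shift j hpd]
    rintro t ht ⟨x, hx, hx1, hx2, hx3⟩
    rw [hx3]
    have h1 : S.ρ₁.1 x ≠ 0 := hx1 ▸ ht.2
    change f.1 x = _
    rw [← hfF x h1, hx2]
    rfl

/-- A point derivation of the functions on the base in coordinates. -/
theorem LocalChart.pointDerivation_eq_sum {p : FrameBundle o} (hp : S.ρ₂.1 p.base ≠ 0)
    (δ : smoothFunctions d M →ₗ[ℂ] ℂ)
    (hδ : ∀ f g, δ (f * g) = δ f * g.1 p.base + f.1 p.base * δ g) (f : smoothFunctions d M) :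
    δ f = ∑ j, δ (S.coordFun j) * (S.coordDer j (pullbackHom o f)).1 p := by
  obtain ⟨F, hF, hfF⟩ := S.exists_extension f
  have h1 := DerivationCalculus.pointDerivation_eq_sum (R := smoothFunctions d M) p.base δ hδ
    (chartAt (EuclideanSpace ℝ (Fin d)) S.center) S.ρ₁ (S.ρ₁_eq_one hp)
    (fun H hH => cutoff_mul_mem_smoothFunctions S.isOpen_dom S.tsupport_subset₁
      (hH.contMDiff.comp_contMDiffOn
        ((contMDiffOn_chart (I := 𝓡 d) (n := ∞) (x := S.center)).mono S.dom_subset)))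
    (EuclideanSpace.basisFun (Fin d) ℝ).toBasis S.coordFun
    (fun j x hx => by
      change S.ρ₀.1 x * _ = _
      rw [S.ρ₀_eq_one hx, one_mul]
      simp [Module.Basis.coord_apply])
    f F hF fun x hx => (hfF x hx).symm
  rw [h1]
  refine Finset.sum_congr rfl fun j _ => ?_
  rw [S.coordDer_pullback_apply j hF hfF, S.ρ₁_eq_one hp, one_mul,
    OrthonormalBasis.coe_toBasis]

/-- The matrix units in the frame of the chart, cut off. -/
def LocalChart.unit (k l : Fin n) : endSections (d := d) n E :=
  S.descendEnd (constMatrix (Matrix.single k l 1))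

theorem LocalChart.matrixAt_unit (k l : Fin n) {p : FrameBundle o} (hp : p.base ∈ S.dom) :
    matrixAt p (S.unit k l) = S.ρ₀.1 p.base • ((S.gauge p : Matrix (Fin n) (Fin n) ℂ)ᴴ *
      Matrix.single k l 1 * (S.gauge p : Matrix (Fin n) (Fin n) ℂ)) := by
  rw [LocalChart.unit, S.matrixAt_descendEnd _ hp, evalMat_constMatrix]

theorem gauge_mul_conjTranspose (g : Matrix.specialUnitaryGroup (Fin n) ℂ) :
    (g : Matrix (Fin n) (Fin n) ℂ) * (g : Matrix (Fin n) (Fin n) ℂ)ᴴ = 1 :=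
  Matrix.mem_unitaryGroup_iff.1 (Matrix.mem_specialUnitaryGroup_iff.1 g.2).1

theorem gauge_conjTranspose_mul (g : Matrix.specialUnitaryGroup (Fin n) ℂ) :
    (g : Matrix (Fin n) (Fin n) ℂ)ᴴ * (g : Matrix (Fin n) (Fin n) ℂ) = 1 :=
  Matrix.mem_unitaryGroup_iff'.1 (Matrix.mem_specialUnitaryGroup_iff.1 g.2).1

theorem conj_mul_conj (g : Matrix.specialUnitaryGroup (Fin n) ℂ) (a b : Matrix (Fin n) (Fin n) ℂ) :
    (g : Matrix (Fin n) (Fin n) ℂ)ᴴ * a * g * ((g : Matrix (Fin n) (Fin n) ℂ)ᴴ * b * g) =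
      (g : Matrix (Fin n) (Fin n) ℂ)ᴴ * (a * b) * g := by
  calc _ = (g : Matrix (Fin n) (Fin n) ℂ)ᴴ * a * (g * (g : Matrix (Fin n) (Fin n) ℂ)ᴴ) * b * g := by
        simp only [Matrix.mul_assoc]
    _ = _ := by rw [gauge_mul_conjTranspose, Matrix.mul_one]; simp only [Matrix.mul_assoc]

/-- The field is constant, up to the cut-off, in the frame of the chart; its matrix there is `m`
conjugated back by the change of frame. -/
theorem LocalChart.exists_matrixAt_eq {p : FrameBundle o} (hp : S.ρ₀.1 p.base = 1)
    (m : Matrix (Fin n) (Fin n) ℂ) : ∃ a : endSections (d := d) n E, matrixAt p a = m := by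
  have hpd : p.base ∈ S.dom := S.mem_dom (by rw [hp]; exact one_ne_zero)
  refine ⟨S.descendEnd (constMatrix ((S.gauge p : Matrix (Fin n) (Fin n) ℂ) * m *
    (S.gauge p : Matrix (Fin n) (Fin n) ℂ)ᴴ)), ?_⟩
  rw [S.matrixAt_descendEnd _ hpd, evalMat_constMatrix, hp, one_smul]
  calc _ = ((S.gauge p : Matrix (Fin n) (Fin n) ℂ)ᴴ * (S.gauge p : Matrix (Fin n) (Fin n) ℂ)) * m *
        ((S.gauge p : Matrix (Fin n) (Fin n) ℂ)ᴴ * (S.gauge p : Matrix (Fin n) (Fin n) ℂ)) := by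
        simp only [Matrix.mul_assoc]
    _ = m := by rw [gauge_conjTranspose_mul, Matrix.one_mul, Matrix.mul_one]

section Units

variable [VectorBundle ℝ (Fin n → ℂ) E] [ContMDiffVectorBundle ∞ (Fin n → ℂ) E (𝓡 d)]

/-- Each unit carries one cut-off, a product carries two. Where ρ₀ is one these are honest matrix
units. -/
theorem LocalChart.unit_mul_unit (hn : 1 ≤ n) (k l i j : Fin n) :
    S.unit k l * S.unit i j = if l = i then scalarSection n E S.ρ₀ * S.unit k j else 0 := by
  refine endSections_ext_matrixAt hn o fun p => ?_
  by_cases hp : S.ρ₀.1 p.base = 0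
  · have h0 : ∀ k l, matrixAt p (S.unit k l) = 0 := fun k l =>
      S.matrixAt_descendEnd_eq_zero _ hp
    split_ifs
    · simp only [map_mul, h0, mul_zero]
    · rw [map_mul, h0, zero_mul, map_zero]
  · have hpd := S.mem_dom hp
    rw [map_mul, S.matrixAt_unit _ _ hpd, S.matrixAt_unit _ _ hpd, Matrix.smul_mul,
      Matrix.mul_smul, conj_mul_conj]
    split_ifs with hli
    · subst hli
      rw [map_mul, matrixAt_scalarSection, S.matrixAt_unit _ _ hpd, Matrix.smul_mul,
        Matrix.one_mul, Matrix.single_mul_single_same, mul_one]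
    · have h0 : (Matrix.single k l 1 * Matrix.single i j 1 : Matrix (Fin n) (Fin n) ℂ) = 0 := by
        simp [hli]
      rw [h0, Matrix.mul_zero, Matrix.zero_mul, smul_zero,
        smul_zero, map_zero]

/-- The coefficients of an endomorphism field in the frame of the chart, cut off. -/
def LocalChart.coeff (a : endSections (d := d) n E) (k l : Fin n) : smoothFunctions d M :=
  S.ρ₁ * S.descend (frameMatrix o a k l)

/-- An expansion valid as an identity of global sections, so that a derivation can be applied to it.
It reads off the matrix in the frame of the chart, with ρ₁ hiding the region where the units are cut
off. -/
theorem LocalChart.scalarSection_mul_eq_sum (hn : 1 ≤ n) (a : endSections (d := d) n E) :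
    scalarSection n E S.ρ₁ * a = ∑ k, ∑ l, scalarSection n E (S.coeff a k l) * S.unit k l := by
  refine endSections_ext_matrixAt hn o fun p => ?_
  rw [map_mul, matrixAt_scalarSection, map_sum]
  simp only [map_sum, map_mul, matrixAt_scalarSection, Matrix.smul_mul, Matrix.one_mul]
  by_cases hp : S.ρ₁.1 p.base = 0
  · rw [hp, zero_smul]
    refine (Finset.sum_eq_zero fun k _ => Finset.sum_eq_zero fun l _ => ?_).symm
    change (S.ρ₁.1 p.base * _) • _ = _
    rw [hp, zero_mul, zero_smul]
  · have hpd := S.mem_dom₁ hp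
    rw [S.matrixAt_eq hpd a, ← S.toFrameChart.sum_smul_conj_single p (matrixAt (S.point p.base hpd) a),
      Finset.smul_sum]
    refine Finset.sum_congr rfl fun k _ => ?_
    rw [Finset.smul_sum]
    refine Finset.sum_congr rfl fun l _ => ?_
    rw [S.matrixAt_unit _ _ hpd]
    change _ = (S.ρ₁.1 p.base * (S.descend (frameMatrix o a k l)).1 p.base) • _
    rw [S.descend_apply _ hpd, S.ρ₀_eq_one hp, one_mul, one_smul, mul_smul]
    rfl

end Units

end LocalGeneration

/-! ### Structure of derivations at a frame. -/

section PointwiseDerivations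

variable {d n : ℕ} {M : Type*} [TopologicalSpace M] [ChartedSpace (EuclideanSpace ℝ (Fin d)) M]
  {E : M → Type*} [TopologicalSpace (TotalSpace (Fin n → ℂ) E)]
  [∀ x, AddCommGroup (E x)] [∀ x, Module ℂ (E x)] [∀ x, TopologicalSpace (E x)]
  [FiberBundle (Fin n → ℂ) E] [VectorBundle ℂ (Fin n → ℂ) E]
  {h : HermitianMetric E (d := d) (n := n)} {o : Orientation h}

/-- Derivations of the endomorphism fields with values in the matrices, along the evaluation in a
frame. -/
def IsDerivationAt (p : FrameBundle o)
    (D : endSections (d := d) n E →ₗ[ℂ] Matrix (Fin n) (Fin n) ℂ) : Prop :=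
  ∀ a b, D (a * b) = D a * matrixAt p b + matrixAt p a * D b

variable {p : FrameBundle o} {D : endSections (d := d) n E →ₗ[ℂ] Matrix (Fin n) (Fin n) ℂ}

/-- Applying `D` to ρ'ρ = ρ', with ρ equal to one at the base point, cancels `D` of ρ' and leaves
ρ'(p) times `D` of ρ. -/
theorem IsDerivationAt.cutoff_eq_zero (hD : IsDerivationAt p D) {ρ ρ' : smoothFunctions d M}
    (hρ : ρ' * ρ = ρ') (hp : ρ'.1 p.base ≠ 0) : D (scalarSection n E ρ) = 0 := by
  have h1 : ρ.1 p.base = 1 := mul_left_cancel₀ hp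
    ((congrFun (congrArg Subtype.val hρ) p.base).trans (mul_one _).symm)
  have h2 := hD (scalarSection n E ρ') (scalarSection n E ρ)
  rw [← map_mul, hρ, matrixAt_scalarSection, matrixAt_scalarSection, h1, one_smul, mul_one,
    smul_mul_assoc, one_mul] at h2
  exact (smul_eq_zero.1 (left_eq_add.1 h2)).resolve_left hp

variable [IsManifold (𝓡 d) ∞ M] (S : LocalChart o)

/-- Multiples of the identity are central, so their image commutes with all matrices at `p` of
endomorphism fields, and these are all matrices. -/
theorem IsDerivationAt.scalarSection_eq (hn : 1 ≤ n) (hD : IsDerivationAt p D)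
    (hp : S.ρ₀.1 p.base = 1) (f : smoothFunctions d M) :
    D (scalarSection n E f) = D (scalarSection n E f) ⟨0, hn⟩ ⟨0, hn⟩ • 1 := by
  have hc : D (scalarSection n E f) ∈ Subalgebra.center ℂ (Matrix (Fin n) (Fin n) ℂ) := by
    refine Subalgebra.mem_center_iff.2 fun m => ?_
    obtain ⟨a, rfl⟩ := S.exists_matrixAt_eq hp m
    have h1 : scalarSection n E f * a = a * scalarSection n E f :=
      (Subalgebra.mem_center_iff.1 (centralSection n E f).2 a).symm
    have h2 := congrArg D h1
    rw [hD, hD, matrixAt_scalarSection, smul_mul_assoc, one_mul, mul_smul_comm, mul_one,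
      add_comm] at h2
    exact (add_left_cancel h2).symm
  have h1 := exists_scalar_of_mem_center hn hc
  refine h1.trans ?_
  ext i j
  simp [Matrix.diagonal_apply, Matrix.one_apply]

/-- The action of a derivation along the evaluation on the multiples of the identity. -/
def scalarDerivation (hn : 1 ≤ n)
    (D : endSections (d := d) n E →ₗ[ℂ] Matrix (Fin n) (Fin n) ℂ) :
    smoothFunctions d M →ₗ[ℂ] ℂ where
  toFun f := D (scalarSection n E f) ⟨0, hn⟩ ⟨0, hn⟩
  map_add' f g := by rw [map_add, map_add, Matrix.add_apply]
  map_smul' c f := by rw [map_smul, map_smul, Matrix.smul_apply, RingHom.id_apply]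

theorem scalarDerivation_apply (hn : 1 ≤ n) (f : smoothFunctions d M) :
    scalarDerivation hn D f = D (scalarSection n E f) ⟨0, hn⟩ ⟨0, hn⟩ := rfl

theorem IsDerivationAt.scalarDerivation_mul (hn : 1 ≤ n) (hD : IsDerivationAt p D)
    (f g : smoothFunctions d M) : scalarDerivation hn D (f * g) =
      scalarDerivation hn D f * g.1 p.base + f.1 p.base * scalarDerivation hn D g := by
  simp only [scalarDerivation_apply]
  rw [map_mul, hD, matrixAt_scalarSection, matrixAt_scalarSection, mul_smul_comm, mul_one,
    smul_mul_assoc, one_mul, Matrix.add_apply, Matrix.smul_apply, Matrix.smul_apply, smul_eq_mul,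
    smul_eq_mul, mul_comm (g.1 p.base)]

variable [VectorBundle ℝ (Fin n → ℂ) E] [ContMDiffVectorBundle ∞ (Fin n → ℂ) E (𝓡 d)]

/-- `D` annihilates the cut-off ρ₁, whose value at the base point is one; so `a` may be replaced by
ρ₁ a and expanded in matrix units. -/
theorem IsDerivationAt.apply_eq_sum_coeff (hn : 1 ≤ n) (hD : IsDerivationAt p D)
    (hp : S.ρ₂.1 p.base ≠ 0) (a : endSections (d := d) n E) :
    D a = ∑ k, ∑ l, (scalarDerivation hn D (S.coeff a k l) • matrixAt p (S.unit k l) +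
      (S.coeff a k l).1 p.base • D (S.unit k l)) := by
  have hp1 := S.ρ₁_eq_one hp
  have hp0 := S.ρ₀_eq_one (S.ρ₁_ne_zero hp)
  have h1 := congrArg D (S.scalarSection_mul_eq_sum hn a)
  rw [hD, hD.cutoff_eq_zero S.mul₂₁ hp, zero_mul, zero_add, matrixAt_scalarSection, hp1,
    one_smul, one_mul] at h1
  rw [h1]
  simp only [map_sum]
  refine Finset.sum_congr rfl fun k _ => Finset.sum_congr rfl fun l _ => ?_
  rw [hD, hD.scalarSection_eq S hn hp0, matrixAt_scalarSection, smul_mul_assoc, one_mul,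
    smul_mul_assoc, one_mul]
  rfl

theorem isDerivationAt_comp (p : FrameBundle o) (T : endSections (d := d) n E →ₗ[ℂ] matrixFunctions o)
    (hT : ∀ a b, T (a * b) = T a * frameMatrix o b + frameMatrix o a * T b) :
    IsDerivationAt p ((evalMat p).toLinearMap ∘ₗ T) := by
  intro a b
  simp only [LinearMap.comp_apply, AlgHom.toLinearMap_apply, hT, map_add, map_mul]
  rfl

/-- The derivative of endomorphism fields in the direction of a coordinate, as a linear map into the
matrix valued functions. -/
def alongDer (X : Der (matrixFunctions o)) :
    endSections (d := d) n E →ₗ[ℂ] matrixFunctions o :=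
  X.1 ∘ₗ (frameMatrixHom o).toLinearMap

theorem alongDer_apply (X : Der (matrixFunctions o)) (a : endSections (d := d) n E) :
    alongDer X a = X (frameMatrix o a) := rfl

theorem alongDer_mul (X : Der (matrixFunctions o)) (a b : endSections (d := d) n E) :
    alongDer X (a * b) = alongDer X a * frameMatrix o b + frameMatrix o a * alongDer X b := by
  simp only [alongDer_apply, ← frameMatrixHom_apply]
  rw [map_mul, Der.leibniz]

theorem isDerivationAt_alongDer (p : FrameBundle o) (X : Der (matrixFunctions o)) :
    IsDerivationAt p ((evalMat p).toLinearMap ∘ₗ alongDer X) :=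
  isDerivationAt_comp p _ (alongDer_mul X)

theorem LocalChart.liftDer_coordDer_scalarSection (j : Fin d) (f : smoothFunctions d M) :
    (liftDer (S.coordDer j) : Der (matrixFunctions o)) (frameMatrix o (scalarSection n E f)) =
      Matrix.scalar (Fin n) (S.coordDer j (pullbackHom o f)) := by
  rw [frameMatrix_scalarSection]
  ext1 i k
  rw [liftDer_apply]
  by_cases hik : i = k
  · subst hik
    simp
    rfl
  · simp [Matrix.diagonal_apply_ne _ hik]

/-- Along the shift the matrix of a unit is ρ₀ times a constant matrix, and the derivative of ρ₀ is
zero where ρ₁ does not vanish. -/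
theorem LocalChart.coordDer_unit (hn : 1 ≤ n) (j : Fin d) (k l : Fin n)
    (hp : S.ρ₂.1 p.base ≠ 0) : evalMat p
      ((liftDer (S.coordDer j) : Der (matrixFunctions o)) (frameMatrix o (S.unit k l))) = 0 := by
  have h0 := (isDerivationAt_alongDer p (liftDer (S.coordDer j))).cutoff_eq_zero S.mul₁₀
    (S.ρ₁_ne_zero hp)
  rw [LinearMap.comp_apply, alongDer_apply, S.liftDer_coordDer_scalarSection] at h0
  have h1 : (S.coordDer j (pullbackHom o S.ρ₀)).1 p = 0 := by
    have := congrFun (congrFun h0 ⟨0, hn⟩) ⟨0, hn⟩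
    rw [AlgHom.toLinearMap_apply, evalMat_scalar] at this
    simpa using this
  ext i m
  rw [evalMat_apply, liftDer_apply]
  have h2 : (S.coordDer j (frameMatrix o (S.unit k l) i m)).1 p =
      (S.coordDer j (((S.gauge p : Matrix (Fin n) (Fin n) ℂ)ᴴ * Matrix.single k l 1 *
        (S.gauge p : Matrix (Fin n) (Fin n) ℂ) : Matrix (Fin n) (Fin n) ℂ) i m •
          pullbackHom o S.ρ₀)).1 p := by
    refine S.coordDer_congr j rfl fun x hx => ?_
    have h3 := congrFun (congrFun (S.matrixAt_unit k l
      (p := (S.point x hx).act (S.gauge p)) hx) i) m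
    rw [S.gauge_point_act] at h3
    refine h3.trans ?_
    rw [Matrix.smul_apply, smul_eq_mul, mul_comm]
    rfl
  rw [h2, map_smul]
  change _ * (S.coordDer j (pullbackHom o S.ρ₀)).1 p = 0
  rw [h1, mul_zero]

/-- The matrix that generates the inner part of a derivation. -/
def LocalChart.innerPart (hn : 1 ≤ n) (p : FrameBundle o)
    (D : endSections (d := d) n E →ₗ[ℂ] Matrix (Fin n) (Fin n) ℂ) : Matrix (Fin n) (Fin n) ℂ :=
  ∑ i, D (S.unit i ⟨0, hn⟩) * matrixAt p (S.unit ⟨0, hn⟩ i)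

/-- The structure of derivations at a frame. The inner part is read off from the values on matrix
units, which the coordinate derivations annihilate; on coefficient functions `D` is a point
derivation of the base, hence a combination of partial derivatives. Since the units and the
functions generate locally, this accounts for all of `D`. -/
theorem IsDerivationAt.apply_eq (hn : 1 ≤ n) (hD : IsDerivationAt p D)
    (hp : S.ρ₂.1 p.base ≠ 0) (a : endSections (d := d) n E) :
    D a = ∑ j, scalarDerivation hn D (S.coordFun j) •
        evalMat p ((liftDer (S.coordDer j) : Der (matrixFunctions o)) (frameMatrix o a)) +
      (S.innerPart hn p D * matrixAt p a - matrixAt p a * S.innerPart hn p D) := by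
  have hp0 := S.ρ₀_eq_one (S.ρ₁_ne_zero hp)
  have hpd := S.mem_dom₂ hp
  have hunit : ∀ k l, D (S.unit k l) = S.innerPart hn p D * matrixAt p (S.unit k l) -
      matrixAt p (S.unit k l) * S.innerPart hn p D := by
    refine matrixUnit_inner (fun k l => matrixAt p (S.unit k l)) (fun k l => D (S.unit k l))
      ⟨0, hn⟩ ?_ ?_ ?_
    · intro k l i j
      rw [← map_mul, S.unit_mul_unit hn]
      split_ifs
      · rw [map_mul, matrixAt_scalarSection, hp0, one_smul, one_mul]
      · rw [map_zero]
    · have h1 := S.toFrameChart.sum_smul_conj_single p (1 : Matrix (Fin n) (Fin n) ℂ)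
      rw [Matrix.mul_one, gauge_conjTranspose_mul] at h1
      rw [← h1]
      refine Finset.sum_congr rfl fun i _ => ?_
      rw [Finset.sum_eq_single i]
      · rw [S.matrixAt_unit _ _ hpd, hp0, one_smul, Matrix.one_apply_eq, one_smul]
      · intro j _ hj
        rw [Matrix.one_apply_ne hj.symm, zero_smul]
      · intro h2
        exact absurd (Finset.mem_univ _) h2
    · intro k l i j
      rw [← hD, S.unit_mul_unit hn]
      split_ifs
      · rw [hD, hD.cutoff_eq_zero S.mul₁₀ (S.ρ₁_ne_zero hp), zero_mul, zero_add,
          matrixAt_scalarSection, hp0, one_smul, one_mul]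
      · rw [map_zero]
  have hcoeff : ∑ k, ∑ l, (S.coeff a k l).1 p.base • matrixAt p (S.unit k l) = matrixAt p a := by
    have h1 := congrArg (matrixAt p) (S.scalarSection_mul_eq_sum hn a)
    simp only [map_sum, map_mul, matrixAt_scalarSection, smul_mul_assoc, one_mul,
      S.ρ₁_eq_one hp, one_smul] at h1
    exact h1.symm
  have hcoord : ∀ j, evalMat p ((liftDer (S.coordDer j) : Der (matrixFunctions o))
      (frameMatrix o a)) = ∑ k, ∑ l,
        (S.coordDer j (pullbackHom o (S.coeff a k l))).1 p • matrixAt p (S.unit k l) := by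
    intro j
    have h1 := (isDerivationAt_alongDer p (liftDer (S.coordDer j))).apply_eq_sum_coeff S hn hp a
    rw [LinearMap.comp_apply, alongDer_apply, AlgHom.toLinearMap_apply] at h1
    rw [h1]
    refine Finset.sum_congr rfl fun k _ => Finset.sum_congr rfl fun l _ => ?_
    rw [LinearMap.comp_apply, alongDer_apply, AlgHom.toLinearMap_apply, S.coordDer_unit hn j k l hp,
      smul_zero, add_zero, scalarDerivation_apply, LinearMap.comp_apply, alongDer_apply,
      S.liftDer_coordDer_scalarSection, AlgHom.toLinearMap_apply, evalMat_scalar]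
    simp
  rw [hD.apply_eq_sum_coeff S hn hp a]
  simp only [Finset.sum_add_distrib]
  congr 1
  · have h1 : ∀ k l, scalarDerivation hn D (S.coeff a k l) • matrixAt p (S.unit k l) =
        ∑ j, scalarDerivation hn D (S.coordFun j) •
          (S.coordDer j (pullbackHom o (S.coeff a k l))).1 p • matrixAt p (S.unit k l) := by
      intro k l
      rw [S.pointDerivation_eq_sum hp (scalarDerivation hn D) (hD.scalarDerivation_mul hn),
        Finset.sum_smul]
      exact Finset.sum_congr rfl fun j _ => mul_smul _ _ _
    simp only [hcoord, h1, Finset.smul_sum]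
    exact (Finset.sum_congr rfl fun k _ => Finset.sum_comm).trans Finset.sum_comm
  · rw [← hcoeff]
    simp only [hunit, Finset.mul_sum, Finset.sum_mul, smul_sub, Finset.sum_sub_distrib,
      mul_smul_comm, smul_mul_assoc]

end PointwiseDerivations

/-! ### Local generators of the derivations, with smooth coefficients. -/

section LocalGenerators

variable {d n : ℕ} {M : Type*} [TopologicalSpace M] [ChartedSpace (EuclideanSpace ℝ (Fin d)) M]
  {E : M → Type*} [TopologicalSpace (TotalSpace (Fin n → ℂ) E)]
  [∀ x, AddCommGroup (E x)] [∀ x, Module ℂ (E x)] [∀ x, TopologicalSpace (E x)]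
  [FiberBundle (Fin n → ℂ) E] [VectorBundle ℂ (Fin n → ℂ) E]
  {h : HermitianMetric E (d := d) (n := n)} {o : Orientation h}

/-- For the trace form, the conjugated units with indices `l, k` are dual to those with indices `k,
l`. -/
theorem FrameChart.sum_trace_smul_conj_single (S : FrameChart o) (p : FrameBundle o)
    (m : Matrix (Fin n) (Fin n) ℂ) :
    ∑ k, ∑ l, (m * ((S.gauge p : Matrix (Fin n) (Fin n) ℂ)ᴴ * Matrix.single l k 1 *
        (S.gauge p : Matrix (Fin n) (Fin n) ℂ))).trace •
      ((S.gauge p : Matrix (Fin n) (Fin n) ℂ)ᴴ * Matrix.single k l 1 *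
        (S.gauge p : Matrix (Fin n) (Fin n) ℂ)) = m := by
  set g : Matrix (Fin n) (Fin n) ℂ := (S.gauge p : Matrix (Fin n) (Fin n) ℂ) with hg
  have h1 := S.sum_smul_conj_single p (g * m * gᴴ)
  rw [← hg] at h1
  have h2 : gᴴ * (g * m * gᴴ) * g = m := by
    calc _ = (gᴴ * g) * m * (gᴴ * g) := by simp only [Matrix.mul_assoc]
      _ = m := by rw [gauge_conjTranspose_mul, Matrix.one_mul, Matrix.mul_one]
  rw [h2] at h1
  conv_rhs => rw [← h1]
  refine Finset.sum_congr rfl fun k _ => Finset.sum_congr rfl fun l _ => ?_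
  congr 1
  have h3 : (m * (gᴴ * Matrix.single l k 1 * g)).trace =
      (g * m * gᴴ * Matrix.single l k 1).trace := by
    rw [← Matrix.mul_assoc, Matrix.trace_mul_comm]
    simp only [Matrix.mul_assoc]
  rw [h3, Matrix.trace_mul_single]
  simp

variable [IsManifold (𝓡 d) ∞ M] (S : LocalChart o)
  [VectorBundle ℝ (Fin n → ℂ) E] [ContMDiffVectorBundle ∞ (Fin n → ℂ) E (𝓡 d)]

theorem LocalChart.exists_endDer (hn : 1 ≤ n) (j : Fin d) :
    ∃ Y : Der (endSections (d := d) n E), ∀ a, frameMatrix o (Y a) =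
      (liftDer (S.coordDer j) : Der (matrixFunctions o)) (frameMatrix o a) := by
  obtain ⟨Y, hY⟩ := exists_restricted_derivation (frameMatrixHom_injective hn o)
    (liftDer (S.coordDer j)) _ (S.coordDer_frameMatrix j)
  exact ⟨Y, fun a => by rw [hY, ← S.coordDer_frameMatrix]⟩

/-- The derivation of the endomorphism fields in the direction of the `j`-th coordinate. -/
def LocalChart.endDer (hn : 1 ≤ n) (j : Fin d) : Der (endSections (d := d) n E) :=
  (S.exists_endDer hn j).choose

theorem LocalChart.frameMatrix_endDer (hn : 1 ≤ n) (j : Fin d) (a : endSections (d := d) n E) :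
    frameMatrix o (S.endDer hn j a) =
      (liftDer (S.coordDer j) : Der (matrixFunctions o)) (frameMatrix o a) :=
  (S.exists_endDer hn j).choose_spec a

/-- Local generators of the derivations of the endomorphism fields. -/
def LocalChart.der (hn : 1 ≤ n) : Fin d ⊕ Fin n × Fin n → Der (endSections (d := d) n E) :=
  Sum.elim (S.endDer hn) fun kl => adDer (S.unit kl.1 kl.2)

/-- Lifts of the local generators to the matrix valued functions. -/
def LocalChart.liftedDer : Fin d ⊕ Fin n × Fin n → Der (matrixFunctions o) :=
  Sum.elim (fun j => liftDer (S.coordDer j)) fun kl => adDer (frameMatrix o (S.unit kl.1 kl.2))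

theorem LocalChart.liftedDer_frameMatrix (hn : 1 ≤ n) (I : Fin d ⊕ Fin n × Fin n)
    (a : endSections (d := d) n E) :
    S.liftedDer I (frameMatrix o a) = frameMatrix o (S.der hn I a) := by
  rcases I with j | kl
  · exact (S.frameMatrix_endDer hn j a).symm
  · change adDer _ _ = frameMatrix o (adDer _ _)
    rw [adDer_apply, adDer_apply]
    simp only [← frameMatrixHom_apply, map_sub, map_mul]

/-- The coefficients of a derivation along the embedding of the endomorphism fields with respect to
the local generators. -/
def LocalChart.coef (hn : 1 ≤ n) (T : endSections (d := d) n E →ₗ[ℂ] matrixFunctions o) :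
    Fin d ⊕ Fin n × Fin n → frameFunctions o :=
  Sum.elim (fun j => T (scalarSection n E (S.coordFun j)) ⟨0, hn⟩ ⟨0, hn⟩) fun kl =>
    ((∑ i, T (S.unit i ⟨0, hn⟩) * frameMatrix o (S.unit ⟨0, hn⟩ i)) *
      frameMatrix o (S.unit kl.2 kl.1)).trace

/-- The pointwise structure theorem with coefficients that are smooth functions on the frame bundle,
defined by `T` and the chart alone. This uniformity in `p` is what later gives smoothness of the
forms constructed pointwise. -/
theorem LocalChart.evalMat_eq_sum (hn : 1 ≤ n)
    {T : endSections (d := d) n E →ₗ[ℂ] matrixFunctions o}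
    (hT : ∀ a b, T (a * b) = T a * frameMatrix o b + frameMatrix o a * T b) {p : FrameBundle o}
    (hp : S.ρ₂.1 p.base ≠ 0) (a : endSections (d := d) n E) :
    evalMat p (T a) = ∑ I, (S.coef hn T I).1 p • matrixAt p (S.der hn I a) := by
  have h0 := (isDerivationAt_comp p T hT).apply_eq S hn hp a
  have hp0 := S.ρ₀_eq_one (S.ρ₁_ne_zero hp)
  have hunit : ∀ k l, matrixAt p (S.unit k l) = (S.gauge p : Matrix (Fin n) (Fin n) ℂ)ᴴ *
      Matrix.single k l 1 * (S.gauge p : Matrix (Fin n) (Fin n) ℂ) := fun k l => by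
    rw [S.matrixAt_unit k l (S.mem_dom₂ hp), hp0, one_smul]
  refine h0.trans ?_
  rw [Fintype.sum_sum_type, Fintype.sum_prod_type]
  congr 1
  · refine Finset.sum_congr rfl fun j _ => ?_
    rw [← S.frameMatrix_endDer hn]
    rfl
  · set m := S.innerPart hn p ((evalMat p).toLinearMap ∘ₗ T) with hm
    have h1 : ∀ k l, (S.coef hn T (Sum.inr (k, l))).1 p = (m * matrixAt p (S.unit l k)).trace := by
      intro k l
      change (Matrix.trace (n := Fin n) _ : frameFunctions o).1 p = _
      rw [evalFun_trace, map_mul, map_sum]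
      simp only [map_mul]
      rfl
    have h2 : m = ∑ k, ∑ l, (S.coef hn T (Sum.inr (k, l))).1 p • matrixAt p (S.unit k l) := by
      simp only [h1, hunit]
      exact (S.sum_trace_smul_conj_single p m).symm
    have h3 : ∀ k l, matrixAt p (S.der hn (Sum.inr (k, l)) a) =
        matrixAt p (S.unit k l) * matrixAt p a - matrixAt p a * matrixAt p (S.unit k l) := by
      intro k l
      rw [← map_mul, ← map_mul, ← map_sub]
      rfl
    conv_lhs => rw [h2]
    simp only [h3, Finset.sum_mul, Finset.mul_sum, smul_sub, Finset.sum_sub_distrib,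
      smul_mul_assoc, mul_smul_comm]

end LocalGenerators

/-! ### Derivations and determinants. -/

section DeterminantDerivation

variable {R : Type*} [CommRing R] [Algebra ℂ R] {ε : R →ₐ[ℂ] ℂ} {δ : R →ₗ[ℂ] ℂ}

/-- If δ multiplies every factor by `c`, the Leibniz rule multiplies a product of `k` factors by `k
c`. A determinant is a sum of products of `n` factors, hence the weight `n c` below. -/
theorem apply_prod_of_eigenvector (hδ : ∀ a b, δ (a * b) = δ a * ε b + ε a * δ b) (c : ℂ)
    {ι : Type*} (s : Finset ι) (f : ι → R) (hf : ∀ i ∈ s, δ (f i) = c * ε (f i)) :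
    δ (∏ i ∈ s, f i) = s.card * c * ε (∏ i ∈ s, f i) := by
  classical
  induction s using Finset.induction_on with
  | empty =>
    have h := hδ 1 1
    rw [mul_one, map_one ε, mul_one, one_mul] at h
    simpa using left_eq_add.1 h
  | insert a s ha ih =>
    rw [Finset.prod_insert ha, hδ, hf a (Finset.mem_insert_self _ _),
      ih fun i hi => hf i (Finset.mem_insert_of_mem hi), Finset.card_insert_of_notMem ha, map_mul]
    push_cast
    ring

theorem apply_det_of_eigenvector (hδ : ∀ a b, δ (a * b) = δ a * ε b + ε a * δ b) (c : ℂ) {n : ℕ}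
    (w : Matrix (Fin n) (Fin n) R) (hw : ∀ i j, δ (w i j) = c * ε (w i j)) :
    δ w.det = n * c * ε w.det := by
  rw [Matrix.det_apply, map_sum, map_sum, Finset.mul_sum]
  refine Finset.sum_congr rfl fun σ _ => ?_
  rw [Units.smul_def, map_zsmul, map_zsmul,
    apply_prod_of_eigenvector hδ c Finset.univ _ fun i _ => hw _ _, Finset.card_univ,
    Fintype.card_fin, mul_smul_comm]

end DeterminantDerivation

/-! ### Matrix entries of endomorphism fields control the coordinates of P. -/

section VerticalDerivations

variable {d n : ℕ} {M : Type*} [TopologicalSpace M] [ChartedSpace (EuclideanSpace ℝ (Fin d)) M]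
  {E : M → Type*} [TopologicalSpace (TotalSpace (Fin n → ℂ) E)]
  [∀ x, AddCommGroup (E x)] [∀ x, Module ℂ (E x)] [∀ x, TopologicalSpace (E x)]
  [FiberBundle (Fin n → ℂ) E] [VectorBundle ℂ (Fin n → ℂ) E]
  {h : HermitianMetric E (d := d) (n := n)} {o : Orientation h}

/-- The real and imaginary parts of a matrix entry are complex combinations of the entry and its
conjugate, on which complex linear derivations can be computed. -/
theorem realLinear_eq_sum {d n : ℕ}
    (l : EuclideanSpace ℝ (Fin d) × (Fin n → Fin n → ℂ) →ₗ[ℝ] ℝ)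
    (v : EuclideanSpace ℝ (Fin d) × (Fin n → Fin n → ℂ)) :
    ((l v : ℝ) : ℂ) = ∑ j, (l (EuclideanSpace.basisFun (Fin d) ℝ j, 0) : ℂ) * ((v.1 j : ℝ) : ℂ) +
      ∑ i, ∑ j, ((l (0, Pi.single i (Pi.single j 1)) : ℂ) * (2⁻¹ * (v.2 i j + star (v.2 i j))) +
        (l (0, Pi.single i (Pi.single j Complex.I)) : ℂ) *
          ((2 * Complex.I)⁻¹ * (v.2 i j - star (v.2 i j)))) := by
  have h1 : v = ∑ j, v.1 j • ((EuclideanSpace.basisFun (Fin d) ℝ j, 0) :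
      EuclideanSpace ℝ (Fin d) × (Fin n → Fin n → ℂ)) +
      ∑ i, ∑ j, ((v.2 i j).re • ((0, Pi.single i (Pi.single j 1)) :
        EuclideanSpace ℝ (Fin d) × (Fin n → Fin n → ℂ)) +
      (v.2 i j).im • ((0, Pi.single i (Pi.single j Complex.I)) :
        EuclideanSpace ℝ (Fin d) × (Fin n → Fin n → ℂ))) := by
    refine Prod.ext ?_ ?_
    · simp only [Prod.fst_add, Prod.fst_sum, Prod.smul_fst, smul_zero, add_zero,
        Finset.sum_const_zero]
      exact ((EuclideanSpace.basisFun (Fin d) ℝ).sum_repr v.1).symm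
    · simp only [Prod.snd_add, Prod.snd_sum, Prod.smul_snd, smul_zero,
        Finset.sum_const_zero, zero_add]
      funext a b
      simp only [Finset.sum_apply, Pi.add_apply, Pi.smul_apply]
      rw [Finset.sum_eq_single a, Finset.sum_eq_single b]
      · simp [Complex.re_add_im]
      · intro j _ hj
        simp [hj.symm]
      · simp
      · intro i _ hi
        simp [hi.symm]
      · simp
  conv_lhs => rw [h1]
  simp only [map_add, map_sum, map_smul, smul_eq_mul]
  push_cast
  congr 1
  · exact Finset.sum_congr rfl fun j _ => mul_comm _ _
  · refine Finset.sum_congr rfl fun i _ => Finset.sum_congr rfl fun j _ => ?_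
    have h2 : 2⁻¹ * (v.2 i j + star (v.2 i j)) = ((v.2 i j).re : ℂ) := by
      rw [Complex.re_eq_add_conj, div_eq_inv_mul]
      rfl
    have h3 : (2 * Complex.I)⁻¹ * (v.2 i j - star (v.2 i j)) = ((v.2 i j).im : ℂ) := by
      rw [Complex.im_eq_sub_conj, div_eq_inv_mul]
      rfl
    rw [h2, h3, mul_comm, mul_comm ((v.2 i j).im : ℂ)]

variable [IsManifold (𝓡 d) ∞ M]

theorem FrameChart.smoothNear_comp_coord (S : FrameChart o)
    {H : EuclideanSpace ℝ (Fin d) × (Fin n → Fin n → ℂ) → ℂ} (hH : ContDiff ℝ ∞ H)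
    {p : FrameBundle o} (hp : p.base ∈ S.dom) : SmoothNear (fun q => H (S.coord q)) p :=
  S.smoothNear_of_coord_rep hp isOpen_univ (Set.mem_univ _) hH.contDiffOn fun _ _ _ => rfl

/-- A function of the coordinates on the frame bundle, cut off. -/
def LocalChart.coordMul (S : LocalChart o)
    (H : EuclideanSpace ℝ (Fin d) × (Fin n → Fin n → ℂ) → ℂ) (hH : ContDiff ℝ ∞ H) :
    frameFunctions o :=
  ⟨fun p => S.ρ₀.1 p.base * H (S.coord p),
    cutoff_mul_mem S.tsupport_subset fun _ hp => S.smoothNear_comp_coord hH hp⟩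

theorem contDiff_entry {d n : ℕ} (i j : Fin n) : ContDiff ℝ ∞
    (fun v : EuclideanSpace ℝ (Fin d) × (Fin n → Fin n → ℂ) => v.2 i j) :=
  (contDiff_apply_apply ℝ ℂ i j).comp contDiff_snd

theorem contDiff_star_entry {d n : ℕ} (i j : Fin n) : ContDiff ℝ ∞
    (fun v : EuclideanSpace ℝ (Fin d) × (Fin n → Fin n → ℂ) => star (v.2 i j)) :=
  Complex.conjCLE.contDiff.comp (contDiff_entry i j)

/-- The entries of the change of frame as smooth functions, cut off. -/
def LocalChart.gaugeFun (S : LocalChart o) (i j : Fin n) : frameFunctions o :=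
  S.coordMul _ (contDiff_entry i j)

/-- The conjugates of the entries of the change of frame as smooth functions, cut off. -/
def LocalChart.gaugeFunConj (S : LocalChart o) (i j : Fin n) : frameFunctions o :=
  S.coordMul _ (contDiff_star_entry i j)

/-- In the frame `p` a matrix unit of the chart has the entries of its conjugate by the change of
frame. So these quadratic expressions are entries of endomorphism fields, up to the second cut-off.
-/
theorem LocalChart.gaugeFunConj_mul_gaugeFun (S : LocalChart o) (k i l j : Fin n) :
    S.gaugeFunConj k i * S.gaugeFun l j = pullbackHom o S.ρ₀ * frameMatrix o (S.unit k l) i j := by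
  ext p
  change S.ρ₀.1 p.base * star ((S.gauge p : Matrix (Fin n) (Fin n) ℂ) k i) *
    (S.ρ₀.1 p.base * (S.gauge p : Matrix (Fin n) (Fin n) ℂ) l j) =
      S.ρ₀.1 p.base * matrixAt p (S.unit k l) i j
  by_cases hp : S.ρ₀.1 p.base = 0
  · rw [hp]
    ring
  · rw [S.matrixAt_unit k l (S.mem_dom hp), Matrix.smul_apply, smul_eq_mul]
    have h1 : ((S.gauge p : Matrix (Fin n) (Fin n) ℂ)ᴴ * Matrix.single k l 1 *
        (S.gauge p : Matrix (Fin n) (Fin n) ℂ) : Matrix (Fin n) (Fin n) ℂ) i j =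
        star ((S.gauge p : Matrix (Fin n) (Fin n) ℂ) k i) *
          (S.gauge p : Matrix (Fin n) (Fin n) ℂ) l j := by
      rw [Matrix.mul_apply, Finset.sum_eq_single l]
      · simp
      · intro m _ hm
        rw [Matrix.mul_single_apply_of_ne _ _ _ _ _ hm, zero_mul]
      · simp
    rw [h1]
    ring

theorem LocalChart.det_gaugeFun (S : LocalChart o) :
    (Matrix.of S.gaugeFun).det = pullbackHom o S.ρ₀ ^ n := by
  ext p
  have h1 : evalFun p (Matrix.of S.gaugeFun).det =
      (S.ρ₀.1 p.base • (S.gauge p : Matrix (Fin n) (Fin n) ℂ)).det := by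
    rw [AlgHom.map_det]
    rfl
  refine h1.trans ?_
  rw [Matrix.det_smul, (Matrix.mem_specialUnitaryGroup_iff.1 (S.gauge p).2).2, mul_one,
    Fintype.card_fin]
  exact (map_pow (evalFun p) (pullbackHom o S.ρ₀) n).symm

theorem LocalChart.coordMul_realLinear (S : LocalChart o)
    (l : EuclideanSpace ℝ (Fin d) × (Fin n → Fin n → ℂ) →ₗ[ℝ] ℝ)
    (hl : ContDiff ℝ ∞ fun v => ((l v : ℝ) : ℂ)) :
    S.coordMul _ hl = ∑ j, (l (EuclideanSpace.basisFun (Fin d) ℝ j, 0) : ℂ) •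
        pullbackHom o (S.coordFun j) +
      ∑ i, ∑ j, ((l (0, Pi.single i (Pi.single j 1)) : ℂ) •
          ((2⁻¹ : ℂ) • (S.gaugeFun i j + S.gaugeFunConj i j)) +
        (l (0, Pi.single i (Pi.single j Complex.I)) : ℂ) •
          ((2 * Complex.I)⁻¹ • (S.gaugeFun i j - S.gaugeFunConj i j))) := by
  ext p
  refine Eq.trans ?_ (evalFun_apply p _)
  simp only [map_add, map_sum, map_smul, map_sub, smul_eq_mul]
  change S.ρ₀.1 p.base * ((l (S.coord p) : ℝ) : ℂ) = _
  rw [realLinear_eq_sum, mul_add, Finset.mul_sum, Finset.mul_sum]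
  congr 1
  · refine Finset.sum_congr rfl fun j _ => ?_
    exact mul_left_comm _ _ _
  · refine Finset.sum_congr rfl fun i _ => ?_
    rw [Finset.mul_sum]
    refine Finset.sum_congr rfl fun j _ => ?_
    change _ = _ * (_ * (S.ρ₀.1 p.base * (S.gauge p : Matrix (Fin n) (Fin n) ℂ) i j +
      S.ρ₀.1 p.base * star ((S.gauge p : Matrix (Fin n) (Fin n) ℂ) i j))) +
      _ * (_ * (S.ρ₀.1 p.base * (S.gauge p : Matrix (Fin n) (Fin n) ℂ) i j -
      S.ρ₀.1 p.base * star ((S.gauge p : Matrix (Fin n) (Fin n) ℂ) i j)))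
    change S.ρ₀.1 p.base * (_ * (_ * ((S.gauge p : Matrix (Fin n) (Fin n) ℂ) i j +
      star ((S.gauge p : Matrix (Fin n) (Fin n) ℂ) i j))) +
      _ * (_ * ((S.gauge p : Matrix (Fin n) (Fin n) ℂ) i j -
      star ((S.gauge p : Matrix (Fin n) (Fin n) ℂ) i j)))) = _
    ring

variable [VectorBundle ℝ (Fin n → ℂ) E] [ContMDiffVectorBundle ∞ (Fin n → ℂ) E (𝓡 d)]

/-- A derivation at a frame that annihilates the matrix entries of endomorphism fields annihilates
the coordinates. -/
theorem LocalChart.apply_gaugeFun_eq_zero (S : LocalChart o) (hn : 1 ≤ n) {p : FrameBundle o}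
    (hp : S.ρ₂.1 p.base ≠ 0) {δ : frameFunctions o →ₗ[ℂ] ℂ}
    (hδ : ∀ f g, δ (f * g) = δ f * evalFun p g + evalFun p f * δ g)
    (h0 : ∀ a i j, δ (frameMatrix o a i j) = 0) (i j : Fin n) :
    δ (S.gaugeFun i j) = 0 ∧ δ (S.gaugeFunConj i j) = 0 := by
  have hρ : evalFun p (pullbackHom o S.ρ₀) = 1 := S.ρ₀_eq_one (S.ρ₁_ne_zero hp)
  have hscalar : ∀ f : smoothFunctions d M, δ (pullbackHom o f) = 0 := by
    intro f
    have h1 := h0 (scalarSection n E f) ⟨0, hn⟩ ⟨0, hn⟩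
    rw [frameMatrix_scalarSection] at h1
    simp only [Matrix.scalar_apply, Matrix.diagonal_apply_eq] at h1
    exact h1
  set g : Matrix (Fin n) (Fin n) ℂ := (S.gauge p : Matrix (Fin n) (Fin n) ℂ) with hg
  have hw : ∀ i j, evalFun p (S.gaugeFun i j) = g i j := fun i j =>
    (congrArg (· * _) hρ).trans (one_mul _)
  have hw' : ∀ i j, evalFun p (S.gaugeFunConj i j) = star (g i j) := fun i j =>
    (congrArg (· * _) hρ).trans (one_mul _)
  -- The Leibniz rule for a product on which δ vanishes, being the product of a base function and an
  -- entry of an endomorphism field.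
  have h1 : ∀ k i l j, δ (S.gaugeFunConj k i) * g l j + star (g k i) * δ (S.gaugeFun l j) = 0 := by
    intro k i l j
    have h2 := congrArg δ (S.gaugeFunConj_mul_gaugeFun k i l j)
    rw [hδ, hδ, hscalar, h0, zero_mul, mul_zero, add_zero, hw, hw'] at h2
    exact h2
  -- Multiplying `h1` for `i = 0` by `g k 0` and summing over `k`, with columns of norm one, gives δ
  -- g = c g: only an infinitesimal phase is left undetermined.
  set c : ℂ := -∑ k, g k ⟨0, hn⟩ * δ (S.gaugeFunConj k ⟨0, hn⟩) with hc
  have hcol : ∀ j, ∑ k, g k j * star (g k j) = 1 := by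
    intro j
    have h2 := congrFun (congrFun (gauge_conjTranspose_mul (S.gauge p)) j) j
    rw [Matrix.mul_apply, Matrix.one_apply_eq] at h2
    rw [← h2]
    exact Finset.sum_congr rfl fun k _ => mul_comm _ _
  have h2 : ∀ l j, δ (S.gaugeFun l j) = c * g l j := by
    intro l j
    have h3 : ∑ k, g k ⟨0, hn⟩ * (δ (S.gaugeFunConj k ⟨0, hn⟩) * g l j +
        star (g k ⟨0, hn⟩) * δ (S.gaugeFun l j)) = 0 :=
      Finset.sum_eq_zero fun k _ => by rw [h1, mul_zero]
    simp only [mul_add, Finset.sum_add_distrib, ← mul_assoc, ← Finset.sum_mul, hcol,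
      one_mul] at h3
    rw [hc]
    linear_combination h3
  -- The determinant of the change of frame is one, so δ of the cut-off determinant is zero, while
  -- it equals `n c`. For U(n) the phase would survive here.
  have h3 : c = 0 := by
    have h4 := apply_det_of_eigenvector hδ c (Matrix.of S.gaugeFun) fun i j => by
      rw [Matrix.of_apply, h2, hw]
    rw [S.det_gaugeFun, ← map_pow, hscalar, map_pow, map_pow, hρ, one_pow, mul_one] at h4
    have h5 : (n : ℂ) ≠ 0 := Nat.cast_ne_zero.2 (by omega)
    exact (mul_eq_zero.1 h4.symm).resolve_left h5
  have h4 : ∀ l j, δ (S.gaugeFun l j) = 0 := fun l j => by rw [h2, h3, zero_mul]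
  refine ⟨h4 i j, ?_⟩
  have h5 : ∑ l, star (g l j) * (δ (S.gaugeFunConj i j) * g l j) = 0 := by
    refine Finset.sum_eq_zero fun l _ => ?_
    have h6 := h1 i j l j
    rw [h4, mul_zero, add_zero] at h6
    rw [h6, mul_zero]
  rw [← one_mul (δ (S.gaugeFunConj i j)), ← hcol j, Finset.sum_mul, ← h5]
  exact Finset.sum_congr rfl fun l _ => by ring

end VerticalDerivations

theorem contDiff_mul_of_tsupport_subset {V : Type*} [NormedAddCommGroup V] [NormedSpace ℝ V]
    {β F : V → ℂ} {O : Set V} (hO : IsOpen O) (hβ : ContDiff ℝ ∞ β) (hF : ContDiffOn ℝ ∞ F O)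
    (h : tsupport β ⊆ O) : ContDiff ℝ ∞ fun v => β v * F v := by
  refine contDiff_iff_contDiffAt.2 fun v => ?_
  by_cases hv : v ∈ O
  · exact hβ.contDiffAt.mul (hF.contDiffAt (hO.mem_nhds hv))
  · have h1 : ∀ᶠ w in nhds v, w ∉ tsupport β :=
      (isClosed_tsupport β).isOpen_compl.mem_nhds fun hv' => hv (h hv')
    refine (contDiffAt_const (c := (0 : ℂ))).congr_of_eventuallyEq ?_
    filter_upwards [h1] with w hw
    rw [image_eq_zero_of_notMem_tsupport hw, zero_mul]

/-! ### Separation of derivations of C^∞(P) by matrix entries. -/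

section GaugeDerivations

variable {d n : ℕ} {M : Type*} [TopologicalSpace M] [ChartedSpace (EuclideanSpace ℝ (Fin d)) M]
  {E : M → Type*} [TopologicalSpace (TotalSpace (Fin n → ℂ) E)]
  [∀ x, AddCommGroup (E x)] [∀ x, Module ℂ (E x)] [∀ x, TopologicalSpace (E x)]
  [FiberBundle (Fin n → ℂ) E] [VectorBundle ℂ (Fin n → ℂ) E]
  {h : HermitianMetric E (d := d) (n := n)} {o : Orientation h}
  [IsManifold (𝓡 d) ∞ M]

/-- Smooth functions on the frame bundle are, near a frame, functions of the coordinates. -/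
theorem LocalChart.exists_cutoff_extension (S : LocalChart o) {p : FrameBundle o}
    (hp : S.ρ₂.1 p.base ≠ 0) (f : frameFunctions o) :
    ∃ (β F : EuclideanSpace ℝ (Fin d) × (Fin n → Fin n → ℂ) → ℂ), ContDiff ℝ ∞ β ∧ ContDiff ℝ ∞ F ∧
      β (S.coord p) = 1 ∧
        ∀ q : FrameBundle o, q.base ∈ S.dom → β (S.coord q) ≠ 0 → f.1 q = F (S.coord q) := by
  obtain ⟨O, hO, hpO, F, hF, hfF⟩ := S.exists_coord_rep (f.2 p) (S.mem_dom₂ hp)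
  obtain ⟨r, hr, hrO⟩ := Metric.isOpen_iff.1 hO _ hpO
  let β₁ : ContDiffBump (S.coord p) := ⟨r / 4, r / 3, by positivity, by linarith⟩
  let β₂ : ContDiffBump (S.coord p) := ⟨r / 3, r / 2, by positivity, by linarith⟩
  have hβ : ∀ β : ContDiffBump (S.coord p), ContDiff ℝ ∞ fun v => ((β v : ℝ) : ℂ) := fun β =>
    Complex.ofRealCLM.contDiff.comp β.contDiff
  have hsupp : ∀ β : ContDiffBump (S.coord p), support (fun v => ((β v : ℝ) : ℂ)) = support β :=
    fun β => by
      ext v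
      simp
  have hβO : tsupport (fun v => ((β₂ v : ℝ) : ℂ)) ⊆ O := by
    refine Set.Subset.trans ?_ hrO
    rw [tsupport, hsupp, ← tsupport, β₂.tsupport_eq]
    exact Metric.closedBall_subset_ball (by change r / 2 < r; linarith)
  refine ⟨fun v => ((β₁ v : ℝ) : ℂ), fun v => ((β₂ v : ℝ) : ℂ) * F v, hβ β₁,
    contDiff_mul_of_tsupport_subset hO (hβ β₂) hF hβO, ?_, fun q hq hqβ => ?_⟩
  · change ((β₁ (S.coord p) : ℝ) : ℂ) = 1
    rw [β₁.one_of_mem_closedBall (Metric.mem_closedBall_self β₁.rIn_pos.le), Complex.ofReal_one]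
  · have h1 : S.coord q ∈ Metric.ball (S.coord p) (r / 3) := by
      have h2 : S.coord q ∈ support β₁ := by rw [← hsupp]; exact hqβ
      rwa [β₁.support_eq] at h2
    have h2 : S.coord q ∈ O := hrO (Metric.ball_subset_ball (by linarith) h1)
    change f.1 q = ((β₂ (S.coord q) : ℝ) : ℂ) * F (S.coord q)
    rw [hfF q hq h2, β₂.one_of_mem_closedBall (Metric.ball_subset_closedBall h1),
      Complex.ofReal_one, one_mul]

variable [VectorBundle ℝ (Fin n → ℂ) E] [ContMDiffVectorBundle ∞ (Fin n → ℂ) E (𝓡 d)]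

/-- Hadamard's lemma expresses δ f through δ of the real coordinates of the frame bundle. These are
combinations of base functions and of the entries of the change of frame and their conjugates, all
annihilated by δ. -/
theorem LocalChart.pointDerivation_eq_zero (S : LocalChart o) (hn : 1 ≤ n) {p : FrameBundle o}
    (hp : S.ρ₂.1 p.base ≠ 0) {δ : frameFunctions o →ₗ[ℂ] ℂ}
    (hδ : ∀ f g, δ (f * g) = δ f * evalFun p g + evalFun p f * δ g)
    (h0 : ∀ a i j, δ (frameMatrix o a i j) = 0) (f : frameFunctions o) : δ f = 0 := by
  obtain ⟨β, F, hβ, hF, hβp, hfF⟩ := S.exists_cutoff_extension hp f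
  have hscalar : ∀ f : smoothFunctions d M, δ (pullbackHom o f) = 0 := by
    intro f
    have h1 := h0 (scalarSection n E f) ⟨0, hn⟩ ⟨0, hn⟩
    rw [frameMatrix_scalarSection] at h1
    simp only [Matrix.scalar_apply, Matrix.diagonal_apply_eq] at h1
    exact h1
  have hmem : ∀ H : EuclideanSpace ℝ (Fin d) × (Fin n → Fin n → ℂ) → ℂ, ContDiff ℝ ∞ H →
      (fun q : FrameBundle o => S.ρ₁.1 q.base * H (S.coord q)) ∈ frameFunctions o := fun H hH =>
    cutoff_mul_mem S.tsupport_subset₁ fun _ hq => S.smoothNear_comp_coord hH hq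
  -- Cut off in the base by ρ₁ and, by β, also in the matrix coordinates, since `f` agrees with `F`
  -- only near the coordinates of `p`.
  let χ : frameFunctions o := ⟨_, hmem β hβ⟩
  have hχ : ∀ q : FrameBundle o, χ.1 q ≠ 0 → S.ρ₁.1 q.base ≠ 0 ∧ β (S.coord q) ≠ 0 := fun q hq =>
    ⟨fun h1 => hq (by change S.ρ₁.1 q.base * _ = 0; rw [h1, zero_mul]),
      fun h1 => hq (by change S.ρ₁.1 q.base * β _ = 0; rw [h1, mul_zero])⟩
  let B := Module.finBasis ℝ (EuclideanSpace ℝ (Fin d) × (Fin n → Fin n → ℂ))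
  have hB : ∀ j, ContDiff ℝ ∞ fun v => ((B.coord j v : ℝ) : ℂ) := fun j =>
    Complex.ofRealCLM.contDiff.comp (LinearMap.toContinuousLinearMap (B.coord j)).contDiff
  rw [DerivationCalculus.pointDerivation_eq_sum p δ hδ S.coord χ ?_ ?_ B
    (fun j => S.coordMul _ (hB j)) ?_ f F hF ?_]
  · refine Finset.sum_eq_zero fun j _ => ?_
    rw [S.coordMul_realLinear]
    simp only [map_add, map_sum, map_smul, map_sub, hscalar,
      (S.apply_gaugeFun_eq_zero hn hp hδ h0 _ _).1, (S.apply_gaugeFun_eq_zero hn hp hδ h0 _ _).2,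
      smul_zero, add_zero, sub_zero, Finset.sum_const_zero, zero_mul]
  · change S.ρ₁.1 p.base * β (S.coord p) = 1
    rw [hβp, mul_one, S.ρ₁_eq_one hp]
  · intro H hH
    have h1 := hmem (fun v => β v * H v) (hβ.mul hH)
    convert h1 using 1
    funext q
    exact mul_assoc _ _ _
  · intro j q hq
    change S.ρ₀.1 q.base * _ = _
    rw [S.ρ₀_eq_one (hχ q hq).1, one_mul]
  · intro q hq
    exact hfF q (S.mem_dom₁ (hχ q hq).1) (hχ q hq).2

variable [T2Space M]

/-- The matrix entries of endomorphism fields separate the derivations of the functions on the frame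
bundle. -/
theorem eq_zero_of_apply_frameMatrix_eq_zero (hn : 1 ≤ n) (D : Der (frameFunctions o))
    (hD : ∀ a i j, D (frameMatrix o a i j) = 0) : D = 0 := by
  ext f p
  obtain ⟨S, hS⟩ := exists_localChart hn o p.base
  refine S.pointDerivation_eq_zero hn hS (δ := (evalFun p).toLinearMap ∘ₗ D.1) (fun f g => ?_)
    (fun a i j => ?_) f
  · change evalFun p (D (f * g)) = evalFun p (D f) * _ + _ * evalFun p (D g)
    rw [Der.leibniz, map_add, map_mul, map_mul]
  · change evalFun p (D _) = 0
    rw [hD, map_zero]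

end GaugeDerivations

/-! ### The derivations A^v + ad_A and the annihilator of 𝔄. -/

section GaugeAction

variable {d n : ℕ} {M : Type*} [TopologicalSpace M] [ChartedSpace (EuclideanSpace ℝ (Fin d)) M]
  {E : M → Type*} [TopologicalSpace (TotalSpace (Fin n → ℂ) E)]
  [∀ x, AddCommGroup (E x)] [∀ x, Module ℂ (E x)] [∀ x, TopologicalSpace (E x)]
  [FiberBundle (Fin n → ℂ) E] [VectorBundle ℂ (Fin n → ℂ) E]
  {h : HermitianMetric E (d := d) (n := n)} {o : Orientation h}

open scoped Matrix.Norms.Operator in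
theorem hasDerivAt_expSU {n : ℕ} (A : su n) (i j : Fin n) :
    HasDerivAt (fun t : ℝ => (expSU A t : Matrix (Fin n) (Fin n) ℂ) i j)
      ((A : Matrix (Fin n) (Fin n) ℂ) i j) 0 := by
  have h1 := hasDerivAt_exp_smul_const (𝕂 := ℝ) (A : Matrix (Fin n) (Fin n) ℂ) 0
  rw [zero_smul, NormedSpace.exp_zero, one_mul] at h1
  let L : Matrix (Fin n) (Fin n) ℂ →ₗ[ℝ] ℂ :=
    { toFun := fun B => B i j, map_add' := fun _ _ => rfl, map_smul' := fun _ _ => rfl }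
  exact (LinearMap.toContinuousLinearMap L).hasFDerivAt.comp_hasDerivAt (0 : ℝ) h1

theorem hasDerivAt_conj_expSU {n : ℕ} (A : su n) (m : Matrix (Fin n) (Fin n) ℂ) (i j : Fin n) :
    HasDerivAt (fun t : ℝ => ((expSU A t : Matrix (Fin n) (Fin n) ℂ)ᴴ * m *
        (expSU A t : Matrix (Fin n) (Fin n) ℂ) : Matrix (Fin n) (Fin n) ℂ) i j)
      ((m * A - A * m) i j) 0 := by
  have h1 : ∀ k l : Fin n, HasDerivAt (fun t : ℝ =>
      star ((expSU A t : Matrix (Fin n) (Fin n) ℂ) k l))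
      (star ((A : Matrix (Fin n) (Fin n) ℂ) k l)) 0 := fun k l =>
    Complex.conjCLE.toContinuousLinearMap.hasFDerivAt.comp_hasDerivAt (0 : ℝ) (hasDerivAt_expSU A k l)
  have h2 : HasDerivAt (fun t : ℝ => ∑ l, (∑ k,
      star ((expSU A t : Matrix (Fin n) (Fin n) ℂ) k i) * m k l) *
        (expSU A t : Matrix (Fin n) (Fin n) ℂ) l j)
      (∑ l, ((∑ k, star ((A : Matrix (Fin n) (Fin n) ℂ) k i) * m k l) *
          (expSU A 0 : Matrix (Fin n) (Fin n) ℂ) l j +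
        (∑ k, star ((expSU A 0 : Matrix (Fin n) (Fin n) ℂ) k i) * m k l) *
          (A : Matrix (Fin n) (Fin n) ℂ) l j)) 0 :=
    HasDerivAt.fun_sum fun l _ => (HasDerivAt.fun_sum fun k _ => (h1 k i).mul_const _).mul
      (hasDerivAt_expSU A l j)
  refine HasDerivAt.congr_deriv (f := fun t : ℝ => ((expSU A t : Matrix (Fin n) (Fin n) ℂ)ᴴ * m *
    (expSU A t : Matrix (Fin n) (Fin n) ℂ) : Matrix (Fin n) (Fin n) ℂ) i j) h2 ?_
  have h3 : m * (A : Matrix (Fin n) (Fin n) ℂ) - (A : Matrix (Fin n) (Fin n) ℂ) * m =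
      (A : Matrix (Fin n) (Fin n) ℂ)ᴴ * m * 1 + 1ᴴ * m * (A : Matrix (Fin n) (Fin n) ℂ) := by
    rw [A.2.1, Matrix.conjTranspose_one]
    noncomm_ring
  symm
  rw [h3, Matrix.add_apply, Matrix.mul_apply, Matrix.mul_apply (N := (A : Matrix (Fin n) (Fin n) ℂ)),
    ← Finset.sum_add_distrib, expSU_zero]
  rfl

variable [IsManifold (𝓡 d) ∞ M]

/-- Moving the frame by exp(tA) conjugates the matrix of an endomorphism; the derivative `[m, A]` at
`t = 0` is cancelled by ad_A. This is why forms coming from 𝔄 are basic. -/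
theorem gaugeAction_frameMatrix (A : su n) (a : endSections (d := d) n E) :
    gaugeAction A (frameMatrix o a) = 0 := by
  ext i j p
  have h1 : deriv (fun t => (frameMatrix o a i j).1 (p.act (expSU A t))) 0 =
      (matrixAt p a * A - A * matrixAt p a) i j := by
    rw [← (hasDerivAt_conj_expSU A (matrixAt p a) i j).deriv]
    congr 1
    funext t
    rw [← matrixAt_act]
    rfl
  have h2 : evalMat p (adDer (constMatrix (A : Matrix (Fin n) (Fin n) ℂ)) (frameMatrix o a)) =
      A * matrixAt p a - matrixAt p a * A := by
    rw [adDer_apply, map_sub, map_mul, map_mul, evalMat_constMatrix]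
    rfl
  change deriv (fun t => (frameMatrix o a i j).1 (p.act (expSU A t))) 0 +
    evalMat p (adDer (constMatrix (A : Matrix (Fin n) (Fin n) ℂ)) (frameMatrix o a)) i j = 0
  rw [h1, h2, Matrix.sub_apply, Matrix.sub_apply]
  ring

theorem smul_eq_scalarCenter_smul {C : Type*} [CommRing C] [Algebra ℂ C] (c : C)
    (hc : c ∈ Subalgebra.center ℂ C) (m : Matrix (Fin n) (Fin n) C) :
    (scalarCenter ⟨c, hc⟩ : Subalgebra.center ℂ (Matrix (Fin n) (Fin n) C)) • m = c • m := by
  ext i j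
  change (Matrix.scalar (Fin n) c * m) i j = c • m i j
  simp [Matrix.scalar_apply, Matrix.diagonal_mul]

theorem mem_center_of_comm {C : Type*} [CommRing C] [Algebra ℂ C] (c : C) :
    c ∈ Subalgebra.center ℂ C := Subalgebra.mem_center_iff.2 fun _ => mul_comm _ _

/-- A matrix as a combination of a basis of `su(n)` and the identity. -/
theorem exists_eq_sum_smul_constMatrix {C : Type*} [CommRing C] [Algebra ℂ C] (hn : 1 ≤ n)
    (b : Module.Basis (Fin (n ^ 2 - 1)) ℝ (su n)) (m : Matrix (Fin n) (Fin n) C) :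
    ∃ (c : Fin (n ^ 2 - 1) → C) (t : C),
      m = ∑ k, c k • constMatrix (b k : Matrix (Fin n) (Fin n) ℂ) + t • 1 := by
  let v : Fin (n ^ 2 - 1) ⊕ Unit → Matrix (Fin n) (Fin n) C := fun k =>
    constMatrix (extendedBasis hn b k)
  have h1 : ∀ x : Matrix (Fin n) (Fin n) ℂ,
      (constMatrix x : Matrix (Fin n) (Fin n) C) ∈ Submodule.span C (Set.range v) := by
    intro x
    rw [← (extendedBasis hn b).sum_repr x, constMatrix_sum_smul]
    refine Submodule.sum_mem _ fun k _ => ?_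
    rw [← algebraMap_smul C]
    exact Submodule.smul_mem _ _ (Submodule.subset_span ⟨k, rfl⟩)
  have h2 : m ∈ Submodule.span C (Set.range v) := by
    rw [Matrix.matrix_eq_sum_single m]
    refine Submodule.sum_mem _ fun i _ => Submodule.sum_mem _ fun j _ => ?_
    have h3 : Matrix.single i j (m i j) = m i j • (constMatrix (Matrix.single i j (1 : ℂ))) := by
      rw [constMatrix, Matrix.map_single, map_one, Matrix.smul_single, smul_eq_mul, mul_one]
    rw [h3]
    exact Submodule.smul_mem _ _ (h1 _)
  obtain ⟨c, hc⟩ := (Submodule.mem_span_range_iff_exists_fun C).1 h2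
  refine ⟨fun k => c (Sum.inl k), c (Sum.inr ()), ?_⟩
  rw [← hc, Fintype.sum_sum_type]
  simp only [v, extendedBasis_inl, extendedBasis_inr, Finset.univ_unique, Finset.sum_singleton]
  congr 2
  rw [constMatrix_eq_mapMatrix, map_one]

theorem liftDer_sub {C : Type*} [CommRing C] [Algebra ℂ C] (X Y : Der C) :
    (liftDer (X - Y) : Der (Matrix (Fin n) (Fin n) C)) = liftDer X - liftDer Y := by
  ext b
  rfl

theorem liftDer_sum {C : Type*} [CommRing C] [Algebra ℂ C] {ι : Type*} (s : Finset ι)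
    (X : ι → Der C) :
    (liftDer (∑ k ∈ s, X k) : Der (Matrix (Fin n) (Fin n) C)) = ∑ k ∈ s, liftDer (X k) := by
  classical
  induction s using Finset.induction_on with
  | empty =>
    ext b
    rfl
  | insert a s ha ih => rw [Finset.sum_insert ha, Finset.sum_insert ha, liftDer_add, ih]

/-- Removing the inner part of a derivation of the matrix algebra by combinations of derivations
with a basis of `su(n)` as inner parts. -/
theorem exists_sub_sum_eq_liftDer {C : Type*} [CommRing C] [Algebra ℂ C] (hn : 1 ≤ n)
    (b : Module.Basis (Fin (n ^ 2 - 1)) ℝ (su n)) (Z : Der (Matrix (Fin n) (Fin n) C))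
    (V : Fin (n ^ 2 - 1) → Der C) :
    ∃ (c : Fin (n ^ 2 - 1) → Subalgebra.center ℂ (Matrix (Fin n) (Fin n) C)) (D : Der C),
      Z - ∑ k, c k • (liftDer (V k) + adDer (constMatrix (b k : Matrix (Fin n) (Fin n) ℂ))) =
        liftDer D := by
  obtain ⟨m, _, hm⟩ := exists_eq_liftDer_add_adDer hn Z
  obtain ⟨c, t, hc⟩ := exists_eq_sum_smul_constMatrix hn b m
  let c' : Fin (n ^ 2 - 1) → Subalgebra.center ℂ C := fun k => ⟨c k, mem_center_of_comm _⟩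
  -- The multiple of the unit matrix in `m` is central and disappears.
  have had : (adDer m : Der (Matrix (Fin n) (Fin n) C)) = ∑ k, (scalarCenter (c' k) :
      Subalgebra.center ℂ (Matrix (Fin n) (Fin n) C)) •
        adDer (constMatrix (b k : Matrix (Fin n) (Fin n) ℂ)) := by
    ext1 a
    rw [Der.sum_apply, adDer_apply, hc]
    simp only [add_mul, mul_add, Finset.sum_mul, Finset.mul_sum, smul_mul_assoc, mul_smul_comm,
      one_mul, mul_one, add_sub_add_right_eq_sub, ← Finset.sum_sub_distrib, ← smul_sub]
    exact Finset.sum_congr rfl fun k _ => (smul_eq_scalarCenter_smul _ _ _).symm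
  refine ⟨fun k => scalarCenter (c' k), scalarPart hn Z - ∑ k, c' k • V k, ?_⟩
  conv_lhs => rw [hm, had]
  simp only [smul_add, Finset.sum_add_distrib, ← liftDer_smul]
  rw [add_sub_add_right_eq_sub, liftDer_sub, liftDer_sum]

variable [VectorBundle ℝ (Fin n → ℂ) E] [ContMDiffVectorBundle ∞ (Fin n → ℂ) E (𝓡 d)]
  [T2Space M]

/-- The derivations that annihilate the endomorphism fields are generated by the infinitesimal gauge
transformations. -/
theorem exists_eq_sum_gaugeAction (hn : 1 ≤ n) (b : Module.Basis (Fin (n ^ 2 - 1)) ℝ (su n))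
    (Z : Der (matrixFunctions o)) (hZ : ∀ a, Z (frameMatrix o a) = 0) :
    ∃ c : Fin (n ^ 2 - 1) → Subalgebra.center ℂ (matrixFunctions o),
      Z = ∑ k, c k • gaugeAction (b k) := by
  obtain ⟨c, D, hD⟩ := exists_sub_sum_eq_liftDer hn b Z fun k => fundamentalDer (b k)
  refine ⟨c, sub_eq_zero.1 (hD.trans ?_)⟩
  -- `Z` and the gauge derivations annihilate endomorphism fields, hence so does the lift of `D`,
  -- and their entries separate derivations of the functions.
  have h0 : D = 0 := by
    refine eq_zero_of_apply_frameMatrix_eq_zero hn _ fun a i j => ?_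
    have h1 : (liftDer D : Der (matrixFunctions o)) (frameMatrix o a) = 0 := by
      rw [← hD, Der.sub_apply, hZ, Der.sum_apply, zero_sub, neg_eq_zero]
      refine Finset.sum_eq_zero fun k _ => ?_
      exact (congrArg (((c k : matrixFunctions o)) * ·) (gaugeAction_frameMatrix (b k) a)).trans
        (mul_zero _)
    exact congrFun (congrFun h1 i) j
  rw [h0]
  ext a
  rfl

end GaugeAction

/-! ### Forms constructed from their values at points. -/

section PointwiseForms

variable {B : Type*} [Ring B] [Algebra ℂ B] {k : ℕ}

instance : Module ℂ (Der B) := inferInstance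

instance : SMul ℂ (Der B) := inferInstance

/-- A form as a complex multilinear map. -/
def complexMultilinear (ξ : Form B k) : MultilinearMap ℂ (fun _ : Fin k => Der B) B where
  toFun v := ξ v
  map_update_add' := by
    intro _ v i x y
    exact ξ.map_update_add v i x y
  map_update_smul' := by
    intro inst v i c x
    rw [Subsingleton.elim inst (instDecidableEqFin _)]
    exact map_update_csmul ξ v i c x

theorem complexMultilinear_apply (ξ : Form B k) (v : Fin k → Der B) :
    complexMultilinear ξ v = ξ v := rfl

/-- A multilinear map that vanishes if one of the arguments lies in `K` only depends on the arguments
modulo `K`. -/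
theorem multilinear_congr_of_sub_mem {V W : Type*} [AddCommGroup V] [Module ℂ V] [AddCommGroup W]
    [Module ℂ W] (f : MultilinearMap ℂ (fun _ : Fin k => V) W) (K : Set V)
    (hK : ∀ v i, v i ∈ K → f v = 0) {v v' : Fin k → V} (hv : ∀ i, v i - v' i ∈ K) :
    f v = f v' := by
  suffices h : ∀ s : Finset (Fin k), f (fun i => if i ∈ s then v i else v' i) = f v' by
    simpa using h Finset.univ
  intro s
  induction s using Finset.induction_on with
  | empty => simp
  | insert a s ha ih =>
    rw [← ih]
    set w : Fin k → V := fun i => if i ∈ s then v i else v' i with hw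
    have h1 : (fun i => if i ∈ insert a s then v i else v' i) = update w a (v a) := by
      funext i
      by_cases hi : i = a
      · subst hi
        simp
      · simp [hw, hi]
    have h2 : w = update w a (v' a) := by
      simp [hw, ha]
    rw [h1, ← sub_eq_zero]
    conv_lhs => rw [h2]
    rw [update_idem, ← f.map_update_sub]
    exact hK _ a (by rw [update_self]; exact hv a)

/-- Construction of a form from its values at points, which are given in terms of representatives of
the arguments. -/
theorem exists_form_of_representatives {ι V W : Type*} [AddCommGroup V] [Module ℂ V]
    [AddCommGroup W] [Module ℂ W] (ev : ι → B →ₗ[ℂ] W) (hev : ∀ b, (∀ i, ev i b = 0) → b = 0)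
    (χ : ι → Subalgebra.center ℂ B → ℂ) (hχ : ∀ i z b, ev i (z • b) = χ i z • ev i b)
    (Rep : ι → Submodule ℂ (V × Der B)) (htotal : ∀ i X, ∃ Y, (Y, X) ∈ Rep i)
    (hsmul : ∀ i z Y X, (Y, X) ∈ Rep i → (χ i z • Y, z • X) ∈ Rep i)
    (Φ : ι → MultilinearMap ℂ (fun _ : Fin k => V) W)
    (halt : ∀ i v a b, v a = v b → a ≠ b → Φ i v = 0)
    (hex : ∀ X : Fin k → Der B, ∃ b, ∀ i Y, (∀ j, (Y j, X j) ∈ Rep i) → ev i b = Φ i Y) :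
    ∃ ξ : Form B k, ∀ i Y X, (∀ j, (Y j, X j) ∈ Rep i) → ev i (ξ X) = Φ i Y := by
  -- `F` is merely a chosen function. Its multilinearity is checked after each evaluation, where any
  -- representatives may be used, in particular sums and multiples of given ones.
  choose F hF using hex
  have hup : ∀ {i : ι} {Y : Fin k → V} {X : Fin k → Der B} (_ : ∀ j, (Y j, X j) ∈ Rep i)
      (j : Fin k) {y : V} {x : Der B} (_ : (y, x) ∈ Rep i) (l : Fin k),
      (update Y j y l, update X j x l) ∈ Rep i := by
    intro i Y X h j y x hxy l
    by_cases hl : l = j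
    · subst hl
      rw [update_self, update_self]
      exact hxy
    · rw [update_of_ne hl, update_of_ne hl]
      exact h l
  refine ⟨{ toFun := F, map_update_add' := ?_, map_update_smul' := ?_, map_eq_zero_of_eq' := ?_ },
    fun i Y X h => hF X i Y h⟩
  · intro inst X j x y
    rw [Subsingleton.elim inst (instDecidableEqFin _)]
    refine sub_eq_zero.1 (hev _ fun i => ?_)
    choose Y hY using htotal i
    have hXY : ∀ l, (Y (X l), X l) ∈ Rep i := fun l => hY _
    rw [map_sub, map_add, hF _ i _ (hup hXY j ((Rep i).add_mem (hY x) (hY y))),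
      hF _ i _ (hup hXY j (hY x)), hF _ i _ (hup hXY j (hY y)), MultilinearMap.map_update_add,
      sub_self]
  · intro inst X j z x
    rw [Subsingleton.elim inst (instDecidableEqFin _)]
    refine sub_eq_zero.1 (hev _ fun i => ?_)
    choose Y hY using htotal i
    have hXY : ∀ l, (Y (X l), X l) ∈ Rep i := fun l => hY _
    rw [map_sub, hχ, hF _ i _ (hup hXY j (hsmul i z _ _ (hY x))), hF _ i _ (hup hXY j (hY x)),
      MultilinearMap.map_update_smul, sub_self]
  · intro X a b hab hne
    refine hev _ fun i => ?_
    choose Y hY using htotal i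
    rw [hF X i (fun l => Y (X l)) fun l => hY _]
    exact halt i _ a b (congrArg Y hab) hne

/-- A form that vanishes on all tuples from a set vanishes on all tuples from the span of the set. -/
theorem form_eq_zero_of_mem_span (ξ : Form B k) (T : Set (Der B))
    (hT : ∀ v : Fin k → Der B, (∀ i, v i ∈ T) → ξ v = 0) {v : Fin k → Der B}
    (hv : ∀ i, v i ∈ Submodule.span (Subalgebra.center ℂ B) T) : ξ v = 0 := by
  -- Induction on the set of slots whose arguments are allowed in the span instead of in `T`.
  suffices h : ∀ (s : Finset (Fin k)) (v : Fin k → Der B),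
      (∀ i ∈ s, v i ∈ Submodule.span (Subalgebra.center ℂ B) T) → (∀ i ∉ s, v i ∈ T) → ξ v = 0 from
    h Finset.univ v (fun i _ => hv i) fun i hi => absurd (Finset.mem_univ i) hi
  intro s
  induction s using Finset.induction_on with
  | empty => exact fun v _ h => hT v fun i => h i (Finset.notMem_empty i)
  | insert a s ha ih =>
    intro v h1 h2
    have h3 : ∀ x ∈ Submodule.span (Subalgebra.center ℂ B) T, ξ (update v a x) = 0 := by
      intro x hx
      induction hx using Submodule.span_induction with
      | mem x hx =>
        refine ih _ (fun i hi => ?_) fun i hi => ?_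
        · rw [update_of_ne (ne_of_mem_of_not_mem hi ha)]
          exact h1 i (Finset.mem_insert_of_mem hi)
        · by_cases hia : i = a
          · subst hia
            rw [update_self]
            exact hx
          · rw [update_of_ne hia]
            exact h2 i fun h => (Finset.mem_insert.1 h).elim hia hi
      | zero => exact ξ.map_update_zero v a
      | add x y _ _ hx hy => rw [ξ.map_update_add, hx, hy, add_zero]
      | smul z x _ hx => rw [ξ.map_update_smul, hx, smul_zero]
    have h4 := h3 (v a) (h1 a (Finset.mem_insert_self _ _))
    rwa [update_eq_self] at h4

end PointwiseForms

/-! ### Locality of forms on 𝔄 and the corresponding forms on 𝔅. -/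

section RepresentativesAtFrames

variable {d n : ℕ} {M : Type*} [TopologicalSpace M] [ChartedSpace (EuclideanSpace ℝ (Fin d)) M]
  {E : M → Type*} [TopologicalSpace (TotalSpace (Fin n → ℂ) E)]
  [∀ x, AddCommGroup (E x)] [∀ x, Module ℂ (E x)] [∀ x, TopologicalSpace (E x)]
  [FiberBundle (Fin n → ℂ) E] [VectorBundle ℂ (Fin n → ℂ) E]
  {h : HermitianMetric E (d := d) (n := n)} {o : Orientation h}

/-- The pairs of derivations of the endomorphism fields and of the matrix valued functions that agree
on the endomorphism fields at the frame `p`. -/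
def relatedAt (p : FrameBundle o) :
    Submodule ℂ (Der (endSections (d := d) n E) × Der (matrixFunctions o)) where
  carrier := {Z | ∀ a, matrixAt p (Z.1 a) = evalMat p (Z.2 (frameMatrix o a))}
  add_mem' := by
    intro Z Z' hZ hZ' a
    exact (map_add (matrixAt p) _ _).trans ((congrArg₂ (· + ·) (hZ a) (hZ' a)).trans
      (map_add (evalMat p) _ _).symm)
  zero_mem' := fun a => (map_zero (matrixAt p)).trans (map_zero (evalMat p)).symm
  smul_mem' := by
    intro c Z hZ a
    exact (map_smul (matrixAt p) c _).trans ((congrArg (c • ·) (hZ a)).trans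
      (map_smul (evalMat p) c _).symm)

theorem mem_relatedAt {p : FrameBundle o} {Y : Der (endSections (d := d) n E)}
    {X : Der (matrixFunctions o)} : (Y, X) ∈ relatedAt p ↔
      ∀ a, matrixAt p (Y a) = evalMat p (X (frameMatrix o a)) := Iff.rfl

/-- The value of a central matrix valued function at a frame. -/
def centerEval (hn : 1 ≤ n) (p : FrameBundle o) (z : Subalgebra.center ℂ (matrixFunctions o)) : ℂ :=
  ((z : matrixFunctions o) ⟨0, hn⟩ ⟨0, hn⟩).1 p

theorem evalMat_center_smul (hn : 1 ≤ n) (p : FrameBundle o)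
    (z : Subalgebra.center ℂ (matrixFunctions o)) (m : matrixFunctions o) :
    evalMat p (z • m) = centerEval hn p z • evalMat p m := by
  change evalMat p ((z : matrixFunctions o) * m) = _
  rw [exists_scalar_of_mem_center hn z.2, map_mul, evalMat_scalar]
  ext i j
  simp [Matrix.scalar_apply, Matrix.diagonal_mul, centerEval]

theorem smul_mem_relatedAt (hn : 1 ≤ n) (p : FrameBundle o)
    (z : Subalgebra.center ℂ (matrixFunctions o)) {Y : Der (endSections (d := d) n E)}
    {X : Der (matrixFunctions o)} (hYX : (Y, X) ∈ relatedAt p) :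
    (centerEval hn p z • Y, z • X) ∈ relatedAt p := by
  intro a
  change matrixAt p (centerEval hn p z • Y a) = evalMat p (z • X (frameMatrix o a))
  rw [map_smul, evalMat_center_smul hn, mem_relatedAt.1 hYX a]

theorem matrixAt_eq_zero_of_base_eq {p q : FrameBundle o} (hpq : q.base = p.base)
    {a : endSections (d := d) n E} (ha : matrixAt p a = 0) : matrixAt q a = 0 := by
  obtain ⟨g, rfl⟩ := exists_act_eq p q hpq
  rw [matrixAt_act, ha, Matrix.mul_zero, Matrix.zero_mul]

variable [IsManifold (𝓡 d) ∞ M] [VectorBundle ℝ (Fin n → ℂ) E]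
  [ContMDiffVectorBundle ∞ (Fin n → ℂ) E (𝓡 d)]

theorem LocalChart.sum_smul_der_mem_relatedAt (S : LocalChart o) (hn : 1 ≤ n) {p : FrameBundle o}
    (hp : S.ρ₂.1 p.base ≠ 0) (X : Der (matrixFunctions o)) :
    (∑ I, (S.coef hn (alongDer X) I).1 p • S.der hn I, X) ∈ relatedAt p := by
  intro a
  rw [← alongDer_apply, S.evalMat_eq_sum hn (alongDer_mul X) hp a, Der.sum_apply, map_sum]
  refine Finset.sum_congr rfl fun I _ => ?_
  rw [Der.csmul_apply, map_smul]

theorem LocalChart.coef_eq_zero (S : LocalChart o) (hn : 1 ≤ n)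
    {T : endSections (d := d) n E →ₗ[ℂ] matrixFunctions o} {p : FrameBundle o}
    (hT : ∀ a, evalMat p (T a) = 0) (I : Fin d ⊕ Fin n × Fin n) : (S.coef hn T I).1 p = 0 := by
  rcases I with j | kl
  · exact congrFun (congrFun (hT _) ⟨0, hn⟩) ⟨0, hn⟩
  · change (Matrix.trace (n := Fin n) _ : frameFunctions o).1 p = 0
    rw [evalFun_trace, map_mul, map_sum]
    simp only [map_mul, hT, zero_mul, Finset.sum_const_zero, Matrix.trace_zero]

/-- A derivation of the endomorphism fields as a combination of the local generators. -/
theorem LocalChart.centralSection_smul_eq_sum (S : LocalChart o) (hn : 1 ≤ n)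
    (Y : Der (endSections (d := d) n E)) : centralSection n E S.ρ₂ • Y =
      ∑ I, centralSection n E (S.ρ₂ * S.descend
        (S.coef hn ((frameMatrixHom o).toLinearMap ∘ₗ Y.1) I)) • S.der hn I := by
  classical
  choose P hP using exists_frame hn o
  ext1 a
  -- Over the chart the test frame has to be the one of the chart, since `descend` evaluates the
  -- coefficients in it.
  refine endSections_ext _ _ (fun x => if hx : x ∈ S.dom then S.point x hx else P x)
    (fun x => ?_) fun x => ?_
  · split_ifs
    · rfl
    · exact hP x
  · set p : FrameBundle o := if hx : x ∈ S.dom then S.point x hx else P x with hp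
    have hpx : p.base = x := by
      rw [hp]
      split_ifs
      · rfl
      · exact hP x
    have h1 : ∀ (f : smoothFunctions d M) (Z : Der (endSections (d := d) n E)),
        matrixAt p ((centralSection n E f • Z) a) = f.1 x • matrixAt p (Z a) := by
      intro f Z
      change matrixAt p (scalarSection n E f * Z a) = _
      rw [map_mul, matrixAt_scalarSection, hpx, smul_mul_assoc, one_mul]
    rw [h1, Der.sum_apply, map_sum]
    simp only [h1]
    by_cases hx : S.ρ₂.1 x = 0
    · rw [hx, zero_smul]
      refine (Finset.sum_eq_zero fun I _ => ?_).symm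
      change (S.ρ₂.1 x * _) • _ = _
      rw [hx, zero_mul, zero_smul]
    · have hxd := S.mem_dom₂ hx
      have hpS : p = S.point x hxd := dif_pos hxd
      have h2 := S.evalMat_eq_sum hn (T := (frameMatrixHom o).toLinearMap ∘ₗ Y.1) (fun a b => by
        change frameMatrixHom o (Y (a * b)) = frameMatrixHom o (Y a) * frameMatrixHom o b +
          frameMatrixHom o a * frameMatrixHom o (Y b)
        rw [Der.leibniz, map_add, map_mul, map_mul]) (p := p) (by rwa [hpx]) a
      have h3 : matrixAt p (Y a) = _ := h2
      rw [h3, Finset.smul_sum]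
      refine Finset.sum_congr rfl fun I _ => ?_
      rw [smul_smul]
      congr 1
      change _ = S.ρ₂.1 x * (S.descend _).1 x
      rw [S.descend_apply _ hxd, S.ρ₀_eq_one (S.ρ₁_ne_zero hx), one_mul, hpS]

variable [T2Space M]

/-- Forms on the endomorphism fields are local: their values at a point depend only on the values of
the derivations at the point. -/
theorem matrixAt_form_eq_zero (hn : 1 ≤ n) {k : ℕ} (η : Form (endSections (d := d) n E) k)
    (p : FrameBundle o) (v : Fin k → Der (endSections (d := d) n E)) (i : Fin k)
    (hv : ∀ a, matrixAt p (v i a) = 0) : matrixAt p (η v) = 0 := by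
  obtain ⟨S, hS⟩ := exists_localChart hn o p.base
  have hxd := S.mem_dom₂ hS
  -- The argument `v i`, multiplied by the cut-off, is expanded in local generators. Its
  -- coefficients at the base point depend only on its values there, and so vanish.
  have h1 := congrArg (fun Y => matrixAt p (η (update v i Y))) (S.centralSection_smul_eq_sum hn (v i))
  have h2 : ∀ (f : smoothFunctions d M) (Z : Der (endSections (d := d) n E)),
      matrixAt p (η (update v i (centralSection n E f • Z))) =
        f.1 p.base • matrixAt p (η (update v i Z)) := by
    intro f Z
    rw [η.map_update_smul]
    change matrixAt p (scalarSection n E f * _) = _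
    rw [map_mul, matrixAt_scalarSection, smul_mul_assoc, one_mul]
  simp only [map_update_finsetSum, map_sum, h2, update_eq_self] at h1
  have h3 : ∀ I, (S.ρ₂ * S.descend (S.coef hn ((frameMatrixHom o).toLinearMap ∘ₗ (v i).1) I)).1
      p.base = 0 := by
    intro I
    change _ * (S.descend _).1 p.base = 0
    rw [S.descend_apply _ hxd, S.coef_eq_zero hn (fun a => ?_), mul_zero, mul_zero]
    -- The coefficients are evaluated in the frame of the chart, not in `p`; vanishing of a matrix
    -- does not depend on the frame.
    exact matrixAt_eq_zero_of_base_eq (p := p) (q := S.point p.base hxd) rfl (hv a)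
  simp only [h3, zero_smul, Finset.sum_const_zero] at h1
  exact (smul_eq_zero.1 h1).resolve_left hS

theorem matrixAt_form_congr (hn : 1 ≤ n) {k : ℕ} (η : Form (endSections (d := d) n E) k)
    (p : FrameBundle o) {v v' : Fin k → Der (endSections (d := d) n E)}
    (hv : ∀ i a, matrixAt p (v i a) = matrixAt p (v' i a)) : matrixAt p (η v) = matrixAt p (η v') := by
  refine multilinear_congr_of_sub_mem
    ((matrixAt p).toLinearMap.compMultilinearMap (complexMultilinear η))
    {Y | ∀ a, matrixAt p (Y a) = 0} (fun v i hvi => matrixAt_form_eq_zero hn η p v i hvi)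
    fun i a => ?_
  rw [Der.sub_apply, map_sub, hv, sub_self]

/-- The form on the matrix valued functions that corresponds to a form on the endomorphism fields. -/
theorem exists_form_related (hn : 1 ≤ n) {k : ℕ} (η : Form (endSections (d := d) n E) k) :
    ∃ ξ : Form (matrixFunctions o) k, ∀ p Y X, (∀ i, (Y i, X i) ∈ relatedAt p) →
      evalMat p (ξ X) = matrixAt p (η Y) := by
  have htotal : ∀ (p : FrameBundle o) (X : Der (matrixFunctions o)), ∃ Y, (Y, X) ∈ relatedAt p := by
    intro p X
    obtain ⟨S, hS⟩ := exists_localChart hn o p.base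
    exact ⟨_, S.sum_smul_der_mem_relatedAt hn hS X⟩
  refine exists_form_of_representatives (fun p : FrameBundle o => (evalMat p).toLinearMap)
    (fun b hb => matrixFunctions_ext fun p => (hb p).trans (map_zero (evalMat p)).symm)
    (centerEval hn) (evalMat_center_smul hn) relatedAt htotal
    (fun p z Y X hYX => smul_mem_relatedAt hn p z hYX)
    (fun p => (matrixAt p).toLinearMap.compMultilinearMap (complexMultilinear η))
    (fun p v a b hab hne => ?_) fun X => ?_
  · exact (congrArg (matrixAt p) (η.map_eq_zero_of_eq v hab hne)).trans (map_zero (matrixAt p))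
  · choose R hR using htotal
    have hind : ∀ p Y, (∀ i, (Y i, X i) ∈ relatedAt p) →
        matrixAt p (η fun i => R p (X i)) = matrixAt p (η Y) := fun p Y hY =>
      matrixAt_form_congr hn η p fun i a => (hR p (X i) a).trans (hY i a).symm
    -- Near `p₀` the arbitrary representatives may be replaced by combinations of the local
    -- generators; multilinear expansion yields a finite sum of products of smooth functions.
    have hsmooth : ∀ i j, (fun p => matrixAt p (η fun i => R p (X i)) i j) ∈ frameFunctions o := by
      intro i j
      refine mem_frameFunctions_of_locally fun p₀ => ?_
      obtain ⟨S, hS⟩ := exists_localChart hn o p₀.base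
      refine ⟨∑ r : Fin k → Fin d ⊕ Fin n × Fin n, (∏ l, S.coef hn (alongDer (X l)) (r l)) *
        frameMatrix o (η fun l => S.der hn (r l)) i j, {x | S.ρ₂.1 x ≠ 0},
        S.ρ₂.2.continuous.isOpen_preimage _ isOpen_compl_singleton, hS, fun p hp => ?_⟩
      rw [hind p _ fun l => S.sum_smul_der_mem_relatedAt hn hp (X l), ← complexMultilinear_apply,
        MultilinearMap.map_sum]
      simp only [MultilinearMap.map_smul_univ, map_sum, map_smul, Matrix.sum_apply,
        Matrix.smul_apply]
      refine Eq.trans ?_ (evalFun_apply p _)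
      simp only [map_sum, map_mul, map_prod]
      rfl
    exact ⟨Matrix.of fun i j => ⟨_, hsmooth i j⟩, fun p Y hY => (by ext i j; rfl :
      evalMat p _ = matrixAt p (η fun i => R p (X i))).trans (hind p Y hY)⟩

end RepresentativesAtFrames

/-! ### Existence and uniqueness of the basic form. -/

section BasicForms

variable {d n : ℕ} {M : Type*} [TopologicalSpace M] [ChartedSpace (EuclideanSpace ℝ (Fin d)) M]
  {E : M → Type*} [TopologicalSpace (TotalSpace (Fin n → ℂ) E)]
  [∀ x, AddCommGroup (E x)] [∀ x, Module ℂ (E x)] [∀ x, TopologicalSpace (E x)]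
  [FiberBundle (Fin n → ℂ) E] [VectorBundle ℂ (Fin n → ℂ) E]
  {h : HermitianMetric E (d := d) (n := n)} {o : Orientation h}

theorem evalMat_prod_center_smul (hn : 1 ≤ n) (p : FrameBundle o) {ι : Type*} (s : Finset ι)
    (z : ι → Subalgebra.center ℂ (matrixFunctions o)) (m : matrixFunctions o) :
    evalMat p ((∏ i ∈ s, z i) • m) = (∏ i ∈ s, centerEval hn p (z i)) • evalMat p m := by
  classical
  induction s using Finset.induction_on with
  | empty => rw [Finset.prod_empty, Finset.prod_empty, one_smul, one_smul]
  | insert a s ha ih =>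
    rw [Finset.prod_insert ha, Finset.prod_insert ha, mul_smul, mul_smul, evalMat_center_smul hn,
      ih]

/-- A function on the frame bundle as a central matrix valued function. -/
def centralFunction (f : frameFunctions o) : Subalgebra.center ℂ (matrixFunctions o) :=
  scalarCenter ⟨f, mem_center_of_comm f⟩

theorem centerEval_centralFunction (hn : 1 ≤ n) (p : FrameBundle o) (f : frameFunctions o) :
    centerEval hn p (centralFunction f) = f.1 p := by
  change ((Matrix.scalar (Fin n) f) ⟨0, hn⟩ ⟨0, hn⟩ : frameFunctions o).1 p = _
  simp

theorem evalMat_centralFunction_smul (hn : 1 ≤ n) (p : FrameBundle o) (f : frameFunctions o)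
    (m : matrixFunctions o) : evalMat p (centralFunction f • m) = f.1 p • evalMat p m := by
  rw [evalMat_center_smul hn, centerEval_centralFunction]

/-- The derivations of the matrix valued functions that preserve the endomorphism fields. -/
def liftableDer (o : Orientation h) : Set (Der (matrixFunctions o)) :=
  {X | ∃ Y : Der (endSections (d := d) n E), ∀ a, X (frameMatrix o a) = frameMatrix o (Y a)}

variable [IsManifold (𝓡 d) ∞ M] [VectorBundle ℝ (Fin n → ℂ) E]
  [ContMDiffVectorBundle ∞ (Fin n → ℂ) E (𝓡 d)] [T2Space M]

/-- The difference between ρ₂ X and its expansion in lifted generators annihilates 𝔄, so it is a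
combination of gauge derivations. -/
theorem LocalChart.centralFunction_smul_mem_span (S : LocalChart o) (hn : 1 ≤ n)
    (b : Module.Basis (Fin (n ^ 2 - 1)) ℝ (su n)) (X : Der (matrixFunctions o)) :
    centralFunction (pullbackHom o S.ρ₂) • X ∈ Submodule.span
      (Subalgebra.center ℂ (matrixFunctions o)) (liftableDer o ∪ gaugeDer o) := by
  set W : Der (matrixFunctions o) := ∑ I, centralFunction (pullbackHom o S.ρ₂ *
    S.coef hn (alongDer X) I) • S.liftedDer I with hW
  have hV : ∀ a, (centralFunction (pullbackHom o S.ρ₂) • X - W) (frameMatrix o a) = 0 := by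
    intro a
    refine matrixFunctions_ext fun p => ?_
    rw [Der.sub_apply, map_sub, map_zero, hW, Der.sum_apply, map_sum]
    have h1 : ∀ (f : frameFunctions o) (Z : Der (matrixFunctions o)),
        evalMat p ((centralFunction f • Z) (frameMatrix o a)) =
          f.1 p • evalMat p (Z (frameMatrix o a)) := fun f Z =>
      evalMat_centralFunction_smul hn p f _
    simp only [h1]
    by_cases hp : S.ρ₂.1 p.base = 0
    · have h2 : (pullbackHom o S.ρ₂).1 p = 0 := hp
      rw [h2, zero_smul, zero_sub, neg_eq_zero]
      refine Finset.sum_eq_zero fun I _ => ?_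
      change ((pullbackHom o S.ρ₂).1 p * _) • _ = _
      rw [h2, zero_mul, zero_smul]
    · have h2 := S.evalMat_eq_sum hn (alongDer_mul X) hp a
      rw [alongDer_apply] at h2
      rw [h2, Finset.smul_sum, sub_eq_zero]
      refine Finset.sum_congr rfl fun I _ => ?_
      rw [S.liftedDer_frameMatrix hn, smul_smul]
      rfl
  obtain ⟨c, hc⟩ := exists_eq_sum_gaugeAction hn b _ hV
  rw [← sub_add_cancel (centralFunction (pullbackHom o S.ρ₂) • X) W, hc]
  refine Submodule.add_mem _ (Submodule.sum_mem _ fun k _ => Submodule.smul_mem _ _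
    (Submodule.subset_span (Or.inr ⟨b k, rfl⟩))) (Submodule.sum_mem _ fun I _ =>
      Submodule.smul_mem _ _ (Submodule.subset_span (Or.inl ⟨S.der hn I, fun a => ?_⟩)))
  exact S.liftedDer_frameMatrix hn I a

/-- The principle behind all uniqueness statements. After multiplication by cut-offs the arguments
lie in the span of gauge derivations, excluded by horizontality, and of derivations that restrict to
𝔄; the cut-offs are nonzero at the given point. Invariance plays no role. -/
theorem form_eq_zero_of_isHorizontal (hn : 1 ≤ n) (b : Module.Basis (Fin (n ^ 2 - 1)) ℝ (su n))
    {k : ℕ} {ξ : Form (matrixFunctions o) k} (hξ : IsHorizontal (gaugeDer o) ξ)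
    (h0 : ∀ X : Fin k → Der (matrixFunctions o), (∀ i, X i ∈ liftableDer o) → ξ X = 0) : ξ = 0 := by
  ext1 X
  refine matrixFunctions_ext fun p => ?_
  obtain ⟨S, hS⟩ := exists_localChart hn o p.base
  have h1 : ξ (fun i => centralFunction (pullbackHom o S.ρ₂) • X i) = 0 := by
    refine form_eq_zero_of_mem_span ξ (liftableDer o ∪ gaugeDer o) (fun v hv => ?_) fun i =>
      S.centralFunction_smul_mem_span hn b (X i)
    by_cases hg : ∃ i, v i ∈ gaugeDer o
    · obtain ⟨i, hi⟩ := hg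
      exact hξ.map_eq_zero v i hi
    · exact h0 v fun i => (hv i).resolve_right fun hi => hg ⟨i, hi⟩
  have h2 := ξ.toMultilinearMap.map_smul_univ
    (fun _ : Fin k => centralFunction (pullbackHom o S.ρ₂)) X
  change ξ _ = _ • ξ X at h2
  rw [h1] at h2
  have h3 := congrArg (evalMat p) h2
  rw [map_zero, evalMat_prod_center_smul hn] at h3
  refine ((smul_eq_zero.1 h3.symm).resolve_left (Finset.prod_ne_zero_iff.2 fun i _ => ?_)).trans
    (map_zero (evalMat p)).symm
  rw [centerEval_centralFunction]
  exact hS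

theorem form_eq_of_isInduced (hn : 1 ≤ n) (b : Module.Basis (Fin (n ^ 2 - 1)) ℝ (su n))
    {k : ℕ} {η : Form (endSections (d := d) n E) k} {ξ ξ' : Form (matrixFunctions o) k}
    (hξ : IsHorizontal (gaugeDer o) ξ) (hξ' : IsHorizontal (gaugeDer o) ξ')
    (hi : IsInduced (frameMatrix o) η ξ) (hi' : IsInduced (frameMatrix o) η ξ') : ξ = ξ' := by
  refine sub_eq_zero.1 (form_eq_zero_of_isHorizontal hn b
    (isHorizontal_of_map_eq_zero fun v i hv => ?_) fun X hX => ?_)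
  · rw [AlternatingMap.sub_apply, hξ.map_eq_zero v i hv, hξ'.map_eq_zero v i hv, sub_zero]
  · choose Y hY using hX
    rw [AlternatingMap.sub_apply, hi Y X hY, hi' Y X hY, sub_self]

/-- The constructed form vanishes as soon as one argument annihilates 𝔄. Gauge derivations do, which
gives horizontality, and so do their brackets with each other and with derivations that restrict to
𝔄. Hence the Lie derivative is horizontal and zero on the latter, thus zero. The pointwise
description is kept for the descent to M. -/
theorem exists_basic_form (hn : 1 ≤ n) (b : Module.Basis (Fin (n ^ 2 - 1)) ℝ (su n)) {k : ℕ}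
    (η : Form (endSections (d := d) n E) k) :
    ∃ ξ : Form (matrixFunctions o) k, IsBasic (gaugeDer o) ξ ∧ IsInduced (frameMatrix o) η ξ ∧
      ∀ p Y X, (∀ i, (Y i, X i) ∈ relatedAt p) → evalMat p (ξ X) = matrixAt p (η Y) := by
  obtain ⟨ξ, hξ⟩ := exists_form_related (o := o) hn η
  have hind : IsInduced (frameMatrix o) η ξ := fun Y X hYX =>
    matrixFunctions_ext fun p => hξ p Y X fun i a => (congrArg (evalMat p) (hYX i a)).symm
  have hvan : ∀ (X : Fin k → Der (matrixFunctions o)) (i : Fin k),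
      (∀ a, X i (frameMatrix o a) = 0) → ξ X = 0 := by
    intro X i hX
    refine matrixFunctions_ext fun p => ?_
    obtain ⟨S, hS⟩ := exists_localChart hn o p.base
    rw [hξ p (update (fun j => ∑ I, (S.coef hn (alongDer (X j)) I).1 p • S.der hn I) i 0) X ?_,
      η.map_coord_zero i (update_self _ _ _), map_zero, map_zero]
    intro j
    by_cases hj : j = i
    · subst hj
      rw [update_self]
      intro a
      rw [hX, map_zero]
      exact map_zero (matrixAt p)
    · rw [update_of_ne hj]
      exact S.sum_smul_der_mem_relatedAt hn hS (X j)
  have hhor : IsHorizontal (gaugeDer o) ξ := isHorizontal_of_map_eq_zero fun v i hv => by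
    obtain ⟨A, hA⟩ := hv
    exact hvan v i fun a => by rw [← hA, gaugeAction_frameMatrix]
  refine ⟨ξ, ⟨hhor, ?_⟩, hind, hξ⟩
  rintro _ ⟨A, rfl⟩
  refine form_eq_zero_of_isHorizontal hn b (isHorizontal_of_map_eq_zero fun v i hv => ?_)
    fun X hX => ?_
  · rw [lieForm_apply, hhor.map_eq_zero v i hv, map_zero, zero_sub, neg_eq_zero]
    refine Finset.sum_eq_zero fun j _ => ?_
    by_cases hj : j = i
    · subst hj
      obtain ⟨A', hA'⟩ := hv
      refine hvan _ j fun a => ?_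
      rw [update_self, Der.bracket_apply, ← hA', gaugeAction_frameMatrix, gaugeAction_frameMatrix,
        map_zero, map_zero, sub_zero]
    · exact hhor.map_eq_zero _ i (by rwa [update_of_ne (Ne.symm hj)])
  · choose Y hY using hX
    rw [lieForm_apply, hind Y X hY, gaugeAction_frameMatrix, zero_sub, neg_eq_zero]
    refine Finset.sum_eq_zero fun j _ => hvan _ j fun a => ?_
    rw [update_self, Der.bracket_apply, hY, gaugeAction_frameMatrix, gaugeAction_frameMatrix,
      map_zero, sub_zero]

end BasicForms

/-! ### Dependence on the matrix arguments. -/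

section MixedArguments

variable {C : Type*} [CommRing C] [Algebra ℂ C] {n : ℕ}

/-- A form on the matrix algebra, with fixed derivations of `C` as first arguments, as an alternating
map of the matrices that generate the remaining arguments. -/
def mixedAlternating {p q r : ℕ} (hr : p + q = r) (ξ : Form (Matrix (Fin n) (Fin n) C) r)
    (X : Fin p → Der C) : Matrix (Fin n) (Fin n) ℂ [⋀^Fin q]→ₗ[ℂ] Matrix (Fin n) (Fin n) C where
  toFun m := ξ (mixedArgs hr X m)
  map_update_add' := by
    intro inst m i x y
    rw [Subsingleton.elim inst (instDecidableEqFin _)]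
    simp only [mixedArgs_update_right]
    have h1 : (adDer (constMatrix (x + y)) : Der (Matrix (Fin n) (Fin n) C)) =
        adDer (constMatrix x) + adDer (constMatrix y) := by
      rw [constMatrix_eq_mapMatrix, map_add]
      exact map_add adDerLin _ _
    rw [h1, ξ.map_update_add]
  map_update_smul' := by
    intro inst m i c x
    rw [Subsingleton.elim inst (instDecidableEqFin _)]
    simp only [mixedArgs_update_right]
    have h1 : (adDer (constMatrix (c • x)) : Der (Matrix (Fin n) (Fin n) C)) =
        c • adDer (constMatrix x) := by
      rw [constMatrix_eq_mapMatrix, map_smul]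
      exact map_smul adDerLin _ _
    rw [h1, map_update_csmul]
  map_eq_zero_of_eq' := by
    intro m i j hm hij
    refine ξ.map_eq_zero_of_eq _ (i := Fin.cast hr (Fin.natAdd p i))
      (j := Fin.cast hr (Fin.natAdd p j)) ?_ ?_
    · rw [mixedArgs_natAdd, mixedArgs_natAdd, hm]
    · simpa [Fin.ext_iff] using hij

theorem apply_mixedArgs_linearCombination {p q r : ℕ} (hr : p + q = r)
    (ξ : Form (Matrix (Fin n) (Fin n) C) r) (X : Fin p → Der C)
    (l : Matrix (Fin n) (Fin n) C →ₗ[ℂ] ℂ) (m : Fin q → Matrix (Fin n) (Fin n) ℂ)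
    (R : Matrix (Fin q) (Fin q) ℂ) :
    l (ξ (mixedArgs hr X fun k => ∑ i, R i k • m i)) = R.det * l (ξ (mixedArgs hr X m)) :=
  map_linearCombination_det (l.compAlternatingMap (mixedAlternating hr ξ X)) m R

end MixedArguments

/-! ### Fibre integrals at a frame: vertical arguments and change of frame. -/

section Descent

variable {d n : ℕ} {M : Type*} [TopologicalSpace M] [ChartedSpace (EuclideanSpace ℝ (Fin d)) M]
  {E : M → Type*} [TopologicalSpace (TotalSpace (Fin n → ℂ) E)]
  [∀ x, AddCommGroup (E x)] [∀ x, Module ℂ (E x)] [∀ x, TopologicalSpace (E x)]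
  [FiberBundle (Fin n → ℂ) E] [VectorBundle ℂ (Fin n → ℂ) E]
  {h : HermitianMetric E (d := d) (n := n)} {o : Orientation h}

theorem fiberIntegral_apply_at (b : Module.Basis (Fin (n ^ 2 - 1)) ℝ (su n)) {q r : ℕ}
    (hr : q + (n ^ 2 - 1) = r) (ξ : Form (matrixFunctions o) r)
    (W : Fin q → Der (frameFunctions o)) (p : FrameBundle o) :
    (fiberIntegral b hr ξ W).1 p =
      (volumeFactor b : ℂ) * (evalMat p (ξ (basisArgs b hr W))).trace := by
  rw [fiberIntegral_eq_trace, ← evalFun_trace]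
  rfl

/-- The pairs of derivations of the functions on the frame bundle and on the base that agree at the
frame `p`. -/
def baseRelatedAt (p : FrameBundle o) :
    Submodule ℂ (Der (frameFunctions o) × Der (smoothFunctions d M)) where
  carrier := {Z | ∀ f, (Z.1 (pullbackHom o f)).1 p = (Z.2 f).1 p.base}
  add_mem' := fun hZ hZ' f => congrArg₂ (· + ·) (hZ f) (hZ' f)
  zero_mem' := fun _ => rfl
  smul_mem' := fun c _ hZ f => congrArg (c * ·) (hZ f)

theorem evalMat_adDer_constMatrix (p : FrameBundle o) (m : Matrix (Fin n) (Fin n) ℂ)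
    (a : endSections (d := d) n E) : evalMat p (adDer (constMatrix m) (frameMatrix o a)) =
      m * matrixAt p a - matrixAt p a * m := by
  rw [adDer_apply, map_sub, map_mul, map_mul, evalMat_constMatrix]
  rfl

variable [IsManifold (𝓡 d) ∞ M] [VectorBundle ℝ (Fin n → ℂ) E]
  [ContMDiffVectorBundle ∞ (Fin n → ℂ) E (𝓡 d)] [T2Space M]

theorem exists_mem_relatedAt (hn : 1 ≤ n) (p : FrameBundle o) (X : Der (matrixFunctions o)) :
    ∃ Y, (Y, X) ∈ relatedAt p := by
  obtain ⟨S, hS⟩ := exists_localChart hn o p.base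
  exact ⟨_, S.sum_smul_der_mem_relatedAt hn hS X⟩

variable {q r : ℕ} {η : Form (endSections (d := d) n E) r} {ξ : Form (matrixFunctions o) r}

theorem evalMat_form_congr (hn : 1 ≤ n)
    (hξ : ∀ p Y X, (∀ i, (Y i, X i) ∈ relatedAt p) → evalMat p (ξ X) = matrixAt p (η Y))
    {p : FrameBundle o} {X X' : Fin r → Der (matrixFunctions o)}
    (hX : ∀ i a, evalMat p (X i (frameMatrix o a)) = evalMat p (X' i (frameMatrix o a))) :
    evalMat p (ξ X) = evalMat p (ξ X') := by
  choose Y hY using fun i => exists_mem_relatedAt hn p (X i)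
  rw [hξ p Y X hY, hξ p Y X' fun i a => (hY i a).trans (hX i a)]

/-- A derivation that is vertical at `p` acts on 𝔄 at `p` like an inner one, by the structure of
derivations at a frame. Its generator may be taken traceless, a complex combination of the `b k`,
and alternation against the last arguments gives zero. -/
theorem fiberIntegral_eq_zero_of_vertical (hn : 1 ≤ n)
    (b : Module.Basis (Fin (n ^ 2 - 1)) ℝ (su n)) (hr : q + (n ^ 2 - 1) = r)
    (hξ : ∀ p Y X, (∀ i, (Y i, X i) ∈ relatedAt p) → evalMat p (ξ X) = matrixAt p (η Y))
    (p : FrameBundle o) (W : Fin q → Der (frameFunctions o)) (i : Fin q)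
    (hW : ∀ f, (W i (pullbackHom o f)).1 p = 0) : (fiberIntegral b hr ξ W).1 p = 0 := by
  obtain ⟨S, hS⟩ := exists_localChart hn o p.base
  set D := (evalMat p).toLinearMap ∘ₗ alongDer (liftDer (W i) : Der (matrixFunctions o)) with hD
  have h0 : ∀ f, scalarDerivation hn D f = 0 := by
    intro f
    change ((liftDer (W i) : Der (matrixFunctions o)) (frameMatrix o (scalarSection n E f))
      ⟨0, hn⟩ ⟨0, hn⟩).1 p = 0
    rw [frameMatrix_scalarSection, liftDer_apply, Matrix.scalar_apply, Matrix.diagonal_apply_eq]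
    exact hW f
  set m := S.innerPart hn p D with hm
  set m₀ : Matrix (Fin n) (Fin n) ℂ :=
    ∑ k, suCoord hn b k m • (b k : Matrix (Fin n) (Fin n) ℂ) with hm₀
  have h1 : ∀ a, evalMat p ((liftDer (W i) : Der (matrixFunctions o)) (frameMatrix o a)) =
      evalMat p (adDer (constMatrix m₀) (frameMatrix o a)) := by
    intro a
    have h2 := (isDerivationAt_alongDer p (liftDer (W i))).apply_eq S hn hS a
    rw [← hD, ← hm] at h2
    simp only [h0, zero_smul, Finset.sum_const_zero, zero_add] at h2
    rw [evalMat_adDer_constMatrix]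
    refine h2.trans ?_
    rw [← sum_suCoord hn b m, ← hm₀, add_mul, mul_add, smul_mul_assoc, one_mul, mul_smul_comm,
      mul_one, add_sub_add_right_eq_sub]
  have h2 : evalMat p (ξ (basisArgs b hr W)) = evalMat p (ξ (update (basisArgs b hr W)
      (Fin.cast hr (Fin.castAdd _ i)) (adDer (constMatrix m₀)))) := by
    refine evalMat_form_congr hn hξ fun j a => ?_
    by_cases hj : j = Fin.cast hr (Fin.castAdd _ i)
    · subst hj
      rw [update_self, basisArgs_castAdd, h1]
    · rw [update_of_ne hj]
  have h3 : ξ (update (basisArgs b hr W) (Fin.cast hr (Fin.castAdd _ i))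
      (adDer (constMatrix m₀))) = 0 := by
    rw [hm₀, adDer_constMatrix_sum_smul, map_update_finsetSum]
    refine Finset.sum_eq_zero fun k _ => ?_
    rw [map_update_csmul, map_update_basisArgs_left, smul_zero]
  rw [fiberIntegral_apply_at, h2, h3, map_zero, Matrix.trace_zero, mul_zero]

theorem fiberIntegral_congr_at (hn : 1 ≤ n)
    (b : Module.Basis (Fin (n ^ 2 - 1)) ℝ (su n)) (hr : q + (n ^ 2 - 1) = r)
    (hξ : ∀ p Y X, (∀ i, (Y i, X i) ∈ relatedAt p) → evalMat p (ξ X) = matrixAt p (η Y))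
    (p : FrameBundle o) {W W' : Fin q → Der (frameFunctions o)}
    (hW : ∀ i f, (W i (pullbackHom o f)).1 p = (W' i (pullbackHom o f)).1 p) :
    (fiberIntegral b hr ξ W).1 p = (fiberIntegral b hr ξ W').1 p := by
  refine multilinear_congr_of_sub_mem ((evalFun p).toLinearMap.compMultilinearMap
    (complexMultilinear (fiberIntegral b hr ξ))) {W | ∀ f, (W (pullbackHom o f)).1 p = 0}
    (fun v i hv => fiberIntegral_eq_zero_of_vertical hn b hr hξ p v i hv) fun i f => ?_
  exact sub_eq_zero.2 (hW i f)

theorem append_mem_relatedAt {s : ℕ} (hr : q + s = r) {p : FrameBundle o}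
    {W : Fin q → Der (frameFunctions o)} {Y : Fin q → Der (endSections (d := d) n E)}
    (hY : ∀ i a, (liftDer (W i) : Der (matrixFunctions o)) (frameMatrix o a) =
      frameMatrix o (Y i a)) {m : Fin s → endSections (d := d) n E}
    {c : Fin s → Matrix (Fin n) (Fin n) ℂ} (hm : ∀ k, matrixAt p (m k) = c k) (i : Fin r) :
    (Fin.append Y (fun k => adDer (m k)) (Fin.cast hr.symm i), mixedArgs hr W c i) ∈
      relatedAt p := by
  obtain ⟨i, rfl⟩ : ∃ j, Fin.cast hr j = i := ⟨Fin.cast hr.symm i, by simp⟩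
  rw [Fin.cast_cast, Fin.cast_eq_self]
  refine Fin.addCases (fun j => ?_) (fun k => ?_) i
  · rw [mixedArgs_castAdd, Fin.append_left]
    exact fun a => (congrArg (evalMat p) (hY j a)).symm
  · rw [mixedArgs_natAdd, Fin.append_right]
    intro a
    rw [evalMat_adDer_constMatrix, ← hm, ← map_mul, ← map_mul, ← map_sub]
    rfl

/-- For arguments from P that restrict to 𝔄, the values at `p` and `p · g` are both matrices of one
and the same endomorphism field, with inner arguments given by fields equal to the `b k` at `p · g`.
At `p` these fields are the conjugates of the `b k`, a change of basis of determinant one, and the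
trace ignores the conjugation of the value. No connectedness of the fibre is involved. -/
theorem fiberIntegral_act (hn : 1 ≤ n)
    (b : Module.Basis (Fin (n ^ 2 - 1)) ℝ (su n)) (hr : q + (n ^ 2 - 1) = r)
    (hξ : ∀ p Y X, (∀ i, (Y i, X i) ∈ relatedAt p) → evalMat p (ξ X) = matrixAt p (η Y))
    (p : FrameBundle o) (g : Matrix.specialUnitaryGroup (Fin n) ℂ)
    {W : Fin q → Der (frameFunctions o)}
    (hW : ∀ i, (liftDer (W i) : Der (matrixFunctions o)) ∈ liftableDer o) :
    (fiberIntegral b hr ξ W).1 (p.act g) = (fiberIntegral b hr ξ W).1 p := by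
  obtain ⟨S, hS⟩ := exists_localChart hn o p.base
  choose Y hY using hW
  have hm : ∀ k, ∃ a : endSections (d := d) n E,
      matrixAt (p.act g) a = (b k : Matrix (Fin n) (Fin n) ℂ) := fun k =>
    S.exists_matrixAt_eq (p := p.act g) (S.ρ₀_eq_one (S.ρ₁_ne_zero hS)) _
  choose m hm using hm
  obtain ⟨R, hR, hRb⟩ := exists_conj_matrix hn b g
  have hmp : ∀ k, matrixAt p (m k) = ∑ l, R l k • (b l : Matrix (Fin n) (Fin n) ℂ) := by
    intro k
    rw [← hRb, ← hm, matrixAt_act]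
    calc _ = (g : Matrix (Fin n) (Fin n) ℂ) * (g : Matrix (Fin n) (Fin n) ℂ)ᴴ * matrixAt p (m k) *
          ((g : Matrix (Fin n) (Fin n) ℂ) * (g : Matrix (Fin n) (Fin n) ℂ)ᴴ) := by
            rw [gauge_mul_conjTranspose, Matrix.one_mul, Matrix.mul_one]
      _ = _ := by simp only [Matrix.mul_assoc]
  rw [fiberIntegral_apply_at, fiberIntegral_apply_at]
  congr 1
  have h1 := hξ (p.act g) _ (basisArgs b hr W) (append_mem_relatedAt hr hY hm)
  have h2 := hξ p _ _ (append_mem_relatedAt hr hY hmp)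
  have h3 : (evalMat p (ξ (mixedArgs hr W fun k => ∑ l, R l k •
      (b l : Matrix (Fin n) (Fin n) ℂ)))).trace = (evalMat p (ξ (basisArgs b hr W))).trace := by
    have h4 := apply_mixedArgs_linearCombination hr ξ W (Matrix.traceLinearMap (Fin n) ℂ ℂ ∘ₗ
      (evalMat p).toLinearMap) (fun k => (b k : Matrix (Fin n) (Fin n) ℂ)) R
    rw [hR, one_mul] at h4
    exact h4
  rw [← h3, h1, h2, matrixAt_act, Matrix.trace_mul_comm, ← Matrix.mul_assoc,
    gauge_mul_conjTranspose, Matrix.one_mul]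

end Descent

/-! ### Descent of the fibre integral to M. -/

section DescendedForm

variable {d n : ℕ} {M : Type*} [TopologicalSpace M] [ChartedSpace (EuclideanSpace ℝ (Fin d)) M]
  {E : M → Type*} [TopologicalSpace (TotalSpace (Fin n → ℂ) E)]
  [∀ x, AddCommGroup (E x)] [∀ x, Module ℂ (E x)] [∀ x, TopologicalSpace (E x)]
  [FiberBundle (Fin n → ℂ) E] [VectorBundle ℂ (Fin n → ℂ) E]
  {h : HermitianMetric E (d := d) (n := n)} {o : Orientation h}

/-- Evaluation of functions at a point. -/
def evalBase (x : M) : smoothFunctions d M →ₐ[ℂ] ℂ :=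
  (Pi.evalAlgHom ℂ (fun _ : M => ℂ) x).comp (smoothFunctions d M).val

theorem evalBase_apply (x : M) (f : smoothFunctions d M) : evalBase x f = f.1 x := rfl

variable [IsManifold (𝓡 d) ∞ M]

/-- The derivative of the functions in the direction of a vector field, in coordinates. -/
theorem LocalChart.apply_eq_sum (S : LocalChart o) (Z : Der (smoothFunctions d M))
    {p : FrameBundle o} (hp : S.ρ₂.1 p.base ≠ 0) (f : smoothFunctions d M) :
    (Z f).1 p.base = ∑ j, (Z (S.coordFun j)).1 p.base * (S.coordDer j (pullbackHom o f)).1 p := by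
  refine S.pointDerivation_eq_sum hp ((evalBase p.base).toLinearMap ∘ₗ Z.1) (fun f g => ?_) f
  change evalBase p.base (Z (f * g)) = evalBase p.base (Z f) * evalBase p.base g +
    evalBase p.base f * evalBase p.base (Z g)
  rw [Der.leibniz, map_add, map_mul, map_mul]

theorem LocalChart.sum_smul_coordDer_mem_baseRelatedAt (S : LocalChart o)
    (Z : Der (smoothFunctions d M)) {p : FrameBundle o} (hp : S.ρ₂.1 p.base ≠ 0) :
    (∑ j, (Z (S.coordFun j)).1 p.base • S.coordDer j, Z) ∈ baseRelatedAt p := by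
  intro f
  rw [S.apply_eq_sum Z hp f, Der.sum_apply]
  refine (map_sum (evalFun p) _ _).trans (Finset.sum_congr rfl fun j _ => ?_)
  rfl

variable [VectorBundle ℝ (Fin n → ℂ) E] [ContMDiffVectorBundle ∞ (Fin n → ℂ) E (𝓡 d)]

/-- The coefficients are constants: values of functions frozen at one point. Such combinations
restrict to 𝔄 globally, and pointwise they represent any vector field. -/
theorem LocalChart.liftDer_sum_smul_coordDer_mem (S : LocalChart o) (hn : 1 ≤ n) (c : Fin d → ℂ) :
    (liftDer (∑ j, c j • S.coordDer j) : Der (matrixFunctions o)) ∈ liftableDer o := by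
  refine ⟨∑ j, c j • S.endDer hn j, fun a => ?_⟩
  rw [liftDer_sum, Der.sum_apply, Der.sum_apply]
  simp only [Der.csmul_apply]
  refine Eq.trans ?_ (map_sum (frameMatrixHom o) _ _).symm
  refine Finset.sum_congr rfl fun j _ => ?_
  rw [map_smul, frameMatrixHom_apply, S.frameMatrix_endDer]
  rfl

variable [T2Space M] {q r : ℕ} {η : Form (endSections (d := d) n E) r}
  {ξ : Form (matrixFunctions o) r}

/-- The fibre integral of the form that corresponds to a form on the endomorphism fields descends to
the base. -/
theorem exists_descended_form (hn : 1 ≤ n)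
    (b : Module.Basis (Fin (n ^ 2 - 1)) ℝ (su n)) (hr : q + (n ^ 2 - 1) = r)
    (hξ : ∀ p Y X, (∀ i, (Y i, X i) ∈ relatedAt p) → evalMat p (ξ X) = matrixAt p (η Y)) :
    ∃ τ : Form (smoothFunctions d M) q,
      IsInduced (pullbackFunction o) τ (fiberIntegral b hr ξ) := by
  have htotal : ∀ (p : FrameBundle o) (Z : Der (smoothFunctions d M)),
      ∃ W, (W, Z) ∈ baseRelatedAt p := by
    intro p Z
    obtain ⟨S, hS⟩ := exists_localChart hn o p.base
    exact ⟨_, S.sum_smul_coordDer_mem_baseRelatedAt Z hS⟩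
  obtain ⟨τ, hτ⟩ := exists_form_of_representatives
    (fun p : FrameBundle o => (evalBase p.base).toLinearMap)
    (fun f hf => Subtype.ext (funext fun x => by
      obtain ⟨p, rfl⟩ := exists_frame hn o x
      exact hf p))
    (fun p (z : Subalgebra.center ℂ (smoothFunctions d M)) => z.1.1 p.base)
    (fun p z f => rfl) baseRelatedAt htotal
    (fun p z W Z hWZ f => congrArg (z.1.1 p.base * ·) (hWZ f))
    (fun p => (evalFun p).toLinearMap.compMultilinearMap
      (complexMultilinear (fiberIntegral b hr ξ)))
    (fun p v i j hij hne => congrArg (evalFun p)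
      ((fiberIntegral b hr ξ).map_eq_zero_of_eq v hij hne) |>.trans (map_zero (evalFun p)))
    (fun Z => by
      choose P hP using exists_frame hn o
      choose R hR using htotal
      have hcongr : ∀ (p : FrameBundle o) (W W' : Fin q → Der (frameFunctions o)),
          (∀ i, (W i, Z i) ∈ baseRelatedAt p) → (∀ i, (W' i, Z i) ∈ baseRelatedAt p) →
          (fiberIntegral b hr ξ W).1 p = (fiberIntegral b hr ξ W').1 p := fun p W W' hW hW' =>
        fiberIntegral_congr_at hn b hr hξ p fun i f => (hW i f).trans (hW' i f).symm
      -- The frozen coefficients depend only on the base point, so one and the same family of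
      -- derivations represents `Z` at both frames, and `fiberIntegral_act` compares the two values.
      have hind : ∀ (p p' : FrameBundle o) (W W' : Fin q → Der (frameFunctions o)),
          p'.base = p.base → (∀ i, (W i, Z i) ∈ baseRelatedAt p) →
          (∀ i, (W' i, Z i) ∈ baseRelatedAt p') →
          (fiberIntegral b hr ξ W).1 p = (fiberIntegral b hr ξ W').1 p' := by
        intro p p' W W' hpp hW hW'
        obtain ⟨S, hS⟩ := exists_localChart hn o p.base
        obtain ⟨g, rfl⟩ := exists_act_eq p p' hpp
        rw [hcongr p W _ hW fun i => S.sum_smul_coordDer_mem_baseRelatedAt (Z i) hS,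
          hcongr (p.act g) W' _ hW' fun i =>
            S.sum_smul_coordDer_mem_baseRelatedAt (p := p.act g) (Z i) hS]
        exact (fiberIntegral_act hn b hr hξ p g fun i =>
          S.liftDer_sum_smul_coordDer_mem hn _).symm
      -- Near `x₀` the chosen frame is exchanged for the frame of a chart and the representatives
      -- for combinations of coordinate derivations.
      have hsmooth : (fun x => (fiberIntegral b hr ξ fun i => R (P x) (Z i)).1 (P x)) ∈
          smoothFunctions d M := by
        intro x₀
        obtain ⟨S, hS⟩ := exists_localChart hn o x₀
        let F : smoothFunctions d M := ∑ s : Fin q → Fin d, (∏ i, Z i (S.coordFun (s i))) *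
          S.descend (fiberIntegral b hr ξ fun i => S.coordDer (s i))
        refine (F.2 x₀).congr_of_eventuallyEq ?_
        filter_upwards [(S.ρ₂.2.continuous.isOpen_preimage _ isOpen_compl_singleton).mem_nhds hS]
          with x hx
        have hxd := S.mem_dom₂ hx
        rw [hind (P x) (S.point x hxd) _ _ (hP x).symm (fun i => hR _ _) fun i =>
          S.sum_smul_coordDer_mem_baseRelatedAt (p := S.point x hxd) (Z i) hx,
          ← complexMultilinear_apply, MultilinearMap.map_sum]
        simp only [MultilinearMap.map_smul_univ]
        refine (map_sum (evalFun (S.point x hxd)) _ _).trans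
          (Eq.trans ?_ (map_sum (evalBase x) _ _).symm)
        refine Finset.sum_congr rfl fun s _ => ?_
        rw [map_smul, map_mul, map_prod, evalBase_apply x (S.descend _), S.descend_apply _ hxd,
          S.ρ₀_eq_one (S.ρ₁_ne_zero hx), one_mul]
        rfl
      exact ⟨⟨_, hsmooth⟩, fun p W hW => hind (P p.base) p _ W (hP p.base).symm
        (fun i => hR _ _) hW⟩)
  refine ⟨τ, fun Z W hWZ => ?_⟩
  ext p
  exact (hτ p W Z fun i f => congrArg (evalFun p) (hWZ i f)).symm

/-- A form on the base is determined by its pullback to the frame bundle. -/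
theorem eq_of_isInduced_pullback (hn : 1 ≤ n) {τ τ' : Form (smoothFunctions d M) q}
    {ζ : Form (frameFunctions o) q} (hτ : IsInduced (pullbackFunction o) τ ζ)
    (hτ' : IsInduced (pullbackFunction o) τ' ζ) : τ = τ' := by
  ext Z x
  obtain ⟨p, rfl⟩ := exists_frame hn o x
  obtain ⟨S, hS⟩ := exists_localChart hn o p.base
  let z : Subalgebra.center ℂ (smoothFunctions d M) := ⟨S.ρ₂, mem_center_of_comm _⟩
  let c : Fin q → Fin d → smoothFunctions d M := fun i j => S.ρ₂ * Z i (S.coordFun j)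
  -- The cut-off vector fields have global lifts to the frame bundle, built from coordinate
  -- derivations. The cut-off is divided out at the given point in the end.
  let W : Fin q → Der (frameFunctions o) := fun i => ∑ j,
    (⟨pullbackHom o (c i j), mem_center_of_comm _⟩ : Subalgebra.center ℂ (frameFunctions o)) •
      S.coordDer j
  have hW : ∀ i f, W i (pullbackHom o f) = pullbackHom o ((z • Z i) f) := by
    intro i f
    ext p
    change evalFun p (W i (pullbackHom o f)) = S.ρ₂.1 p.base * (Z i f).1 p.base
    rw [Der.sum_apply, map_sum]
    change ∑ j, S.ρ₂.1 p.base * (Z i (S.coordFun j)).1 p.base *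
      (S.coordDer j (pullbackHom o f)).1 p = _
    by_cases hp : S.ρ₂.1 p.base = 0
    · simp [hp]
    · rw [S.apply_eq_sum (Z i) hp f, Finset.mul_sum]
      exact Finset.sum_congr rfl fun j _ => mul_assoc _ _ _
  have h1 : pullbackHom o (τ fun i => z • Z i) = pullbackHom o (τ' fun i => z • Z i) :=
    (hτ _ W hW).symm.trans (hτ' _ W hW)
  have h2 := τ.toMultilinearMap.map_smul_univ (fun _ : Fin q => z) Z
  have h3 := τ'.toMultilinearMap.map_smul_univ (fun _ : Fin q => z) Z
  have h4 : ((∏ _i : Fin q, z).1 : smoothFunctions d M) * τ Z =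
      ((∏ _i : Fin q, z).1 : smoothFunctions d M) * τ' Z :=
    h2.symm.trans ((pullbackHom_injective hn o h1).trans h3)
  have h5 := congrArg (evalBase p.base) h4
  rw [map_mul, map_mul] at h5
  refine mul_left_cancel₀ (fun h6 => hS ?_) h5
  have h7 : evalBase p.base ((∏ _i : Fin q, z).1 : smoothFunctions d M) =
      ∏ _i : Fin q, S.ρ₂.1 p.base :=
    map_prod ((evalBase p.base : smoothFunctions d M →ₐ[ℂ] ℂ).comp
      (Subalgebra.center ℂ (smoothFunctions d M)).val) (fun _ => z) Finset.univ
  rw [h7, Finset.prod_const] at h6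
  exact eq_zero_of_pow_eq_zero h6

end DescendedForm

/-! ### Integration along the noncommutative fibre. -/

section FibreIntegration

variable {d n : ℕ} {M : Type*} [TopologicalSpace M] [ChartedSpace (EuclideanSpace ℝ (Fin d)) M]
  {E : M → Type*} [TopologicalSpace (TotalSpace (Fin n → ℂ) E)]
  [∀ x, AddCommGroup (E x)] [∀ x, Module ℂ (E x)] [∀ x, TopologicalSpace (E x)]
  [FiberBundle (Fin n → ℂ) E] [VectorBundle ℂ (Fin n → ℂ) E]
  {h : HermitianMetric E (d := d) (n := n)} {o : Orientation h} [IsManifold (𝓡 d) ∞ M]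

theorem isHorizontal_fiberIntegral (b : Module.Basis (Fin (n ^ 2 - 1)) ℝ (su n)) {p r : ℕ}
    (hr : p + (n ^ 2 - 1) = r) {ξ : Form (matrixFunctions o) r}
    (hξ : IsHorizontal (gaugeDer o) ξ) : IsHorizontal (verticalDer o) (fiberIntegral b hr ξ) := by
  refine isHorizontal_of_map_eq_zero fun v i hv => ?_
  obtain ⟨A, hA⟩ := hv
  exact fiberIntegral_eq_zero_of_horizontal b hr ξ (fundamentalDer A) A
    (fun w j hw => hξ.map_eq_zero w j ⟨A, hw.symm⟩) v i hA.symm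

theorem isInvariant_fiberIntegral (hn : 1 ≤ n) (b : Module.Basis (Fin (n ^ 2 - 1)) ℝ (su n))
    {p r : ℕ} (hr : p + (n ^ 2 - 1) = r) {ξ : Form (matrixFunctions o) r}
    (hξ : IsInvariant (gaugeDer o) ξ) : IsInvariant (verticalDer o) (fiberIntegral b hr ξ) := by
  rintro _ ⟨A, rfl⟩
  ext1 X
  rw [lieForm_fiberIntegral b hn hr ξ (fundamentalDer A) A X]
  have h1 : lieForm (liftDer (fundamentalDer A) +
      adDer (constMatrix (A : Matrix (Fin n) (Fin n) ℂ))) ξ = 0 := hξ _ ⟨A, rfl⟩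
  rw [h1, AlternatingMap.zero_apply, Matrix.trace_zero, smul_zero, AlternatingMap.zero_apply]

variable [VectorBundle ℝ (Fin n → ℂ) E] [ContMDiffVectorBundle ∞ (Fin n → ℂ) E (𝓡 d)]
  [T2Space M]

theorem existsUnique_basic_form (hn : 1 ≤ n) (b : Module.Basis (Fin (n ^ 2 - 1)) ℝ (su n))
    {r : ℕ} (η : Form (endSections (d := d) n E) r) :
    ∃! ξ : Form (matrixFunctions o) r, IsBasic (gaugeDer o) ξ ∧ IsInduced (frameMatrix o) η ξ := by
  obtain ⟨ξ, h1, h2, _⟩ := exists_basic_form (o := o) hn b η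
  exact ⟨ξ, ⟨h1, h2⟩, fun ξ' h' => form_eq_of_isInduced hn b h'.1.1 h1.1 h'.2 h2⟩

theorem exists_descended_fiberIntegral (hn : 1 ≤ n)
    (b : Module.Basis (Fin (n ^ 2 - 1)) ℝ (su n)) {p r : ℕ} (hr : p + (n ^ 2 - 1) = r)
    {η : Form (endSections (d := d) n E) r} {ξ : Form (matrixFunctions o) r}
    (hξ : IsBasic (gaugeDer o) ξ) (hind : IsInduced (frameMatrix o) η ξ) :
    ∃ τ : Form (smoothFunctions d M) p,
      IsInduced (pullbackFunction o) τ (fiberIntegral b hr ξ) := by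
  obtain ⟨ξ', h1, h2, h3⟩ := exists_basic_form (o := o) hn b η
  obtain rfl := form_eq_of_isInduced hn b hξ.1 h1.1 hind h2
  exact exists_descended_form hn b hr h3

set_option synthInstance.maxHeartbeats 200000 in
variable (o) in
/-- Integration along the noncommutative fibre. -/
theorem exists_fiberIntegration (hn : 1 ≤ n) (b : Module.Basis (Fin (n ^ 2 - 1)) ℝ (su n))
    {p r : ℕ} (hr : p + (n ^ 2 - 1) = r) :
    ∃ J : Form (endSections (d := d) n E) r →ₗ[ℂ] Form (smoothFunctions d M) p,
      ∀ (η : Form (endSections (d := d) n E) r) (ξ : Form (matrixFunctions o) r)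
        (τ : Form (smoothFunctions d M) p), IsBasic (gaugeDer o) ξ → IsInduced (frameMatrix o) η ξ →
          (IsInduced (pullbackFunction o) τ (fiberIntegral b hr ξ) ↔ τ = J η) := by
  choose Ξ hΞ hΞ' using fun η : Form (endSections (d := d) n E) r =>
    (existsUnique_basic_form (o := o) hn b η).exists
  choose T hT using fun η => exists_descended_fiberIntegral hn b hr (hΞ η) (hΞ' η)
  refine ⟨{ toFun := T, map_add' := fun η η' => ?_, map_smul' := fun c η => ?_ },
    fun η ξ τ h1 h2 => ?_⟩
  · refine eq_of_isInduced_pullback hn (hT _) ?_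
    have h1 : Ξ (η + η') = Ξ η + Ξ η' := form_eq_of_isInduced hn b (hΞ _).1
      (isHorizontal_of_map_eq_zero fun v i hv => by
        rw [AlternatingMap.add_apply, (hΞ η).1.map_eq_zero v i hv, (hΞ η').1.map_eq_zero v i hv,
          add_zero]) (hΞ' _)
      (IsInduced.add (φ := (frameMatrixHom o).toLinearMap) (hΞ' η) (hΞ' η'))
    rw [h1, map_add]
    exact IsInduced.add (φ := (pullbackHom o).toLinearMap) (hT η) (hT η')
  · refine eq_of_isInduced_pullback hn (hT _) ?_
    have h1 : Ξ (c • η) = c • Ξ η := form_eq_of_isInduced hn b (hΞ _).1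
      (isHorizontal_of_map_eq_zero fun v i hv => by
        rw [AlternatingMap.smul_apply, (hΞ η).1.map_eq_zero v i hv, smul_zero]) (hΞ' _)
      (IsInduced.csmul (φ := (frameMatrixHom o).toLinearMap) (hΞ' η) c)
    rw [h1, map_smul]
    exact IsInduced.csmul (φ := (pullbackHom o).toLinearMap) (hT η) c
  · obtain rfl : ξ = Ξ η := form_eq_of_isInduced hn b h1.1 (hΞ η).1 h2 (hΞ' η)
    exact ⟨fun h3 => eq_of_isInduced_pullback hn h3 (hT η), fun h3 => h3 ▸ hT η⟩

end FibreIntegration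

end

end DerivationCalculus

/-! ### The proposition. -/

theorem mainTheorem3 {d n : ℕ} (hn : 1 ≤ n)
    {M : Type*} [TopologicalSpace M] [T2Space M] [SecondCountableTopology M]
    [ChartedSpace (EuclideanSpace ℝ (Fin d)) M] [IsManifold (𝓡 d) ∞ M]
    {E : M → Type*} [TopologicalSpace (TotalSpace (Fin n → ℂ) E)]
    [∀ x, AddCommGroup (E x)] [∀ x, Module ℂ (E x)] [∀ x, TopologicalSpace (E x)]
    [FiberBundle (Fin n → ℂ) E] [VectorBundle ℂ (Fin n → ℂ) E] [VectorBundle ℝ (Fin n → ℂ) E]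
    [ContMDiffVectorBundle ∞ (Fin n → ℂ) E (𝓡 d)]
    (h : HermitianMetric E (d := d) (n := n)) (o : DerivationCalculus.Orientation h)
    (b : Module.Basis (Fin (n ^ 2 - 1)) ℝ (su n)) :
    -- the integral on forms of degree `r = p + (n² - 1)` is induced by the noncommutative integral
    (∀ (p r : ℕ) (hr : p + (n ^ 2 - 1) = r) (ξ : Form (matrixFunctions o) r),
      (∀ (α : Form (frameFunctions o) p) (β : Form (Matrix (Fin n) (Fin n) ℂ) (n ^ 2 - 1)),
        IsTensor hr ξ α β → fiberIntegral b hr ξ = ncIntegral b β • α) ∧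
      (∀ a : ℕ, a ≠ p → HasBidegree a ξ → fiberIntegral b hr ξ = 0)) ∧
    -- it preserves horizontality and invariance
    (∀ (p r : ℕ) (hr : p + (n ^ 2 - 1) = r) (ξ : Form (matrixFunctions o) r),
      (IsHorizontal (gaugeDer o) ξ → IsHorizontal (verticalDer o) (fiberIntegral b hr ξ)) ∧
      (IsInvariant (gaugeDer o) ξ → IsInvariant (verticalDer o) (fiberIntegral b hr ξ))) ∧
    -- it commutes with the differentials (second line: the degree in which the integral is zero
    -- before applying the differential)
    (∀ (p r : ℕ) (hr : p + (n ^ 2 - 1) = r) (hr' : p + 1 + (n ^ 2 - 1) = r + 1)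
      (ξ : Form (matrixFunctions o) r),
      fiberIntegral b hr' (dForm r ξ) = dForm p (fiberIntegral b hr ξ)) ∧
    (∀ (r : ℕ) (hr : 0 + (n ^ 2 - 1) = r + 1) (ξ : Form (matrixFunctions o) r),
      fiberIntegral b hr (dForm r ξ) = 0) ∧
    -- it induces a map in cohomology
    (∀ (p r : ℕ) (hr : p + (n ^ 2 - 1) = r),
      ∃ K : Cohomology (matrixFunctions o) r →ₗ[ℂ] Cohomology (frameFunctions o) p,
        ∀ (ξ : Form (matrixFunctions o) r) (hξ : dForm r ξ = 0),
          ∃ hI : dForm p (fiberIntegral b hr ξ) = 0,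
            K (cohomologyClass ξ hξ) = cohomologyClass (fiberIntegral b hr ξ) hI) ∧
    -- forms on `Γ(End E)` correspond to basic forms
    (∀ (r : ℕ) (η : Form (endSections (d := d) n E) r),
      ∃! ξ : Form (matrixFunctions o) r,
        IsBasic (gaugeDer o) ξ ∧ IsInduced (frameMatrix o) η ξ) ∧
    -- and the integrals of the latter are the pullbacks of forms on `M`
    ∃ J : ∀ (p r : ℕ), p + (n ^ 2 - 1) = r →
        (Form (endSections (d := d) n E) r →ₗ[ℂ] Form (smoothFunctions d M) p),
      (∀ (p r : ℕ) (hr : p + (n ^ 2 - 1) = r) (η : Form (endSections (d := d) n E) r)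
        (ξ : Form (matrixFunctions o) r) (τ : Form (smoothFunctions d M) p),
        IsBasic (gaugeDer o) ξ → IsInduced (frameMatrix o) η ξ →
          (IsInduced (pullbackFunction o) τ (fiberIntegral b hr ξ) ↔ τ = J p r hr η)) ∧
      (∀ (p r : ℕ) (hr : p + (n ^ 2 - 1) = r) (hr' : p + 1 + (n ^ 2 - 1) = r + 1)
        (η : Form (endSections (d := d) n E) r),
        J (p + 1) (r + 1) hr' (dForm r η) = dForm p (J p r hr η)) ∧
      (∀ (r : ℕ) (hr : 0 + (n ^ 2 - 1) = r + 1) (η : Form (endSections (d := d) n E) r),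
        J 0 (r + 1) hr (dForm r η) = 0) ∧
      (∀ (p r : ℕ) (hr : p + (n ^ 2 - 1) = r),
        ∃ K : Cohomology (endSections (d := d) n E) r →ₗ[ℂ] Cohomology (smoothFunctions d M) p,
          ∀ (η : Form (endSections (d := d) n E) r) (hη : dForm r η = 0),
            ∃ hI : dForm p (J p r hr η) = 0,
              K (cohomologyClass η hη) = cohomologyClass (J p r hr η) hI) := by
  choose J hJ using fun p r hr => exists_fiberIntegration (p := p) (r := r) o hn b hr
  have hd : ∀ (r : ℕ) (η : Form (endSections (d := d) n E) r),
      ∃ ξ : Form (matrixFunctions o) r, IsBasic (gaugeDer o) ξ ∧ IsInduced (frameMatrix o) η ξ ∧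
        IsBasic (gaugeDer o) (dForm r ξ) ∧ IsInduced (frameMatrix o) (dForm r η) (dForm r ξ) := by
    intro r η
    obtain ⟨ξ, hξ, hξ'⟩ := (existsUnique_basic_form (o := o) hn b η).exists
    obtain ⟨ζ, hζ, hζ'⟩ := (existsUnique_basic_form (o := o) hn b (dForm r η)).exists
    have h1 : IsInduced (frameMatrix o) (dForm r η) (dForm r ξ) :=
      IsInduced.dForm (φ := (frameMatrixHom o).toLinearMap) hξ'
    -- Horizontality alone identifies the differential of `ξ` with the basic form of the
    -- differential of `η`; its invariance is then inherited.
    have h2 : ζ = dForm r ξ := form_eq_of_isInduced hn b hζ.1 hξ.isHorizontal_dForm hζ' h1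
    exact ⟨ξ, hξ, hξ', h2 ▸ hζ, h1⟩
  have hJd : ∀ (p r : ℕ) (hr : p + (n ^ 2 - 1) = r) (hr' : p + 1 + (n ^ 2 - 1) = r + 1)
      (η : Form (endSections (d := d) n E) r),
      J (p + 1) (r + 1) hr' (dForm r η) = dForm p (J p r hr η) := by
    intro p r hr hr' η
    obtain ⟨ξ, h1, h2, h3, h4⟩ := hd r η
    refine ((hJ (p + 1) (r + 1) hr' _ _ _ h3 h4).1 ?_).symm
    rw [fiberIntegral_dForm b hn hr hr' ξ]
    exact IsInduced.dForm (φ := (pullbackHom o).toLinearMap) ((hJ p r hr η ξ _ h1 h2).2 rfl)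
  have hJ0 : ∀ (r : ℕ) (hr : 0 + (n ^ 2 - 1) = r + 1) (η : Form (endSections (d := d) n E) r),
      J 0 (r + 1) hr (dForm r η) = 0 := by
    intro r hr η
    obtain ⟨ξ, h1, h2, h3, h4⟩ := hd r η
    refine ((hJ 0 (r + 1) hr _ _ _ h3 h4).1 ?_).symm
    rw [fiberIntegral_dForm_eq_zero b hn hr ξ]
    exact fun _ _ _ => rfl
  refine ⟨fun p r hr ξ => ⟨fun α β hαβ => fiberIntegral_of_isTensor b hr hαβ,
      fun a ha hξ => fiberIntegral_of_hasBidegree b hr ha hξ⟩,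
    fun p r hr ξ => ⟨isHorizontal_fiberIntegral b hr, isInvariant_fiberIntegral hn b hr⟩,
    fun p r hr hr' ξ => fiberIntegral_dForm b hn hr hr' ξ,
    fun r hr ξ => fiberIntegral_dForm_eq_zero b hn hr ξ,
    exists_cohomology_map_of_commutes (fun p r hr => fiberIntegral b hr)
      (fun p r hr hr' ξ => fiberIntegral_dForm b hn hr hr' ξ)
      fun r hr ξ => fiberIntegral_dForm_eq_zero b hn hr ξ,
    fun r η => existsUnique_basic_form hn b η,
    J, hJ, hJd, hJ0, exists_cohomology_map_of_commutes J hJd hJ0⟩
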